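/- **Conventions.** Manifolds are smooth, finite-dimensional, Hausdorff, second countable, without boundary. Let $E\to V$ be a vector bundle on a manifold, $s\in C^\infty(E)$. - For sections $t_1,t_2$ of $F\to V$: $t_1=t_2+O(s)$ (resp. $O(s^2)$) means $t_1=t_2+\alpha\cdot s$ with $\alpha\in C^\infty(E^*\otimes F)$ (resp. $t_1=t_2+\alpha\cdot(s\otimes s)$ with $\alpha\in C^\infty(E^*\otimes E^*\otimes F)$). - For smooth $f,g:V\to W$ and $\Lambda\in C^\infty(E^*\otimes g^*TW)$: $f=g+\Lambda\cdot s+O(s^2)$ means that for every smooth $h:W\to\mathbb R$ there is $\alpha\in C^\infty(E^*\otimes E^*)$ with $h\circ f=h\circ g+\Lambda\cdot(s\otimes g^*dh)+\alpha\cdot(s\otimes s)$. - For $f,g:V\to W$ with $f=g+O(s)$ (that is, for every smooth $h:W\to\mathbb R$ there is $\alpha\in C^\infty(E^*)$ with $h\circ f=h\circ g+\alpha\cdot s$), vector bundles $F\to V$, $G\to W$, and $t_1\in C^\infty(F\otimes f^*G)$, $t_2\in C^\infty(F\otimes g^*G)$: $t_1=t_2+O(s)$ means $t_1\cdot f^*\beta=t_2\cdot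 g^*\beta+O(s)$ for all $\beta\in C^\infty(G^*)$. **Objects.** A *Kuranishi neighbourhood* $(V,E,\Gamma,s,\psi)$ on a topological space $X$ consists of a manifold $V$, a vector bundle $E\to V$, a finite group $\Gamma$ acting smoothly on $V$ and compatibly on $E$, an equivariant smooth section $s$ of $E$, and a homeomorphism $\psi$ from $s^{-1}(0)/\Gamma$ to an open subset $\operatorname{Im}\psi$ of $X$. Write $\bar\psi:s^{-1}(0)\to X$ for the induced map. It is *global* if $\operatorname{Im}\psi=X$. **1-morphisms.** Let $f:X\to Y$ be continuous, let $(V_i,E_i,\Gamma_i,s_i,\psi_i)$ and $(V_j,E_j,\Gamma_j,s_j,\psi_j)$ be Kuranishi neighbourhoods on $X$ and $Y$, and let $S\subseteq\operatorname{Im}\psi_i\cap f^{-1}(\operatorname{Im}\psi_j)$ be open. A 1-morphism over $(S,f)$ is $\Phi_{ij}=(P_{ij},\pi_{ij},\phi_{ij},\hat\phi_{ij})$, where $P_{ij}$ is a manifold with commuting smooth actions of $\Gamma_i,\Gamma_j$, the latter free; $\pi_{ij}:P_{ij}\to V_i$ is étale, $\Gamma_i$-equivariant and $\Gamma_j$-invariant,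 its nonempty fibres are $\Gamma_j$-orbits, and its image contains $\bar\psi_i^{-1}(S)$; $\phi_{ij}:P_{ij}\to V_j$ is smooth, $\Gamma_i$-invariant and $\Gamma_j$-equivariant; $\hat\phi_{ij}:\pi_{ij}^*E_i\to\phi_{ij}^*E_j$ is a $\Gamma_i\times\Gamma_j$-equivariant bundle morphism with $\hat\phi_{ij}(\pi_{ij}^*s_i)=\phi_{ij}^*s_j+O(\pi_{ij}^*s_i^2)$; and $f\circ\bar\psi_i\circ\pi_{ij}=\bar\psi_j\circ\phi_{ij}$ on $\pi_{ij}^{-1}(s_i^{-1}(0))$. *Identities:* $P_{ii}=V_i\times\Gamma_i$, with actions $\gamma^1:(v,\gamma)\mapsto(\gamma^1v,\gamma(\gamma^1)^{-1})$ and $\gamma^2:(v,\gamma)\mapsto(v,\gamma^2\gamma)$, $\pi_{ii}(v,\gamma)=v$, $\phi_{ii}(v,\gamma)=\gamma v$, and $\hat\phi_{ii}$ at $(v,\gamma)$ the action of $\gamma$ on $E_i$. *Composition* of $\Phi_{ij}$ over $(S,f)$ and $\Phi_{jk}$ over $(T,g)$, with $f(S)\subseteq T$: $P_{ik}=(P_{ij}\times_{V_j}P_{jk})/\Gamma_j$,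 with $\pi_{ik},\phi_{ik},\hat\phi_{ik}$ and the $\Gamma_i,\Gamma_k$-actions induced by $\pi_{ij}$, $\phi_{jk}$, $\hat\phi_{jk}\circ\hat\phi_{ij}$ and the given actions. **2-morphisms.** A 2-morphism $\Phi_{ij}\Rightarrow\Phi_{ij}'$ over $(S,f)$ is a class $[\dot P,\lambda,\hat\lambda]$, where $\dot P\subseteq P_{ij}$ is a $\Gamma_i\times\Gamma_j$-invariant open neighbourhood of $\pi_{ij}^{-1}(\bar\psi_i^{-1}(S))$, $\lambda:\dot P\to P_{ij}'$ is smooth and equivariant with $\pi_{ij}'\circ\lambda=\pi_{ij}$, and $\hat\lambda:\pi_{ij}^*E_i\to\phi_{ij}^*TV_j$ is an invariant bundle morphism on $\dot P$ with $$\phi_{ij}'\circ\lambda=\phi_{ij}+\hat\lambda\cdot\pi_{ij}^*s_i+O(\pi_{ij}^*s_i^2),\qquad \lambda^*\hat\phi_{ij}'=\hat\phi_{ij}+\hat\lambda\cdot\phi_{ij}^*(\nabla s_j)+O(\pi_{ij}^*s_i)$$ for any connection $\nabla$ on $E_j$. Two triples are equivalent if on some open neighbourhood of $\pi_{ij}^{-1}(\bar\psi_i^{-1}(S))$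 their $\lambda$'s agree and their $\hat\lambda$'s agree up to $O(\pi_{ij}^*s_i)$. The identity of $\Phi_{ij}$ is $[P_{ij},\mathrm{id},0]$. *Vertical composition:* $[\dot P',\lambda',\hat\lambda']\odot[\dot P,\lambda,\hat\lambda]=[\lambda^{-1}(\dot P'),\lambda'\circ\lambda,\hat\lambda+\check\lambda']$, where $\check\lambda':\pi_{ij}^*E_i\to\phi_{ij}^*TV_j$ is equivariant with $\check\lambda'=\lambda^*\hat\lambda'+O(\pi_{ij}^*s_i)$. *Horizontal composition:* for $[\dot P_{ij},\lambda_{ij},\hat\lambda_{ij}]:\Phi_{ij}\Rightarrow\Phi'_{ij}$ and $[\dot P_{jk},\lambda_{jk},\hat\lambda_{jk}]:\Phi_{jk}\Rightarrow\Phi'_{jk}$ it is $[\dot P_{ik},\lambda_{ik},\hat\lambda_{ik}]$, where $\dot P_{ik}$ is a sufficiently small invariant open neighbourhood of $\pi_{ik}^{-1}(\bar\psi_i^{-1}(S))$ in $(\dot P_{ij}\times_{V_j}\dot P_{jk})/\Gamma_j$; $\lambda_{ik}$ satisfies $\pi_{ik}'\circ\lambda_{ik}=\pi_{ik}$ and is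 induced by $(\lambda_{ij},\lambda_{jk})$ over $s_i^{-1}(0)$ (this determines it near $\pi_{ik}^{-1}(\bar\psi_i^{-1}(S))$); and $\hat\lambda_{ik}$ is induced by $$d\phi_{jk}\circ(d\pi_{jk})^{-1}\circ\hat\lambda_{ij}+\hat\lambda_{jk}\circ\rho,$$ with $\rho:\pi_{ij}^*E_i\to\phi_{ij}^*E_j$ equivariant and $\rho=\lambda_{ij}^*\hat\phi'_{ij}+O(\pi_{ij}^*s_i)$. *Coherence 2-isomorphisms:* $\alpha:(\Phi_{kl}\circ\Phi_{jk})\circ\Phi_{ij}\Rightarrow\Phi_{kl}\circ(\Phi_{jk}\circ\Phi_{ij})$, $\beta:\Phi_{ij}\circ\mathrm{id}\Rightarrow\Phi_{ij}$, $\gamma:\mathrm{id}\circ\Phi_{ij}\Rightarrow\Phi_{ij}$ are $[P,\lambda,0]$, with $P$ the whole manifold of the source and $\lambda$ the natural identification: $[p,[q,r]]\mapsto[[p,q],r]$, $[(v,\gamma),p]\mapsto\gamma^{-1}p$, $[p,(v,\gamma)]\mapsto\gamma p$ respectively. **Theorem.** (a) Let $X$ be a topological space and $S\subseteq X$ open.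 These definitions give a weak 2-category (bicategory with essentially small categories of 1-morphisms) $\mathbf{Kur}_S(X)$, with objects the Kuranishi neighbourhoods on $X$ with $S\subseteq\operatorname{Im}\psi$, and 1- and 2-morphisms those over $(S,\mathrm{id}_X)$. (b) They also give a weak 2-category $\mathbf{GKur}$, whose objects are pairs of a topological space $X$ and a global Kuranishi neighbourhood on $X$; whose 1-morphisms from an object over $X$ to an object over $Y$ are pairs $(f,\Phi)$ of a continuous map $f:X\to Y$ and a 1-morphism $\Phi$ over $(X,f)$; and whose 2-morphisms $(f,\Phi)\Rightarrow(g,\Psi)$ exist only if $f=g$, and are then the 2-morphisms $\Phi\Rightarrow\Psi$ over $(X,f)$. In particular the compositions exist and are independent of the choices made. All 2-morphisms in $\mathbf{Kur}_S(X)$ and $\mathbf{GKur}$ are 2-isomorphisms, that is, these are $(2,1)$-categories. -/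

import Mathlib

open CategoryTheory TopologicalSpace
open scoped Manifold ContDiff Topology

universe u

noncomputable section

/-! ## Smooth families of linear and bilinear maps between pulled-back vector bundles

For maps `a : M → B`, `b : M → B'` and vector bundles `E → B`, `E' → B'`, a morphism of vector
bundles `a^*(E) → b^*(E')` on `M` is a family of linear maps `E (a p) → E' (b p)`, `p ∈ M`, that is
smooth when read in the local trivializations of `E` and `E'`. -/

section Families

/-- The identification of two fibres of a bundle over equal base points. -/
def fiberCast {B : Type*} (E : B → Type*) [∀ x, AddCommGroup (E x)] [∀ x, Module ℝ (E x)]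
    [∀ x, TopologicalSpace (E x)] {v w : B} (h : v = w) : E v →L[ℝ] E w :=
  h ▸ ContinuousLinearMap.id ℝ (E v)

variable (m : ℕ) {M : Type*} [TopologicalSpace M] [ChartedSpace (EuclideanSpace ℝ (Fin m)) M]
  {B : Type*} [TopologicalSpace B] {B' : Type*} [TopologicalSpace B']
  (F : Type*) [NormedAddCommGroup F] [NormedSpace ℝ F] (E : B → Type*)
  [∀ x, AddCommGroup (E x)] [∀ x, Module ℝ (E x)] [∀ x, TopologicalSpace (E x)]
  [TopologicalSpace (Bundle.TotalSpace F E)] [FiberBundle F E] [VectorBundle ℝ F E]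
  (F' : Type*) [NormedAddCommGroup F'] [NormedSpace ℝ F'] (E' : B' → Type*)
  [∀ x, AddCommGroup (E' x)] [∀ x, Module ℝ (E' x)] [∀ x, TopologicalSpace (E' x)]
  [TopologicalSpace (Bundle.TotalSpace F' E')] [FiberBundle F' E'] [VectorBundle ℝ F' E']
  [∀ x, IsTopologicalAddGroup (E' x)] [∀ x, ContinuousSMul ℝ (E' x)]

/-- `L` is a smooth morphism of vector bundles `a^*(E) → b^*(E')` on `M`. -/
def IsSmoothHom (a : M → B) (b : M → B') (L : ∀ p, E (a p) →L[ℝ] E' (b p)) : Prop :=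
  ∀ p₀ : M, ContMDiffAt (𝓡 m) 𝓘(ℝ, F →L[ℝ] F') ∞
    (fun p ↦ ContinuousLinearMap.inCoordinates F E F' E' (a p₀) (a p) (b p₀) (b p) (L p)) p₀

/-- `α` is a smooth section of `a^*(E)^* ⊗ a^*(E)^* ⊗ b^*(E')` on `M`: after inserting into the
first slot the local section of `E` with constant coordinates `x`, it is smooth near `p₀`. -/
def IsSmoothBilin (a : M → B) (b : M → B') (α : ∀ p, E (a p) →L[ℝ] E (a p) →L[ℝ] E' (b p)) :
    Prop :=
  ∀ (p₀ : M) (x : F), ContMDiffAt (𝓡 m) 𝓘(ℝ, F →L[ℝ] F') ∞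
    (fun p ↦ ContinuousLinearMap.inCoordinates F E F' E' (a p₀) (a p) (b p₀) (b p)
      (α p ((trivializationAt F E (a p₀)).symm (a p) x))) p₀

/-- `α` is a smooth section of `a^*(E)^* ⊗ a^*(E)^*` on `M`. -/
def IsSmoothForm (a : M → B) (α : ∀ p, E (a p) →L[ℝ] E (a p) →L[ℝ] ℝ) : Prop :=
  IsSmoothBilin m F E ℝ (Bundle.Trivial M ℝ) a (fun p ↦ p) α

/-- `β` is a smooth section of the dual bundle `G^*` of a vector bundle `G` on a manifold. -/
def IsSmoothCovector (n : ℕ) {W : Type*} [TopologicalSpace W]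
    [ChartedSpace (EuclideanSpace ℝ (Fin n)) W] (FG : Type*) [NormedAddCommGroup FG]
    [NormedSpace ℝ FG] (G : W → Type*) [∀ x, AddCommGroup (G x)] [∀ x, Module ℝ (G x)]
    [∀ x, TopologicalSpace (G x)] [TopologicalSpace (Bundle.TotalSpace FG G)] [FiberBundle FG G]
    [VectorBundle ℝ FG G] (β : ∀ w, G w →L[ℝ] ℝ) : Prop :=
  IsSmoothHom n FG G ℝ (Bundle.Trivial W ℝ) (fun w ↦ w) (fun w ↦ w) β

/-! ### The notations `O(s)` and `O(s²)`

Throughout, `s` is a section of `E → B`, and the base manifold `M` carries the pulled-back bundle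
`a^*(E)` with its section `a^*(s)`. -/

/-- `t₁ = t₂ + O(s²)` for sections `t₁, t₂` of `b^*(E')`. -/
def SectionEqModSq (a : M → B) (s : ∀ x, E x) (b : M → B') (t₁ t₂ : ∀ p, E' (b p)) : Prop :=
  ∃ α : ∀ p, E (a p) →L[ℝ] E (a p) →L[ℝ] E' (b p), IsSmoothBilin m F E F' E' a b α ∧
    ∀ p, t₁ p = t₂ p + α p (s (a p)) (s (a p))

/-- `t₁ = t₂ + O(s)` for sections `t₁, t₂` of `a^*(E)^* ⊗ b^*(E')`. -/
def HomEqMod (a : M → B) (s : ∀ x, E x) (b : M → B') (t₁ t₂ : ∀ p, E (a p) →L[ℝ] E' (b p)) :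
    Prop :=
  ∃ α : ∀ p, E (a p) →L[ℝ] E (a p) →L[ℝ] E' (b p), IsSmoothBilin m F E F' E' a b α ∧
    ∀ p, t₁ p = t₂ p + α p (s (a p))

/-- `t₁ = t₂ + O(s)` for sections `t₁` of `a^*(E)^* ⊗ b^*(E')` and `t₂` of `a^*(E)^* ⊗ c^*(E')`,
where `b, c : M → B'` are maps to a manifold with `b = c + O(s)`: for every smooth section `β` of
the dual of `E'`, one has `t₁ · b^*(β) = t₂ · c^*(β) + O(s)` as sections of `a^*(E)^*`. -/
def HomEqModAlong (n : ℕ) [ChartedSpace (EuclideanSpace ℝ (Fin n)) B']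
    (a : M → B) (s : ∀ x, E x) (b c : M → B')
    (t₁ : ∀ p, E (a p) →L[ℝ] E' (b p)) (t₂ : ∀ p, E (a p) →L[ℝ] E' (c p)) : Prop :=
  ∀ β : ∀ w, E' w →L[ℝ] ℝ, IsSmoothCovector n F' E' β →
    ∃ α : ∀ p, E (a p) →L[ℝ] E (a p) →L[ℝ] ℝ, IsSmoothForm m F E a α ∧
      ∀ p, (β (b p)).comp (t₁ p) = (β (c p)).comp (t₂ p) + α p (s (a p))

/-- `f = g + Λ · s + O(s²)` for maps `f, g : M → W` to a manifold and a morphism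
`Λ : a^*(E) → g^*(TW)`: for every smooth function `h` on `W`, one has
`h ∘ f = h ∘ g + Λ · (s ⊗ g^*(dh)) + O(s²)`. -/
def MapEqModSq (n : ℕ) {W : Type*} [TopologicalSpace W]
    [ChartedSpace (EuclideanSpace ℝ (Fin n)) W]
    (a : M → B) (s : ∀ x, E x) (f g : M → W)
    (Λ : ∀ p, E (a p) →L[ℝ] TangentSpace (𝓡 n) (g p)) : Prop :=
  ∀ h : W → ℝ, ContMDiff (𝓡 n) 𝓘(ℝ) ∞ h →
    ∃ α : ∀ p, E (a p) →L[ℝ] E (a p) →L[ℝ] ℝ, IsSmoothForm m F E a α ∧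
      ∀ p, h (f p) = h (g p) + mvfderiv (𝓡 n) h (g p) (Λ p (s (a p)))
        + α p (s (a p)) (s (a p))

/-! ### Elementary properties needed for the equivalence relation on 2-morphism representatives -/

theorem HomEqMod.refl' (a : M → B) (s : ∀ x, E x) (b : M → B')
    (t : ∀ p, E (a p) →L[ℝ] E' (b p)) : HomEqMod m F E F' E' a s b t t := by
  refine ⟨fun p ↦ 0, fun p₀ x ↦ ?_, fun p ↦ by simp⟩
  have : (fun p ↦ ContinuousLinearMap.inCoordinates F E F' E' (a p₀) (a p) (b p₀) (b p)
      ((0 : E (a p) →L[ℝ] E (a p) →L[ℝ] E' (b p))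
        ((trivializationAt F E (a p₀)).symm (a p) x))) = fun _ ↦ 0 := by
    funext p; ext y; simp [ContinuousLinearMap.inCoordinates]
  rw [this]
  exact contMDiffAt_const

theorem HomEqMod.symm' {a : M → B} {s : ∀ x, E x} {b : M → B'}
    {t₁ t₂ : ∀ p, E (a p) →L[ℝ] E' (b p)} (h : HomEqMod m F E F' E' a s b t₁ t₂) :
    HomEqMod m F E F' E' a s b t₂ t₁ := by
  obtain ⟨α, hα, h⟩ := h
  refine ⟨fun p ↦ -α p, fun p₀ x ↦ ?_, fun p ↦ by simp [h p]⟩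
  have : (fun p ↦ ContinuousLinearMap.inCoordinates F E F' E' (a p₀) (a p) (b p₀) (b p)
      ((-α p) ((trivializationAt F E (a p₀)).symm (a p) x))) = fun p ↦
      -(ContinuousLinearMap.inCoordinates F E F' E' (a p₀) (a p) (b p₀) (b p)
      (α p ((trivializationAt F E (a p₀)).symm (a p) x))) := by
    funext p; ext y; simp [ContinuousLinearMap.inCoordinates]
  rw [this]
  exact (hα p₀ x).neg

theorem HomEqMod.trans' {a : M → B} {s : ∀ x, E x} {b : M → B'}
    {t₁ t₂ t₃ : ∀ p, E (a p) →L[ℝ] E' (b p)} (h : HomEqMod m F E F' E' a s b t₁ t₂)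
    (h' : HomEqMod m F E F' E' a s b t₂ t₃) : HomEqMod m F E F' E' a s b t₁ t₃ := by
  obtain ⟨α, hα, h⟩ := h
  obtain ⟨α', hα', h'⟩ := h'
  refine ⟨fun p ↦ α' p + α p, fun p₀ x ↦ ?_, fun p ↦ by
    rw [h p, h' p, add_apply, add_assoc]⟩
  have : (fun p ↦ ContinuousLinearMap.inCoordinates F E F' E' (a p₀) (a p) (b p₀) (b p)
      ((α' p + α p) ((trivializationAt F E (a p₀)).symm (a p) x))) = fun p ↦
      (ContinuousLinearMap.inCoordinates F E F' E' (a p₀) (a p) (b p₀) (b p)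
      (α' p ((trivializationAt F E (a p₀)).symm (a p) x))) +
      (ContinuousLinearMap.inCoordinates F E F' E' (a p₀) (a p) (b p₀) (b p)
      (α p ((trivializationAt F E (a p₀)).symm (a p) x))) := by
    funext p; ext y; simp [ContinuousLinearMap.inCoordinates]
  rw [this]
  exact (hα' p₀ x).add (hα p₀ x)

theorem HomEqMod.restrict {N : Type*} [TopologicalSpace N]
    [ChartedSpace (EuclideanSpace ℝ (Fin m)) N] {a : M → B} {s : ∀ x, E x} {b : M → B'}
    {t₁ t₂ : ∀ p, E (a p) →L[ℝ] E' (b p)} (h : HomEqMod m F E F' E' a s b t₁ t₂) {j : N → M}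
    (hj : ContMDiff (𝓡 m) (𝓡 m) ∞ j) :
    HomEqMod m F E F' E' (fun q ↦ a (j q)) s (fun q ↦ b (j q)) (fun q ↦ t₁ (j q))
      (fun q ↦ t₂ (j q)) := by
  obtain ⟨α, hα, h⟩ := h
  exact ⟨fun q ↦ α (j q), fun q₀ x ↦ (hα (j q₀) x).comp q₀ (hj q₀), fun q ↦ h (j q)⟩

end Families

/-! ## Kuranishi neighbourhoods -/

/-- Two points of an invariant subset `Z` are equivalent if they lie in one orbit of `Γ`. -/
def orbitSetoid (Γ : Type*) {V : Type*} [Group Γ] [MulAction Γ V] (Z : Set V) : Setoid Z :=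
  (MulAction.orbitRel Γ V).comap Subtype.val

/-- A Kuranishi neighbourhood `(V, E, Γ, s, ψ)` on a topological space `X`. Manifolds are smooth,
finite-dimensional, Hausdorff, second countable and without boundary. -/
structure KurNbhd (X : Type u) [TopologicalSpace X] : Type (u + 1) where
  /-- the manifold `V` -/
  V : Type u
  dim : ℕ
  [topV : TopologicalSpace V]
  [chartV : ChartedSpace (EuclideanSpace ℝ (Fin dim)) V]
  [smoothV : IsManifold (𝓡 dim) ∞ V]
  [t2V : T2Space V]
  [sccV : SecondCountableTopology V]
  /-- the obstruction bundle `E → V`, a smooth real vector bundle -/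
  E : V → Type u
  rank : ℕ
  [addE : ∀ v, AddCommGroup (E v)]
  [modE : ∀ v, Module ℝ (E v)]
  [topE : ∀ v, TopologicalSpace (E v)]
  [topTot : TopologicalSpace (Bundle.TotalSpace (EuclideanSpace ℝ (Fin rank)) E)]
  [fibE : FiberBundle (EuclideanSpace ℝ (Fin rank)) E]
  [vecE : VectorBundle ℝ (EuclideanSpace ℝ (Fin rank)) E]
  [smoothE : ContMDiffVectorBundle ∞ (EuclideanSpace ℝ (Fin rank)) E (𝓡 dim)]
  /-- the finite group `Γ`, acting smoothly on `V` -/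
  Γ : Type u
  [grp : Group Γ]
  [fin : Finite Γ]
  [act : MulAction Γ V]
  smul_smooth : ∀ γ : Γ, ContMDiff (𝓡 dim) (𝓡 dim) ∞ (fun v : V ↦ γ • v)
  /-- the compatible action on `E`: the element `γ` maps `E v` linearly to `E (γ • v)` -/
  lift : ∀ (γ : Γ) (v : V), E v →L[ℝ] E (γ • v)
  lift_one : ∀ v e, fiberCast E (one_smul Γ v) (lift 1 v e) = e
  lift_mul : ∀ γ δ v e, fiberCast E (mul_smul γ δ v) (lift (γ * δ) v e)
    = lift γ (δ • v) (lift δ v e)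
  lift_smooth : ∀ γ : Γ, IsSmoothHom dim (EuclideanSpace ℝ (Fin rank)) E
    (EuclideanSpace ℝ (Fin rank)) E (fun v ↦ v) (fun v ↦ γ • v) (lift γ)
  /-- the Kuranishi section, smooth and equivariant -/
  s : ∀ v, E v
  s_smooth : ContMDiff (𝓡 dim) ((𝓡 dim).prod 𝓘(ℝ, EuclideanSpace ℝ (Fin rank))) ∞
    (fun v ↦ Bundle.TotalSpace.mk' (EuclideanSpace ℝ (Fin rank)) v (s v))
  s_equivariant : ∀ γ v, lift γ v (s v) = s (γ • v)
  /-- the homeomorphism from `s⁻¹(0)/Γ` onto an open subset of `X` -/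
  ψ : Quotient (orbitSetoid Γ {v : V | s v = 0}) → X
  ψ_isOpenEmbedding : Topology.IsOpenEmbedding ψ

attribute [instance] KurNbhd.topV KurNbhd.chartV KurNbhd.smoothV KurNbhd.t2V KurNbhd.sccV
  KurNbhd.addE KurNbhd.modE KurNbhd.topE KurNbhd.topTot KurNbhd.fibE KurNbhd.vecE
  KurNbhd.smoothE KurNbhd.grp KurNbhd.fin KurNbhd.act

namespace KurNbhd

variable {X : Type u} [TopologicalSpace X]

instance (K : KurNbhd X) (v : K.V) : IsTopologicalAddGroup (K.E v) :=
  (VectorBundle.continuousLinearEquivAt ℝ (EuclideanSpace ℝ (Fin K.rank)) K.E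
    v).toContinuousAddEquiv.isTopologicalAddGroup

instance (K : KurNbhd X) (v : K.V) : ContinuousSMul ℝ (K.E v) :=
  (VectorBundle.continuousLinearEquivAt ℝ (EuclideanSpace ℝ (Fin K.rank)) K.E
    v).continuousSMul

/-- The model fibre of `E`. -/
abbrev F (K : KurNbhd X) : Type := EuclideanSpace ℝ (Fin K.rank)

/-- The model space of `V`, which is also the model fibre of `TV`. -/
abbrev H (K : KurNbhd X) : Type := EuclideanSpace ℝ (Fin K.dim)

/-- The tangent bundle of `V`. -/
abbrev T (K : KurNbhd X) (v : K.V) : Type := TangentSpace (𝓡 K.dim) v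

/-- The footprint `Im ψ`. -/
def footprint (K : KurNbhd X) : Set X := Set.range K.ψ

/-- The composition of `ψ` with the projection `s⁻¹(0) → s⁻¹(0)/Γ`. -/
def psiBar (K : KurNbhd X) (v : K.V) (h : K.s v = 0) : X :=
  K.ψ (Quotient.mk _ ⟨v, h⟩)

end KurNbhd

/-! ## 1-morphisms -/

/-- A 1-morphism `(P, π, φ, φhat) : K → L` over `(S, f)`, for Kuranishi neighbourhoods `K` on `X`
and `L` on `Y`, a continuous map `f : X → Y`, and an open set `S` in `Im ψ_K ∩ f⁻¹(Im ψ_L)`. -/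
structure OneMor {X Y : Type u} [TopologicalSpace X] [TopologicalSpace Y]
    (K : KurNbhd X) (L : KurNbhd Y) (f : C(X, Y)) (S : Set X) : Type (u + 1) where
  /-- the manifold `P`, which has the dimension of `V_K` since `π` is étale -/
  P : Type u
  [topP : TopologicalSpace P]
  [chartP : ChartedSpace (EuclideanSpace ℝ (Fin K.dim)) P]
  [smoothP : IsManifold (𝓡 K.dim) ∞ P]
  [t2P : T2Space P]
  [sccP : SecondCountableTopology P]
  /-- the action of `Γ_K` on `P` -/
  actL : K.Γ →* Equiv.Perm P
  /-- the action of `Γ_L` on `P` -/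
  actR : L.Γ →* Equiv.Perm P
  act_comm : ∀ γ δ p, actL γ (actR δ p) = actR δ (actL γ p)
  actL_smooth : ∀ γ, ContMDiff (𝓡 K.dim) (𝓡 K.dim) ∞ (actL γ)
  actR_smooth : ∀ δ, ContMDiff (𝓡 K.dim) (𝓡 K.dim) ∞ (actR δ)
  actR_free : ∀ δ p, actR δ p = p → δ = 1
  π : P → K.V
  π_etale : IsLocalDiffeomorph (𝓡 K.dim) (𝓡 K.dim) ∞ π
  π_actL : ∀ γ p, π (actL γ p) = γ • π p
  π_actR : ∀ δ p, π (actR δ p) = π p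
  /-- the image of `π` contains the preimage of `S` in the zero set; it is open and invariant
  because `π` is étale and equivariant -/
  π_image : ∀ (v : K.V) (h : K.s v = 0), K.psiBar v h ∈ S → v ∈ Set.range π
  /-- the nonempty fibres of `π` are `Γ_L`-orbits -/
  π_fibre : ∀ p q, π p = π q → ∃ δ, actR δ p = q
  φ : P → L.V
  φ_smooth : ContMDiff (𝓡 K.dim) (𝓡 L.dim) ∞ φ
  φ_actL : ∀ γ p, φ (actL γ p) = φ p
  φ_actR : ∀ δ p, φ (actR δ p) = δ • φ p
  /-- the morphism of vector bundles `π^*(E_K) → φ^*(E_L)` -/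
  hat : ∀ p, K.E (π p) →L[ℝ] L.E (φ p)
  hat_smooth : IsSmoothHom K.dim K.F K.E L.F L.E π φ hat
  hat_actL : ∀ γ p e, hat (actL γ p) (fiberCast K.E (π_actL γ p).symm (K.lift γ (π p) e))
    = fiberCast L.E (φ_actL γ p).symm (hat p e)
  hat_actR : ∀ δ p e, hat (actR δ p) (fiberCast K.E (π_actR δ p).symm e)
    = fiberCast L.E (φ_actR δ p).symm (L.lift δ (φ p) (hat p e))
  /-- `φhat(π^*(s_K)) = φ^*(s_L) + O(π^*(s_K)²)` -/
  hat_s : SectionEqModSq K.dim K.F K.E L.F L.E π K.s φ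
    (fun p ↦ hat p (K.s (π p))) (fun p ↦ L.s (φ p))
  /-- `f ∘ ψ_K ∘ π = ψ_L ∘ φ` on the zero set of `π^*(s_K)` -/
  footprint_map : ∀ p (h : K.s (π p) = 0), ∃ h' : L.s (φ p) = 0,
    f (K.psiBar (π p) h) = L.psiBar (φ p) h'

attribute [instance] OneMor.topP OneMor.chartP OneMor.smoothP OneMor.t2P OneMor.sccP

section OneMorphisms

variable {X Y Z : Type u} [TopologicalSpace X] [TopologicalSpace Y] [TopologicalSpace Z]
  {K : KurNbhd X} {L : KurNbhd Y} {M : KurNbhd Z}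

/-- The preimage of `S` in `P`, that is, `π⁻¹(ψ⁻¹(S))`. -/
def OneMor.core {f : C(X, Y)} {S : Set X} (Φ : OneMor K L f S) : Set Φ.P :=
  {p | ∃ h : K.s (Φ.π p) = 0, K.psiBar (Φ.π p) h ∈ S}

/-- Data exhibiting a 1-morphism `Ξ : K → K` as the identity 1-morphism: an identification
of its manifold `P` with `V × Γ` under which the actions and maps are the prescribed ones. -/
structure IdData {f : C(X, X)} {S : Set X} (Ξ : OneMor K K f S) where
  e : K.V × K.Γ ≃ Ξ.P
  /-- `P` has the smooth structure of `V × Γ`, the disjoint union of copies of `V` -/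
  e_smooth : ∀ γ, IsLocalDiffeomorph (𝓡 K.dim) (𝓡 K.dim) ∞ (fun v ↦ e (v, γ))
  e_actL : ∀ δ v γ, Ξ.actL δ (e (v, γ)) = e (δ • v, γ * δ⁻¹)
  e_actR : ∀ δ v γ, Ξ.actR δ (e (v, γ)) = e (v, δ * γ)
  e_π : ∀ v γ, Ξ.π (e (v, γ)) = v
  e_φ : ∀ v γ, Ξ.φ (e (v, γ)) = γ • v
  e_hat : ∀ v γ x, Ξ.hat (e (v, γ)) (fiberCast K.E (e_π v γ).symm x)
    = fiberCast K.E (e_φ v γ).symm (K.lift γ v x)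

/-- The fibre product `P_{KL} ×_{V_L} P_{LM}`. -/
abbrev FibProd {f : C(X, Y)} {S : Set X} {g : C(Y, Z)} {T : Set Y}
    (Φ : OneMor K L f S) (Ψ : OneMor L M g T) : Type u :=
  {x : Φ.P × Ψ.P // Φ.φ x.1 = Ψ.π x.2}

/-- Data exhibiting a 1-morphism `Ξ : K → M` as the composition `Ψ ∘ Φ` of `Φ : K → L` and
`Ψ : L → M`: a projection from the fibre product that identifies the manifold `P` of `Ξ` with
the quotient of the fibre product by `Γ_L`, such that the actions and maps of `Ξ` are the
induced ones. (The smooth structure of `P` is determined, since `Ξ.π` is étale.) -/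
structure CompData {f : C(X, Y)} {S : Set X} {g : C(Y, Z)} {T : Set Y} {h : C(X, Z)} {S' : Set X}
    (Φ : OneMor K L f S) (Ψ : OneMor L M g T) (Ξ : OneMor K M h S') where
  proj : FibProd Φ Ψ → Ξ.P
  isQuotientMap : Topology.IsQuotientMap proj
  proj_eq_iff : ∀ x y, proj x = proj y ↔
    ∃ δ : L.Γ, Φ.actR δ x.1.1 = y.1.1 ∧ Ψ.actL δ x.1.2 = y.1.2
  proj_actL : ∀ γ (x y : FibProd Φ Ψ), y.1.1 = Φ.actL γ x.1.1 → y.1.2 = x.1.2 →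
    Ξ.actL γ (proj x) = proj y
  proj_actR : ∀ γ (x y : FibProd Φ Ψ), y.1.1 = x.1.1 → y.1.2 = Ψ.actR γ x.1.2 →
    Ξ.actR γ (proj x) = proj y
  proj_π : ∀ x, Ξ.π (proj x) = Φ.π x.1.1
  proj_φ : ∀ x, Ξ.φ (proj x) = Ψ.φ x.1.2
  proj_hat : ∀ (x : FibProd Φ Ψ) (e : K.E (Φ.π x.1.1)),
    Ξ.hat (proj x) (fiberCast K.E (proj_π x).symm e)
      = fiberCast M.E (proj_φ x).symm
          (Ψ.hat x.1.2 (fiberCast L.E x.2 (Φ.hat x.1.1 e)))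

end OneMorphisms

/-! ## 2-morphisms -/

section TwoMorphisms

variable {X Y : Type u} [TopologicalSpace X] [TopologicalSpace Y]
  {K : KurNbhd X} {L : KurNbhd Y} {f f' f'' : C(X, Y)} {S : Set X}

/-- A triple `(dom, lam, lamHat)` representing a 2-morphism `Φ ⇒ Φ'` of 1-morphisms `K → L`.
(The continuous maps under `Φ` and `Φ'` do not enter; 2-morphisms are considered only when these
maps are equal.) -/
structure TwoMorRep (Φ : OneMor K L f S) (Φ' : OneMor K L f' S) : Type u where
  /-- an invariant open neighbourhood of `π⁻¹(ψ⁻¹(S))` in `P` -/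
  dom : Opens Φ.P
  core_subset : Φ.core ⊆ dom
  dom_actL : ∀ γ, ∀ p ∈ dom, Φ.actL γ p ∈ dom
  dom_actR : ∀ δ, ∀ p ∈ dom, Φ.actR δ p ∈ dom
  lam : dom → Φ'.P
  lam_smooth : ContMDiff (𝓡 K.dim) (𝓡 K.dim) ∞ lam
  lam_actL : ∀ γ (p : dom), lam ⟨Φ.actL γ p, dom_actL γ p p.2⟩ = Φ'.actL γ (lam p)
  lam_actR : ∀ δ (p : dom), lam ⟨Φ.actR δ p, dom_actR δ p p.2⟩ = Φ'.actR δ (lam p)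
  lam_π : ∀ p, Φ'.π (lam p) = Φ.π p
  /-- the morphism of vector bundles `π^*(E_K) → φ^*(TV_L)` -/
  lamHat : ∀ p : dom, K.E (Φ.π p) →L[ℝ] L.T (Φ.φ p)
  lamHat_smooth : IsSmoothHom K.dim K.F K.E L.H L.T
    (fun p : dom ↦ Φ.π p) (fun p : dom ↦ Φ.φ p) lamHat
  lamHat_actL : ∀ γ (p : dom) e,
    lamHat ⟨Φ.actL γ p, dom_actL γ p p.2⟩
        (fiberCast K.E (Φ.π_actL γ p).symm (K.lift γ (Φ.π p) e))
      = fiberCast L.T (Φ.φ_actL γ p).symm (lamHat p e)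
  lamHat_actR : ∀ δ (p : dom) e,
    lamHat ⟨Φ.actR δ p, dom_actR δ p p.2⟩ (fiberCast K.E (Φ.π_actR δ p).symm e)
      = fiberCast L.T (Φ.φ_actR δ p).symm
          (mfderiv (𝓡 L.dim) (𝓡 L.dim) (fun w : L.V ↦ δ • w) (Φ.φ p) (lamHat p e))
  /-- `φ' ∘ lam = φ + lamHat · π^*(s_K) + O(π^*(s_K)²)` -/
  eq_φ : MapEqModSq K.dim K.F K.E L.dim (fun p : dom ↦ Φ.π p) K.s
    (fun p : dom ↦ Φ'.φ (lam p)) (fun p : dom ↦ Φ.φ p) lamHat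
  /-- `lam^*(φhat') = φhat + lamHat · φ^*(ds_L) + O(π^*(s_K))`, where `ds_L` is the derivative of
  `s_L` with respect to any connection on `E_L` -/
  eq_hat : ∀ (nabla : CovariantDerivative (𝓡 L.dim) L.F L.E) [nabla.ContMDiffCovariantDerivative ∞],
    HomEqModAlong K.dim K.F K.E L.F L.E L.dim (fun p : dom ↦ Φ.π p) K.s
      (fun p : dom ↦ Φ'.φ (lam p)) (fun p : dom ↦ Φ.φ p)
      (fun p : dom ↦ (Φ'.hat (lam p)).comp (fiberCast K.E (lam_π p).symm))
      (fun p : dom ↦ Φ.hat p + (nabla L.s (Φ.φ p)).comp (lamHat p))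

/-- The relation `≈`: two representatives agree near `π⁻¹(ψ⁻¹(S))`, up to `O(π^*(s_K))` in the
component `lamHat`. -/
def TwoMorRep.Equiv {Φ : OneMor K L f S} {Φ' : OneMor K L f' S} (x y : TwoMorRep Φ Φ') : Prop :=
  ∃ (U : Opens Φ.P) (hx : U ≤ x.dom) (hy : U ≤ y.dom), Φ.core ⊆ U ∧
    (∀ p : U, x.lam ⟨p, hx p.2⟩ = y.lam ⟨p, hy p.2⟩) ∧
    HomEqMod K.dim K.F K.E L.H L.T (fun p : U ↦ Φ.π p) K.s (fun p : U ↦ Φ.φ p)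
      (fun p : U ↦ x.lamHat ⟨p, hx p.2⟩) (fun p : U ↦ y.lamHat ⟨p, hy p.2⟩)

theorem TwoMorRep.equiv_equivalence (Φ : OneMor K L f S) (Φ' : OneMor K L f' S) :
    Equivalence (TwoMorRep.Equiv (Φ := Φ) (Φ' := Φ')) where
  refl x := ⟨x.dom, le_rfl, le_rfl, x.core_subset, fun _ ↦ rfl, HomEqMod.refl' ..⟩
  symm := by
    rintro x y ⟨U, hx, hy, hU, h, h'⟩
    exact ⟨U, hy, hx, hU, fun p ↦ (h p).symm, HomEqMod.symm' _ _ _ _ _ h'⟩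
  trans := by
    rintro x y z ⟨U, hx, hy, hU, h₁, h₂⟩ ⟨U', hy', hz, hU', h₁', h₂'⟩
    refine ⟨U ⊓ U', inf_le_left.trans hx, inf_le_right.trans hz, Set.subset_inter hU hU',
      fun p ↦ (h₁ ⟨p, p.2.1⟩).trans (h₁' ⟨p, p.2.2⟩), ?_⟩
    have e₁ := HomEqMod.restrict _ _ _ _ _ h₂ (j := Opens.inclusion (inf_le_left : U ⊓ U' ≤ U))
      (contMDiff_inclusion _)
    have e₂ := HomEqMod.restrict _ _ _ _ _ h₂' (j := Opens.inclusion (inf_le_right : U ⊓ U' ≤ U'))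
      (contMDiff_inclusion _)
    exact HomEqMod.trans' _ _ _ _ _ e₁ e₂

/-- A 2-morphism `Φ ⇒ Φ'`: a class of triples `(dom, lam, lamHat)` under `≈`. -/
def TwoMor (Φ : OneMor K L f S) (Φ' : OneMor K L f' S) : Type u :=
  Quotient ⟨TwoMorRep.Equiv (Φ := Φ) (Φ' := Φ'), TwoMorRep.equiv_equivalence Φ Φ'⟩

/-- The 2-morphism `[dom, lam, lamHat]`. -/
def TwoMorRep.toTwoMor {Φ : OneMor K L f S} {Φ' : OneMor K L f' S} (x : TwoMorRep Φ Φ') :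
    TwoMor Φ Φ' :=
  Quotient.mk _ x

end TwoMorphisms


/-! ## The structure 2-morphisms and the compositions of 2-morphisms

Each predicate below says that a representative `z` is the one prescribed by the construction. -/

section Structure

variable {X Y Z W : Type u} [TopologicalSpace X] [TopologicalSpace Y] [TopologicalSpace Z]
  [TopologicalSpace W] {K : KurNbhd X} {L : KurNbhd Y} {M : KurNbhd Z} {N : KurNbhd W}
  {S S' : Set X} {T T' : Set Y} {R : Set Z}

/-- `z = (P, id, 0)`, representing the identity 2-morphism of `Φ`. -/
structure IsIdRep {f : C(X, Y)} {Φ : OneMor K L f S} (z : TwoMorRep Φ Φ) : Prop where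
  mem : ∀ p, p ∈ z.dom
  lam_eq : ∀ p, z.lam p = p
  lamHat_eq : ∀ p, z.lamHat p = 0

/-- `z` is a vertical composition `y ⊙ x`. Its domain is `x.lam⁻¹(y.dom)`, and
`z.lam = y.lam ∘ x.lam`, `z.lamHat = x.lamHat + check` for a choice of
`check : π^*(E_K) → φ^*(TV_L)` with `check = x.lam^*(y.lamHat) + O(π^*(s_K))`. -/
structure IsVertRep {f f' f'' : C(X, Y)} {Φ : OneMor K L f S} {Φ' : OneMor K L f' S}
    {Φ'' : OneMor K L f'' S} (x : TwoMorRep Φ Φ') (y : TwoMorRep Φ' Φ'')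
    (z : TwoMorRep Φ Φ'') : Prop where
  dom_le : z.dom ≤ x.dom
  lam_mem : ∀ p : z.dom, x.lam ⟨p, dom_le p.2⟩ ∈ y.dom
  mem_dom : ∀ p : x.dom, x.lam p ∈ y.dom → (p : Φ.P) ∈ z.dom
  lam_eq : ∀ p : z.dom, z.lam p = y.lam ⟨x.lam ⟨p, dom_le p.2⟩, lam_mem p⟩
  lamHat_eq : ∃ check : ∀ p : z.dom, K.E (Φ.π p) →L[ℝ] L.T (Φ.φ p),
    IsSmoothHom K.dim K.F K.E L.H L.T (fun p : z.dom ↦ Φ.π p) (fun p : z.dom ↦ Φ.φ p) check ∧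
    HomEqModAlong K.dim K.F K.E L.H L.T L.dim (fun p : z.dom ↦ Φ.π p) K.s
      (fun p : z.dom ↦ Φ'.φ (x.lam ⟨p, dom_le p.2⟩)) (fun p : z.dom ↦ Φ.φ p)
      (fun p : z.dom ↦ (y.lamHat ⟨x.lam ⟨p, dom_le p.2⟩, lam_mem p⟩).comp
        (fiberCast K.E (x.lam_π ⟨p, dom_le p.2⟩).symm)) check ∧
    ∀ p : z.dom, z.lamHat p = x.lamHat ⟨p, dom_le p.2⟩ + check p

/-- `z` is a horizontal composition `y * x : Ψ ∘ Φ ⇒ Ψ' ∘ Φ'` of `x : Φ ⇒ Φ'` and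
`y : Ψ ⇒ Ψ'`, where `c`, `c'` exhibit the composite 1-morphisms.

On the zero set of `π^*(s_K)`, where `φ' ∘ x.lam = φ`, the map `z.lam` is induced by
`(x.lam, y.lam)`; since `z.lam` commutes with the étale projections to `V_K`, this determines it
near the zero set. The bundle morphism `z.lamHat` is induced by
`dφ_{LM} ∘ (dπ_{LM})⁻¹ ∘ x.lamHat + y.lamHat ∘ rho` for a choice of equivariant
`rho : π_{KL}^*(E_K) → φ_{KL}^*(E_L)` with `rho = x.lam^*(φhat'_{KL}) + O(π_{KL}^*(s_K))`. -/
structure IsHorizRep {f f' : C(X, Y)} {g g' : C(Y, Z)} {h h' : C(X, Z)}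
    {Φ : OneMor K L f S} {Φ' : OneMor K L f' S} {Ψ : OneMor L M g T} {Ψ' : OneMor L M g' T}
    {Ξ : OneMor K M h S} {Ξ' : OneMor K M h' S} (c : CompData Φ Ψ Ξ) (c' : CompData Φ' Ψ' Ξ')
    (x : TwoMorRep Φ Φ') (y : TwoMorRep Ψ Ψ') (z : TwoMorRep Ξ Ξ') : Prop where
  dom_left : ∀ w, c.proj w ∈ z.dom → w.1.1 ∈ x.dom
  dom_right : ∀ w, c.proj w ∈ z.dom → w.1.2 ∈ y.dom
  lam_eq : ∀ (w : FibProd Φ Ψ) (hw : c.proj w ∈ z.dom), K.s (Φ.π w.1.1) = 0 →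
    ∃ h : Φ'.φ (x.lam ⟨w.1.1, dom_left w hw⟩) = Ψ'.π (y.lam ⟨w.1.2, dom_right w hw⟩),
      z.lam ⟨c.proj w, hw⟩ =
        c'.proj ⟨(x.lam ⟨w.1.1, dom_left w hw⟩, y.lam ⟨w.1.2, dom_right w hw⟩), h⟩
  lamHat_eq : ∃ rho : ∀ p : x.dom, K.E (Φ.π p) →L[ℝ] L.E (Φ.φ p),
    IsSmoothHom K.dim K.F K.E L.F L.E (fun p : x.dom ↦ Φ.π p) (fun p : x.dom ↦ Φ.φ p) rho ∧
    (∀ γ (p : x.dom) e, rho ⟨Φ.actL γ p, x.dom_actL γ p p.2⟩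
        (fiberCast K.E (Φ.π_actL γ p).symm (K.lift γ (Φ.π p) e))
      = fiberCast L.E (Φ.φ_actL γ p).symm (rho p e)) ∧
    (∀ δ (p : x.dom) e, rho ⟨Φ.actR δ p, x.dom_actR δ p p.2⟩
        (fiberCast K.E (Φ.π_actR δ p).symm e)
      = fiberCast L.E (Φ.φ_actR δ p).symm (L.lift δ (Φ.φ p) (rho p e))) ∧
    HomEqModAlong K.dim K.F K.E L.F L.E L.dim (fun p : x.dom ↦ Φ.π p) K.s
      (fun p : x.dom ↦ Φ'.φ (x.lam p)) (fun p : x.dom ↦ Φ.φ p)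
      (fun p : x.dom ↦ (Φ'.hat (x.lam p)).comp (fiberCast K.E (x.lam_π p).symm)) rho ∧
    ∀ (w : FibProd Φ Ψ) (hw : c.proj w ∈ z.dom) (e : K.E (Φ.π w.1.1)),
      z.lamHat ⟨c.proj w, hw⟩ (fiberCast K.E (c.proj_π w).symm e)
        = fiberCast M.T (c.proj_φ w).symm
            (mfderiv (𝓡 L.dim) (𝓡 M.dim) Ψ.φ w.1.2
                ((mfderiv (𝓡 L.dim) (𝓡 L.dim) Ψ.π w.1.2).inverse
                  (fiberCast L.T w.2 (x.lamHat ⟨w.1.1, dom_left w hw⟩ e)))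
              + y.lamHat ⟨w.1.2, dom_right w hw⟩
                  (fiberCast L.E w.2 (rho ⟨w.1.1, dom_left w hw⟩ e)))

/-- `z = (P, lam, 0)` represents the coherence 2-isomorphism
`(Θ ∘ Ψ) ∘ Φ ⇒ Θ ∘ (Ψ ∘ Φ)`, where `lam` is the natural identification
`[p, [q, r]] ↦ [[p, q], r]` of the iterated quotients of fibre products. -/
structure IsAssocRep {f : C(X, Y)} {g : C(Y, Z)} {k : C(Z, W)} {gf : C(X, Z)} {kg : C(Y, W)}
    {h h' : C(X, W)} {Φ : OneMor K L f S} {Ψ : OneMor L M g T} {Θ : OneMor M N k R}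
    {ΨΦ : OneMor K M gf S} {ΘΨ : OneMor L N kg T} {Ξ : OneMor K N h S} {Ξ' : OneMor K N h' S}
    (c : CompData Φ Ψ ΨΦ) (c₁ : CompData ΨΦ Θ Ξ') (d : CompData Ψ Θ ΘΨ) (d₁ : CompData Φ ΘΨ Ξ)
    (z : TwoMorRep Ξ Ξ') : Prop where
  mem : ∀ p, p ∈ z.dom
  lam_eq : ∀ p q r (h₁ : Φ.φ p = Ψ.π q) (h₂ : Ψ.φ q = Θ.π r),
    z.lam ⟨d₁.proj ⟨(p, d.proj ⟨(q, r), h₂⟩), h₁.trans (d.proj_π ⟨(q, r), h₂⟩).symm⟩, mem _⟩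
      = c₁.proj ⟨(c.proj ⟨(p, q), h₁⟩, r), (c.proj_φ ⟨(p, q), h₁⟩).trans h₂⟩
  lamHat_eq : ∀ p, z.lamHat p = 0

/-- `z = (P, lam, 0)` represents the coherence 2-isomorphism `Φ ∘ id_K ⇒ Φ`, where `lam` is the
natural identification `[(v, γ), p] ↦ γ⁻¹ · p` of `((V_K × Γ_K) ×_{V_K} P)/Γ_K` with `P`. -/
structure IsBetaRep {f : C(X, Y)} {i : C(X, X)} {h : C(X, Y)} {Φ : OneMor K L f S}
    {I : OneMor K K i S} {Ξ : OneMor K L h S} (d : IdData I) (c : CompData I Φ Ξ)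
    (z : TwoMorRep Ξ Φ) : Prop where
  mem : ∀ p, p ∈ z.dom
  lam_eq : ∀ v γ p (h : I.φ (d.e (v, γ)) = Φ.π p),
    z.lam ⟨c.proj ⟨(d.e (v, γ), p), h⟩, mem _⟩ = Φ.actL γ⁻¹ p
  lamHat_eq : ∀ p, z.lamHat p = 0

/-- `z = (P, lam, 0)` represents the coherence 2-isomorphism `id_L ∘ Φ ⇒ Φ`, where `lam` is the
natural identification `[p, (v, γ)] ↦ γ · p` of `(P ×_{V_L} (V_L × Γ_L))/Γ_L` with `P`. -/
structure IsGammaRep {f : C(X, Y)} {i : C(Y, Y)} {h : C(X, Y)} {Φ : OneMor K L f S}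
    {I : OneMor L L i T} {Ξ : OneMor K L h S} (d : IdData I) (c : CompData Φ I Ξ)
    (z : TwoMorRep Ξ Φ) : Prop where
  mem : ∀ p, p ∈ z.dom
  lam_eq : ∀ p v γ (h : Φ.φ p = I.π (d.e (v, γ))),
    z.lam ⟨c.proj ⟨(p, d.e (v, γ)), h⟩, mem _⟩ = Φ.actR γ p
  lamHat_eq : ∀ p, z.lamHat p = 0

end Structure

/-! ## Weak 2-categories of Kuranishi neighbourhoods -/

/-- Let `C` be a bicategory whose objects `A` have an underlying space `sp A`, a Kuranishi
neighbourhood `nb A` on it and a set `S A`, whose 1-morphisms `f` have an underlying continuous map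
`base f` and 1-morphism `one f` of Kuranishi neighbourhoods, and whose 2-morphisms `η` have an
underlying 2-morphism `two η`. This structure says that the identities, compositions and coherence
2-isomorphisms of `C` are those constructed for Kuranishi neighbourhoods: `idData` and `compData`
identify the identity and composite 1-morphisms, and the remaining fields give the 2-morphisms.

In `C` composition is written in diagrammatic order: `f ≫ g` is `g ∘ f` and `η ≫ θ` is `θ ⊙ η`. The
horizontal composition `θ * η` of `η : f ⟶ f'` and `θ : g ⟶ g'` is `η ▷ g ≫ f' ◁ θ`, and the
coherence 2-isomorphism `(k ∘ g) ∘ f ⇒ k ∘ (g ∘ f)` is the inverse of the associator of `f, g, k`. -/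
structure KurStructure {C : Type (u + 1)} [Bicategory.{u, u + 1} C] (sp : C → Type u)
    [∀ A, TopologicalSpace (sp A)] (nb : ∀ A, KurNbhd (sp A)) (S : ∀ A, Set (sp A))
    (base : ∀ {A B : C}, (A ⟶ B) → C(sp A, sp B))
    (one : ∀ {A B : C} (f : A ⟶ B), OneMor (nb A) (nb B) (base f) (S A))
    (two : ∀ {A B : C} {f g : A ⟶ B}, (f ⟶ g) → TwoMor (one f) (one g)) where
  base_id : ∀ A : C, base (𝟙 A) = ContinuousMap.id (sp A)
  base_comp : ∀ {A B D : C} (f : A ⟶ B) (g : B ⟶ D), base (f ≫ g) = (base g).comp (base f)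
  idData : ∀ A : C, IdData (one (𝟙 A))
  compData : ∀ {A B D : C} (f : A ⟶ B) (g : B ⟶ D), CompData (one f) (one g) (one (f ≫ g))
  two_id : ∀ {A B : C} (f : A ⟶ B), ∃ z : TwoMorRep (one f) (one f),
    IsIdRep z ∧ two (𝟙 f) = z.toTwoMor
  /-- For all choices of representatives, the vertical composition can be formed, and any way of
  forming it gives the composition in `C`. -/
  two_vert : ∀ {A B : C} {f g h : A ⟶ B} (η : f ⟶ g) (θ : g ⟶ h)
    (x : TwoMorRep (one f) (one g)) (y : TwoMorRep (one g) (one h)),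
    two η = x.toTwoMor → two θ = y.toTwoMor →
    (∃ z, IsVertRep x y z) ∧ ∀ z, IsVertRep x y z → two (η ≫ θ) = z.toTwoMor
  /-- Likewise for horizontal composition. -/
  two_horiz : ∀ {A B D : C} {f f' : A ⟶ B} {g g' : B ⟶ D} (η : f ⟶ f') (θ : g ⟶ g')
    (x : TwoMorRep (one f) (one f')) (y : TwoMorRep (one g) (one g')),
    two η = x.toTwoMor → two θ = y.toTwoMor →
    (∃ z, IsHorizRep (compData f g) (compData f' g') x y z) ∧
      ∀ z, IsHorizRep (compData f g) (compData f' g') x y z →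
        two (Bicategory.whiskerRight η g ≫ Bicategory.whiskerLeft f' θ) = z.toTwoMor
  two_assoc : ∀ {A B D G : C} (f : A ⟶ B) (g : B ⟶ D) (k : D ⟶ G),
    ∃ z, IsAssocRep (compData f g) (compData (f ≫ g) k) (compData g k) (compData f (g ≫ k)) z ∧
      two (Bicategory.associator f g k).inv = z.toTwoMor
  two_beta : ∀ {A B : C} (f : A ⟶ B),
    ∃ z, IsBetaRep (idData A) (compData (𝟙 A) f) z ∧ two (Bicategory.leftUnitor f).hom = z.toTwoMor
  two_gamma : ∀ {A B : C} (f : A ⟶ B),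
    ∃ z, IsGammaRep (idData B) (compData f (𝟙 B)) z ∧ two (Bicategory.rightUnitor f).hom = z.toTwoMor

/-- The objects of `Kur_S(X)`: Kuranishi neighbourhoods on `X` with `S ⊆ Im ψ`. -/
structure KurObj {X : Type u} [TopologicalSpace X] (S : Opens X) : Type (u + 1) where
  nb : KurNbhd X
  subset_footprint : (S : Set X) ⊆ nb.footprint

/-- The objects of `GKur`: topological spaces with a global Kuranishi neighbourhood. -/
structure GKurObj : Type (u + 1) where
  space : Type u
  [top : TopologicalSpace space]
  nb : KurNbhd space
  footprint_eq : nb.footprint = Set.univ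

attribute [instance] GKurObj.top

/-- The 1-morphisms `(f, Φ)` of `GKur`. -/
structure GKurHom (A B : GKurObj.{u}) : Type (u + 1) where
  map : C(A.space, B.space)
  mor : OneMor A.nb B.nb map Set.univ

/-- The 2-morphisms `(f, Φ) ⇒ (g, Ψ)` of `GKur`: they exist only if `f = g`, and are then the
2-morphisms `Φ ⇒ Ψ`. -/
structure GKurHom₂ {A B : GKurObj.{u}} (F G : GKurHom A B) : Type u where
  map_eq : F.map = G.map
  mor : TwoMor F.mor G.mor

end

/-!
# Kuranishi neighbourhoods form weak 2-categories

A 2-morphism is a class of triples `(dom, lam, lamHat)`. The idea is to turn every identity between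
such classes into a congruence of germs at a zero of `s`. The conditions `O(s)` and `O(s²)` hold
trivially where `s ≠ 0`, and they glue by partitions of unity, so they are equivalent to germ
congruences at the zeros (`HomCongAt`, `MapCongAt`). These are closed under sums, composition,
pullback, étale base change and, thanks to a connection, differentiation.

*Vertical composition.* A family with values in `φ'^*(TV)` is moved to `φ^*(TV)` up to `O(s)` by
partitions of unity, and made equivariant by averaging over the finite groups
(`exists_equivariant_homCongAt`). With `x.hatAt`, the value of `lamHat` along a map, vertical
composition becomes addition and the inverse is negation along `lam⁻¹`, so that 2-morphisms form a
groupoid.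

*Horizontal composition.* On `s⁻¹(0)` the map `lam` of the composite is forced. As `π` is étale with
free finite `Γ_j`-orbits as fibres, it extends, equivariantly and uniquely near the zero set
(`exists_horizLam`). The congruences are checked along a `HorizProbe`, an étale parametrization of
the fibre product on which `φ' ∘ lam` is also lifted; there `lamHat` is `horizHat`. Differentiating
`φ' ∘ lam = φ + lamHat · s + O(s²)` and the equation for `φhat` gives the interchange law and the
naturality of the unitors and the associator.

*Coherence.* The coherence 2-isomorphisms have `lamHat = 0`. Flat 2-morphisms (`TwoMorRep.IsFlat`)
are closed under both compositions and determined by `lam` over the zero set, so the triangle and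
pentagon identities reduce to identities between explicit maps.

*Existence and size.* Charts on `V × Γ` and on `(P ×_V P')/Γ_j` are pulled back along `π`. A 1-morphism
embeds in `V × Γ_j`, hence is isomorphic to one with a code in the universe of `V`
(`OneMor.nonempty_twoMor_of_code_eq`). Both bicategories are instances of one construction from a
`KurFrame`: base maps closed under identity and composition.
-/

set_option linter.unusedSectionVars false

open ContinuousLinearMap renaming comp_apply → clm_comp_apply, id_apply → clm_id_apply
open Bundle (TotalSpace)
open FiberBundle (mem_baseSet_trivializationAt)
open Filter (eventually_all univ_mem inter_mem)
open Finset (sum_congr sum_sub_distrib sum_insert)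
open Module (finBasis finrank)
open Set (MapsTo)
open TwoMorRep hiding Equiv

local notation "𝔼[" n "]" => EuclideanSpace ℝ (Fin n)
local notation "C∞[" m "," n "]" => ContMDiff (𝓡 m) (𝓡 n) ∞
local notation "C∞At[" m "," n "]" => ContMDiffAt (𝓡 m) (𝓡 n) ∞
local notation "C∞[" m "]" => ContMDiff (𝓡 m) 𝓘(ℝ) ∞
local notation "C∞At[" m "]" => ContMDiffAt (𝓡 m) 𝓘(ℝ) ∞
local notation "T[" n "," B "]" => (TangentSpace (𝓡 n) : B → Type)
local notation "Étale[" n "]" => IsLocalDiffeomorph (𝓡 n) (𝓡 n) ∞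
local notation "ÉtaleAt[" n "]" => IsLocalDiffeomorphAt (𝓡 n) (𝓡 n) ∞
local notation "D[" m "," n "]" => mfderiv (𝓡 m) (𝓡 n)
local notation "Conn[" K "]" => CovariantDerivative (𝓡 (KurNbhd.dim K)) (KurNbhd.F K) (KurNbhd.E K)

noncomputable section

/-- The sections of `a^*(E)^* ⊗ b^*(E')`. -/
abbrev HomFam {M B B' : Type*} (E : B → Type*) [∀ x, AddCommGroup (E x)] [∀ x, Module ℝ (E x)]
    [∀ x, TopologicalSpace (E x)] (E' : B' → Type*) [∀ x, AddCommGroup (E' x)]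
    [∀ x, Module ℝ (E' x)] [∀ x, TopologicalSpace (E' x)] (a : M → B) (b : M → B') :=
  ∀ p, E (a p) →L[ℝ] E' (b p)

lemma ContMDiffAt.mdiffAt {n : ℕ} {M N : Type*} [TopologicalSpace M] [ChartedSpace 𝔼[n] M]
    {H G : Type*} [NormedAddCommGroup G] [NormedSpace ℝ G] [TopologicalSpace H]
    {J : ModelWithCorners ℝ G H} [TopologicalSpace N] [ChartedSpace H N] {f : M → N} {p : M}
    (h : ContMDiffAt (𝓡 n) J ∞ f p) : MDifferentiableAt (𝓡 n) J f p :=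
  h.mdifferentiableAt (by simp)

section Smoothness

variable (m : ℕ) {M : Type*} [TopologicalSpace M] [ChartedSpace 𝔼[m] M] (n : ℕ) {B : Type*}
  [TopologicalSpace B] [ChartedSpace 𝔼[n] B] (F : Type*) [NormedAddCommGroup F] [NormedSpace ℝ F]
  (E : B → Type*) [∀ x, AddCommGroup (E x)] [∀ x, Module ℝ (E x)] [∀ x, TopologicalSpace (E x)]
  [TopologicalSpace (TotalSpace F E)] [FiberBundle F E] [VectorBundle ℝ F E]

/-- The section `e` of `a^*(E)` is smooth at `p`. -/
def SmVec (a : M → B) (e : ∀ p, E (a p)) (p : M) : Prop :=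
  ContMDiffAt (𝓡 m) ((𝓡 n).prod 𝓘(ℝ, F)) ∞ (fun q ↦ TotalSpace.mk' F (a q) (e q)) p

/-- The section `s` of `E` is smooth. -/
abbrev SmSec (s : ∀ x, E x) : Prop := ∀ x, SmVec n n F E (fun x ↦ x) s x

/-- The section `ξ` of `a^*(E)^*` is smooth at `p`: it maps smooth sections to smooth functions. -/
def SmCov (a : M → B) (ξ : ∀ p, E (a p) →L[ℝ] ℝ) (p : M) : Prop :=
  ∀ e, SmVec m n F E a e p → C∞At[m] (fun q ↦ ξ q (e q)) p

variable (n' : ℕ) {B' : Type*} [TopologicalSpace B'] [ChartedSpace 𝔼[n'] B'] (F' : Type*)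
  [NormedAddCommGroup F'] [NormedSpace ℝ F'] (E' : B' → Type*) [∀ x, AddCommGroup (E' x)]
  [∀ x, Module ℝ (E' x)] [∀ x, TopologicalSpace (E' x)] [TopologicalSpace (TotalSpace F' E')]
  [FiberBundle F' E'] [VectorBundle ℝ F' E']

/-- The section `L` of `a^*(E)^* ⊗ b^*(E')` is smooth at `p`: it maps smooth sections to smooth
sections. -/
def SmHom (a : M → B) (b : M → B') (L : ∀ p, E (a p) →L[ℝ] E' (b p)) (p : M) : Prop :=
  ∀ e, SmVec m n F E a e p → SmVec m n' F' E' b (fun q ↦ L q (e q)) p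

/-- The function `u` is `O(s)` near `p`: there `u = ξ · s` for a smooth section `ξ` of `a^*(E)^*`.
-/
def InI (a : M → B) (s : ∀ x, E x) (p : M) (u : M → ℝ) : Prop :=
  ∃ ξ : ∀ q, E (a q) →L[ℝ] ℝ, ∀ᶠ q in 𝓝 p, SmCov m n F E a ξ q ∧ u q = ξ q (s (a q))

/-- The function `u` is `O(s²)` near `p`: there `u = ξ · s` for a smooth section `ξ` of `a^*(E)^*`
that is itself `O(s)`. -/
def InI2 (a : M → B) (s : ∀ x, E x) (p : M) (u : M → ℝ) : Prop :=
  ∃ ξ : ∀ q, E (a q) →L[ℝ] ℝ, (∀ᶠ q in 𝓝 p, SmCov m n F E a ξ q ∧ u q = ξ q (s (a q))) ∧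
    ∀ e : ∀ q, E (a q), (∀ᶠ q in 𝓝 p, SmVec m n F E a e q) → InI m n F E a s p (fun q ↦ ξ q (e q))

/-- The germ version of `HomEqModAlong`: `b p = c p`, and `t₁ = t₂ + O(s)` near `p`, where
`t₁`, `t₂` have values in `b^*(E')` and `c^*(E')`. -/
def HomCongAt (a : M → B) (s : ∀ x, E x) (b c : M → B') (t₁ : ∀ p, E (a p) →L[ℝ] E' (b p))
    (t₂ : ∀ p, E (a p) →L[ℝ] E' (c p)) (p : M) : Prop :=
  b p = c p ∧ ∀ β : ∀ w, E' w →L[ℝ] ℝ, (∀ᶠ w in 𝓝 (c p), SmCov n' n' F' E' (fun w ↦ w) β w) →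
    ∀ e : ∀ q, E (a q), (∀ᶠ q in 𝓝 p, SmVec m n F E a e q) →
      InI m n F E a s p (fun q ↦ β (b q) (t₁ q (e q)) - β (c q) (t₂ q (e q)))

/-- The germ version of `MapEqModSq`: `b p = c p`, and `b = c + Λ · s + O(s²)` near `p`. -/
def MapCongAt (a : M → B) (s : ∀ x, E x) (b c : M → B')
    (Λ : ∀ p, E (a p) →L[ℝ] TangentSpace (𝓡 n') (c p)) (p : M) : Prop :=
  b p = c p ∧ ∀ h : B' → ℝ, (∀ᶠ w in 𝓝 (c p), C∞At[n'] h w) →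
    InI2 m n F E a s p (fun q ↦ h (b q) - (h (c q) + mvfderiv (𝓡 n') h (c q) (Λ q (s (a q)))))

/-- `b = c + O(s)` for maps to a manifold. -/
def MapEqMod (a : M → B) (s : ∀ x, E x) (b c : M → B') : Prop :=
  ∀ h : B' → ℝ, C∞[n'] h → ∀ p : M, InI m n F E a s p (fun q ↦ h (b q) - h (c q))

variable {m n n'} {E E'} {F F'}

/-! ### Local frames -/

section Frames
variable [FiniteDimensional ℝ F] (F) (E)

/-- The frame of `E` near `b₀` given by the preferred trivialization at `b₀`. -/
def frameAt (b₀ : B) (i : Fin (finrank ℝ F)) (b : B) : E b :=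
  (trivializationAt F E b₀).symmL ℝ b (finBasis ℝ F i)

/-- The coframe dual to `frameAt`. -/
def coframeAt (b₀ : B) (i : Fin (finrank ℝ F)) (b : B) : E b →L[ℝ] ℝ :=
  ((finBasis ℝ F).coord i).toContinuousLinearMap.comp
    ((trivializationAt F E b₀).continuousLinearMapAt ℝ b)

variable {F E}

lemma sum_coframeAt_smul {b₀ b : B} (hb : b ∈ (trivializationAt F E b₀).baseSet) (v : E b) :
    v = ∑ i, coframeAt F E b₀ i b v • frameAt F E b₀ i b := by
  have h := (finBasis ℝ F).sum_repr ((trivializationAt F E b₀).continuousLinearMapAt ℝ b v)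
  have h2 := congrArg ((trivializationAt F E b₀).symmL ℝ b) h
  rw [(trivializationAt F E b₀).symmL_continuousLinearMapAt hb, map_sum] at h2
  rw [← h2]
  refine sum_congr rfl fun i _ ↦ ?_
  rw [map_smul]
  simp only [h2]
  rfl

variable [ContMDiffVectorBundle ∞ F E (𝓡 n)]

lemma smVec_frameAt {a : M → B} {p : M} (ha : C∞At[m,n] a p) {b₀ : B}
    (hp : a p ∈ (trivializationAt F E b₀).baseSet) (i) :
    SmVec m n F E a (fun q ↦ frameAt F E b₀ i (a q)) p := by
  have h : a ⁻¹' (trivializationAt F E b₀).baseSet ∈ 𝓝 p :=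
    ha.continuousAt.preimage_mem_nhds ((trivializationAt F E b₀).open_baseSet.mem_nhds hp)
  refine ((trivializationAt F E b₀).contMDiffAt_iff ?_).2 ⟨ha, ?_⟩
  · simpa [Bundle.Trivialization.mem_source] using hp
  · refine (contMDiffAt_const (c := finBasis ℝ F i)).congr_of_eventuallyEq ?_
    filter_upwards [h] with q hq
    have := (trivializationAt F E b₀).continuousLinearMapAt_symmL (R := ℝ) hq (finBasis ℝ F i)
    simpa [frameAt, (trivializationAt F E b₀).coe_linearMapAt_of_mem hq] using this

lemma SmVec.coframeAt {a : M → B} {p : M} {e : ∀ p, E (a p)} (he : SmVec m n F E a e p) {b₀ : B}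
    (hp : a p ∈ (trivializationAt F E b₀).baseSet) (i) :
    C∞At[m] (fun q ↦ coframeAt F E b₀ i (a q) (e q)) p := by
  obtain ⟨ha, h⟩ := ((trivializationAt F E b₀).contMDiffAt_iff
    (by simpa [Bundle.Trivialization.mem_source] using hp)).1 he
  have h' : a ⁻¹' (trivializationAt F E b₀).baseSet ∈ 𝓝 p :=
    ha.continuousAt.preimage_mem_nhds ((trivializationAt F E b₀).open_baseSet.mem_nhds hp)
  have h2 := ((finBasis ℝ F).coord i).toContinuousLinearMap.contMDiff.contMDiffAt.comp p h
  refine h2.congr_of_eventuallyEq ?_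
  filter_upwards [h'] with q hq
  simp [_root_.coframeAt, (trivializationAt F E b₀).coe_linearMapAt_of_mem hq]

lemma SmVec.base {a : M → B} {p : M} {e : ∀ p, E (a p)} (he : SmVec m n F E a e p) :
    C∞At[m,n] a p := (Bundle.contMDiffAt_totalSpace.1 he).1

lemma smVec_iff {a : M → B} {p : M} {e : ∀ p, E (a p)} {b₀ : B}
    (hp : a p ∈ (trivializationAt F E b₀).baseSet) :
    SmVec m n F E a e p ↔ C∞At[m,n] a p ∧ ContMDiffAt (𝓡 m) 𝓘(ℝ, F) ∞
    (fun q ↦ (trivializationAt F E b₀).continuousLinearMapAt ℝ (a q) (e q)) p := by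
  refine ((trivializationAt F E b₀).contMDiffAt_iff
    (by simpa [Bundle.Trivialization.mem_source] using hp)).trans (and_congr_right fun ha ↦ ?_)
  have h' : a ⁻¹' (trivializationAt F E b₀).baseSet ∈ 𝓝 p :=
    ha.continuousAt.preimage_mem_nhds ((trivializationAt F E b₀).open_baseSet.mem_nhds hp)
  refine Filter.EventuallyEq.contMDiffAt_iff ?_
  filter_upwards [h'] with q hq
  simp [(trivializationAt F E b₀).coe_linearMapAt_of_mem hq]

end Frames

variable [FiniteDimensional ℝ F] [ContMDiffVectorBundle ∞ F E (𝓡 n)] [FiniteDimensional ℝ F']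
  [ContMDiffVectorBundle ∞ F' E' (𝓡 n')] {k : ℕ} {N : Type*} [TopologicalSpace N]
  [ChartedSpace 𝔼[k] N] {n'' : ℕ} {B'' : Type*} [TopologicalSpace B''] [ChartedSpace 𝔼[n''] B'']
  {F'' : Type*} [NormedAddCommGroup F''] [NormedSpace ℝ F''] {E'' : B'' → Type*}
  [∀ x, AddCommGroup (E'' x)] [∀ x, Module ℝ (E'' x)] [∀ x, TopologicalSpace (E'' x)]
  [TopologicalSpace (TotalSpace F'' E'')] [FiberBundle F'' E''] [VectorBundle ℝ F'' E'']
  [FiniteDimensional ℝ F''] [ContMDiffVectorBundle ∞ F'' E'' (𝓡 n'')]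
  [∀ x, IsTopologicalAddGroup (E x)] [∀ x, ContinuousSMul ℝ (E x)]
  [∀ x, IsTopologicalAddGroup (E' x)] [∀ x, ContinuousSMul ℝ (E' x)]
  [∀ x, IsTopologicalAddGroup (E'' x)] [∀ x, ContinuousSMul ℝ (E'' x)] {a : M → B} {b c d : M → B'}
  {s : ∀ x, E x} {p : M} {u u' : M → ℝ} {j : N → M}

-- the notions above for the bundles `E`, `E'`, the map `a` and the section `s` of this section
local notation "Vec∞" => SmVec m n F E
local notation "Vec'∞" => SmVec m n' F' E'
local notation "Cov∞" => SmCov m n F E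
local notation "Cov'∞" => SmCov n' n' F' E' (fun w ↦ w)
local notation "Hom∞" => SmHom m n F E n' F' E'
local notation "𝒪₁" => InI m n F E a s
local notation "𝒪₂" => InI2 m n F E a s
local notation "HomCong" => HomCongAt m n F E n' F' E' a s
local notation "MapCong" => MapCongAt m n F E n' a s
local notation "Triv" => trivializationAt F E
local notation "Fam" => HomFam E E'
local notation "Ftan" => HomFam E T[n',B']

lemma SmVec.congr {e e' : ∀ p, E (a p)} (he : Vec∞ a e p) (h : ∀ᶠ q in 𝓝 p, e' q = e q) :
    Vec∞ a e' p :=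
  ContMDiffAt.congr_of_eventuallyEq he (h.mono fun q hq ↦ by simp [hq])

lemma SmVec.add {e e' : ∀ p, E (a p)} (he : Vec∞ a e p) (he' : Vec∞ a e' p) :
    Vec∞ a (fun q ↦ e q + e' q) p := by
  have hp := mem_baseSet_trivializationAt F E (a p)
  rw [smVec_iff hp] at *
  exact ⟨he.1, by simpa using! he.2.add he'.2⟩

lemma SmVec.smul {f : M → ℝ} {e : ∀ p, E (a p)} (hf : C∞At[m] f p) (he : Vec∞ a e p) :
    Vec∞ a (fun q ↦ f q • e q) p := by
  have hp := mem_baseSet_trivializationAt F E (a p)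
  rw [smVec_iff hp] at *
  exact ⟨he.1, by simpa using! hf.smul he.2⟩

lemma smVec_zero (ha : C∞At[m,n] a p) : Vec∞ a (fun _ ↦ 0) p := by
  have hp := mem_baseSet_trivializationAt F E (a p)
  rw [smVec_iff hp]
  exact ⟨ha, by simpa using contMDiffAt_const⟩

lemma smVec_sum {ι : Type*} (I : Finset ι) {e : ι → ∀ p, E (a p)} (ha : C∞At[m,n] a p)
    (he : ∀ i ∈ I, Vec∞ a (e i) p) : Vec∞ a (fun q ↦ ∑ i ∈ I, e i q) p := by
  classical
  induction I using Finset.induction_on with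
  | empty => simpa using smVec_zero ha
  | insert i I hi ih =>
    simp only [sum_insert hi]
    exact (he i (by simp)).add (ih fun j hj ↦ he j (by simp [hj]))

/-- Smoothness of a covector needs to be tested on a frame only. -/
lemma smCov_of_frame {ξ : ∀ p, E (a p) →L[ℝ] ℝ} {b₀ : B} (hp : a p ∈ (Triv b₀).baseSet)
    (h : ∀ i, C∞At[m] (fun q ↦ ξ q (frameAt F E b₀ i (a q))) p) : Cov∞ a ξ p := by
  intro e he
  have h' : a ⁻¹' (Triv b₀).baseSet ∈ 𝓝 p :=
    he.base.continuousAt.preimage_mem_nhds ((Triv b₀).open_baseSet.mem_nhds hp)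
  have : C∞At[m] (fun q ↦ ∑ i, coframeAt F E b₀ i (a q) (e q) * ξ q (frameAt F E b₀ i (a q))) p :=
    contMDiffAt_finsetSum fun i _ ↦ (he.coframeAt hp i).mul (h i)
  refine this.congr_of_eventuallyEq ?_
  filter_upwards [h'] with q hq
  conv_lhs => rw [sum_coframeAt_smul hq (e q)]
  simp

lemma smHom_of_frame (hb : C∞At[m,n'] b p) {L : Fam a b} {b₀ : B} (hp : a p ∈ (Triv b₀).baseSet)
    (h : ∀ i, Vec'∞ b (fun q ↦ L q (frameAt F E b₀ i (a q))) p) : Hom∞ a b L p := by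
  intro e he
  have h' : a ⁻¹' (Triv b₀).baseSet ∈ 𝓝 p :=
    he.base.continuousAt.preimage_mem_nhds ((Triv b₀).open_baseSet.mem_nhds hp)
  have := smVec_sum (E := E') Finset.univ hb
    fun i _ ↦ SmVec.smul (E := E') (he.coframeAt hp i) (h i)
  refine this.congr ?_
  filter_upwards [h'] with q hq
  conv_lhs => rw [sum_coframeAt_smul hq (e q)]
  simp

lemma smHom_iff (ha : C∞At[m,n] a p) (hb : C∞At[m,n'] b p) {L : Fam a b} :
    Hom∞ a b L p ↔ ContMDiffAt (𝓡 m) 𝓘(ℝ, F →L[ℝ] F') ∞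
    (fun q ↦ ContinuousLinearMap.inCoordinates F E F' E' (a p) (a q) (b p) (b q) (L q)) p := by
  constructor
  · intro h
    have hp := mem_baseSet_trivializationAt F E (a p)
    have hp' := mem_baseSet_trivializationAt F' E' (b p)
    have h1 : ∀ i, ContMDiffAt (𝓡 m) 𝓘(ℝ, F') ∞ (fun q ↦
        ContinuousLinearMap.inCoordinates F E F' E' (a p) (a q) (b p) (b q) (L q)
          (finBasis ℝ F i)) p := fun i ↦
      ((smVec_iff hp').1 (h _ (smVec_frameAt ha hp i))).2
    have h2 : ∀ i, ContMDiffAt (𝓡 m) 𝓘(ℝ, F →L[ℝ] F') ∞ (fun q ↦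
        ContinuousLinearMap.smulRightL ℝ F F' ((finBasis ℝ F).coord i).toContinuousLinearMap
          (ContinuousLinearMap.inCoordinates F E F' E' (a p) (a q) (b p) (b q) (L q)
          (finBasis ℝ F i))) p := fun i ↦
      (ContinuousLinearMap.contMDiff _).contMDiffAt.comp p (h1 i)
    refine (contMDiffAt_finsetSum (t := Finset.univ) fun i _ ↦ h2 i).congr_of_eventuallyEq
      (.of_forall fun q ↦ ?_)
    ext v
    conv_lhs => rw [← (finBasis ℝ F).sum_repr v, map_sum]
    simp
  · intro h e he
    exact ContMDiffAt.clm_apply_of_inCoordinates h he hb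

lemma isSmoothHom_iff (ha : C∞[m,n] a) (hb : C∞[m,n'] b) {L : Fam a b} :
    IsSmoothHom m F E F' E' a b L ↔ ∀ p, Hom∞ a b L p :=
  forall_congr' fun p ↦ (smHom_iff (ha p) (hb p)).symm

lemma smVec_trivial_iff {g : M → ℝ} (ha : C∞At[m,n] a p) :
    SmVec m n ℝ (Bundle.Trivial B ℝ) a g p ↔ C∞At[m] g p := by
  refine Bundle.contMDiffAt_totalSpace.trans ?_
  simp only [ha, true_and]
  rfl

lemma smHom_trivial_iff (hb : C∞At[m,n'] b p) {ξ : ∀ p, E (a p) →L[ℝ] ℝ} :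
    SmHom m n F E n' ℝ (Bundle.Trivial B' ℝ) a b ξ p ↔ Cov∞ a ξ p :=
  forall₂_congr fun _ _ ↦ smVec_trivial_iff hb

lemma isSmoothCovector_iff {β :
    ∀ w, E w →L[ℝ] ℝ} : IsSmoothCovector n F E β ↔ ∀ w, SmCov n n F E (fun w ↦ w) β w :=
  (isSmoothHom_iff contMDiff_id contMDiff_id).trans
    (forall_congr' fun _ ↦ smHom_trivial_iff contMDiffAt_id)

lemma isSmoothBilin_of (ha : C∞[m,n] a) (hb : C∞[m,n'] b)
    {α : ∀ p, E (a p) →L[ℝ] E (a p) →L[ℝ] E' (b p)}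
    (h : ∀ p e, Vec∞ a e p → Hom∞ a b (fun q ↦ α q (e q)) p) : IsSmoothBilin m F E F' E' a b α := by
  intro p x
  refine (smHom_iff (ha p) (hb p)).1 (h p _ ?_)
  have hp := mem_baseSet_trivializationAt F E (a p)
  rw [smVec_iff hp]
  refine ⟨ha p, (contMDiffAt_const (c := x)).congr_of_eventuallyEq ?_⟩
  filter_upwards [(ha p).continuousAt.preimage_mem_nhds
    ((Triv (a p)).open_baseSet.mem_nhds hp)] with q hq
  have := (Triv (a p)).continuousLinearMapAt_symmL (R := ℝ) hq x
  rwa [(Triv (a p)).symmL_apply hq] at this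

lemma IsSmoothBilin.smHom (ha : C∞[m,n] a) (hb : C∞[m,n'] b)
    {α : ∀ p, E (a p) →L[ℝ] E (a p) →L[ℝ] E' (b p)} (h : IsSmoothBilin m F E F' E' a b α)
    {e : ∀ p, E (a p)} (he : Vec∞ a e p) : Hom∞ a b (fun q ↦ α q (e q)) p := by
  intro e' he'
  have hp := mem_baseSet_trivializationAt F E (a p)
  have h1 : ∀ i, Vec'∞ b (fun q ↦ α q (frameAt F E (a p) i (a q)) (e' q)) p :=
    fun i ↦ ((smHom_iff (ha p) (hb p)).2 (h p (finBasis ℝ F i)) _ he').congr <| by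
      filter_upwards [(ha p).continuousAt.preimage_mem_nhds
        ((Triv (a p)).open_baseSet.mem_nhds hp)] with q hq
      rw [frameAt, (Triv (a p)).symmL_apply hq]
  have := smVec_sum (E := E') Finset.univ (hb p)
    fun i _ ↦ SmVec.smul (E := E') (he.coframeAt hp i) (h1 i)
  refine this.congr ?_
  filter_upwards [(ha p).continuousAt.preimage_mem_nhds
    ((Triv (a p)).open_baseSet.mem_nhds hp)] with q hq
  conv_lhs => rw [sum_coframeAt_smul hq (e q)]
  simp

/-! ### Pullbacks of smooth families -/

lemma SmVec.comp {e : ∀ p, E (a p)} {q : N} (hj : C∞At[k,m] j q) (he : Vec∞ a e (j q)) :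
    SmVec k n F E (fun q ↦ a (j q)) (fun q ↦ e (j q)) q :=
  ContMDiffAt.comp (g := fun q ↦ TotalSpace.mk' F (a q) (e q)) q he hj

lemma SmCov.comp {ξ : ∀ p, E (a p) →L[ℝ] ℝ} {q : N} (hj : C∞At[k,m] j q) (ha : C∞At[m,n] a (j q))
    (hξ : Cov∞ a ξ (j q)) : SmCov k n F E (fun q ↦ a (j q)) (fun q ↦ ξ (j q)) q :=
  have hp := mem_baseSet_trivializationAt F E (a (j q))
  smCov_of_frame hp fun i ↦ (hξ _ (smVec_frameAt ha hp i)).comp q hj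

lemma SmHom.pull {L : Fam a b} {q : N} (hj : C∞At[k,m] j q) (ha : C∞At[m,n] a (j q))
    (hb : C∞At[m,n'] b (j q)) (hL : Hom∞ a b L (j q)) :
    SmHom k n F E n' F' E' (fun q ↦ a (j q)) (fun q ↦ b (j q)) (fun q ↦ L (j q)) q :=
  have hp := mem_baseSet_trivializationAt F E (a (j q))
  smHom_of_frame (b := fun q ↦ b (j q)) (hb.comp q hj) hp
    fun i ↦ (hL _ (smVec_frameAt ha hp i)).comp hj

/-! ### Algebra of smooth families -/

lemma SmCov.add {ξ ξ' : ∀ p, E (a p) →L[ℝ] ℝ} (h : Cov∞ a ξ p) (h' : Cov∞ a ξ' p) :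
    Cov∞ a (fun q ↦ ξ q + ξ' q) p :=
  fun e he ↦ (h e he).add (h' e he)

lemma SmCov.smul {f : M → ℝ} {ξ : ∀ p, E (a p) →L[ℝ] ℝ} (hf : C∞At[m] f p) (h : Cov∞ a ξ p) :
    Cov∞ a (fun q ↦ f q • ξ q) p :=
  fun e he ↦ hf.mul (h e he)

lemma smCov_zero : Cov∞ a (fun _ ↦ 0) p :=
  fun _ _ ↦ contMDiffAt_const

lemma SmCov.congr {ξ ξ' : ∀ p, E (a p) →L[ℝ] ℝ} (h : Cov∞ a ξ p) (h' : ∀ᶠ q in 𝓝 p, ξ' q = ξ q) :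
    Cov∞ a ξ' p :=
  fun e he ↦ (h e he).congr_of_eventuallyEq (h'.mono fun q hq ↦ by simp [hq])

lemma SmCov.comp_smHom {ξ : ∀ p, E' (b p) →L[ℝ] ℝ} {L : Fam a b} (h : SmCov m n' F' E' b ξ p)
    (hL : Hom∞ a b L p) : Cov∞ a (fun q ↦ (ξ q).comp (L q)) p :=
  fun e he ↦ h _ (hL e he)

lemma smCov_coframeAt {b₀ : B} (hp : a p ∈ (Triv b₀).baseSet) (i) :
    Cov∞ a (fun q ↦ coframeAt F E b₀ i (a q)) p :=
  fun _ he ↦ he.coframeAt hp i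

lemma SmHom.add {L L' : Fam a b} (h : Hom∞ a b L p) (h' : Hom∞ a b L' p) :
    Hom∞ a b (fun q ↦ L q + L' q) p :=
  fun e he ↦ (h e he).add (h' e he)

lemma SmHom.smul {f : M → ℝ} {L : Fam a b} (hf : C∞At[m] f p) (h : Hom∞ a b L p) :
    Hom∞ a b (fun q ↦ f q • L q) p :=
  fun e he ↦ (h e he).smul hf

lemma smHom_zero (hb : C∞At[m,n'] b p) : Hom∞ a b (fun _ ↦ 0) p :=
  fun _ _ ↦ smVec_zero hb

lemma smHom_sum {ι : Type*} (I : Finset ι) {L : ι → Fam a b} (hb : C∞At[m,n'] b p)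
    (h : ∀ i ∈ I, Hom∞ a b (L i) p) : Hom∞ a b (fun q ↦ ∑ i ∈ I, L i q) p :=
  fun e he ↦ by simpa using smVec_sum I hb fun i hi ↦ h i hi e he

lemma SmHom.congr {L L' : Fam a b} (h : Hom∞ a b L p) (h' : ∀ᶠ q in 𝓝 p, L' q = L q) :
    Hom∞ a b L' p :=
  fun e he ↦ (h e he).congr (h'.mono fun q hq ↦ by simp [hq])

lemma SmHom.comp {c : M → B''} {L' : ∀ p, E' (b p) →L[ℝ] E'' (c p)} {L : Fam a b}
    (h' : SmHom m n' F' E' n'' F'' E'' b c L' p) (h : Hom∞ a b L p) :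
    SmHom m n F E n'' F'' E'' a c (fun q ↦ (L' q).comp (L q)) p :=
  fun e he ↦ h' _ (h e he)

@[simp] lemma fiberCast_rfl {B : Type*} (E : B → Type*) [∀ x, AddCommGroup (E x)]
    [∀ x, Module ℝ (E x)] [∀ x, TopologicalSpace (E x)] {v : B} (h : v = v) :
    fiberCast E h = ContinuousLinearMap.id ℝ (E v) := rfl

lemma smHom_fiberCast {a' : M → B} (h : ∀ p, a p = a' p) (p : M) :
    SmHom m n F E n F E a a' (fun q ↦ fiberCast E (h q)) p := by
  obtain rfl : a = a' := funext h
  exact fun e he ↦ he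

/-! ### Gluing with partitions of unity -/

/-- Local smooth solutions of a pointwise convex condition glue to a global one. The smoothness
predicate `Sm` is arbitrary: it only has to be local and compatible with finite sums with smooth
coefficients. -/
theorem exists_glued [IsManifold (𝓡 m) ∞ M] [T2Space M] [SigmaCompactSpace M] {V : M → Type*}
    [∀ p, AddCommGroup (V p)] [∀ p, Module ℝ (V p)] (Sm : (∀ p, V p) → M → Prop)
    (hcongr : ∀ α α' p, Sm α p → (∀ᶠ q in 𝓝 p, α' q = α q) → Sm α' p)
    (hsum : ∀ (I : Finset M) (f : M → M → ℝ) (α : M → ∀ p, V p) (p : M),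
      (∀ i, C∞[m] (f i)) → (∀ i ∈ I, Sm (α i) p) →
      Sm (fun q ↦ ∑ i ∈ I, f i q • α i q) p) (P : ∀ p, Set (V p)) (hP : ∀ p, Convex ℝ (P p))
    (hloc : ∀ q, ∃ α : ∀ p, V p, ∀ᶠ p in 𝓝 q, α p ∈ P p ∧ Sm α p) :
    ∃ α : ∀ p, V p, ∀ p, α p ∈ P p ∧ Sm α p := by
  choose α hα using hloc
  obtain ⟨ρ, hρ⟩ := SmoothPartitionOfUnity.exists_isSubordinate (𝓡 m) (isClosed_univ (X := M))
    (fun q ↦ interior {p | α q p ∈ P p ∧ Sm (α q) p}) (fun _ ↦ isOpen_interior)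
    (fun q _ ↦ Set.mem_iUnion.2 ⟨q, mem_interior_iff_mem_nhds.2 (hα q)⟩)
  have key : ∀ i p, p ∈ tsupport (ρ i) → α i p ∈ P p ∧ Sm (α i) p := fun i p hp ↦
    interior_subset (s := {p | α i p ∈ P p ∧ Sm (α i) p}) (hρ i hp)
  refine ⟨fun p ↦ ∑ᶠ i, ρ i p • α i p, fun p ↦ ⟨?_, ?_⟩⟩
  · refine (hP p).finsum_mem (fun i ↦ ρ.nonneg i p) (ρ.sum_eq_one (Set.mem_univ p)) fun i hi ↦ ?_
    exact (key i p (subset_tsupport _ hi)).1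
  · refine hcongr _ _ p (hsum (ρ.fintsupport p) (fun i ↦ ρ i) α p (fun i ↦ (ρ i).contMDiff)
      fun i hi ↦ (key i p ((ρ.mem_fintsupport_iff p i).1 hi)).2) ?_
    filter_upwards [ρ.eventually_finsupport_subset p] with q hq
    refine finsum_eq_sum_of_support_subset _ fun i hi ↦ hq ?_
    rw [ρ.mem_finsupport]
    intro h
    exact hi (by simp only [h, zero_smul])

lemma InI.add (h : 𝒪₁ p u) (h' : 𝒪₁ p u') : 𝒪₁ p (fun q ↦ u q + u' q) := by
  obtain ⟨ξ, h⟩ := h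
  obtain ⟨ξ', h'⟩ := h'
  refine ⟨fun q ↦ ξ q + ξ' q, ?_⟩
  filter_upwards [h, h'] with q hq hq'
  exact ⟨hq.1.add hq'.1, by simp [hq.2, hq'.2]⟩

lemma InI.mul {f : M → ℝ} (hf : ∀ᶠ q in 𝓝 p, C∞At[m] f q) (h : 𝒪₁ p u) :
    𝒪₁ p (fun q ↦ f q * u q) := by
  obtain ⟨ξ, h⟩ := h
  refine ⟨fun q ↦ f q • ξ q, ?_⟩
  filter_upwards [h, hf] with q hq hf
  exact ⟨hq.1.smul hf, by simp [hq.2]⟩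

lemma InI.congr (h : 𝒪₁ p u) (h' : ∀ᶠ q in 𝓝 p, u' q = u q) : 𝒪₁ p u' := by
  obtain ⟨ξ, h⟩ := h
  refine ⟨ξ, ?_⟩
  filter_upwards [h, h'] with q hq h'
  exact ⟨hq.1, h'.trans hq.2⟩

lemma inI_zero : 𝒪₁ p (fun _ ↦ 0) :=
  ⟨fun _ ↦ 0, .of_forall fun _ ↦ ⟨smCov_zero, by simp⟩⟩

lemma InI.neg (h : 𝒪₁ p u) : 𝒪₁ p (fun q ↦ -u q) := by
  simpa using InI.mul (f := fun _ ↦ -1) (.of_forall fun _ ↦ contMDiffAt_const) h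

lemma InI.sub (h : 𝒪₁ p u) (h' : 𝒪₁ p u') : 𝒪₁ p (fun q ↦ u q - u' q) := by
  simpa [sub_eq_add_neg] using h.add h'.neg

lemma inI_sum {ι : Type*} (I : Finset ι) {u : ι → M → ℝ} (h : ∀ i ∈ I, 𝒪₁ p (u i)) :
    𝒪₁ p (fun q ↦ ∑ i ∈ I, u i q) := by
  classical
  induction I using Finset.induction_on with
  | empty => simpa using inI_zero
  | insert i I hi ih =>
    simp only [sum_insert hi]
    exact (h i (by simp)).add (ih fun j hj ↦ h j (by simp [hj]))

lemma InI2.add (h : 𝒪₂ p u) (h' : 𝒪₂ p u') : 𝒪₂ p (fun q ↦ u q + u' q) := by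
  obtain ⟨ξ, h, h1⟩ := h
  obtain ⟨ξ', h', h1'⟩ := h'
  refine ⟨fun q ↦ ξ q + ξ' q, ?_, fun e he ↦ by simpa using (h1 e he).add (h1' e he)⟩
  filter_upwards [h, h'] with q hq hq'
  exact ⟨hq.1.add hq'.1, by simp [hq.2, hq'.2]⟩

lemma InI2.mul {f : M → ℝ} (hf : ∀ᶠ q in 𝓝 p, C∞At[m] f q) (h : 𝒪₂ p u) :
    𝒪₂ p (fun q ↦ f q * u q) := by
  obtain ⟨ξ, h, h1⟩ := h
  refine ⟨fun q ↦ f q • ξ q, ?_, fun e he ↦ by simpa using (h1 e he).mul hf⟩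
  filter_upwards [h, hf] with q hq hf
  exact ⟨hq.1.smul hf, by simp [hq.2]⟩

lemma InI2.congr (h : 𝒪₂ p u) (h' : ∀ᶠ q in 𝓝 p, u' q = u q) : 𝒪₂ p u' := by
  obtain ⟨ξ, h, h1⟩ := h
  refine ⟨ξ, ?_, h1⟩
  filter_upwards [h, h'] with q hq h'
  exact ⟨hq.1, h'.trans hq.2⟩

lemma inI2_zero : 𝒪₂ p (fun _ ↦ 0) :=
  ⟨fun _ ↦ 0, .of_forall fun _ ↦ ⟨smCov_zero, by simp⟩, fun _ _ ↦ by simpa using inI_zero⟩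

lemma InI2.neg (h : 𝒪₂ p u) : 𝒪₂ p (fun q ↦ -u q) := by
  simpa using InI2.mul (f := fun _ ↦ -1) (.of_forall fun _ ↦ contMDiffAt_const) h

lemma InI2.inI (h : 𝒪₂ p u) : 𝒪₁ p u := ⟨h.choose, h.choose_spec.1⟩

/-- A covector with values in `O(s)`, applied to `s`, is `O(s²)`. -/
lemma inI2_of_cov {ξ : ∀ q, E (a q) →L[ℝ] ℝ} (hξ : ∀ᶠ q in 𝓝 p, Cov∞ a ξ q)
    (h : ∀ e : ∀ q, E (a q), (∀ᶠ q in 𝓝 p, Vec∞ a e q) → 𝒪₁ p (fun q ↦ ξ q (e q))) :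
    𝒪₂ p (fun q ↦ ξ q (s (a q))) :=
  ⟨ξ, hξ.mono fun _ hq ↦ ⟨hq, rfl⟩, h⟩

lemma smVec_pull_section (ha : C∞[m,n] a) (hs : SmSec n F E s) (q : M) :
    Vec∞ a (fun q ↦ s (a q)) q :=
  ContMDiffAt.comp (g := fun x ↦ TotalSpace.mk' F x (s x)) q (hs (a q)) (ha q)

/-- Away from the zeros of `s` every smooth function is `O(s)`. -/
lemma inI_of_ne (ha : C∞[m,n] a) (hs : SmSec n F E s) (h : s (a p) ≠ 0)
    (hu : ∀ᶠ q in 𝓝 p, C∞At[m] u q) : 𝒪₁ p u := by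
  have hp := mem_baseSet_trivializationAt F E (a p)
  have hbase : ∀ᶠ q in 𝓝 p, a q ∈ (Triv (a p)).baseSet :=
    (ha p).continuousAt.preimage_mem_nhds ((Triv (a p)).open_baseSet.mem_nhds hp)
  obtain ⟨i, hi⟩ : ∃ i, coframeAt F E (a p) i (a p) (s (a p)) ≠ 0 := by
    by_contra! hcon
    exact h (by rw [sum_coframeAt_smul hp (s (a p))]; simp [hcon])
  have hsm : ∀ᶠ q in 𝓝 p, C∞At[m] (fun q ↦ coframeAt F E (a p) i (a q) (s (a q))) q := by
    filter_upwards [hbase] with q hq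
    exact (smVec_pull_section ha hs q).coframeAt hq i
  have hne := hsm.self_of_nhds.continuousAt.eventually_ne hi
  refine ⟨fun q ↦ (u q * (coframeAt F E (a p) i (a q) (s (a q)))⁻¹) •
    coframeAt F E (a p) i (a q), ?_⟩
  filter_upwards [hbase, hsm, hne, hu] with q hq h1 h2 h3
  refine ⟨(smCov_coframeAt hq i).smul (h3.mul (h1.inv₀ h2)), ?_⟩
  simp [h2]

lemma inI2_of_ne (ha : C∞[m,n] a) (hs : SmSec n F E s) (h : s (a p) ≠ 0)
    (hu : ∀ᶠ q in 𝓝 p, C∞At[m] u q) : 𝒪₂ p u := by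
  obtain ⟨ξ, hξ⟩ := inI_of_ne ha hs h hu
  refine ⟨ξ, hξ, fun e he ↦ inI_of_ne ha hs h ?_⟩
  filter_upwards [hξ, he] with q hq he
  exact hq.1 _ he

lemma InI.eventually_smooth (ha : C∞[m,n] a) (hs : SmSec n F E s) (h : 𝒪₁ p u) :
    ∀ᶠ q in 𝓝 p, C∞At[m] u q := by
  obtain ⟨ξ, h⟩ := h
  filter_upwards [h.eventually_nhds] with q hq
  exact (hq.self_of_nhds.1 _ (smVec_pull_section ha hs q)).congr_of_eventuallyEq
    (hq.mono fun _ h ↦ h.2)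

lemma InI.eq_zero (h : 𝒪₁ p u) (h0 : s (a p) = 0) : u p = 0 := by
  obtain ⟨ξ, h⟩ := h
  simp [h.self_of_nhds.2, h0]

/-- Change of the section: if `s' = τ · s` with `τ` smooth, then `O(s')` is contained in `O(s)`. -/
lemma InI.of_section {a' : M → B'} {s' : ∀ x, E' x} (τ : Fam a a')
    (hτ : ∀ᶠ q in 𝓝 p, Hom∞ a a' τ q ∧ s' (a' q) = τ q (s (a q))) (h : InI m n' F' E' a' s' p u) :
    𝒪₁ p u := by
  obtain ⟨ξ, h⟩ := h
  refine ⟨fun q ↦ (ξ q).comp (τ q), ?_⟩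
  filter_upwards [h, hτ] with q hq hτ
  exact ⟨hq.1.comp_smHom hτ.1, by simp [hq.2, hτ.2]⟩

lemma InI2.of_section {a' : M → B'} {s' : ∀ x, E' x} (τ : Fam a a')
    (hτ : ∀ᶠ q in 𝓝 p, Hom∞ a a' τ q ∧ s' (a' q) = τ q (s (a q))) (h : InI2 m n' F' E' a' s' p u) :
    𝒪₂ p u := by
  obtain ⟨ξ, h, h1⟩ := h
  refine ⟨fun q ↦ (ξ q).comp (τ q), ?_, fun e he ↦ ?_⟩
  · filter_upwards [h, hτ] with q hq hτ
    exact ⟨hq.1.comp_smHom hτ.1, by simp [hq.2, hτ.2]⟩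
  · refine InI.of_section τ hτ (h1 (fun q ↦ τ q (e q)) ?_)
    filter_upwards [he, hτ] with q he hτ
    exact hτ.1 _ he

/-- Change of base: `O(s)` is stable under pullback. -/
lemma InI.comp (ha : C∞[m,n] a) (hj : C∞[k,m] j) {q : N} (h : 𝒪₁ (j q) u) :
    InI k n F E (fun q ↦ a (j q)) s q (fun q ↦ u (j q)) := by
  obtain ⟨ξ, h⟩ := h
  refine ⟨fun q ↦ ξ (j q), ?_⟩
  filter_upwards [(hj q).continuousAt.eventually h] with q hq
  exact ⟨hq.1.comp (hj q) (ha _), hq.2⟩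

/-- To test that a covector has values in `O(s)`, it suffices to use a local frame. -/
lemma inI_of_frame {ξ : ∀ q, E' (b q) →L[ℝ] ℝ} (hb : C∞[m,n'] b) {b₀ : B'}
    (hp : b p ∈ (trivializationAt F' E' b₀).baseSet)
    (h : ∀ i, 𝒪₁ p (fun q ↦ ξ q (frameAt F' E' b₀ i (b q)))) {e : ∀ q, E' (b q)}
    (he : ∀ᶠ q in 𝓝 p, Vec'∞ b e q) : 𝒪₁ p (fun q ↦ ξ q (e q)) := by
  have hbase : ∀ᶠ q in 𝓝 p, b q ∈ (trivializationAt F' E' b₀).baseSet :=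
    (hb p).continuousAt.preimage_mem_nhds ((trivializationAt F' E' b₀).open_baseSet.mem_nhds hp)
  refine (inI_sum Finset.univ fun i _ ↦ (h i).mul (f := fun q ↦
    coframeAt F' E' b₀ i (b q) (e q)) ?_).congr ?_
  · filter_upwards [hbase, he] with q hq he using he.coframeAt hq i
  · filter_upwards [hbase] with q hq
    conv_lhs => rw [sum_coframeAt_smul hq (e q)]
    simp

lemma InI2.comp (ha : C∞[m,n] a) (hj : C∞[k,m] j) {q : N} (h : 𝒪₂ (j q) u) :
    InI2 k n F E (fun q ↦ a (j q)) s q (fun q ↦ u (j q)) := by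
  obtain ⟨ξ, h, h1⟩ := h
  refine ⟨fun q ↦ ξ (j q), ?_, fun e he ↦ ?_⟩
  · filter_upwards [(hj q).continuousAt.eventually h] with q hq
    exact ⟨hq.1.comp (hj q) (ha _), hq.2⟩
  · have hp := mem_baseSet_trivializationAt F E (a (j q))
    refine inI_of_frame (b := fun q ↦ a (j q)) (ξ := fun q ↦ ξ (j q)) (ha.comp hj) hp
      (fun i ↦ ?_) he
    refine InI.comp ha hj (h1 (fun q' ↦ frameAt F E (a (j q)) i (a q')) ?_)
    filter_upwards [(ha (j q)).continuousAt.preimage_mem_nhds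
      ((Triv (a (j q))).open_baseSet.mem_nhds hp)] with q' hq'
    exact smVec_frameAt (ha q') hq' i

lemma eventually_mem_baseSet (ha : C∞[m,n] a) (p : M) : ∀ᶠ q in 𝓝 p, a q ∈ (Triv (a p)).baseSet :=
  (ha p).continuousAt.preimage_mem_nhds ((Triv (a p)).open_baseSet.mem_nhds
    (mem_baseSet_trivializationAt F E (a p)))

section Conversion

variable [IsManifold (𝓡 m) ∞ M] [T2Space M] [SigmaCompactSpace M]

/-- Gluing of sections of `a^*(E)^* ⊗ a^*(E)^* ⊗ b^*(E')` with pointwise convex conditions. -/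
lemma exists_glued_bilin (ha : C∞[m,n] a) (hb : C∞[m,n'] b)
    (P : ∀ p, Set (E (a p) →L[ℝ] E (a p) →L[ℝ] E' (b p))) (hP : ∀ p, Convex ℝ (P p))
    (hloc : ∀ p, ∃ α : ∀ p, E (a p) →L[ℝ] E (a p) →L[ℝ] E' (b p), ∀ᶠ q in 𝓝 p, α q ∈ P q ∧
      ∀ e, Vec∞ a e q → Hom∞ a b (fun q ↦ α q (e q)) q) :
    ∃ α : ∀ p, E (a p) →L[ℝ] E (a p) →L[ℝ] E' (b p), IsSmoothBilin m F E F' E' a b α ∧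
    ∀ p, α p ∈ P p := by
  obtain ⟨α, hα⟩ := exists_glued (m := m) (V := fun p ↦ E (a p) →L[ℝ] E (a p) →L[ℝ] E' (b p))
    (fun α q ↦ ∀ e, Vec∞ a e q → Hom∞ a b (fun q ↦ α q (e q)) q)
    (fun α α' p h h' e he ↦ (h e he).congr (h'.mono fun q hq ↦ by simp [hq]))
    (fun I f α p hf h e he ↦ by
      refine (smHom_sum (E' := E') I (hb p) fun i hi ↦
        (h i hi e he).smul (hf i p)).congr (.of_forall fun q ↦ ?_)
      simp) P hP hloc
  exact ⟨α, isSmoothBilin_of ha hb fun p ↦ (hα p).2, fun p ↦ (hα p).1⟩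

/-- `t₁ = t₂ + O(s)` may be tested on local sections and covectors. -/
lemma homEqMod_iff (ha : C∞[m,n] a) (hb : C∞[m,n'] b) {t₁ t₂ : Fam a b} : HomEqMod m F E F' E' a s b
    t₁ t₂ ↔ ∀ (p : M) (ζ : ∀ q, E' (b q) →L[ℝ] ℝ), (∀ᶠ q in 𝓝 p, SmCov m n' F' E' b ζ q) → ∀ e :
    ∀ q, E (a q), (∀ᶠ q in 𝓝 p, Vec∞ a e q) → 𝒪₁ p (fun q ↦ ζ q (t₁ q (e q)) - ζ q (t₂ q (e q))) :=
    by
  constructor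
  · rintro ⟨α, hα, h⟩ p ζ hζ e he
    refine ⟨fun q ↦ ⟨((ζ q : E' (b q) →ₗ[ℝ] ℝ)) ∘ₗ
      { toFun := fun v ↦ α q v (e q)
        map_add' := by simp
        map_smul' := by simp },
      (ζ q).continuous.comp ((ContinuousEvalConst.continuous_eval_const (e q)).comp
        (α q).continuous)⟩, ?_⟩
    filter_upwards [hζ, he] with q hζ he
    refine ⟨fun e' he' ↦ hζ _ (hα.smHom ha hb he' _ he), ?_⟩
    simp [h q]
  · intro h
    refine exists_glued_bilin ha hb (fun p ↦ {α | t₁ p = t₂ p + α (s (a p))}) (fun p ↦ ?_)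
      fun p ↦ ?_
    · intro α hα α' hα' x y hx hy hxy
      simp only [Set.mem_ofPred_eq] at *
      have e1 : α (s (a p)) = t₁ p - t₂ p := by rw [hα]; abel
      have e2 : α' (s (a p)) = t₁ p - t₂ p := by rw [hα']; abel
      rw [add_apply, smul_apply, smul_apply, e1, e2, ← add_smul, hxy, one_smul]
      abel
    · have hE : ∀ᶠ q in 𝓝 p, a q ∈ (Triv (a p)).baseSet := eventually_mem_baseSet ha p
      have hE' : ∀ᶠ q in 𝓝 p, b q ∈ (trivializationAt F' E' (b p)).baseSet :=
        eventually_mem_baseSet hb p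
      have h1 := fun i i' ↦ h p (fun q ↦ coframeAt F' E' (b p) i' (b q))
        (hE'.mono fun q hq ↦ smCov_coframeAt hq i') (fun q ↦ frameAt F E (a p) i (a q))
        (hE.mono fun q hq ↦ smVec_frameAt (ha q) hq i)
      choose ξ hξ using h1
      refine ⟨fun q ↦ ∑ i, ∑ i', (ξ i i' q).smulRight ((coframeAt F E (a p) i (a q)).smulRight
        (frameAt F' E' (b p) i' (b q))), ?_⟩
      have hξ' := eventually_all.2 fun i ↦ eventually_all.2 fun i' ↦ hξ i i'
      filter_upwards [hE, hE', hξ'] with q hq hq' hξ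
      refine ⟨?_, fun e he e' he' ↦ ?_⟩
      · have key : ∀ v, t₁ q v - t₂ q v = ∑ i, ∑ i', ξ i i' q (s (a q)) •
            coframeAt F E (a p) i (a q) v • frameAt F' E' (b p) i' (b q) := by
          intro v
          conv_lhs => rw [sum_coframeAt_smul hq v]
          simp only [map_sum, map_smul]
          rw [← sum_sub_distrib]
          refine sum_congr rfl fun i _ ↦ ?_
          rw [← smul_sub, sum_coframeAt_smul hq' (t₁ q (frameAt F E (a p) i (a q)) - _),
            Finset.smul_sum]
          refine sum_congr rfl fun i' _ ↦ ?_
          rw [map_sub, (hξ i i').2, smul_comm]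
        change t₁ q = t₂ q + _
        ext v
        rw [add_apply, ← sub_eq_iff_eq_add', key]
        simp
      · have := smVec_sum (E := E') Finset.univ (hb q) fun i _ ↦ smVec_sum (E := E') Finset.univ
          (hb q) fun i' _ ↦ ((smVec_frameAt (E := E') (hb q) hq' i').smul
            (he'.coframeAt hq i)).smul ((hξ i i').1 _ he)
        refine this.congr (.of_forall fun q ↦ ?_)
        simp

/-- `t₁ = t₂ + O(s²)` may be tested on local covectors. -/
lemma sectionEqModSq_iff (ha : C∞[m,n] a) (hb : C∞[m,n'] b) (hs : SmSec n F E s)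
    {t₁ t₂ : ∀ p, E' (b p)} :
    SectionEqModSq m F E F' E' a s b t₁ t₂ ↔ ∀ (p : M) (ζ : ∀ q, E' (b q) →L[ℝ] ℝ),
    (∀ᶠ q in 𝓝 p, SmCov m n' F' E' b ζ q) → 𝒪₂ p (fun q ↦ ζ q (t₁ q) - ζ q (t₂ q)) := by
  constructor
  · rintro ⟨α, hα, h⟩ p ζ hζ
    refine ⟨fun q ↦ (ζ q).comp (α q (s (a q))), ?_, fun e he ↦ ?_⟩
    · filter_upwards [hζ] with q hζ
      exact ⟨hζ.comp_smHom (hα.smHom ha hb (smVec_pull_section ha hs q)), by simp [h q]⟩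
    · have h1 : HomEqMod m F E F' E' a s b (fun q ↦ α q (s (a q))) (fun q ↦ 0) :=
        ⟨α, hα, fun q ↦ by simp⟩
      simpa using (homEqMod_iff ha hb).1 h1 p ζ hζ e he
  · intro h
    refine exists_glued_bilin ha hb (fun p ↦ {α | t₁ p = t₂ p + α (s (a p)) (s (a p))})
      (fun p ↦ ?_) fun p ↦ ?_
    · intro α hα α' hα' x y hx hy hxy
      simp only [Set.mem_ofPred_eq] at *
      have e1 : α (s (a p)) (s (a p)) = t₁ p - t₂ p := by rw [hα]; abel
      have e2 : α' (s (a p)) (s (a p)) = t₁ p - t₂ p := by rw [hα']; abel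
      rw [add_apply, smul_apply, smul_apply, add_apply, smul_apply, smul_apply, e1, e2,
        ← add_smul, hxy, one_smul]
      abel
    · have hE : ∀ᶠ q in 𝓝 p, a q ∈ (Triv (a p)).baseSet := eventually_mem_baseSet ha p
      have hE' : ∀ᶠ q in 𝓝 p, b q ∈ (trivializationAt F' E' (b p)).baseSet :=
        eventually_mem_baseSet hb p
      have h1 := fun i' ↦ h p (fun q ↦ coframeAt F' E' (b p) i' (b q))
        (hE'.mono fun q hq ↦ smCov_coframeAt hq i')
      choose ζ hζ hζ1 using h1
      have h2 := fun i i' ↦ hζ1 i' (fun q ↦ frameAt F E (a p) i (a q))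
        (hE.mono fun q hq ↦ smVec_frameAt (ha q) hq i)
      choose ξ hξ using h2
      refine ⟨fun q ↦ ∑ i, ∑ i', (ξ i i' q).smulRight ((coframeAt F E (a p) i (a q)).smulRight
        (frameAt F' E' (b p) i' (b q))), ?_⟩
      have hξ' := eventually_all.2 fun i ↦ eventually_all.2 fun i' ↦ hξ i i'
      have hζ' := eventually_all.2 hζ
      filter_upwards [hE, hE', hξ', hζ'] with q hq hq' hξ hζ
      refine ⟨?_, fun e he e' he' ↦ ?_⟩
      · have key : t₁ q - t₂ q = ∑ i, ∑ i', ξ i i' q (s (a q)) •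
            coframeAt F E (a p) i (a q) (s (a q)) • frameAt F' E' (b p) i' (b q) := by
          rw [sum_coframeAt_smul hq' (t₁ q - t₂ q), Finset.sum_comm]
          refine sum_congr rfl fun i' _ ↦ ?_
          have e : ζ i' q (s (a q)) = ∑ i, ξ i i' q (s (a q)) *
              coframeAt F E (a p) i (a q) (s (a q)) := by
            conv_lhs => rw [sum_coframeAt_smul hq (s (a q)), map_sum]
            exact sum_congr rfl fun i _ ↦ by
              rw [map_smul, (hξ i i').2, smul_eq_mul, mul_comm]
          rw [map_sub, (hζ i').2, e, Finset.sum_smul]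
          simp only [mul_smul]
        change t₁ q = t₂ q + _
        rw [← sub_eq_iff_eq_add', key]
        simp
      · have := smVec_sum (E := E') Finset.univ (hb q) fun i _ ↦ smVec_sum (E := E') Finset.univ
          (hb q) fun i' _ ↦ ((smVec_frameAt (E := E') (hb q) hq' i').smul
            (he'.coframeAt hq i)).smul ((hξ i i').1 _ he)
        refine this.congr (.of_forall fun q ↦ ?_)
        simp

end Conversion

section Extension
variable [IsManifold (𝓡 n) ∞ B] [T2Space B]

instance contMDiffVectorBundle_tangent : ContMDiffVectorBundle ∞ 𝔼[n] T[n,B] (𝓡 n) :=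
  have : IsManifold (𝓡 n) (∞ + 1) B := by simpa
  inferInstance

/-! ### Extension of local data by bump functions -/

lemma exists_bump {b₀ : B} {U : Set B} (hU : U ∈ 𝓝 b₀) :
    ∃ χ : B → ℝ, C∞[n] χ ∧ (∀ᶠ b in 𝓝 b₀, χ b = 1) ∧ (∀ b, b ∈ U ∨ ∀ᶠ b' in 𝓝 b, χ b' = 0) ∧
    χ b₀ = 1 ∧ ∀ b, b ∉ U → χ b = 0 := by
  obtain ⟨f, -, hf⟩ := (SmoothBumpFunction.nhds_basis_tsupport (I := 𝓡 n) b₀).mem_iff.1 hU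
  refine ⟨f, f.contMDiff, f.eventuallyEq_one, fun b ↦ ?_, f.eq_one, fun b hb ↦ ?_⟩
  · by_cases hb : b ∈ tsupport f
    · exact Or.inl (hf hb)
    · right
      filter_upwards [(isClosed_tsupport f).isOpen_compl.mem_nhds hb] with b' hb'
      exact image_eq_zero_of_notMem_tsupport hb'
  · exact image_eq_zero_of_notMem_tsupport fun h ↦ hb (hf h)

lemma exists_extend_fun {b₀ : B} {h : B → ℝ} (hh : ∀ᶠ b in 𝓝 b₀, C∞At[n] h b) :
    ∃ h' : B → ℝ, C∞[n] h' ∧ ∀ᶠ b in 𝓝 b₀, h' b = h b := by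
  obtain ⟨χ, h1, h2, h3, -⟩ := exists_bump (n := n) hh
  refine ⟨fun b ↦ χ b * h b, fun b ↦ ?_, h2.mono fun b hb ↦ by simp [hb]⟩
  rcases h3 b with hb | hb
  · exact (h1 b).mul hb
  · exact (contMDiffAt_const (c := (0 : ℝ))).congr_of_eventuallyEq
      (hb.mono fun b' hb' ↦ by simp [hb'])

lemma exists_extend_cov {b₀ : B} {β : ∀ b, E b →L[ℝ] ℝ}
    (hβ : ∀ᶠ b in 𝓝 b₀, SmCov n n F E (fun b ↦ b) β b) :
    ∃ β' : ∀ b, E b →L[ℝ] ℝ, IsSmoothCovector n F E β' ∧ ∀ᶠ b in 𝓝 b₀, β' b = β b := by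
  obtain ⟨χ, h1, h2, h3, -⟩ := exists_bump (n := n) hβ
  refine ⟨fun b ↦ χ b • β b, isSmoothCovector_iff.2 fun b ↦ ?_, h2.mono fun b hb ↦ by simp [hb]⟩
  rcases h3 b with hb | hb
  · exact hb.smul (h1 b)
  · exact smCov_zero.congr (hb.mono fun b' hb' ↦ by simp [hb'])

lemma exists_extend_vec {b₀ : B} {σ : ∀ b, E b} (hσ : ∀ᶠ b in 𝓝 b₀, SmVec n n F E (fun b ↦ b) σ b) :
    ∃ σ' : ∀ b, E b, (∀ b, SmVec n n F E (fun b ↦ b) σ' b) ∧ ∀ᶠ b in 𝓝 b₀, σ' b = σ b := by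
  obtain ⟨χ, h1, h2, h3, -⟩ := exists_bump (n := n) hσ
  refine ⟨fun b ↦ χ b • σ b, fun b ↦ ?_, h2.mono fun b hb ↦ by simp [hb]⟩
  rcases h3 b with hb | hb
  · exact SmVec.smul (h1 b) hb
  · exact (smVec_zero contMDiffAt_id).congr (hb.mono fun b' hb' ↦ by simp [hb'])

end Extension

section Tangent
variable [IsManifold (𝓡 m) ∞ M] [IsManifold (𝓡 n) ∞ B]

/-! ### Derivatives as smooth families -/

lemma smHom_mfderiv {f : M → B} (hf : C∞At[m,n] f p) :
    SmHom m m 𝔼[m] T[m,M] n 𝔼[n] T[n,B] (fun q ↦ q) f (fun q ↦ D[m,n] f q) p := by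
  have : IsManifold (𝓡 m) 1 M := .of_le (n := ∞) (by simp)
  have : IsManifold (𝓡 n) 1 B := .of_le (n := ∞) (by simp)
  exact (smHom_iff contMDiffAt_id hf).2 (hf.mfderiv_const (by simp))

lemma smCov_mvfderiv {h : M → ℝ} (hh : C∞At[m] h p) :
    SmCov m m 𝔼[m] T[m,M] (fun q ↦ q) (fun q ↦ mvfderiv (𝓡 m) h q) p := by
  have : IsManifold (𝓡 m) 1 M := .of_le (n := ∞) (by simp)
  intro e he
  have h1 := hh.mfderiv_const (m := ∞) (by simp)
  have h2 := ContMDiffAt.clm_apply_of_inCoordinates (b₁ := fun q : M ↦ q) (b₂ := h) h1 he hh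
  have h3 := (Bundle.contMDiffAt_totalSpace.1 h2).2
  exact h3.congr_of_eventuallyEq (.of_forall fun q ↦ by simp [mvfderiv]; rfl)

end Tangent

section AlongMaps

variable [IsManifold (𝓡 m) ∞ M] [T2Space M] [SigmaCompactSpace M]

/-! ### Congruences along two maps -/

lemma clm_trivial_apply {q : M} (ζ : Bundle.Trivial M ℝ q →L[ℝ] ℝ) (x : ℝ) :
    ζ x = ζ (1 : ℝ) * x := by
  let ζ' : ℝ →L[ℝ] ℝ := ζ
  change ζ' x = ζ' 1 * x
  conv_lhs => rw [← mul_one x, ← smul_eq_mul, map_smul, smul_eq_mul, mul_comm]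

lemma homEqModAlong_iff (ha : C∞[m,n] a) {t₁ : Fam a b} {t₂ : Fam a c} : HomEqModAlong m F E F' E'
    n' a s b c t₁ t₂ ↔
    ∀ β : ∀ w, E' w →L[ℝ] ℝ, IsSmoothCovector n' F' E' β → ∀ (p : M) (e : ∀ q, E (a q)),
    (∀ᶠ q in 𝓝 p, Vec∞ a e q) → 𝒪₁ p (fun q ↦ β (b q) (t₁ q (e q)) - β (c q) (t₂ q (e q))) := by
  refine forall₂_congr fun β hβ ↦ (homEqMod_iff (E' := Bundle.Trivial M ℝ) (F' := ℝ)
    (b := fun q : M ↦ q) (t₁ := fun p ↦ (β (b p)).comp (t₁ p))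
    (t₂ := fun p ↦ (β (c p)).comp (t₂ p)) ha contMDiff_id).trans ⟨fun h p e he ↦ ?_,
      fun h p ζ hζ e he ↦ ?_⟩
  · exact h p (fun q ↦ ContinuousLinearMap.id ℝ ℝ) (.of_forall fun q e he ↦
      (smVec_trivial_iff contMDiffAt_id).1 he) e he
  · refine ((h p e he).mul (f := fun q ↦ ζ q (1 : ℝ)) ?_).congr (.of_forall fun q ↦ ?_)
    · filter_upwards [hζ] with q hζ
      exact hζ (fun _ ↦ (1 : ℝ)) ((smVec_trivial_iff contMDiffAt_id).2 contMDiffAt_const)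
    · have e1 : ∀ x : ℝ, ζ q x = ζ q (1 : ℝ) * x := clm_trivial_apply (ζ q)
      simp only [clm_comp_apply]
      rw [e1 (β (b q) _), e1 (β (c q) _)]
      ring

lemma mapEqModSq_iff [IsManifold (𝓡 n') ∞ B'] (ha : C∞[m,n] a) (hs : SmSec n F E s) {Λ : Ftan a c} :
    MapEqModSq m F E n' a s b c Λ ↔ ∀ h : B' → ℝ, C∞[n'] h → ∀ p :
    M, 𝒪₂ p (fun q ↦ h (b q) - (h (c q) + mvfderiv (𝓡 n') h (c q) (Λ q (s (a q))))) := by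
  refine forall₂_congr fun h hh ↦ (sectionEqModSq_iff (E' := Bundle.Trivial M ℝ) (F' := ℝ)
    (b := fun q : M ↦ q) (t₁ := fun q ↦ h (b q))
    (t₂ := fun q ↦ h (c q) + mvfderiv (𝓡 n') h (c q) (Λ q (s (a q)))) ha contMDiff_id hs).trans
    ⟨fun h p ↦ ?_, fun h' p ζ hζ ↦ ?_⟩
  · exact h p (fun q ↦ ContinuousLinearMap.id ℝ ℝ) (.of_forall fun q e he ↦
      (smVec_trivial_iff contMDiffAt_id).1 he)
  · refine ((h' p).mul (f := fun q ↦ ζ q (1 : ℝ)) ?_).congr (.of_forall fun q ↦ ?_)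
    · filter_upwards [hζ] with q hζ
      exact hζ (fun _ ↦ (1 : ℝ)) ((smVec_trivial_iff contMDiffAt_id).2 contMDiffAt_const)
    · have e1 : ∀ x : ℝ, ζ q x = ζ q (1 : ℝ) * x := clm_trivial_apply (ζ q)
      rw [e1 (h (b q)), e1 (h (c q) + _)]
      ring

variable [IsManifold (𝓡 n') ∞ B'] [T2Space B']

lemma MapEqMod.symm (h : MapEqMod m n F E n' a s b c) : MapEqMod m n F E n' a s c b :=
  fun f hf p ↦ (h f hf p).neg.congr (.of_forall fun q ↦ by ring)

lemma MapEqModSq.mapEqMod (ha : C∞[m,n] a) (hs : SmSec n F E s) (hc : C∞[m,n'] c) {Λ : Ftan a c}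
    (hΛ : ∀ p, SmHom m n F E n' 𝔼[n'] T[n',B'] a c Λ p) (h : MapEqModSq m F E n' a s b c Λ) :
    MapEqMod m n F E n' a s b c := by
  intro f hf p
  have h1 := ((mapEqModSq_iff ha hs).1 h f hf p).inI
  refine (h1.add (u' := fun q ↦ mvfderiv (𝓡 n') f (c q) (Λ q (s (a q))))
    ⟨fun q ↦ (mvfderiv (𝓡 n') f (c q)).comp (Λ q), .of_forall fun q ↦ ⟨?_, by
      simp⟩⟩).congr (.of_forall fun q ↦ by ring)
  exact (SmCov.comp (a := fun w ↦ w) (hc q) contMDiffAt_id (smCov_mvfderiv (hf _))).comp_smHom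
    (hΛ q)

/-- Maps that agree up to `O(s)` are equal at the zeros of `s`. -/
lemma MapEqMod.eq_of_zero (h : MapEqMod m n F E n' a s b c) (h0 : s (a p) = 0) : b p = c p := by
  by_contra hne
  obtain ⟨χ, h1, -, -, h2, h3⟩ := exists_bump (n := n') (b₀ := b p) (U := {c p}ᶜ)
    (isOpen_compl_singleton.mem_nhds hne)
  have := (h χ h1 p).eq_zero h0
  simp [h2, h3 (c p) (by simp)] at this

lemma MapEqMod.of_local (h : MapEqMod m n F E n' a s b c) (hb : Continuous b) (hc : Continuous c)
    (hp : b p = c p) {f : B' → ℝ} (hf : ∀ᶠ w in 𝓝 (c p), C∞At[n'] f w) :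
    𝒪₁ p (fun q ↦ f (b q) - f (c q)) := by
  obtain ⟨f', h1, h2⟩ := exists_extend_fun hf
  refine (h f' h1 p).congr ?_
  filter_upwards [hb.continuousAt.eventually (hp ▸ h2), hc.continuousAt.eventually h2] with q h h'
  rw [h, h']

lemma MapEqModSq.of_local (ha : C∞[m,n] a) (hs : SmSec n F E s) {Λ : Ftan a c}
    (h : MapEqModSq m F E n' a s b c Λ) (hb : Continuous b) (hc : Continuous c) (hp : b p = c p)
    {f : B' → ℝ} (hf : ∀ᶠ w in 𝓝 (c p), C∞At[n'] f w) :
    𝒪₂ p (fun q ↦ f (b q) - (f (c q) + mvfderiv (𝓡 n') f (c q) (Λ q (s (a q))))) := by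
  obtain ⟨f', h1, h2⟩ := exists_extend_fun hf
  refine ((mapEqModSq_iff ha hs).1 h f' h1 p).congr ?_
  filter_upwards [hb.continuousAt.eventually (hp ▸ h2),
    hc.continuousAt.eventually h2.eventually_nhds] with q h h'
  have : mvfderiv (𝓡 n') f' (c q) = mvfderiv (𝓡 n') f (c q) := by
    unfold mvfderiv
    rw [Filter.EventuallyEq.mfderiv_eq h', h'.self_of_nhds]
  rw [h, h'.self_of_nhds, this]

lemma HomEqModAlong.of_local (ha : C∞[m,n] a) {t₁ : Fam a b} {t₂ : Fam a c}
    (h : HomEqModAlong m F E F' E' n' a s b c t₁ t₂) (hb : Continuous b) (hc : Continuous c)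
    (hp : b p = c p) {β : ∀ w, E' w →L[ℝ] ℝ} (hβ : ∀ᶠ w in 𝓝 (c p), Cov'∞ β w) {e : ∀ q, E (a q)}
    (he : ∀ᶠ q in 𝓝 p, Vec∞ a e q) :
    𝒪₁ p (fun q ↦ β (b q) (t₁ q (e q)) - β (c q) (t₂ q (e q))) := by
  obtain ⟨f', h1, h2⟩ := exists_extend_cov hβ
  refine ((homEqModAlong_iff ha).1 h f' h1 p e he).congr ?_
  filter_upwards [hb.continuousAt.eventually (hp ▸ h2), hc.continuousAt.eventually h2] with q h h'
  rw [h, h']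

/-- Every smooth morphism to `b^*(E')` is congruent to a smooth morphism to `c^*(E')`, if
`b = c + O(s)`. Near a zero of `s` one uses a trivialization of `E'`. -/
theorem exists_homEqModAlong (ha : C∞[m,n] a) (hs : SmSec n F E s) (hb : C∞[m,n'] b)
    (hc : C∞[m,n'] c) (hbc : MapEqMod m n F E n' a s b c) {t : Fam a b} (ht : ∀ p, Hom∞ a b t p) : ∃
    t' : Fam a c, (∀ p, Hom∞ a c t' p) ∧ HomEqModAlong m F E F' E' n' a s b c t t' := by
  have key := exists_glued (m := m) (V := fun p ↦ (E (a p) →L[ℝ] E' (c p)) × ℝ)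
    (fun α p ↦ Hom∞ a c (fun q ↦ (α q).1) p ∧
      ∀ β : ∀ w, E' w →L[ℝ] ℝ, IsSmoothCovector n' F' E' β → ∀ e : ∀ q, E (a q),
      (∀ᶠ q in 𝓝 p, Vec∞ a e q) → 𝒪₁ p
        (fun q ↦ (α q).2 * β (b q) (t q (e q)) - β (c q) ((α q).1 (e q)))) ?_ ?_
    (fun p ↦ {x | x.2 = 1}) (fun p ↦ ?_) (fun p ↦ ?_)
  · obtain ⟨α, hα⟩ := key
    refine ⟨fun p ↦ (α p).1, fun p ↦ (hα p).2.1, (homEqModAlong_iff ha).2 fun β hβ p e he ↦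
      ((hα p).2.2 β hβ e he).congr (.of_forall fun q ↦ ?_)⟩
    have : (α q).2 = 1 := (hα q).1
    simp [this]
  · rintro α α' p ⟨h1, h2⟩ h
    refine ⟨h1.congr (h.mono fun q hq ↦ by rw [hq]), fun β hβ e he ↦ (h2 β hβ e he).congr
      (h.mono fun q hq ↦ by rw [hq])⟩
  · intro I f α p hf h
    refine ⟨(smHom_sum (E' := E') I (hc p) fun i hi ↦ (h i hi).1.smul (hf i p)).congr
      (.of_forall fun q ↦ by rw [Prod.fst_sum]; rfl), fun β hβ e he ↦ ?_⟩
    refine (inI_sum I fun i hi ↦ ((h i hi).2 β hβ e he).mul (f := f i)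
      (.of_forall fun q ↦ hf i q)).congr (.of_forall fun q ↦ ?_)
    rw [Prod.snd_sum, Prod.fst_sum]
    simp [Finset.sum_mul, mul_sub, mul_assoc]
  · intro x hx y hy r r' _ _ hr
    change r * x.2 + r' * y.2 = 1
    rw [show x.2 = 1 from hx, show y.2 = 1 from hy]
    linarith
  · by_cases h0 : s (a p) = 0
    · have hbc' : b p = c p := hbc.eq_of_zero h0
      have h1 : ∀ᶠ q in 𝓝 p, c q ∈ (trivializationAt F' E' (c p)).baseSet :=
        eventually_mem_baseSet hc p
      have h2 : ∀ᶠ q in 𝓝 p, b q ∈ (trivializationAt F' E' (c p)).baseSet :=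
        hbc' ▸ eventually_mem_baseSet hb p
      have hsm : ∀ᶠ q in 𝓝 p, Hom∞ a c (fun q ↦ ∑ i,
          ((coframeAt F' E' (c p) i (b q)).comp (t q)).smulRight
            (frameAt F' E' (c p) i (c q))) q := by
        filter_upwards [h1, h2] with q h1 h2
        refine smHom_sum (E' := E') Finset.univ (hc q) fun i _ e he ↦ ?_
        exact (smVec_frameAt (E := E') (hc q) h1 i).smul ((ht q e he).coframeAt h2 i)
      refine ⟨fun q ↦ (∑ i, ((coframeAt F' E' (c p) i (b q)).comp (t q)).smulRight
        (frameAt F' E' (c p) i (c q)), 1), ?_⟩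
      filter_upwards [h1, h2, hsm, h1.eventually_nhds, h2.eventually_nhds,
        hsm.eventually_nhds] with q h1 h2 hsm h1' h2' hsm'
      refine ⟨Eq.refl 1, hsm, fun β hβ e he ↦ ?_⟩
      have hβ' : ∀ f : M → B', C∞[m,n'] f → ∀ q, SmCov m n' F' E' f
          (fun q ↦ β (f q)) q := fun f hf q ↦
        SmCov.comp (a := fun w ↦ w) (hf q) contMDiffAt_id (isSmoothCovector_iff.1 hβ _)
      by_cases hq0 : s (a q) = 0
      · have hbc'' : b q = c q := hbc.eq_of_zero hq0
        have h3 : ∀ i, 𝒪₁ q (fun q ↦ β (b q) (frameAt F' E' (c p) i (b q)) -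
            β (c q) (frameAt F' E' (c p) i (c q))) := fun i ↦ by
          refine hbc.of_local (f := fun w ↦ β w (frameAt F' E' (c p) i w)) hb.continuous
            hc.continuous hbc'' ?_
          filter_upwards [(trivializationAt F' E' (c p)).open_baseSet.mem_nhds h1] with w hw
          exact isSmoothCovector_iff.1 hβ w _ (smVec_frameAt contMDiffAt_id hw i)
        refine (inI_sum Finset.univ fun i _ ↦ (h3 i).mul (f := fun q ↦
          coframeAt F' E' (c p) i (b q) (t q (e q))) ?_).congr ?_
        · filter_upwards [he, h2'] with q he h2
          exact (ht q e he).coframeAt h2 i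
        · filter_upwards [h2'] with q h2
          conv_lhs => rw [sum_coframeAt_smul h2 (t q (e q))]
          simp [mul_sub]
      · refine inI_of_ne ha hs hq0 ?_
        filter_upwards [he, hsm'] with q he hsm
        exact (contMDiffAt_const.mul (hβ' b hb q _ (ht q e he))).sub (hβ' c hc q _ (hsm e he))
    · have h1 : ∀ᶠ q in 𝓝 p, s (a q) ≠ 0 := by
        have hp := mem_baseSet_trivializationAt F E (a p)
        obtain ⟨i, hi⟩ : ∃ i, coframeAt F E (a p) i (a p) (s (a p)) ≠ 0 := by
          by_contra! hcon
          exact h0 (by rw [sum_coframeAt_smul hp (s (a p))]; simp [hcon])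
        have := ((smVec_pull_section ha hs p).coframeAt hp i).continuousAt.eventually_ne hi
        exact this.mono fun q hq h ↦ hq (by simp [h])
      refine ⟨fun q ↦ (0, 1), h1.mono fun q hq ↦ ⟨Eq.refl 1, smHom_zero (hc q),
        fun β hβ e he ↦ inI_of_ne ha hs hq ?_⟩⟩
      filter_upwards [he] with q he
      simp only [one_mul, zero_apply, map_zero, sub_zero]
      exact SmCov.comp (a := fun w ↦ w) (hb q) contMDiffAt_id (isSmoothCovector_iff.1 hβ _) _
        (ht q e he)

end AlongMaps

/-! ### Congruences at a point -/

lemma HomCongAt.refl {t : Fam a b} : HomCong b b t t p :=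
  ⟨rfl, fun β _ e _ ↦ by simpa using inI_zero⟩

lemma HomCongAt.symm {t₁ : Fam a b} {t₂ : Fam a c} (h : HomCong b c t₁ t₂ p) :
    HomCong c b t₂ t₁ p :=
  ⟨h.1.symm, fun β hβ e he ↦ by simpa using (h.2 β (h.1 ▸ hβ) e he).neg⟩

lemma HomCongAt.trans {t₁ : Fam a b} {t₂ : Fam a c} {t₃ : Fam a d} (h : HomCong b c t₁ t₂ p)
    (h' : HomCong c d t₂ t₃ p) : HomCong b d t₁ t₃ p :=
  ⟨h.1.trans h'.1, fun β hβ e he ↦ by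
    simpa using (h.2 β (h'.1 ▸ hβ) e he).add (h'.2 β hβ e he)⟩

lemma HomCongAt.congr {t₁ t₁' : Fam a b} {t₂ t₂' : Fam a c} (h : HomCong b c t₁ t₂ p)
    (h₁ : ∀ᶠ q in 𝓝 p, t₁' q = t₁ q) (h₂ : ∀ᶠ q in 𝓝 p, t₂' q = t₂ q) : HomCong b c t₁' t₂' p :=
  ⟨h.1, fun β hβ e he ↦ (h.2 β hβ e he).congr (by
    filter_upwards [h₁, h₂] with q h₁ h₂
    rw [h₁, h₂])⟩

lemma HomCongAt.add {t₁ t₁' : Fam a b} {t₂ t₂' : Fam a c} (h : HomCong b c t₁ t₂ p)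
    (h' : HomCong b c t₁' t₂' p) : HomCong b c (fun p ↦ t₁ p + t₁' p) (fun p ↦ t₂ p + t₂' p) p :=
  ⟨h.1, fun β hβ e he ↦ ((h.2 β hβ e he).add (h'.2 β hβ e he)).congr
    (.of_forall fun q ↦ by simp; ring)⟩

lemma HomCongAt.smul {t₁ : Fam a b} {t₂ : Fam a c} (r : ℝ) (h : HomCong b c t₁ t₂ p) :
    HomCong b c (fun p ↦ r • t₁ p) (fun p ↦ r • t₂ p) p :=
  ⟨h.1, fun β hβ e he ↦ ((h.2 β hβ e he).mul (f := fun _ ↦ r)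
    (.of_forall fun _ ↦ contMDiffAt_const)).congr
    (.of_forall fun q ↦ by simp; ring)⟩

lemma HomCongAt.neg {t₁ : Fam a b} {t₂ : Fam a c} (h : HomCong b c t₁ t₂ p) :
    HomCong b c (fun p ↦ -t₁ p) (fun p ↦ -t₂ p) p :=
  ⟨h.1, fun β hβ e he ↦ (h.2 β hβ e he).neg.congr (.of_forall fun q ↦ by simp; ring)⟩

/-- Along a single map, one may test with covectors along that map. -/
lemma HomCongAt.cov (hb : C∞[m,n'] b) {t₁ t₂ : Fam a b} (h : HomCong b b t₁ t₂ p)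
    {ζ : ∀ q, E' (b q) →L[ℝ] ℝ} (hζ : ∀ᶠ q in 𝓝 p, SmCov m n' F' E' b ζ q) {e : ∀ q, E (a q)}
    (he : ∀ᶠ q in 𝓝 p, Vec∞ a e q) : 𝒪₁ p (fun q ↦ ζ q (t₁ q (e q)) - ζ q (t₂ q (e q))) := by
  have hp := mem_baseSet_trivializationAt F' E' (b p)
  have hbase : ∀ᶠ q in 𝓝 p, b q ∈ (trivializationAt F' E' (b p)).baseSet :=
    eventually_mem_baseSet hb p
  refine (inI_sum Finset.univ fun i _ ↦ (h.2 (coframeAt F' E' (b p) i)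
    (Filter.Eventually.mono ((trivializationAt F' E' (b p)).open_baseSet.mem_nhds hp)
      fun w hw ↦ smCov_coframeAt hw i) e he).mul (f := fun q ↦
    ζ q (frameAt F' E' (b p) i (b q))) ?_).congr ?_
  · filter_upwards [hζ, hbase] with q hζ hq
    exact hζ _ (smVec_frameAt (hb q) hq i)
  · filter_upwards [hbase] with q hq
    rw [← map_sub, sum_coframeAt_smul hq (t₁ q (e q) - t₂ q (e q)), map_sum]
    refine sum_congr rfl fun i _ ↦ ?_
    rw [map_smul, ← map_sub, smul_eq_mul, mul_comm]

lemma HomCongAt.of_cov (hb : C∞At[m,n'] b p) {t₁ t₂ : Fam a b}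
    (h : ∀ ζ : ∀ q, E' (b q) →L[ℝ] ℝ, (∀ᶠ q in 𝓝 p, SmCov m n' F' E' b ζ q) → ∀ e : ∀ q, E (a q),
      (∀ᶠ q in 𝓝 p, Vec∞ a e q) →
      𝒪₁ p (fun q ↦ ζ q (t₁ q (e q)) - ζ q (t₂ q (e q)))) (hb' : ∀ᶠ q in 𝓝 p, C∞At[m,n'] b q) :
    HomCong b b t₁ t₂ p :=
  ⟨rfl, fun β hβ e he ↦ h (fun q ↦ β (b q)) (by
    filter_upwards [hb.continuousAt.eventually hβ, hb'] with q h1 h2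
    exact SmCov.comp (a := fun w ↦ w) h2 contMDiffAt_id h1) e he⟩

/-- Composition with a morphism of vector bundles on the target. -/
lemma HomCongAt.clm_comp {F'' : Type*} [NormedAddCommGroup F''] [NormedSpace ℝ F'']
    {E'' : B' → Type*} [∀ x, AddCommGroup (E'' x)] [∀ x, Module ℝ (E'' x)]
    [∀ x, TopologicalSpace (E'' x)] [TopologicalSpace (TotalSpace F'' E'')]
    [FiberBundle F'' E''] [VectorBundle ℝ F'' E''] [FiniteDimensional ℝ F'']
    [ContMDiffVectorBundle ∞ F'' E'' (𝓡 n')] [∀ x, IsTopologicalAddGroup (E'' x)]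
    [∀ x, ContinuousSMul ℝ (E'' x)] {t₁ : Fam a b} {t₂ : Fam a c} (h : HomCong b c t₁ t₂ p)
    {L : ∀ w, E' w →L[ℝ] E'' w}
    (hL : ∀ᶠ w in 𝓝 (c p), SmHom n' n' F' E' n' F'' E'' (fun w ↦ w) (fun w ↦ w) L w) :
    HomCongAt m n F E n' F'' E'' a s b c (fun q ↦ (L (b q)).comp (t₁ q))
    (fun q ↦ (L (c q)).comp (t₂ q)) p :=
  ⟨h.1, fun β hβ e he ↦ h.2 (fun w ↦ (β w).comp (L w)) (by
    filter_upwards [hβ, hL] with w hβ hL using hβ.comp_smHom hL) e he⟩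

/-- Change of the section: if `s' = τ · s`, a congruence modulo `O(s')` may be composed with a
morphism of vector bundles on the source. -/
lemma HomCongAt.precomp {a' : M → B''} {s' : ∀ x, E'' x} {t₁ : ∀ p, E'' (a' p) →L[ℝ] E' (b p)}
    {t₂ : ∀ p, E'' (a' p) →L[ℝ] E' (c p)} (h : HomCongAt m n'' F'' E'' n' F' E' a' s' b c t₁ t₂ p)
    (τ : ∀ q, E (a q) →L[ℝ] E'' (a' q))
    (hτ : ∀ᶠ q in 𝓝 p, SmHom m n F E n'' F'' E'' a a' τ q ∧ s' (a' q) = τ q (s (a q)))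
    {L : ∀ q, E (a q) →L[ℝ] E'' (a' q)} (hL : ∀ᶠ q in 𝓝 p, SmHom m n F E n'' F'' E'' a a' L q) :
    HomCong b c (fun q ↦ (t₁ q).comp (L q)) (fun q ↦ (t₂ q).comp (L q)) p :=
  ⟨h.1, fun β hβ e he ↦ (h.2 β hβ (fun q ↦ L q (e q)) (by
    filter_upwards [he, hL] with q he hL using hL _ he)).of_section τ hτ⟩

/-- Congruences are stable under pullback. -/
lemma HomCongAt.pull (ha : C∞[m,n] a) {t₁ : Fam a b} {t₂ : Fam a c} (hj : C∞[k,m] j) {q : N}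
    (h : HomCong b c t₁ t₂ (j q)) :
    HomCongAt k n F E n' F' E' (fun q ↦ a (j q)) s (fun q ↦ b (j q)) (fun q ↦ c (j q))
    (fun q ↦ t₁ (j q)) (fun q ↦ t₂ (j q)) q := by
  refine ⟨h.1, fun β hβ e he ↦ ?_⟩
  have hp := mem_baseSet_trivializationAt F E (a (j q))
  have := inI_of_frame (F := F) (F' := F) (n := n) (n' := n) (s := s) (b := fun q ↦ a (j q))
    (a := fun q ↦ a (j q))
    (ξ := fun q ↦ (β (b (j q))).comp (t₁ (j q)) - (β (c (j q))).comp (t₂ (j q)))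
    (ha.comp hj) hp (fun i ↦ ?_) he
  · simpa using this
  · simpa using InI.comp ha hj (h.2 β hβ (fun q' ↦ frameAt F E (a (j q)) i (a q')) (by
      filter_upwards [eventually_mem_baseSet (F := F) (E := E) ha (j q)] with q' hq'
      exact smVec_frameAt (ha q') hq' i))

lemma MapCongAt.pull (ha : C∞[m,n] a) {Λ : Ftan a c} (hj : C∞[k,m] j) {q : N}
    (h : MapCong b c Λ (j q)) :
    MapCongAt k n F E n' (fun q ↦ a (j q)) s (fun q ↦ b (j q)) (fun q ↦ c (j q)) (fun q ↦ Λ (j q)) q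
    :=
  ⟨h.1, fun f hf ↦ (h.2 f hf).comp ha hj⟩

/-- Composition with the change from `c` to `d`: the maps compose, and the first order terms add
up after transport to `d`. -/
lemma MapCongAt.trans [IsManifold (𝓡 n') ∞ B'] (hc : C∞[m,n'] c) (hd : C∞[m,n'] d) {Λ : Ftan a c}
    {Λ' Λ'' : Ftan a d} (hΛ : ∀ᶠ q in 𝓝 p, SmHom m n F E n' 𝔼[n'] T[n',B'] a c Λ q)
    (hΛ'' : ∀ᶠ q in 𝓝 p, SmHom m n F E n' 𝔼[n'] T[n',B'] a d Λ'' q) (h : MapCong b c Λ p)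
    (h' : MapCong c d Λ' p) (h'' : HomCongAt m n F E n' 𝔼[n'] T[n',B'] a s c d Λ Λ'' p) :
    MapCong b d (fun q ↦ Λ' q + Λ'' q) p := by
  refine ⟨h.1.trans h'.1, fun f hf ↦ ?_⟩
  have hf1 : ∀ᶠ w in 𝓝 (d p), SmCov n' n' 𝔼[n']
      T[n',B'] (fun w ↦ w) (fun w ↦ mvfderiv (𝓡 n') f w) w :=
    hf.mono fun w hw ↦ smCov_mvfderiv hw
  have h1 := inI2_of_cov (p := p) (s := s) (ξ := fun q ↦ (mvfderiv (𝓡 n') f (c q)).comp (Λ q) -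
    (mvfderiv (𝓡 n') f (d q)).comp (Λ'' q)) ?_ (fun e he ↦ by
      simpa using h''.2 _ hf1 e he)
  · refine (((h.2 f (h'.1 ▸ hf)).add (h'.2 f hf)).add h1).congr (.of_forall fun q ↦ ?_)
    simp
    ring
  · filter_upwards [hΛ, hΛ'', hd.continuous.continuousAt.eventually hf1,
      hc.continuous.continuousAt.eventually (h'.1 ▸ hf1)] with q hΛ hΛ'' h1 h2
    have e1 := (SmCov.comp (a := fun w ↦ w) (hc q) contMDiffAt_id h2).comp_smHom hΛ
    have e2 := (SmCov.comp (a := fun w ↦ w) (hd q) contMDiffAt_id h1).comp_smHom hΛ''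
    intro e he
    simpa using (e1 e he).sub (e2 e he)

/-- Exchanging the two maps. -/
lemma MapCongAt.symm [IsManifold (𝓡 n') ∞ B'] (hb : C∞[m,n'] b) (hc : C∞[m,n'] c) {Λ : Ftan a c}
    {Λ' : Ftan a b} (hΛ : ∀ᶠ q in 𝓝 p, SmHom m n F E n' 𝔼[n'] T[n',B'] a c Λ q)
    (hΛ' : ∀ᶠ q in 𝓝 p, SmHom m n F E n' 𝔼[n'] T[n',B'] a b Λ' q) (h : MapCong b c Λ p)
    (h' : HomCongAt m n F E n' 𝔼[n'] T[n',B'] a s c b (fun q ↦ -Λ q) Λ' p) : MapCong c b Λ' p := by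
  refine ⟨h.1.symm, fun f hf ↦ ?_⟩
  have hf1 : ∀ᶠ w in 𝓝 (b p), SmCov n' n' 𝔼[n']
      T[n',B'] (fun w ↦ w) (fun w ↦ mvfderiv (𝓡 n') f w) w :=
    hf.mono fun w hw ↦ smCov_mvfderiv hw
  have h1 := inI2_of_cov (p := p) (s := s) (ξ := fun q ↦ -(mvfderiv (𝓡 n') f (c q)).comp (Λ q) -
    (mvfderiv (𝓡 n') f (b q)).comp (Λ' q)) ?_ (fun e he ↦ by
      simpa using h'.2 _ hf1 e he)
  · refine ((h.2 f (h.1 ▸ hf)).neg.add h1).congr (.of_forall fun q ↦ ?_)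
    simp
    ring
  · filter_upwards [hΛ, hΛ', hb.continuous.continuousAt.eventually hf1,
      hc.continuous.continuousAt.eventually (h.1 ▸ hf1)] with q hΛ hΛ'' h1 h2
    have e1 := (SmCov.comp (a := fun w ↦ w) (hc q) contMDiffAt_id h2).comp_smHom hΛ
    have e2 := (SmCov.comp (a := fun w ↦ w) (hb q) contMDiffAt_id h1).comp_smHom hΛ''
    intro e he
    simpa using (e1 e he).neg.sub (e2 e he)

lemma MapCongAt.refl : MapCong b b (fun _ ↦ 0) p :=
  ⟨rfl, fun h _ ↦ by simpa using inI2_zero⟩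

/-- Change of the section in a congruence of maps. -/
lemma MapCongAt.of_section {a' : M → B''} {s' : ∀ x, E'' x}
    {Λ : ∀ p, E'' (a' p) →L[ℝ] TangentSpace (𝓡 n') (c p)}
    (h : MapCongAt m n'' F'' E'' n' a' s' b c Λ p) (τ : ∀ q, E (a q) →L[ℝ] E'' (a' q))
    (hτ : ∀ᶠ q in 𝓝 p, SmHom m n F E n'' F'' E'' a a' τ q ∧ s' (a' q) = τ q (s (a q))) :
    MapCong b c (fun q ↦ (Λ q).comp (τ q)) p :=
  ⟨h.1, fun f hf ↦ ((h.2 f hf).of_section τ hτ).congr (hτ.mono fun q hq ↦ by simp [hq.2])⟩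

/-- Composition with a map of manifolds on the target. -/
lemma MapCongAt.map [IsManifold (𝓡 n') ∞ B'] [IsManifold (𝓡 n'') ∞ B''] {Λ : Ftan a c}
    (hc : ContinuousAt c p) (h : MapCong b c Λ p) {g : B' → B''}
    (hg : ∀ᶠ w in 𝓝 (c p), C∞At[n',n''] g w) :
    MapCongAt m n F E n'' a s (fun q ↦ g (b q)) (fun q ↦ g (c q))
    (fun q ↦ (D[n',n''] g (c q)).comp (Λ q)) p := by
  refine ⟨congrArg g h.1, fun f hf ↦ ?_⟩
  have h1 := hg.self_of_nhds.continuousAt.eventually hf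
  refine (h.2 (fun w ↦ f (g w)) ?_).congr ?_
  · filter_upwards [hg, h1] with w hg hf using hf.comp w hg
  · filter_upwards [hc.eventually hg, hc.eventually h1] with q h2 h3
    have := mvfderiv_comp_apply (c q) h3.mdiffAt h2.mdiffAt (Λ q (s (a q)))
    rw [clm_comp_apply, ← this]
    rfl

section LocalDiffeo
variable {M' : Type*} [TopologicalSpace M'] [ChartedSpace 𝔼[m] M']

/-! ### Local diffeomorphisms -/

lemma IsLocalDiffeomorphAt.eventually {j : M' → M} {q : M'} (hj : ÉtaleAt[m] j q) :
    ∀ᶠ q' in 𝓝 q, ÉtaleAt[m] j q' := by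
  obtain ⟨Φ, h1, h2⟩ := hj
  filter_upwards [Φ.open_source.mem_nhds h1] with q' hq' using ⟨Φ, hq', h2⟩

lemma IsLocalDiffeomorphAt.exists_inverse {j : M' → M} {q₀ : M'} (hj : ÉtaleAt[m] j q₀) :
    ∃ σ : M → M', σ (j q₀) = q₀ ∧ (∀ᶠ x in 𝓝 (j q₀), j (σ x) = x) ∧ (∀ᶠ q in 𝓝 q₀, σ (j q) = q) ∧
    ∀ᶠ x in 𝓝 (j q₀), C∞At[m,m] σ x := by
  refine ⟨hj.localInverse, hj.localInverse_left_inv hj.localInverse_mem_target,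
    hj.localInverse_eventuallyEq_right, hj.localInverse_eventuallyEq_left, ?_⟩
  filter_upwards [hj.localInverse_open_source.mem_nhds hj.localInverse_mem_source] with x hx
  exact (hj.localInverse_contMDiffOn x hx).contMDiffAt (hj.localInverse_open_source.mem_nhds hx)

lemma SmVec.of_comp {j : M' → M} {q₀ : M'} (hj : ÉtaleAt[m] j q₀) {e : ∀ x, E (a x)}
    (h : Vec∞ (fun q ↦ a (j q)) (fun q ↦ e (j q)) q₀) : Vec∞ a e (j q₀) := by
  obtain ⟨σ, h0, h1, -, h2⟩ := hj.exists_inverse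
  refine ((h0.symm ▸ h : Vec∞ (fun q ↦ a (j q)) (fun q ↦ e (j q)) (σ (j q₀))).comp
    h2.self_of_nhds |> ContMDiffAt.congr_of_eventuallyEq) ?_
  filter_upwards [h1] with x hx
  rw [hx]

/-- The push-forward of a smooth covector under a local diffeomorphism. -/
lemma exists_push_cov {j : M' → M} {q₀ : M'} (hj : ÉtaleAt[m] j q₀) {ξ : ∀ q, E (a (j q)) →L[ℝ] ℝ}
    (hξ : ∀ᶠ q in 𝓝 q₀, Cov∞ (fun q ↦ a (j q)) ξ q) :
    ∃ ξ' : ∀ x, E (a x) →L[ℝ] ℝ, (∀ᶠ x in 𝓝 (j q₀), Cov∞ a ξ' x) ∧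
    ∀ᶠ q in 𝓝 q₀, ξ' (j q) = ξ q := by
  classical
  obtain ⟨σ, h0, h1, h1', h2⟩ := hj.exists_inverse
  refine ⟨fun x ↦ if h : j (σ x) = x then (ξ (σ x)).comp (fiberCast E (congrArg a h.symm)) else 0,
    ?_, ?_⟩
  · have h3 := h2.self_of_nhds.continuousAt.eventually (h0.symm ▸ hξ)
    have h4 := h2.self_of_nhds.continuousAt.eventually
      (h0.symm ▸ hj.eventually.mono fun _ h ↦ h.contMDiffAt)
    filter_upwards [h3, h1.eventually_nhds, h2, h4] with x h3 h1 h2 h4 e he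
    have h5 : Vec∞ (fun q ↦ a (j q)) (fun q ↦ e (j q)) (σ x) :=
      SmVec.comp h4 (by rwa [h1.self_of_nhds])
    refine ((h3 _ h5).comp x h2).congr_of_eventuallyEq ?_
    filter_upwards [h1] with y hy
    simp only [hy, dite_true, clm_comp_apply, Function.comp_apply]
    congr 1
    generalize_proofs h
    generalize j (σ y) = z at *
    subst hy
    simp
  · filter_upwards [h1'] with q hq
    have : j (σ (j q)) = j q := by rw [hq]
    simp only [this, dite_true]
    generalize_proofs h
    revert h
    generalize hz : σ (j q) = z at *
    subst hq
    intro h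
    ext v
    simp

lemma InI.of_comp {j : M' → M} {q₀ : M'} (hj : ÉtaleAt[m] j q₀) {u : M → ℝ}
    (h : InI m n F E (fun q ↦ a (j q)) s q₀ (fun q ↦ u (j q))) : 𝒪₁ (j q₀) u := by
  obtain ⟨ξ, h⟩ := h
  obtain ⟨ξ', h1, h2⟩ := exists_push_cov hj (h.mono fun _ h ↦ h.1)
  obtain ⟨σ, h0, h3, -, h4⟩ := hj.exists_inverse
  refine ⟨ξ', ?_⟩
  have h5 := h4.self_of_nhds.continuousAt.eventually (h0.symm ▸ h2)
  have h6 := h4.self_of_nhds.continuousAt.eventually (h0.symm ▸ h)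
  filter_upwards [h1, h3, h5, h6] with x h1 h3 h5 h6
  refine ⟨h1, ?_⟩
  have := h6.2
  rw [← h5] at this
  exact (show ∀ y, u y = ξ' y (s (a y)) → y = x → u x = ξ' x (s (a x)) by
    rintro y h rfl; exact h) _ this h3

lemma InI2.of_comp {j : M' → M} {q₀ : M'} (hj : ÉtaleAt[m] j q₀) {u : M → ℝ}
    (h : InI2 m n F E (fun q ↦ a (j q)) s q₀ (fun q ↦ u (j q))) : 𝒪₂ (j q₀) u := by
  obtain ⟨ξ, h, h'⟩ := h
  obtain ⟨ξ', h1, h2⟩ := exists_push_cov hj (h.mono fun _ h ↦ h.1)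
  obtain ⟨σ, h0, h3, -, h4⟩ := hj.exists_inverse
  refine ⟨ξ', ?_, fun e he ↦ InI.of_comp hj ((h' (fun q ↦ e (j q)) ?_).congr
    (h2.mono fun q hq ↦ by simp [hq]))⟩
  · have h5 := h4.self_of_nhds.continuousAt.eventually (h0.symm ▸ h2)
    have h6 := h4.self_of_nhds.continuousAt.eventually (h0.symm ▸ h)
    filter_upwards [h1, h3, h5, h6] with x h1 h3 h5 h6
    refine ⟨h1, ?_⟩
    have := h6.2
    rw [← h5] at this
    exact (show ∀ y, u y = ξ' y (s (a y)) → y = x → u x = ξ' x (s (a x)) by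
    rintro y h rfl; exact h) _ this h3
  · filter_upwards [hj.contMDiffAt.continuousAt.eventually he,
      hj.eventually.mono fun _ h ↦ h.contMDiffAt] with q hq hj
    exact SmVec.comp hj hq

lemma SmHom.of_pull {j : M' → M} {q₀ : M'} (hj : ÉtaleAt[m] j q₀) {L : Fam a b}
    (h : Hom∞ (fun q ↦ a (j q)) (fun q ↦ b (j q)) (fun q ↦ L (j q)) q₀) : Hom∞ a b L (j q₀) :=
  fun e he ↦ SmVec.of_comp (e := fun x ↦ L x (e x)) hj (h (fun q ↦ e (j q))
    (SmVec.comp hj.contMDiffAt he))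

lemma HomCongAt.of_pull {j : M' → M} {q₀ : M'} (hj : ÉtaleAt[m] j q₀) {t₁ : Fam a b} {t₂ : Fam a c}
    (h : HomCongAt m n F E n' F' E' (fun q ↦ a (j q)) s (fun q ↦ b (j q)) (fun q ↦ c (j q))
      (fun q ↦ t₁ (j q)) (fun q ↦ t₂ (j q)) q₀) : HomCong b c t₁ t₂ (j q₀) :=
  ⟨h.1, fun β hβ e he ↦ InI.of_comp hj (h.2 β hβ (fun q ↦ e (j q)) (by
    filter_upwards [hj.contMDiffAt.continuousAt.eventually he,
      hj.eventually.mono fun _ h ↦ h.contMDiffAt] with q hq hj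
    exact SmVec.comp hj hq))⟩

lemma MapCongAt.of_pull {j : M' → M} {q₀ : M'} (hj : ÉtaleAt[m] j q₀) {Λ : Ftan a c}
    (h : MapCongAt m n F E n' (fun q ↦ a (j q)) s (fun q ↦ b (j q)) (fun q ↦ c (j q))
      (fun q ↦ Λ (j q)) q₀) : MapCong b c Λ (j q₀) :=
  ⟨h.1, fun f hf ↦ InI2.of_comp hj (h.2 f hf)⟩

/-- Families over pointwise equal base maps that correspond under the identification of the fibres
are smooth together. -/
lemma SmHom.cast {a' : M → B} {b' : M → B'} (ha : ∀ q, a q = a' q) (hb : ∀ q, b q = b' q)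
    {t : Fam a b} {t' : Fam a' b'}
    (ht : ∀ᶠ q in 𝓝 p, ∀ e, fiberCast E' (hb q) (t q e) = t' q (fiberCast E (ha q) e))
    (h : Hom∞ a b t p) : Hom∞ a' b' t' p := by
  obtain rfl : a = a' := funext ha
  obtain rfl : b = b' := funext hb
  exact h.congr (ht.mono fun q hq ↦ ContinuousLinearMap.ext fun e ↦ by simpa using (hq e).symm)

lemma HomCongAt.cast {a' : M → B} {b' c' : M → B'} (ha : ∀ q, a q = a' q) (hb : ∀ q, b q = b' q)
    (hc : ∀ q, c q = c' q) {t₁ : Fam a b} {t₂ : Fam a c} {t₁' : Fam a' b'} {t₂' : Fam a' c'}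
    (h₁ : ∀ᶠ q in 𝓝 p, ∀ e, fiberCast E' (hb q) (t₁ q e) = t₁' q (fiberCast E (ha q) e))
    (h₂ : ∀ᶠ q in 𝓝 p, ∀ e, fiberCast E' (hc q) (t₂ q e) = t₂' q (fiberCast E (ha q) e))
    (h : HomCong b c t₁ t₂ p) : HomCongAt m n F E n' F' E' a' s b' c' t₁' t₂' p := by
  obtain rfl : a = a' := funext ha
  obtain rfl : b = b' := funext hb
  obtain rfl : c = c' := funext hc
  exact h.congr (h₁.mono fun q hq ↦ ContinuousLinearMap.ext fun e ↦ by simpa using (hq e).symm)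
    (h₂.mono fun q hq ↦ ContinuousLinearMap.ext fun e ↦ by simpa using (hq e).symm)

lemma MapCongAt.cast {a' : M → B} {b' c' : M → B'} (ha : ∀ q, a q = a' q) (hb : ∀ q, b q = b' q)
    (hc : ∀ q, c q = c' q) {Λ : Ftan a c} {Λ' : ∀ p, E (a' p) →L[ℝ] TangentSpace (𝓡 n') (c' p)}
    (h₁ : ∀ᶠ q in 𝓝 p, ∀ e, fiberCast (TangentSpace (𝓡 n')) (hc q) (Λ q e) =
      Λ' q (fiberCast E (ha q) e)) (h : MapCong b c Λ p) :
    MapCongAt m n F E n' a' s b' c' Λ' p := by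
  obtain rfl : a = a' := funext ha
  obtain rfl : b = b' := funext hb
  obtain rfl : c = c' := funext hc
  refine ⟨h.1, fun f hf ↦ (h.2 f hf).congr ?_⟩
  filter_upwards [h₁] with q hq
  have := hq (s (a q))
  simp only [fiberCast_rfl, ContinuousLinearMap.coe_id', id_eq] at this
  rw [← this]

lemma MapCongAt.congr {b' : M → B'} {Λ Λ' : Ftan a c} (h : MapCong b c Λ p)
    (hb : ∀ᶠ q in 𝓝 p, b' q = b q) (hΛ : ∀ᶠ q in 𝓝 p, Λ' q = Λ q) : MapCong b' c Λ' p :=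
  ⟨hb.self_of_nhds.trans h.1, fun f hf ↦ (h.2 f hf).congr (by
    filter_upwards [hb, hΛ] with q hb hΛ
    rw [hb, hΛ])⟩

lemma HomCongAt.congr_left {b' : M → B'} {t₁ : Fam a b} {t₁' : Fam a b'} {t₂ : Fam a c}
    (h : HomCong b c t₁ t₂ p)
    (hb : ∀ᶠ q in 𝓝 p, ∃ hb : b q = b' q, ∀ e, fiberCast E' hb (t₁ q e) = t₁' q e) :
    HomCong b' c t₁' t₂ p := by
  refine ⟨hb.self_of_nhds.1.symm.trans h.1, fun β hβ e he ↦ (h.2 β hβ e he).congr ?_⟩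
  filter_upwards [hb] with q ⟨hb, h⟩
  rw [← h]
  congr 1
  generalize t₁ q (e q) = v
  clear h
  generalize b' q = w at *
  subst hb
  simp

end LocalDiffeo

section Etale
variable {Q : Type*} [TopologicalSpace Q] [ChartedSpace 𝔼[n'] Q] {b c : M → Q} {π : Q → B'}

/-! ### Lifting congruences through étale maps -/

/-- A congruence along `π ∘ b` and `π ∘ c` may be tested with covectors along the étale map `π`. -/
lemma HomCongAt.etale (hπ : ÉtaleAt[n'] π (c p)) (hb : ContinuousAt b p) (hc : ContinuousAt c p)
    (hbc : b p = c p) {t₁ : ∀ p, E (a p) →L[ℝ] E' (π (b p))} {t₂ : ∀ p, E (a p) →L[ℝ] E' (π (c p))}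
    (h : HomCong (fun q ↦ π (b q)) (fun q ↦ π (c q)) t₁ t₂ p) {ζ : ∀ q, E' (π q) →L[ℝ] ℝ}
    (hζ : ∀ᶠ q in 𝓝 (c p), SmCov n' n' F' E' π ζ q) {e : ∀ q, E (a q)}
    (he : ∀ᶠ q in 𝓝 p, Vec∞ a e q) :
    𝒪₁ p (fun q ↦ ζ (b q) (t₁ q (e q)) - ζ (c q) (t₂ q (e q))) := by
  obtain ⟨β, h1, h2⟩ := exists_push_cov (a := fun w ↦ w) hπ hζ
  refine (h.2 β h1 e he).congr ?_
  filter_upwards [hb.eventually (hbc ▸ h2), hc.eventually h2] with q h3 h4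
  rw [h3, h4]

section Etale2
variable [IsManifold (𝓡 n') ∞ B'] [IsManifold (𝓡 n') ∞ Q]

lemma IsLocalDiffeomorphAt.mfderiv_inverse {q : Q} (hπ : ÉtaleAt[n'] π q)
    (v : TangentSpace (𝓡 n') (π q)) : D[n',n'] π q ((D[n',n'] π q).inverse v) = v := by
  have h := hπ.mfderivToContinuousLinearEquiv_coe (by simp)
  rw [← h, ContinuousLinearMap.inverse_equiv]
  exact ContinuousLinearEquiv.apply_symm_apply _ v

lemma IsLocalDiffeomorphAt.inverse_mfderiv {q : Q} (hπ : ÉtaleAt[n'] π q)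
    (v : TangentSpace (𝓡 n') q) : (D[n',n'] π q).inverse (D[n',n'] π q v) = v := by
  have h := hπ.mfderivToContinuousLinearEquiv_coe (by simp)
  rw [← h, ContinuousLinearMap.inverse_equiv]
  exact ContinuousLinearEquiv.symm_apply_apply _ v

/-- A congruence of maps lifts through an étale map. -/
lemma MapCongAt.etale (hπ : ÉtaleAt[n'] π (c p)) (hb : ContinuousAt b p) (hc : ContinuousAt c p)
    (hbc : b p = c p) {Λ : ∀ p, E (a p) →L[ℝ] TangentSpace (𝓡 n') (π (c p))}
    (h : MapCong (fun q ↦ π (b q)) (fun q ↦ π (c q)) Λ p) :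
    MapCong b c (fun q ↦ (D[n',n'] π (c q)).inverse.comp (Λ q)) p := by
  refine ⟨hbc, fun f hf ↦ ?_⟩
  obtain ⟨σ, h0, h1, h2, h3⟩ := hπ.exists_inverse
  have h4 := h3.self_of_nhds.continuousAt.eventually (h0.symm ▸ hf)
  refine (h.2 (fun w ↦ f (σ w)) ?_).congr ?_
  · filter_upwards [h4, h3] with w hw h3 using hw.comp w h3
  · filter_upwards [hb.eventually (hbc ▸ h2), hc.eventually h2.eventually_nhds,
      hc.eventually hπ.eventually,
      (hπ.contMDiffAt.continuousAt.comp hc).eventually (h4.and h3)] with q e1 e2 e3 e4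
    have key : mvfderiv (𝓡 n') f (c q) =
        (mvfderiv (𝓡 n') (fun w ↦ f (σ w)) (π (c q))).comp (D[n',n'] π (c q)) := by
      have e5 : C∞At[n'] (fun w ↦ f (σ w)) (π (c q)) :=
        ContMDiffAt.comp (g := f) (π (c q)) e4.1 e4.2
      rw [← mvfderiv_comp (c q) e5.mdiffAt (e3.mdifferentiableAt (by simp))]
      unfold mvfderiv
      have : (f =ᶠ[𝓝 (c q)] (fun w ↦ f (σ w)) ∘ π) := e2.mono fun q' hq' ↦ by simp [hq']
      rw [this.mfderiv_eq]
      rfl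
    rw [e1, e2.self_of_nhds, key]
    simp only [clm_comp_apply]
    rw [e3.mfderiv_inverse]

end Etale2

variable {ψ ψ' : Q → B''}

/-! ### Composition with families along an étale map -/

/-- A congruence along the étale map `π` may be composed with a smooth family `π^*(E') → ψ^*(E'')`.
-/
lemma HomCongAt.etale_comp {b c : M → Q} (hb : ContinuousAt b p) (hc : ContinuousAt c p)
    (hbc : b p = c p) {t₁ : ∀ p, E (a p) →L[ℝ] E' (π (b p))} {t₂ : ∀ p, E (a p) →L[ℝ] E' (π (c p))}
    (h : HomCong (fun q ↦ π (b q)) (fun q ↦ π (c q)) t₁ t₂ p) (hπ : ÉtaleAt[n'] π (c p))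
    (hψ : C∞[n',n''] ψ) {R : ∀ q, E' (π q) →L[ℝ] E'' (ψ q)}
    (hR : ∀ q, SmHom n' n' F' E' n'' F'' E'' π ψ R q) :
    HomCongAt m n F E n'' F'' E'' a s (fun q ↦ ψ (b q)) (fun q ↦ ψ (c q))
    (fun q ↦ (R (b q)).comp (t₁ q)) (fun q ↦ (R (c q)).comp (t₂ q)) p := by
  refine ⟨congrArg ψ hbc, fun β hβ e he ↦ ?_⟩
  refine HomCongAt.etale hπ hb hc hbc h (ζ := fun q ↦ (β (ψ q)).comp (R q)) ?_ he
  filter_upwards [(hψ (c p)).continuousAt.eventually hβ, hπ.eventually] with q hq hq'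
  exact (hq.comp (hψ q) contMDiffAt_id).comp_smHom (hR q)

end Etale

lemma InI.along {c : M → B'} {T : ∀ q, E' (c q) →L[ℝ] ℝ} (ha : C∞[m,n] a) (hc : C∞[m,n'] c)
    {j : N → M} (hj : C∞[k,m] j) {u : N}
    (h : ∀ v : ∀ q, E' (c q), (∀ᶠ q in 𝓝 (j u), Vec'∞ c v q) → 𝒪₁ (j u) (fun q ↦ T q (v q)))
    {e : ∀ u, E' (c (j u))} (he : ∀ᶠ u in 𝓝 u, SmVec k n' F' E' (fun u ↦ c (j u)) e u) :
    InI k n F E (fun u ↦ a (j u)) s u (fun u ↦ T (j u) (e u)) := by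
  refine inI_of_frame (b := fun u ↦ c (j u)) (ξ := fun u ↦ T (j u)) (hc.comp hj)
    (mem_baseSet_trivializationAt F' E' (c (j u))) (fun i ↦ ?_) he
  refine InI.comp ha hj (u := fun q ↦ T q (frameAt F' E' (c (j u)) i (c q))) (h _ ?_)
  filter_upwards [eventually_mem_baseSet (F := F') (E := E') hc (j u)] with q hq
  exact smVec_frameAt (hc q) hq i

variable {n₀ : ℕ} {B₀ : Type*} [TopologicalSpace B₀] [ChartedSpace 𝔼[n₀] B₀] {F₀ : Type*}
  [NormedAddCommGroup F₀] [NormedSpace ℝ F₀] {E₀ : B₀ → Type*} [∀ x, AddCommGroup (E₀ x)]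
  [∀ x, Module ℝ (E₀ x)] [∀ x, TopologicalSpace (E₀ x)] [TopologicalSpace (TotalSpace F₀ E₀)]
  [FiberBundle F₀ E₀] [VectorBundle ℝ F₀ E₀] [FiniteDimensional ℝ F₀]
  [ContMDiffVectorBundle ∞ F₀ E₀ (𝓡 n₀)] [∀ x, IsTopologicalAddGroup (E₀ x)]
  [∀ x, ContinuousSMul ℝ (E₀ x)]

/-- Two families `R₁`, `R₂` on `M` with an arbitrary source bundle `c^*(E')` that agree modulo
`O(s)` become congruent after pullback along `j` and composition with a family from `a₀^*(E₀)`,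
provided that `O(s)` pulls back to `O(s₀)`. -/
lemma homCongAt_of_along {c : M → B'} {b₁ b₂ : M → B''} {R₁ : ∀ q, E' (c q) →L[ℝ] E'' (b₁ q)}
    {R₂ : ∀ q, E' (c q) →L[ℝ] E'' (b₂ q)} (ha : C∞[m,n] a) (hc : C∞[m,n'] c) {j : N → M}
    (hj : C∞[k,m] j) {u : N} (hb : b₁ (j u) = b₂ (j u)) (h : ∀ β : ∀ w, E'' w →L[ℝ] ℝ,
      (∀ᶠ w in 𝓝 (b₂ (j u)), SmCov n'' n'' F'' E'' (fun w ↦ w) β w) → ∀ v : ∀ q, E' (c q),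
      (∀ᶠ q in 𝓝 (j u), Vec'∞ c v q) →
      𝒪₁ (j u) (fun q ↦ β (b₁ q) (R₁ q (v q)) - β (b₂ q) (R₂ q (v q)))) {a₀ : N → B₀}
    {s₀ : ∀ x, E₀ x} (τ : ∀ u, E₀ (a₀ u) →L[ℝ] E (a (j u)))
    (hτ : ∀ᶠ u in 𝓝 u, SmHom k n₀ F₀ E₀ n F E a₀ (fun u ↦ a (j u)) τ u ∧
      s (a (j u)) = τ u (s₀ (a₀ u))) {t : ∀ u, E₀ (a₀ u) →L[ℝ] E' (c (j u))}
    (ht : ∀ᶠ u in 𝓝 u, SmHom k n₀ F₀ E₀ n' F' E' a₀ (fun u ↦ c (j u)) t u) :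
    HomCongAt k n₀ F₀ E₀ n'' F'' E'' a₀ s₀ (fun u ↦ b₁ (j u)) (fun u ↦ b₂ (j u))
    (fun u ↦ (R₁ (j u)).comp (t u)) (fun u ↦ (R₂ (j u)).comp (t u)) u := by
  refine ⟨hb, fun β hβ e he ↦ ?_⟩
  refine InI.of_section τ hτ ?_
  refine InI.along (T := fun q ↦ (β (b₁ q)).comp (R₁ q) - (β (b₂ q)).comp (R₂ q)) ha hc hj
    (h β hβ) (e := fun u ↦ t u (e u)) ?_
  filter_upwards [ht, he] with u ht he using ht _ he

section Global
variable [IsManifold (𝓡 m) ∞ M] [T2Space M] [SigmaCompactSpace M]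

/-! ### Congruences are local, and only matter at the zeros of the section -/

lemma smCov_of_covector {β : ∀ w, E' w →L[ℝ] ℝ} (hβ : IsSmoothCovector n' F' E' β) (hb : C∞[m,n'] b)
    (q : M) : SmCov m n' F' E' b (fun q ↦ β (b q)) q :=
  SmCov.comp (a := fun w ↦ w) (hb q) contMDiffAt_id (isSmoothCovector_iff.1 hβ _)

lemma homEqModAlong_of_at (ha : C∞[m,n] a) (hs : SmSec n F E s) (hb : C∞[m,n'] b) (hc : C∞[m,n'] c)
    {t₁ : Fam a b} {t₂ : Fam a c} (h₁ : ∀ p, Hom∞ a b t₁ p) (h₂ : ∀ p, Hom∞ a c t₂ p)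
    (h : ∀ p, s (a p) = 0 → HomCong b c t₁ t₂ p) : HomEqModAlong m F E F' E' n' a s b c t₁ t₂ := by
  refine (homEqModAlong_iff ha).2 fun β hβ p e he ↦ ?_
  by_cases h0 : s (a p) = 0
  · exact (h p h0).2 β (.of_forall (isSmoothCovector_iff.1 hβ)) e he
  · refine inI_of_ne ha hs h0 (he.mono fun q he ↦ ?_)
    exact (smCov_of_covector hβ hb q _ (h₁ q _ he)).sub (smCov_of_covector hβ hc q _ (h₂ q _ he))

lemma homEqMod_of_at (ha : C∞[m,n] a) (hs : SmSec n F E s) (hb : C∞[m,n'] b) {t₁ t₂ : Fam a b}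
    (h₁ : ∀ p, Hom∞ a b t₁ p) (h₂ : ∀ p, Hom∞ a b t₂ p)
    (h : ∀ p, s (a p) = 0 → HomCong b b t₁ t₂ p) : HomEqMod m F E F' E' a s b t₁ t₂ := by
  refine (homEqMod_iff ha hb).2 fun p ζ hζ e he ↦ ?_
  by_cases h0 : s (a p) = 0
  · exact (h p h0).cov hb hζ he
  · refine inI_of_ne ha hs h0 ?_
    filter_upwards [he, hζ] with q he hζ
    exact (hζ _ (h₁ q _ he)).sub (hζ _ (h₂ q _ he))

lemma HomEqMod.at (ha : C∞[m,n] a) (hb : C∞[m,n'] b) {t₁ t₂ : Fam a b}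
    (h : HomEqMod m F E F' E' a s b t₁ t₂) (p : M) : HomCong b b t₁ t₂ p :=
  HomCongAt.of_cov (hb p) (fun ζ hζ e he ↦ (homEqMod_iff ha hb).1 h p ζ hζ e he) (.of_forall hb)

lemma mapEqModSq_of_at [IsManifold (𝓡 n') ∞ B'] (ha : C∞[m,n] a) (hs : SmSec n F E s)
    (hb : C∞[m,n'] b) (hc : C∞[m,n'] c) {Λ : Ftan a c}
    (hΛ : ∀ p, SmHom m n F E n' 𝔼[n'] T[n',B'] a c Λ p) (h : ∀ p, s (a p) = 0 → MapCong b c Λ p) :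
    MapEqModSq m F E n' a s b c Λ := by
  refine (mapEqModSq_iff ha hs).2 fun f hf p ↦ ?_
  by_cases h0 : s (a p) = 0
  · exact (h p h0).2 f (.of_forall hf)
  · refine inI2_of_ne ha hs h0 (.of_forall fun q ↦ ?_)
    exact ((hf (b q)).comp q (hb q)).sub (((hf (c q)).comp q (hc q)).add
      (SmCov.comp (a := fun w ↦ w) (hc q) contMDiffAt_id (smCov_mvfderiv (hf _)) _
        (hΛ q _ (smVec_pull_section ha hs q))))

variable [IsManifold (𝓡 n') ∞ B'] [T2Space B']

lemma HomEqModAlong.at (ha : C∞[m,n] a) {t₁ : Fam a b} {t₂ : Fam a c}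
    (h : HomEqModAlong m F E F' E' n' a s b c t₁ t₂) (hb : Continuous b) (hc : Continuous c) {p : M}
    (hp : b p = c p) : HomCong b c t₁ t₂ p :=
  ⟨hp, fun _ hβ _ he ↦ h.of_local ha hb hc hp hβ he⟩

lemma MapEqModSq.at (ha : C∞[m,n] a) (hs : SmSec n F E s) (hb : Continuous b) (hc : C∞[m,n'] c)
    {Λ : Ftan a c} (hΛ : ∀ p, SmHom m n F E n' 𝔼[n'] T[n',B'] a c Λ p)
    (h : MapEqModSq m F E n' a s b c Λ) {p : M} (hp : s (a p) = 0) : MapCong b c Λ p :=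
  have h0 := (h.mapEqMod ha hs hc hΛ).eq_of_zero hp
  ⟨h0, fun _ hf ↦ h.of_local ha hs hb hc.continuous h0 hf⟩

lemma exists_homCongAt (ha : C∞[m,n] a) (hs : SmSec n F E s) (hb : C∞[m,n'] b) (hc : C∞[m,n'] c)
    (hbc : MapEqMod m n F E n' a s b c) {t : Fam a b} (ht : ∀ p, Hom∞ a b t p) :
    ∃ t' : Fam a c, (∀ p, Hom∞ a c t' p) ∧ ∀ p, s (a p) = 0 → HomCong b c t t' p := by
  obtain ⟨t', h, h'⟩ := exists_homEqModAlong ha hs hb hc hbc ht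
  exact ⟨t', h, fun p hp ↦ h'.at ha hb.continuous hc.continuous (hbc.eq_of_zero hp)⟩

end Global

section Differential

variable [IsManifold (𝓡 m) ∞ M]

/-! ### Differentiating congruences -/

/-- The smooth vector fields `v` along the identity near `p`. -/
abbrev SmField (m : ℕ) {M : Type*} [TopologicalSpace M] [ChartedSpace 𝔼[m] M] [IsManifold (𝓡 m) ∞ M]
    (v : ∀ q : M, TangentSpace (𝓡 m) q) (p : M) : Prop :=
  SmVec m m 𝔼[m] T[m,M] (fun q ↦ q) v p

lemma mvfderiv_congr {u u' : M → ℝ} (h : ∀ᶠ q in 𝓝 p, u q = u' q) :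
    mvfderiv (𝓡 m) u p = mvfderiv (𝓡 m) u' p := by
  unfold mvfderiv
  have : u =ᶠ[𝓝 p] u' := h
  rw [this.mfderiv_eq]
  rfl

lemma mvfderiv_sum_mul {ι : Type*} (I : Finset ι) {f g : ι → M → ℝ} (hf : ∀ i ∈ I, C∞At[m] (f i) p)
    (hg : ∀ i ∈ I, C∞At[m] (g i) p) (v : TangentSpace (𝓡 m) p) :
    mvfderiv (𝓡 m) (fun q ↦ ∑ i ∈ I, f i q * g i q) p v = ∑ i ∈ I,
    (f i p * mvfderiv (𝓡 m) (g i) p v + g i p * mvfderiv (𝓡 m) (f i) p v) := by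
  classical
  have key : C∞At[m] (fun q ↦ ∑ i ∈ I, f i q * g i q) p ∧
    mvfderiv (𝓡 m) (fun q ↦ ∑ i ∈ I, f i q * g i q) p v =
      ∑ i ∈ I, (f i p * mvfderiv (𝓡 m) (g i) p v + g i p * mvfderiv (𝓡 m) (f i) p v) := by
    induction I using Finset.induction_on with
    | empty => exact ⟨by simpa using contMDiffAt_const, by simp [mvfderiv_const]⟩
    | insert i I hi ih =>
      obtain ⟨h1, h2⟩ := ih (fun j hj ↦ hf j (by simp [hj])) (fun j hj ↦ hg j (by simp [hj]))
      have hfi := hf i (by simp)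
      have hgi := hg i (by simp)
      simp only [sum_insert hi]
      refine ⟨(hfi.mul hgi).add h1, ?_⟩
      have e := mvfderiv_fun_add (hfi.mul hgi).mdiffAt h1.mdiffAt
      have e' := mvfderiv_mul hfi.mdiffAt hgi.mdiffAt
      refine (DFunLike.congr_fun e v).trans ?_
      rw [add_apply, h2, e']
      simp
  exact key.2

lemma contMDiffAt_mvfderiv {u : M → ℝ} (hu : C∞At[m] u p) {v : ∀ q : M, TangentSpace (𝓡 m) q}
    (hv : SmField m v p) : C∞At[m] (fun q ↦ mvfderiv (𝓡 m) u q (v q)) p :=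
  smCov_mvfderiv hu v hv

lemma inI_coframe (ha : C∞[m,n] a) {b₀ : B} (hp : a p ∈ (Triv b₀).baseSet) (i) :
    𝒪₁ p (fun q ↦ coframeAt F E b₀ i (a q) (s (a q))) := by
  refine ⟨fun q ↦ coframeAt F E b₀ i (a q), ?_⟩
  filter_upwards [(ha p).continuousAt.preimage_mem_nhds
    ((Triv b₀).open_baseSet.mem_nhds hp)] with q hq
  exact ⟨smCov_coframeAt hq i, rfl⟩

/-- Derivatives of functions `O(s²)` are `O(s)`. -/
lemma InI2.mvfderiv (ha : C∞[m,n] a) (hs : SmSec n F E s) {u : M → ℝ} (h : 𝒪₂ p u)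
    {v : ∀ q : M, TangentSpace (𝓡 m) q} (hv : ∀ᶠ q in 𝓝 p, SmField m v q) :
    𝒪₁ p (fun q ↦ mvfderiv (𝓡 m) u q (v q)) := by
  obtain ⟨ξ, h1, h2⟩ := h
  have hp := mem_baseSet_trivializationAt F E (a p)
  have hE : ∀ᶠ q in 𝓝 p, a q ∈ (Triv (a p)).baseSet := eventually_mem_baseSet ha p
  have h3 := fun i ↦ h2 (fun q ↦ frameAt F E (a p) i (a q))
    (hE.mono fun q hq ↦ smVec_frameAt (ha q) hq i)
  have h4 := fun i ↦ (h3 i).eventually_smooth ha hs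
  have h5 : ∀ᶠ q in 𝓝 p, u q = ∑ i, ξ q (frameAt F E (a p) i (a q)) *
      coframeAt F E (a p) i (a q) (s (a q)) := by
    filter_upwards [h1, hE] with q h1 hq
    rw [h1.2]
    conv_lhs => rw [sum_coframeAt_smul hq (s (a q)), map_sum]
    exact sum_congr rfl fun i _ ↦ by rw [map_smul, smul_eq_mul, mul_comm]
  have hcs : ∀ i, ∀ᶠ q in 𝓝 p, C∞At[m]
      (fun q ↦ coframeAt F E (a p) i (a q) (s (a q))) q := fun i ↦ hE.mono fun q hq ↦
    (smVec_pull_section ha hs q).coframeAt hq i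
  refine (inI_sum Finset.univ fun i _ ↦ ((h3 i).mul (f := fun q ↦
      _root_.mvfderiv (𝓡 m) (fun q ↦ coframeAt F E (a p) i (a q) (s (a q))) q (v q)) ?_).add
    ((inI_coframe ha hp i).mul (f := fun q ↦ _root_.mvfderiv (𝓡 m) (fun q ↦
      ξ q (frameAt F E (a p) i (a q))) q (v q)) ?_)).congr ?_
  · filter_upwards [hcs i, hv] with q h h' using contMDiffAt_mvfderiv h h'
  · filter_upwards [h4 i, hv] with q h h' using contMDiffAt_mvfderiv h h'
  · filter_upwards [h5.eventually_nhds, eventually_all.2 h4, eventually_all.2 hcs]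
      with q h5 h4 hcs
    rw [mvfderiv_congr h5, mvfderiv_sum_mul _ (fun i _ ↦ h4 i) (fun i _ ↦ hcs i)]
    exact sum_congr rfl fun i _ ↦ by ring

variable [IsManifold (𝓡 n) ∞ B] [T2Space B]

lemma MDifferentiableAt.of_smVec {σ : ∀ b, E b} {b : B} (h : SmVec n n F E (fun b ↦ b) σ b) :
    MDifferentiableAt (𝓡 n) ((𝓡 n).prod 𝓘(ℝ, F)) (fun b ↦ TotalSpace.mk' F b (σ b)) b :=
  ContMDiffAt.mdifferentiableAt h (by simp)

/-- A smooth connection maps local smooth sections to local smooth sections. -/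
lemma smHom_connection (nabla : CovariantDerivative (𝓡 n) F E)
    [hn : nabla.ContMDiffCovariantDerivative ∞] {σ : ∀ b, E b} {b₀ : B}
    (hσ : ∀ᶠ b in 𝓝 b₀, SmVec n n F E (fun b ↦ b) σ b) :
    SmHom n n 𝔼[n] T[n,B] n F E (fun b ↦ b) (fun b ↦ b) (nabla σ) b₀ := by
  obtain ⟨σ', h1, h2⟩ := exists_extend_vec hσ
  have h3 : ∀ᶠ b in 𝓝 b₀, nabla σ b = nabla σ' b := by
    filter_upwards [hσ, h2.eventually_nhds] with b hb h2
    exact nabla.isCovariantDerivativeOnUniv.congr_of_eventuallyEq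
      (MDifferentiableAt.of_smVec hb) (MDifferentiableAt.of_smVec (h1 b)) univ_mem
      (h2.mono fun _ h ↦ h.symm)
  refine SmHom.congr ?_ h3
  have h4 := hn.contMDiff.contMDiff (σ := σ') (fun b _ ↦ (h1 b).contMDiffWithinAt)
  have h5 := (h4 b₀ trivial).contMDiffAt univ_mem
  exact (smHom_iff contMDiffAt_id contMDiffAt_id).2 ((contMDiffAt_hom_bundle _).1 h5).2

/-- The derivative of `ζ · s` for a covector `ζ` along `a` is, modulo `O(s)`, given by the covariant
derivative of `s`. -/
lemma inI_mvfderiv_sub_connection (ha : C∞[m,n] a) (hs : SmSec n F E s)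
    (nabla : CovariantDerivative (𝓡 n) F E) [nabla.ContMDiffCovariantDerivative ∞]
    {ζ : ∀ q, E (a q) →L[ℝ] ℝ} (hζ : ∀ᶠ q in 𝓝 p, Cov∞ a ζ q) {v : ∀ q : M, TangentSpace (𝓡 m) q}
    (hv : ∀ᶠ q in 𝓝 p, SmField m v q) :
    𝒪₁ p (fun q ↦ mvfderiv (𝓡 m) (fun q ↦ ζ q (s (a q))) q (v q) -
      ζ q (nabla s (a q) (D[m,n] a q (v q)))) := by
  have hp := mem_baseSet_trivializationAt F E (a p)
  have hB : ∀ᶠ b in 𝓝 (a p), b ∈ (Triv (a p)).baseSet := (Triv (a p)).open_baseSet.mem_nhds hp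
  have hE : ∀ᶠ q in 𝓝 p, a q ∈ (Triv (a p)).baseSet := eventually_mem_baseSet ha p
  have hfr : ∀ i, ∀ᶠ b in 𝓝 (a p), SmVec n n F E (fun b ↦ b) (frameAt F E (a p) i) b := fun i ↦
    hB.mono fun b hb ↦ smVec_frameAt contMDiffAt_id hb i
  have hco : ∀ i, ∀ᶠ b in 𝓝 (a p), C∞At[n]
      (fun b ↦ coframeAt F E (a p) i b (s b)) b := fun i ↦ hB.mono fun b hb ↦
    (hs b).coframeAt hb i
  have hnab : ∀ᶠ b in 𝓝 (a p), nabla s b = ∑ i, (coframeAt F E (a p) i b (s b) •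
      nabla (frameAt F E (a p) i) b + (mvfderiv (𝓡 n) (fun b ↦ coframeAt F E (a p) i b (s b))
        b).smulRight (frameAt F E (a p) i b)) := by
    filter_upwards [hB.eventually_nhds, eventually_all.2 hfr, eventually_all.2 hco]
      with b hb hfr hco
    have key : ∀ I : Finset (Fin (finrank ℝ F)),
        SmVec n n F E (fun b ↦ b) (∑ i ∈ I, (fun b ↦ coframeAt F E (a p) i b (s b)) •
          frameAt F E (a p) i) b ∧
        nabla (∑ i ∈ I, (fun b ↦ coframeAt F E (a p) i b (s b)) • frameAt F E (a p) i) b =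
        ∑ i ∈ I, (coframeAt F E (a p) i b (s b) • nabla (frameAt F E (a p) i) b +
          (mvfderiv (𝓡 n) (fun b ↦ coframeAt F E (a p) i b (s b)) b).smulRight
            (frameAt F E (a p) i b)) := by
      classical
      intro I
      induction I using Finset.induction_on with
      | empty => exact ⟨smVec_zero contMDiffAt_id, by
          simp [nabla.isCovariantDerivativeOnUniv.zero (Set.mem_univ b)]⟩
      | insert i I hi ih =>
        have h1 : SmVec n n F E (fun b ↦ b) ((fun b ↦ coframeAt F E (a p) i b (s b)) •
          frameAt F E (a p) i) b := (hfr i).smul (hco i)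
        simp only [sum_insert hi]
        refine ⟨h1.add ih.1, ?_⟩
        rw [← ih.2, ← nabla.isCovariantDerivativeOnUniv.leibniz
          (MDifferentiableAt.of_smVec (hfr i)) (hco i).mdiffAt]
        exact nabla.isCovariantDerivativeOnUniv.add (MDifferentiableAt.of_smVec h1)
          (MDifferentiableAt.of_smVec ih.1)
    rw [← (key Finset.univ).2]
    refine nabla.isCovariantDerivativeOnUniv.congr_of_eventuallyEq
      (MDifferentiableAt.of_smVec (hs b)) (MDifferentiableAt.of_smVec (key Finset.univ).1)
      univ_mem (hb.mono fun b' hb' ↦ ?_)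
    rw [Finset.sum_apply]
    exact sum_coframeAt_smul hb' (s b')
  have hζf : ∀ i, ∀ᶠ q in 𝓝 p, C∞At[m] (fun q ↦ ζ q (frameAt F E (a p) i (a q))) q := fun i ↦ by
    filter_upwards [hζ, hE] with q hζ hq using hζ _ (smVec_frameAt (ha q) hq i)
  have hcs : ∀ i, ∀ᶠ q in 𝓝 p, C∞At[m]
      (fun q ↦ coframeAt F E (a p) i (a q) (s (a q))) q := fun i ↦ hE.mono fun q hq ↦
    (smVec_pull_section ha hs q).coframeAt hq i
  refine (inI_sum Finset.univ fun i _ ↦ (inI_coframe ha hp i).mul (f := fun q ↦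
    mvfderiv (𝓡 m) (fun q ↦ ζ q (frameAt F E (a p) i (a q))) q (v q) -
      ζ q (nabla (frameAt F E (a p) i) (a q) (D[m,n] a q (v q)))) ?_).congr ?_
  · filter_upwards [hζf i, hv, hζ, (ha p).continuousAt.eventually (hfr i).eventually_nhds]
      with q h1 h2 h3 h4
    refine (contMDiffAt_mvfderiv h1 h2).sub (h3 _ ?_)
    exact (SmHom.pull (ha q) contMDiffAt_id contMDiffAt_id (smHom_connection nabla h4)) _
      (smHom_mfderiv (ha q) _ h2)
  · filter_upwards [hE.eventually_nhds, (ha p).continuousAt.eventually hnab,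
      eventually_all.2 hζf, eventually_all.2 hcs,
      (ha p).continuousAt.eventually (eventually_all.2 hco)] with q hE hnab hζf hcs hco
    have e1 : ∀ᶠ q' in 𝓝 q, ζ q' (s (a q')) = ∑ i, ζ q' (frameAt F E (a p) i (a q')) *
        coframeAt F E (a p) i (a q') (s (a q')) := hE.mono fun q' hq' ↦ by
      conv_lhs => rw [sum_coframeAt_smul hq' (s (a q')), map_sum]
      exact sum_congr rfl fun i _ ↦ by rw [map_smul, smul_eq_mul, mul_comm]
    have e2 : ∀ i, mvfderiv (𝓡 m) (fun q ↦ coframeAt F E (a p) i (a q) (s (a q))) q (v q) =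
        mvfderiv (𝓡 n) (fun b ↦ coframeAt F E (a p) i b (s b)) (a q) (D[m,n] a q (v q)) := fun i ↦
      mvfderiv_comp_apply q (hco i).mdiffAt (ha q).mdiffAt (v q)
    rw [mvfderiv_congr e1, mvfderiv_sum_mul _ (fun i _ ↦ hζf i) (fun i _ ↦ hcs i), hnab]
    simp only [e2, sum_apply, add_apply, smul_apply,
      ContinuousLinearMap.smulRight_apply, map_sum, map_add, map_smul, smul_eq_mul]
    rw [← sum_sub_distrib]
    exact sum_congr rfl fun i _ ↦ by ring

end Differential

section MapDeriv
variable [IsManifold (𝓡 m) ∞ M] [IsManifold (𝓡 n') ∞ B']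

/-! ### Differentiating congruences of maps -/

/-- The coframe of the tangent bundle given by a chart consists of differentials of functions. -/
lemma exists_coframeAt_eq_mvfderiv (b₀ : B') (i : Fin (finrank ℝ 𝔼[n'])) :
    ∃ h : B' → ℝ, ∀ᶠ w in 𝓝 b₀, C∞At[n'] h w ∧
    coframeAt 𝔼[n'] T[n',B'] b₀ i w = mvfderiv (𝓡 n') h w := by
  let l : 𝔼[n'] →L[ℝ] ℝ := ((finBasis ℝ 𝔼[n']).coord i).toContinuousLinearMap
  refine ⟨fun w ↦ l (extChartAt (𝓡 n') b₀ w), ?_⟩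
  filter_upwards [(chartAt 𝔼[n'] b₀).open_source.mem_nhds (mem_chart_source _ b₀)] with w hw
  have h1 : ContMDiffAt (𝓡 n') 𝓘(ℝ, 𝔼[n']) ∞ (extChartAt (𝓡 n') b₀) w := contMDiffAt_extChartAt' hw
  have h2 : ContMDiffAt 𝓘(ℝ, 𝔼[n']) 𝓘(ℝ) ∞ l (extChartAt (𝓡 n') b₀ w) := l.contMDiff.contMDiffAt
  refine ⟨h2.comp w h1, ContinuousLinearMap.ext fun v ↦ ?_⟩
  have e := mvfderiv_comp_apply w h2.mdiffAt h1.mdiffAt v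
  refine Eq.trans ?_ e.symm
  unfold coframeAt
  rw [TangentBundle.continuousLinearMapAt_trivializationAt hw]
  simp only [clm_comp_apply, mvfderiv]
  rw [mfderiv_eq_fderiv, l.fderiv]
  rfl

lemma MapCongAt.inI (hc : C∞[m,n'] c) {Λ : Ftan a c}
    (hΛ : ∀ᶠ q in 𝓝 p, SmHom m n F E n' 𝔼[n'] T[n',B'] a c Λ q) (h : MapCong b c Λ p) {f : B' → ℝ}
    (hf : ∀ᶠ w in 𝓝 (c p), C∞At[n'] f w) : 𝒪₁ p (fun q ↦ f (b q) - f (c q)) := by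
  refine ((h.2 f hf).inI.add (u' := fun q ↦ mvfderiv (𝓡 n') f (c q) (Λ q (s (a q))))
    ⟨fun q ↦ (mvfderiv (𝓡 n') f (c q)).comp (Λ q), ?_⟩).congr
    (.of_forall fun q ↦ by ring)
  filter_upwards [hΛ, hc.continuous.continuousAt.eventually hf] with q h1 h2
  exact ⟨(SmCov.comp (a := fun w ↦ w) (hc q) contMDiffAt_id (smCov_mvfderiv h2)).comp_smHom h1, rfl⟩

variable [IsManifold (𝓡 n) ∞ B] [T2Space B]

/-- Differentiating `b = c + Λ · s + O(s²)` gives `db = dc + Λ · ∇s + O(s)`. -/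
lemma MapCongAt.inI_mfderiv (ha : C∞[m,n] a) (hs : SmSec n F E s)
    (nabla : CovariantDerivative (𝓡 n) F E) [nabla.ContMDiffCovariantDerivative ∞] (hb : C∞[m,n'] b)
    (hc : C∞[m,n'] c) {Λ : Ftan a c} (hΛ : ∀ᶠ q in 𝓝 p, SmHom m n F E n' 𝔼[n'] T[n',B'] a c Λ q)
    (h : MapCong b c Λ p) {β : ∀ w : B', TangentSpace (𝓡 n') w →L[ℝ] ℝ}
    (hβ : ∀ᶠ w in 𝓝 (c p), SmCov n' n' 𝔼[n'] T[n',B'] (fun w ↦ w) β w)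
    {v : ∀ q : M, TangentSpace (𝓡 m) q} (hv : ∀ᶠ q in 𝓝 p, SmField m v q) :
    𝒪₁ p (fun q ↦ β (b q) (D[m,n'] b q (v q)) -
      β (c q) (D[m,n'] c q (v q) +
        Λ q (nabla s (a q) (D[m,n] a q (v q))))) := by
  have hp := mem_baseSet_trivializationAt 𝔼[n'] T[n',B'] (c p)
  set E' : B' → Type := TangentSpace (𝓡 n')
  set F' := 𝔼[n']
  have hB : ∀ᶠ w in 𝓝 (c p), w ∈ (trivializationAt F' E' (c p)).baseSet :=
    (trivializationAt F' E' (c p)).open_baseSet.mem_nhds hp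
  have hcb := hc.continuous.continuousAt.eventually hB
  have hbt : Filter.Tendsto b (𝓝 p) (𝓝 (c p)) := h.1 ▸ hb.continuous.continuousAt
  have hbb := hbt.eventually hB
  choose f hf using fun i ↦ exists_coframeAt_eq_mvfderiv (n' := n') (c p) i
  -- the smooth vector field `dc(v) + Λ(∇s(da(v)))` along `c`
  have hw : ∀ᶠ q in 𝓝 p, SmVec m n' F' E' c (fun q ↦ D[m,n'] c q (v q) +
        Λ q (nabla s (a q) (D[m,n] a q (v q)))) q := by
    filter_upwards [hv, hΛ] with q hv hΛ
    refine (smHom_mfderiv (hc q) _ hv).add (hΛ _ ?_)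
    exact (SmHom.pull (ha q) contMDiffAt_id contMDiffAt_id (smHom_connection nabla
      (.of_forall hs))) _ (smHom_mfderiv (ha q) _ hv)
  -- the congruence for the differentials of the coordinate functions
  have key : ∀ i, 𝒪₁ p (fun q ↦ coframeAt F' E' (c p) i (b q)
      (D[m,n'] b q (v q)) - coframeAt F' E' (c p) i (c q) (D[m,n'] c q (v q) +
        Λ q (nabla s (a q) (D[m,n] a q (v q))))) := by
    intro i
    have hfs := (hf i).mono fun w hw ↦ hw.1
    have hζ : ∀ᶠ q in 𝓝 p, Cov∞ a (fun q ↦ (mvfderiv (𝓡 n') (f i) (c q)).comp (Λ q)) q := by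
      filter_upwards [hΛ, hc.continuous.continuousAt.eventually hfs] with q h1 h2
      exact (SmCov.comp (a := fun w ↦ w) (hc q) contMDiffAt_id (smCov_mvfderiv h2)).comp_smHom h1
    have h1 := (h.2 (f i) hfs).mvfderiv ha hs hv
    have h2 := inI_mvfderiv_sub_connection ha hs nabla hζ hv
    refine (h1.add h2).congr ?_
    filter_upwards [hc.continuous.continuousAt.eventually (hf i),
      hbt.eventually (hf i), hζ] with q hfc hfb hζ
    have d1 : C∞At[m] (fun q ↦ f i (b q)) q := hfb.1.comp q (hb q)
    have d2 : C∞At[m] (fun q ↦ f i (c q)) q := hfc.1.comp q (hc q)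
    have d3 : C∞At[m] (fun q ↦ mvfderiv (𝓡 n') (f i) (c q) (Λ q (s (a q)))) q :=
      hζ _ (smVec_pull_section ha hs q)
    have e1 := mvfderiv_comp_apply q hfb.1.mdiffAt (hb q).mdiffAt (v q)
    have e2 := mvfderiv_comp_apply q hfc.1.mdiffAt (hc q).mdiffAt (v q)
    have e3 := mvfderiv_fun_sub d1.mdiffAt (d2.add d3).mdiffAt
    have e4 := mvfderiv_fun_add d2.mdiffAt d3.mdiffAt
    have e5 := DFunLike.congr_fun e3 (v q)
    rw [sub_apply] at e5
    have e6 := DFunLike.congr_fun e4 (v q)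
    rw [add_apply] at e6
    have e7 : (mvfderiv (𝓡 m) (fun q ↦ f i (b q) - (f i (c q) +
        mvfderiv (𝓡 n') (f i) (c q) (Λ q (s (a q))))) q) (v q) =
      mvfderiv (𝓡 m) (fun q ↦ f i (b q)) q (v q) - (mvfderiv (𝓡 m) (fun q ↦ f i (c q)) q (v q) +
        mvfderiv (𝓡 m) (fun q ↦ mvfderiv (𝓡 n') (f i) (c q) (Λ q (s (a q)))) q (v q)) :=
      e5.trans (congrArg _ e6)
    rw [e7, hfc.2, hfb.2, map_add]
    have e1' : mvfderiv (𝓡 m) (fun q ↦ f i (b q)) q (v q) = _ := e1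
    have e2' : mvfderiv (𝓡 m) (fun q ↦ f i (c q)) q (v q) = _ := e2
    rw [e1', e2']
    simp only [clm_comp_apply]
    ring
  have hg : ∀ i, ∀ᶠ w in 𝓝 (c p), C∞At[n'] (fun w ↦ β w (frameAt F' E' (c p) i w)) w := fun i ↦ by
    filter_upwards [hβ, hB] with w h1 h2 using h1 _ (smVec_frameAt contMDiffAt_id h2 i)
  refine (inI_sum Finset.univ fun i _ ↦ ((key i).mul (f := fun q ↦
    β (b q) (frameAt F' E' (c p) i (b q))) ?_).add ((h.inI hc hΛ (hg i)).mul (f := fun q ↦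
      coframeAt F' E' (c p) i (c q) (D[m,n'] c q (v q) +
        Λ q (nabla s (a q) (D[m,n] a q (v q))))) ?_)).congr ?_
  · filter_upwards [hbt.eventually (hg i)] with q hq
    exact hq.comp q (hb q)
  · filter_upwards [hw, hcb] with q hw hq using hw.coframeAt hq i
  · filter_upwards [hcb, hbb] with q hq hq'
    conv_lhs => rw [sum_coframeAt_smul hq' (D[m,n'] b q (v q)),
      sum_coframeAt_smul hq (D[m,n'] c q (v q) + _)]
    simp only [map_sum, map_smul, smul_eq_mul]
    rw [← sum_sub_distrib]
    exact sum_congr rfl fun i _ ↦ by ring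

end MapDeriv

section Connection

variable [IsManifold (𝓡 n) ∞ B] [T2Space B] [SigmaCompactSpace B]

/-! ### Existence of connections -/

lemma MDifferentiableAt.coframeAt {σ : ∀ b, E b} {b b₀ : B}
    (hσ : MDifferentiableAt (𝓡 n) ((𝓡 n).prod 𝓘(ℝ, F)) (fun b ↦ TotalSpace.mk' F b (σ b)) b)
    (hb : b ∈ (Triv b₀).baseSet) (i) :
    MDifferentiableAt (𝓡 n) 𝓘(ℝ) (fun b ↦ coframeAt F E b₀ i b (σ b)) b := by
  have : ContMDiffVectorBundle 1 F E (𝓡 n) := ContMDiffVectorBundle.of_le (n := ∞) (by simp)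
  have h1 := (((Triv b₀).mdifferentiableAt_totalSpace_iff (𝓡 n) _
    (by simpa [Bundle.Trivialization.mem_source] using hb)).1 hσ).2
  have h2 := (((finBasis ℝ F).coord i).toContinuousLinearMap.contMDiff.contMDiffAt
    (n := ∞)).mdifferentiableAt (by simp) |>.comp b h1
  refine h2.congr_of_eventuallyEq ?_
  filter_upwards [(Triv b₀).open_baseSet.mem_nhds hb] with b' hb'
  simp [_root_.coframeAt, Bundle.Trivialization.coe_linearMapAt_of_mem _ hb']

/-- Smooth vector bundles have smooth connections: the trivial connections of local frames are
glued with a partition of unity. -/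
theorem exists_connection :
    ∃ nabla : CovariantDerivative (𝓡 n) F E, nabla.ContMDiffCovariantDerivative ∞ := by
  let D : (∀ b, E b) → B → Prop := fun σ b ↦
    MDifferentiableAt (𝓡 n) ((𝓡 n).prod 𝓘(ℝ, F)) (fun b ↦ TotalSpace.mk' F b (σ b)) b
  have key := exists_glued (m := n) (M := B)
    (V := fun b ↦ (∀ x, E x) → TangentSpace (𝓡 n) b →L[ℝ] E b)
    (fun c b ↦ ∀ σ : ∀ b, E b, (∀ b, SmVec n n F E (fun b ↦ b) σ b) →
      SmHom n n 𝔼[n] T[n,B] n F E (fun b ↦ b) (fun b ↦ b) (fun b ↦ c b σ) b)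
    (fun c c' b h h' σ hσ ↦ (h σ hσ).congr (h'.mono fun q hq ↦ by rw [hq]))
    (fun I f c b hf h σ hσ ↦ (smHom_sum (E' := E) I contMDiffAt_id fun i hi ↦
      (h i hi σ hσ).smul (hf i b)).congr (.of_forall fun q ↦ by simp))
    (fun b ↦ {c | (∀ σ σ', D σ b → D σ' b → c (σ + σ') = c σ + c σ') ∧
      ∀ (σ : ∀ b, E b) (g : B → ℝ), D σ b → MDifferentiableAt (𝓡 n) 𝓘(ℝ) g b →
        c (g • σ) = g b • c σ + (mvfderiv (𝓡 n) g b).smulRight (σ b)}) (fun b ↦ ?_) (fun b₀ ↦ ?_)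
  · obtain ⟨c, hc⟩ := key
    refine ⟨⟨fun σ b ↦ c b σ, ⟨fun hσ hσ' _ ↦ (hc _).1.1 _ _ hσ hσ',
      fun hσ hg _ ↦ (hc _).1.2 _ _ hσ hg⟩⟩, ⟨⟨fun {σ} hσ b _ ↦ ?_⟩⟩⟩
    have h1 : ∀ b, SmVec n n F E (fun b ↦ b) σ b := fun b ↦
      (hσ b trivial).contMDiffAt univ_mem
    refine ContMDiffAt.contMDiffWithinAt ((contMDiffAt_hom_bundle _).2 ⟨contMDiffAt_id, ?_⟩)
    exact (smHom_iff contMDiffAt_id contMDiffAt_id).1 ((hc b).2 σ h1)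
  · rintro c ⟨h1, h2⟩ c' ⟨h1', h2'⟩ x y hx hy hxy
    refine ⟨fun σ σ' hσ hσ' ↦ ?_, fun σ g hσ hg ↦ ?_⟩
    · simp only [Pi.add_apply, Pi.smul_apply, h1 _ _ hσ hσ', h1' _ _ hσ hσ']
      module
    · simp only [Pi.add_apply, Pi.smul_apply, h2 _ _ hσ hg, h2' _ _ hσ hg, smul_add]
      have e : (mvfderiv (𝓡 n) g b).smulRight (σ b) =
        x • (mvfderiv (𝓡 n) g b).smulRight (σ b) + y • (mvfderiv (𝓡 n) g b).smulRight (σ b) := by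
        rw [← add_smul, hxy, one_smul]
      conv_rhs => rw [e]
      module
  · have hp := mem_baseSet_trivializationAt F E b₀
    refine ⟨fun b σ ↦ ∑ i, (mvfderiv (𝓡 n) (fun b ↦ coframeAt F E b₀ i b (σ b)) b).smulRight
      (frameAt F E b₀ i b), ?_⟩
    filter_upwards [(Triv b₀).open_baseSet.mem_nhds hp] with b hb
    refine ⟨⟨fun σ σ' hσ hσ' ↦ ?_, fun σ g hσ hg ↦ ?_⟩, fun σ hσ v hv ↦ ?_⟩
    · rw [← Finset.sum_add_distrib]
      refine sum_congr rfl fun i _ ↦ ?_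
      have e := mvfderiv_fun_add (hσ.coframeAt hb i) (hσ'.coframeAt hb i)
      simp only [Pi.add_apply, map_add]
      rw [e]
      ext v
      simp [add_smul]
    · have e0 : (mvfderiv (𝓡 n) g b).smulRight (σ b) = ∑ i, coframeAt F E b₀ i b (σ b) •
          (mvfderiv (𝓡 n) g b).smulRight (frameAt F E b₀ i b) := by
        ext v
        conv_lhs => rw [sum_coframeAt_smul hb (σ b)]
        simp only [ContinuousLinearMap.smulRight_apply, sum_apply, smul_apply, Finset.smul_sum]
        exact sum_congr rfl fun i _ ↦ by rw [smul_comm]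
      rw [e0, Finset.smul_sum, ← Finset.sum_add_distrib]
      refine sum_congr rfl fun i _ ↦ ?_
      have e := mvfderiv_mul hg (hσ.coframeAt hb i)
      have e' : (fun b ↦ coframeAt F E b₀ i b ((g • σ) b)) =
        g * fun b ↦ coframeAt F E b₀ i b (σ b) := by
        funext b
        simp
      rw [e', e]
      ext v
      simp [add_smul, mul_smul]
    · refine (smVec_sum (E := E) Finset.univ contMDiffAt_id fun i _ ↦
        (smVec_frameAt (E := E) contMDiffAt_id hb i).smul (contMDiffAt_mvfderiv
          ((hσ b).coframeAt hb i) hv)).congr (.of_forall fun q ↦ ?_)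
      simp

end Connection

/-- Congruences may be composed with bundle morphisms covering a smooth map. -/
lemma HomCongAt.base_map {t₁ : Fam a b} {t₂ : Fam a c} (h : HomCong b c t₁ t₂ p) {g : B' → B''}
    (hg : C∞[n',n''] g) {L : ∀ w, E' w →L[ℝ] E'' (g w)}
    (hL : ∀ w, SmHom n' n' F' E' n'' F'' E'' (fun w ↦ w) g L w) :
    HomCongAt m n F E n'' F'' E'' a s (fun q ↦ g (b q)) (fun q ↦ g (c q))
    (fun q ↦ (L (b q)).comp (t₁ q)) (fun q ↦ (L (c q)).comp (t₂ q)) p :=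
  ⟨congrArg g h.1, fun β hβ e he ↦ h.2 (fun w ↦ (β (g w)).comp (L w))
    ((hg.continuous.continuousAt.eventually hβ).mono fun w hw ↦
      (hw.comp (hg w) contMDiffAt_id).comp_smHom (hL w)) e he⟩

lemma homCongAt_sum {ι : Type*} (I : Finset ι) {t₁ : ι → Fam a b} {t₂ : ι → Fam a c}
    (hbc : b p = c p) (h : ∀ i ∈ I, HomCong b c (t₁ i) (t₂ i) p) :
    HomCong b c (fun q ↦ ∑ i ∈ I, t₁ i q) (fun q ↦ ∑ i ∈ I, t₂ i q) p := by
  refine ⟨hbc, fun β hβ e he ↦ (inI_sum I fun i hi ↦ (h i hi).2 β hβ e he).congr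
    (.of_forall fun q ↦ ?_)⟩
  simp only [sum_apply, map_sum, sum_sub_distrib]

end Smoothness

/-! ### Lifts through étale maps -/

section Lifts

lemma sigmaCompactSpace_of_euclidean (m : ℕ) (N : Type*) [TopologicalSpace N] [ChartedSpace 𝔼[m] N]
    [SecondCountableTopology N] : SigmaCompactSpace N := by
  have : LocallyCompactSpace N := Manifold.locallyCompact_of_finiteDimensional (𝓡 m)
  infer_instance

variable {m : ℕ} {N : Type*} [TopologicalSpace N] [ChartedSpace 𝔼[m] N] {n : ℕ} {V : Type*}
  [TopologicalSpace V] [ChartedSpace 𝔼[n] V] {Q : Type*} [TopologicalSpace Q] [ChartedSpace 𝔼[n] Q]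
  {π : Q → V}

lemma IsLocalDiffeomorphAt.eventually_inj {q : Q} (hπ : ÉtaleAt[n] π q) {T : Type*}
    [TopologicalSpace T] {f g : T → Q} {x : T} (hf : ContinuousAt f x) (hg : ContinuousAt g x)
    (hfx : f x = q) (hgx : g x = q) (h : ∀ᶠ y in 𝓝 x, π (f y) = π (g y)) :
    ∀ᶠ y in 𝓝 x, f y = g y := by
  obtain ⟨σ, -, -, h1, -⟩ := hπ.exists_inverse
  filter_upwards [h, hf.eventually (hfx ▸ h1), hg.eventually (hgx ▸ h1)] with y h h2 h3
  rw [← h2, ← h3, h]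

lemma IsLocalDiffeomorphAt.fun_comp {N : Type*} [TopologicalSpace N] [ChartedSpace 𝔼[n] N]
    {f : N → Q} {x : N} (hπ : ÉtaleAt[n] π (f x)) (hf : ÉtaleAt[n] f x) :
    ÉtaleAt[n] (fun y ↦ π (f y)) x :=
  IsLocalDiffeomorphAt.comp (hf := hf) (hg := hπ)

/-- Continuous lifts of smooth maps through étale maps are smooth. -/
lemma contMDiffAt_of_lift {f : N → Q} {x : N} (hπ : ÉtaleAt[n] π (f x)) (hf : ContinuousAt f x)
    (h : C∞At[m,n] (fun y ↦ π (f y)) x) : C∞At[m,n] f x := by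
  obtain ⟨σ, -, -, h1, h2⟩ := hπ.exists_inverse
  refine (h2.self_of_nhds.comp x h).congr_of_eventuallyEq ?_
  filter_upwards [hf.eventually h1] with y hy using hy.symm

lemma isLocalDiffeomorphAt_of_inverse {f : Q → V} {g : V → Q} {q : Q}
    (hf : ∀ᶠ y in 𝓝 q, C∞At[n,n] f y) (hg : ∀ᶠ y in 𝓝 (f q), C∞At[n,n] g y)
    (h : ∀ᶠ y in 𝓝 q, g (f y) = y) (h' : ∀ᶠ y in 𝓝 (f q), f (g y) = y) : ÉtaleAt[n] f q := by
  obtain ⟨U, hU, hUo, hqU⟩ := eventually_nhds_iff.1 (hf.and h)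
  obtain ⟨W, hW, hWo, hqW⟩ := eventually_nhds_iff.1 (hg.and h')
  have hfU : ContinuousOn f U := fun y hy ↦ (hU y hy).1.continuousAt.continuousWithinAt
  have hgW : ContinuousOn g W := fun y hy ↦ (hW y hy).1.continuousAt.continuousWithinAt
  let Φ : PartialDiffeomorph (𝓡 n) (𝓡 n) Q V ∞ :=
    { toFun := f, invFun := g, source := U ∩ f ⁻¹' W
      target := W ∩ g ⁻¹' U
      map_source' := fun y hy ↦ ⟨hy.2, by
        change g (f y) ∈ U
        rw [(hU y hy.1).2]
        exact hy.1⟩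
      map_target' := fun y hy ↦ ⟨hy.2, by
        change f (g y) ∈ W
        rw [(hW y hy.1).2]
        exact hy.1⟩
      left_inv' := fun y hy ↦ (hU y hy.1).2
      right_inv' := fun y hy ↦ (hW y hy.1).2
      open_source := hfU.isOpen_inter_preimage hUo hWo
      open_target := hgW.isOpen_inter_preimage hWo hUo
      contMDiffOn_toFun := fun y hy ↦ (hU y hy.1).1.contMDiffWithinAt
      contMDiffOn_invFun := fun y hy ↦ (hW y hy.1).1.contMDiffWithinAt }
  exact ⟨Φ, ⟨hqU, hqW⟩, fun _ _ ↦ rfl⟩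

/-- Continuous lifts of étale maps through étale maps are étale. -/
lemma isLocalDiffeomorphAt_of_lift {N : Type*} [TopologicalSpace N] [ChartedSpace 𝔼[n] N]
    {f : N → Q} {x : N} (hπ : ÉtaleAt[n] π (f x)) (hf : Continuous f)
    (h : ÉtaleAt[n] (fun y ↦ π (f y)) x) : ÉtaleAt[n] f x := by
  obtain ⟨τ, h0, h1, h2, h3⟩ := h.exists_inverse
  have hg : ∀ᶠ y in 𝓝 (f x), C∞At[n,n] (fun y ↦ τ (π y)) y := by
    filter_upwards [hπ.contMDiffAt.continuousAt.eventually h3, hπ.eventually] with y hy hy'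
    exact hy.comp y hy'.contMDiffAt
  refine isLocalDiffeomorphAt_of_inverse (g := fun y ↦ τ (π y)) ?_ hg h2 ?_
  · filter_upwards [hf.continuousAt.eventually hπ.eventually, h.eventually] with y h4 h5
    exact contMDiffAt_of_lift h4 hf.continuousAt h5.contMDiffAt
  · have hc : ContinuousAt (fun y ↦ τ (π y)) (f x) := hg.self_of_nhds.continuousAt
    have h0' : (fun y ↦ τ (π y)) (f x) = x := h0
    refine hπ.eventually_inj (f := fun y ↦ f (τ (π y))) (g := fun y ↦ y)
      (hf.continuousAt.comp hc) continuousAt_id (congrArg f h0) rfl ?_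
    exact hπ.contMDiffAt.continuousAt.eventually h1

/-- Smooth maps lift locally through étale maps. -/
lemma exists_local_lift {q₀ : Q} (hπ : ÉtaleAt[n] π q₀) {g : N → V} (hg : C∞[m,n] g) {x₀ : N}
    (h0 : g x₀ = π q₀) {O : Set N} (hO : O ∈ 𝓝 x₀) {O' : Set Q} (hO' : O' ∈ 𝓝 q₀) :
    ∃ (U : Opens N) (hU : x₀ ∈ U) (σ : U → Q), C∞[m,n] σ ∧ (∀ u : U, g u = π (σ u)) ∧ σ ⟨x₀, hU⟩ =
    q₀ ∧ (U : Set N) ⊆ O ∧ ∀ u, σ u ∈ O' := by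
  obtain ⟨σ, h1, h2, h3, h4⟩ := hπ.exists_inverse
  have hσ : ∀ᶠ v in 𝓝 (π q₀), σ v ∈ O' := h4.self_of_nhds.continuousAt.eventually (h1.symm ▸ hO')
  obtain ⟨W, hW, hWo, hxW⟩ := eventually_nhds_iff.1 ((((hg x₀).continuousAt.eventually
    (h0 ▸ (h2.and (h4.and hσ))))).and hO)
  refine ⟨⟨W, hWo⟩, hxW, fun u ↦ σ (g u), fun u ↦ ?_, fun u ↦ (hW u u.2).1.1.symm, ?_,
    fun u hu ↦ (hW u hu).2, fun u ↦ (hW u u.2).1.2.2⟩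
  · exact ContMDiffAt.comp (g := σ) u (hW u u.2).1.2.1 (ContMDiffAt.comp (g := g) u (hg _)
      (contMDiff_subtype_val u))
  · exact (congrArg σ h0).trans h1

lemma etale_val (U : Opens V) : Étale[n] (Subtype.val : U → V) := by
  intro u
  obtain ⟨u, hu⟩ := u
  classical
  refine isLocalDiffeomorphAt_of_inverse (g := fun v ↦ if h : v ∈ U then ⟨v, h⟩ else ⟨u, hu⟩)
    (.of_forall contMDiff_subtype_val) ?_
    (.of_forall fun y ↦ by simp) ?_
  · filter_upwards [U.isOpen.mem_nhds hu] with v hv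
    refine (contMDiffAt_subtype_iff (U := U) (x := ⟨v, hv⟩)).1 ?_
    exact contMDiffAt_id.congr_of_eventuallyEq (.of_forall fun y ↦ by simp)
  · filter_upwards [U.isOpen.mem_nhds hu] with v hv
    simp [show v ∈ U from hv]

end Lifts

/-! ### Kuranishi neighbourhoods and 1-morphisms -/

section Kuranishi

variable {X Y Z W : Type u} [TopologicalSpace X] [TopologicalSpace Y] [TopologicalSpace Z]
  [TopologicalSpace W] {K : KurNbhd X} {L : KurNbhd Y} {M : KurNbhd Z} {S : Set X} {T : Set Y}
  {R : Set Z} {f f' f'' f''' : C(X, Y)} {g g' g'' : C(Y, Z)} {h h' h'' : C(X, Z)}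
  {Φ : OneMor K L f S} {Φ' : OneMor K L f' S} {Φ'' : OneMor K L f'' S} {Φ''' : OneMor K L f''' S}
  {Ψ : OneMor L M g T} {Ψ' : OneMor L M g' T} {Ψ'' : OneMor L M g'' T} {Ξ : OneMor K M h S}
  {Ξ' : OneMor K M h' S} {Ξ'' : OneMor K M h'' S}

instance (K : KurNbhd X) : SigmaCompactSpace K.V := sigmaCompactSpace_of_euclidean K.dim K.V

instance {f : C(X, Y)} {S : Set X} (Φ : OneMor K L f S) : SigmaCompactSpace Φ.P :=
  sigmaCompactSpace_of_euclidean K.dim Φ.P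

instance {f : C(X, Y)} {S : Set X} (Φ : OneMor K L f S) (U : Opens Φ.P) : SigmaCompactSpace U :=
  sigmaCompactSpace_of_euclidean K.dim U

lemma KurNbhd.smVec_s (K : KurNbhd X) (v : K.V) :
    SmVec K.dim K.dim K.F K.E (fun v ↦ v) K.s v := K.s_smooth v

/-- Smooth families `a^*(E_K) → b^*(E_L)`. -/
abbrev SmE (m : ℕ) (K : KurNbhd X) (L : KurNbhd Y) {N : Type*} [TopologicalSpace N]
    [ChartedSpace 𝔼[m] N] (a : N → K.V) (b : N → L.V) (t : ∀ p, K.E (a p) →L[ℝ] L.E (b p)) (p : N) :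
    Prop :=
  SmHom m K.dim K.F K.E L.dim L.F L.E a b t p

/-- Smooth families `a^*(E_K) → b^*(TV_L)`. -/
abbrev SmT (m : ℕ) (K : KurNbhd X) (L : KurNbhd Y) {N : Type*} [TopologicalSpace N]
    [ChartedSpace 𝔼[m] N] (a : N → K.V) (b : N → L.V) (t : ∀ p, K.E (a p) →L[ℝ] L.T (b p)) (p : N) :
    Prop :=
  SmHom m K.dim K.F K.E L.dim L.H L.T a b t p

/-- Congruence modulo `O(a^*(s_K))` near `p` of families with values in `E_L`. -/
abbrev CongE (m : ℕ) (K : KurNbhd X) (L : KurNbhd Y) {N : Type*} [TopologicalSpace N]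
    [ChartedSpace 𝔼[m] N] (a : N → K.V) (b c : N → L.V) (t₁ : ∀ p, K.E (a p) →L[ℝ] L.E (b p))
    (t₂ : ∀ p, K.E (a p) →L[ℝ] L.E (c p)) (p : N) : Prop :=
  HomCongAt m K.dim K.F K.E L.dim L.F L.E a K.s b c t₁ t₂ p

/-- Congruence modulo `O(a^*(s_K))` near `p` of families with values in `TV_L`. -/
abbrev CongT (m : ℕ) (K : KurNbhd X) (L : KurNbhd Y) {N : Type*} [TopologicalSpace N]
    [ChartedSpace 𝔼[m] N] (a : N → K.V) (b c : N → L.V) (t₁ : ∀ p, K.E (a p) →L[ℝ] L.T (b p))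
    (t₂ : ∀ p, K.E (a p) →L[ℝ] L.T (c p)) (p : N) : Prop :=
  HomCongAt m K.dim K.F K.E L.dim L.H L.T a K.s b c t₁ t₂ p

/-- `b = c + Λ · a^*(s_K) + O(a^*(s_K)²)` near `p`. -/
abbrev MapCong (m : ℕ) (K : KurNbhd X) (L : KurNbhd Y) {N : Type*} [TopologicalSpace N]
    [ChartedSpace 𝔼[m] N] (a : N → K.V) (b c : N → L.V) (Λ : ∀ p, K.E (a p) →L[ℝ] L.T (c p))
    (p : N) : Prop :=
  MapCongAt m K.dim K.F K.E L.dim a K.s b c Λ p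

lemma OneMor.π_smooth (Φ : OneMor K L f S) : C∞[K.dim,K.dim] Φ.π :=
  Φ.π_etale.contMDiff

lemma OneMor.smooth_π (Φ : OneMor K L f S) (D : Opens Φ.P) : C∞[K.dim,K.dim] fun p : D ↦ Φ.π p :=
  Φ.π_smooth.comp contMDiff_subtype_val

lemma OneMor.smooth_φ (Φ : OneMor K L f S) (D : Opens Φ.P) : C∞[K.dim,L.dim] fun p : D ↦ Φ.φ p :=
  Φ.φ_smooth.comp contMDiff_subtype_val

lemma OneMor.smE_hat (Φ : OneMor K L f S) (p : Φ.P) : SmE K.dim K L Φ.π Φ.φ Φ.hat p :=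
  (isSmoothHom_iff Φ.π_smooth Φ.φ_smooth).1 Φ.hat_smooth p

lemma OneMor.s_zero (Φ : OneMor K L f S) {p : Φ.P} (h : K.s (Φ.π p) = 0) : L.s (Φ.φ p) = 0 :=
  (Φ.footprint_map p h).1

/-- The section `φ^*(s_L)` is exactly of the form `τ · π^*(s_K)`, with `τ` congruent to `Φ.hat`. -/
lemma OneMor.exists_hat_exact (Φ : OneMor K L f S) :
    ∃ τ : ∀ p, K.E (Φ.π p) →L[ℝ] L.E (Φ.φ p), (∀ p, SmE K.dim K L Φ.π Φ.φ τ p) ∧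
    (∀ p, L.s (Φ.φ p) = τ p (K.s (Φ.π p))) ∧ ∀ p, CongE K.dim K L Φ.π Φ.φ Φ.φ τ Φ.hat p := by
  obtain ⟨α, hα, h⟩ := Φ.hat_s
  have h1 : ∀ p, SmE K.dim K L Φ.π Φ.φ (fun p ↦ α p (K.s (Φ.π p))) p := fun p ↦
    hα.smHom Φ.π_smooth Φ.φ_smooth (smVec_pull_section Φ.π_smooth K.smVec_s p)
  refine ⟨fun p ↦ Φ.hat p + (-1 : ℝ) • α p (K.s (Φ.π p)), fun p ↦
    (Φ.smE_hat p).add ((h1 p).smul contMDiffAt_const), fun p ↦ ?_, fun p ↦ ?_⟩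
  · have := h p
    dsimp only at this
    simp only [add_apply, smul_apply]
    rw [this]
    module
  · refine (HomEqMod.at Φ.π_smooth Φ.φ_smooth (HomEqMod.symm' _ _ _ _ _
      (t₁ := Φ.hat) ⟨α, hα, fun p ↦ ?_⟩) p)
    module

/-! ### Representatives of 2-morphisms -/

/-- Differentiating `φhat(π^*(s_K)) = φ^*(s_L) + O(π^*(s_K)²)`: the morphism `φhat` intertwines the
covariant derivatives of the two sections, up to `O(π^*(s_K))`. -/
lemma OneMor.inI_hat_connection (Φ : OneMor K L f S) (nK : Conn[K])
    [nK.ContMDiffCovariantDerivative ∞] (nL : Conn[L])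
    [nL.ContMDiffCovariantDerivative ∞] {p : Φ.P} {ζ : ∀ q, L.E (Φ.φ q) →L[ℝ] ℝ}
    (hζ : ∀ᶠ q in 𝓝 p, SmCov K.dim L.dim L.F L.E Φ.φ ζ q) {v : ∀ q : Φ.P, TangentSpace (𝓡 K.dim) q}
    (hv : ∀ᶠ q in 𝓝 p, SmField K.dim v q) :
    InI K.dim K.dim K.F K.E Φ.π K.s p (fun q ↦
      ζ q (Φ.hat q (nK K.s (Φ.π q) (D[K.dim,K.dim] Φ.π q (v q)))) -
      ζ q (nL L.s (Φ.φ q) (D[K.dim,L.dim] Φ.φ q (v q)))) := by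
  obtain ⟨τ, hτ, hτs, -⟩ := Φ.exists_hat_exact
  have hζ' : ∀ᶠ q in 𝓝 p, SmCov K.dim K.dim K.F K.E Φ.π (fun q ↦ (ζ q).comp (Φ.hat q)) q :=
    hζ.mono fun q h ↦ h.comp_smHom (Φ.smE_hat q)
  have h1 := inI_mvfderiv_sub_connection Φ.π_smooth K.smVec_s nK hζ' hv
  have h2 := (inI_mvfderiv_sub_connection Φ.φ_smooth L.smVec_s nL hζ hv).of_section τ
    (.of_forall fun q ↦ ⟨hτ q, hτs q⟩)
  have h3 := ((sectionEqModSq_iff Φ.π_smooth Φ.φ_smooth K.smVec_s).1 Φ.hat_s p ζ hζ).mvfderiv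
    Φ.π_smooth K.smVec_s hv
  refine ((h3.sub h1).add h2).congr ?_
  filter_upwards [hζ, hζ'] with q hq hq'
  have d1 : MDifferentiableAt (𝓡 K.dim) 𝓘(ℝ) (fun q ↦ ζ q (Φ.hat q (K.s (Φ.π q)))) q :=
    ContMDiffAt.mdifferentiableAt (n := ∞)
      (hq' _ (smVec_pull_section Φ.π_smooth K.smVec_s q)) (by simp)
  have d2 : MDifferentiableAt (𝓡 K.dim) 𝓘(ℝ) (fun q ↦ ζ q (L.s (Φ.φ q))) q :=
    ContMDiffAt.mdifferentiableAt (n := ∞)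
      (hq _ (smVec_pull_section Φ.φ_smooth L.smVec_s q)) (by simp)
  have := congrArg (fun A ↦ A (v q)) (mvfderiv_fun_sub d1 d2)
  simp only [sub_apply] at this
  rw [this]
  simp only [clm_comp_apply]
  ring

lemma OneMor.exists_open_core (Φ : OneMor K L f S) (hS : IsOpen S) :
    ∃ W : Opens Φ.P, ∀ p, p ∈ Φ.core ↔ p ∈ W ∧ K.s (Φ.π p) = 0 := by
  have hc : Continuous (fun z : {v : K.V // K.s v = 0} ↦ K.psiBar z z.2) :=
    K.ψ_isOpenEmbedding.continuous.comp continuous_quotient_mk'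
  obtain ⟨O, hO, hO'⟩ := isOpen_induced_iff.1 (hS.preimage hc)
  refine ⟨⟨Φ.π ⁻¹' O, hO.preimage Φ.π_smooth.continuous⟩, fun p ↦ ?_⟩
  have key : ∀ h : K.s (Φ.π p) = 0, Φ.π p ∈ O ↔ K.psiBar (Φ.π p) h ∈ S := fun h ↦
    iff_of_eq (congrArg (fun A : Set _ ↦ (⟨Φ.π p, h⟩ : {v : K.V // K.s v = 0}) ∈ A) hO')
  exact ⟨fun ⟨h, h'⟩ ↦ ⟨(key h).2 h', h⟩, fun ⟨h, h'⟩ ↦ ⟨h', (key h').1 h⟩⟩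

namespace TwoMorRep

lemma smT_lamHat (x : TwoMorRep Φ Φ') (p : x.dom) :
    SmT K.dim K L (fun p : x.dom ↦ Φ.π p) (fun p : x.dom ↦ Φ.φ p) x.lamHat p :=
  (isSmoothHom_iff (Φ.smooth_π _)
    (Φ.smooth_φ _)).1 x.lamHat_smooth p

lemma mapCong (x : TwoMorRep Φ Φ') {p : x.dom} (h : K.s (Φ.π p) = 0) :
    MapCong K.dim K L (fun p : x.dom ↦ Φ.π p) (fun p : x.dom ↦ Φ'.φ (x.lam p))
    (fun p : x.dom ↦ Φ.φ p) x.lamHat p :=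
  x.eq_φ.at (Φ.smooth_π _) K.smVec_s
    (Φ'.φ_smooth.continuous.comp x.lam_smooth.continuous)
    (Φ.smooth_φ _) x.smT_lamHat h

lemma φ_lam (x : TwoMorRep Φ Φ') {p : x.dom} (h : K.s (Φ.π p) = 0) : Φ'.φ (x.lam p) = Φ.φ p :=
  (x.mapCong h).1

lemma congE (x : TwoMorRep Φ Φ') {p : x.dom} (h : K.s (Φ.π p) = 0)
    (nL : Conn[L]) [nL.ContMDiffCovariantDerivative ∞] :
    CongE K.dim K L (fun p : x.dom ↦ Φ.π p) (fun p : x.dom ↦ Φ'.φ (x.lam p)) (fun p : x.dom ↦ Φ.φ p)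
    (fun p : x.dom ↦ (Φ'.hat (x.lam p)).comp (fiberCast K.E (x.lam_π p).symm))
    (fun p : x.dom ↦ Φ.hat p + (nL L.s (Φ.φ p)).comp (x.lamHat p)) p :=
  (x.eq_hat nL).at (Φ.smooth_π _)
    (Φ'.φ_smooth.continuous.comp x.lam_smooth.continuous)
    (Φ.smooth_φ _).continuous (x.φ_lam h)

lemma mem_core_lam (x : TwoMorRep Φ Φ') {p : x.dom} (h : (p : Φ.P) ∈ Φ.core) :
    x.lam p ∈ Φ'.core := by
  have key : ∀ {v w : K.V}, v = w → (∃ h : K.s v = 0, K.psiBar v h ∈ S) →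
      ∃ h : K.s w = 0, K.psiBar w h ∈ S := by
    rintro v _ rfl h
    exact h
  exact key (x.lam_π p).symm h

/-- Equivalent representatives agree at the points of the core, and their bundle morphisms are
congruent there. -/
lemma Equiv.lam_eq {x y : TwoMorRep Φ Φ'} (h : x.Equiv y) {p : Φ.P} (hp : p ∈ Φ.core)
    (hx : p ∈ x.dom) (hy : p ∈ y.dom) : x.lam ⟨p, hx⟩ = y.lam ⟨p, hy⟩ := by
  obtain ⟨U, _, _, hU, h, -⟩ := h
  exact h ⟨p, hU hp⟩

lemma Equiv.congT {x y : TwoMorRep Φ Φ'} (h : x.Equiv y) {m : ℕ} {N : Type*} [TopologicalSpace N]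
    [ChartedSpace 𝔼[m] N] {j : N → Φ.P} (hj : C∞[m,K.dim] j) (hx : ∀ u, j u ∈ x.dom)
    (hy : ∀ u, j u ∈ y.dom) {q : N} (hq : j q ∈ Φ.core) :
    CongT m K L (fun u ↦ Φ.π (j u)) (fun u ↦ Φ.φ (j u)) (fun u ↦ Φ.φ (j u))
    (fun u ↦ x.lamHat ⟨j u, hx u⟩) (fun u ↦ y.lamHat ⟨j u, hy u⟩) q := by
  obtain ⟨U, hxU, hyU, hU, -, h⟩ := h
  let U' : Opens N := ⟨j ⁻¹' U, U.isOpen.preimage hj.continuous⟩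
  have hj' : C∞[m,K.dim] (fun u : U' ↦ (⟨j u, u.2⟩ : U)) := fun u ↦
    contMDiffAt_of_lift (etale_val U _)
      ((hj.continuous.comp continuous_subtype_val).subtype_mk _).continuousAt
      ((hj.comp contMDiff_subtype_val) u)
  have ha := Φ.smooth_π U
  have hb := Φ.smooth_φ U
  have := (h.at ha hb ⟨j q, hU hq⟩).pull ha hj' (q := ⟨q, hU hq⟩)
  refine HomCongAt.of_pull (j := (Subtype.val : U' → N)) (q₀ := ⟨q, hU hq⟩)
    (etale_val U' _) ?_
  exact this

lemma equiv_of_probe (hS : IsOpen S) {x y : TwoMorRep Φ Φ'}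
    (h : ∀ p (hp : p ∈ Φ.core), x.lam ⟨p, x.core_subset hp⟩ = y.lam ⟨p, y.core_subset hp⟩ ∧
      ∃ (N : Type u) (_ : TopologicalSpace N) (_ : ChartedSpace 𝔼[K.dim] N)
        (j : N → Φ.P) (q : N) (hx : ∀ u, j u ∈ x.dom) (hy : ∀ u, j u ∈ y.dom), j q = p ∧
        Étale[K.dim] j ∧
        CongT K.dim K L (fun u ↦ Φ.π (j u)) (fun u ↦ Φ.φ (j u)) (fun u ↦ Φ.φ (j u))
          (fun u ↦ x.lamHat ⟨j u, hx u⟩) (fun u ↦ y.lamHat ⟨j u, hy u⟩) q) : x.Equiv y := by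
  obtain ⟨W, hW⟩ := Φ.exists_open_core hS
  let D : Opens Φ.P := x.dom ⊓ y.dom
  let ix : D → x.dom := Opens.inclusion inf_le_left
  let iy : D → y.dom := Opens.inclusion inf_le_right
  have hix : C∞[K.dim,K.dim] ix := contMDiff_inclusion _
  have hiy : C∞[K.dim,K.dim] iy := contMDiff_inclusion _
  let A : Set D := {p | ∀ᶠ p' in 𝓝 p, x.lam (ix p') = y.lam (iy p')}
  have hA : IsOpen A := isOpen_setOfPred_eventually_nhds
  let U : Opens Φ.P := ⟨Subtype.val '' A, D.isOpen.isOpenMap_subtype_val _ hA⟩ ⊓ W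
  have hUx : U ≤ x.dom := by rintro _ ⟨⟨p, -, rfl⟩, -⟩; exact p.2.1
  have hUy : U ≤ y.dom := by rintro _ ⟨⟨p, -, rfl⟩, -⟩; exact p.2.2
  have ha := Φ.smooth_π U
  have hb := Φ.smooth_φ U
  refine ⟨U, hUx, hUy, fun p hp ↦ ⟨?_, ((hW p).1 hp).1⟩, fun p ↦ ?_,
    homEqMod_of_at ha K.smVec_s hb ?_ ?_ fun p h0 ↦ ?_⟩
  · have hpD : p ∈ D := ⟨x.core_subset hp, y.core_subset hp⟩
    refine ⟨⟨p, hpD⟩, ?_, rfl⟩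
    exact (Φ'.π_etale _).eventually_inj (f := fun p' ↦ x.lam (ix p'))
      (g := fun p' ↦ y.lam (iy p')) (x := (⟨p, hpD⟩ : D))
      (x.lam_smooth.continuous.comp hix.continuous).continuousAt
      (y.lam_smooth.continuous.comp hiy.continuous).continuousAt rfl (h p hp).1.symm
      (.of_forall fun p' ↦ (x.lam_π (ix p')).trans (y.lam_π (iy p')).symm)
  · obtain ⟨p, ⟨p', hp', rfl⟩, -⟩ := p
    exact hp'.self_of_nhds
  · exact fun p ↦ (x.smT_lamHat _).pull (contMDiff_inclusion hUx p) (Φ.smooth_π _ _)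
      (Φ.smooth_φ _ _)
  · exact fun p ↦ (y.smT_lamHat _).pull (contMDiff_inclusion hUy p) (Φ.smooth_π _ _)
      (Φ.smooth_φ _ _)
  · obtain ⟨-, N, _, _, j, q, hx, hy, hq, hj, hc⟩ := h p ((hW p).2 ⟨p.2.2, h0⟩)
    let N' : Opens N := ⟨j ⁻¹' U, U.isOpen.preimage hj.contMDiff.continuous⟩
    have hqN : q ∈ N' := by
      change j q ∈ U
      rw [hq]
      exact p.2
    have hi := etale_val (n := K.dim) N'
    let j' : N' → U := fun u ↦ ⟨j u, u.2⟩
    have hj'c : Continuous j' := (hj.contMDiff.continuous.comp continuous_subtype_val).subtype_mk _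
    have hj' : ÉtaleAt[K.dim] j' ⟨q, hqN⟩ :=
      isLocalDiffeomorphAt_of_lift (etale_val U _) hj'c
        (IsLocalDiffeomorphAt.fun_comp (f := (Subtype.val : N' → N)) (x := ⟨q, hqN⟩)
          (π := j) (hj q) (hi ⟨q, hqN⟩))
    have hp : j' ⟨q, hqN⟩ = p := Subtype.ext hq
    rw [← hp]
    refine HomCongAt.of_pull (j := j') (q₀ := ⟨q, hqN⟩) hj' ?_
    have := HomCongAt.pull (k := K.dim) (m := K.dim) (Φ.π_smooth.comp hj.contMDiff) hi.contMDiff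
      (q := (⟨q, hqN⟩ : N')) hc
    exact this

end TwoMorRep

/-! ### Averaging over finite groups -/

section Averaging

@[simp] lemma fiberCast_fiberCast {B : Type*} (E : B → Type*) [∀ x, AddCommGroup (E x)]
    [∀ x, Module ℝ (E x)] [∀ x, TopologicalSpace (E x)] {u v w : B} (h : u = v) (h' : v = w)
    (e : E u) : fiberCast E h' (fiberCast E h e) = fiberCast E (h.trans h') e := by
  subst h h'
  simp

/-- A lift to the vector bundle `E → V` of an action of a group on `V`. The element `γ` maps `E v`
to `E w` for every proof of `w = γ • v`. -/
structure BundleAction (Γ : Type*) [Group Γ] (n : ℕ) {V : Type*} [TopologicalSpace V]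
    [ChartedSpace 𝔼[n] V] [MulAction Γ V] (F : Type*) [NormedAddCommGroup F]
    [NormedSpace ℝ F] (E : V → Type*) [∀ x, AddCommGroup (E x)] [∀ x, Module ℝ (E x)]
    [∀ x, TopologicalSpace (E x)] [TopologicalSpace (TotalSpace F E)] [FiberBundle F E]
    [VectorBundle ℝ F E] where
  map : ∀ (γ : Γ) {v w : V}, w = γ • v → E v →L[ℝ] E w
  map_one : ∀ {v w : V} (h : v = w) (h' : w = (1 : Γ) • v) e, map 1 h' e = fiberCast E h e
  map_mul : ∀ (γ δ : Γ) {u v w : V} (h : v = δ • u) (h' : w = γ • v) (h'' : w = (γ * δ) • u) e,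
    map (γ * δ) h'' e = map γ h' (map δ h e)
  base_smooth : ∀ γ : Γ, C∞[n,n] (fun v : V ↦ γ • v)
  map_smooth : ∀ (γ : Γ) (v : V),
    SmHom n n F E n F E (fun v ↦ v) (fun v ↦ γ • v) (fun _ ↦ map γ rfl) v

variable {Γ : Type*} [Group Γ] {n : ℕ} {V : Type*} [TopologicalSpace V] [ChartedSpace 𝔼[n] V]
  [MulAction Γ V] {F : Type*} [NormedAddCommGroup F] [NormedSpace ℝ F] {E : V → Type*}
  [∀ x, AddCommGroup (E x)] [∀ x, Module ℝ (E x)] [∀ x, TopologicalSpace (E x)]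
  [TopologicalSpace (TotalSpace F E)] [FiberBundle F E] [VectorBundle ℝ F E]
  [FiniteDimensional ℝ F] [ContMDiffVectorBundle ∞ F E (𝓡 n)] [∀ x, IsTopologicalAddGroup (E x)]
  [∀ x, ContinuousSMul ℝ (E x)] {Γ' : Type*} [Group Γ'] {n' : ℕ} {V' : Type*} [TopologicalSpace V']
  [ChartedSpace 𝔼[n'] V'] [MulAction Γ' V'] {F' : Type*} [NormedAddCommGroup F'] [NormedSpace ℝ F']
  {E' : V' → Type*} [∀ x, AddCommGroup (E' x)] [∀ x, Module ℝ (E' x)] [∀ x, TopologicalSpace (E' x)]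
  [TopologicalSpace (TotalSpace F' E')] [FiberBundle F' E'] [VectorBundle ℝ F' E']
  [FiniteDimensional ℝ F'] [ContMDiffVectorBundle ∞ F' E' (𝓡 n')]
  [∀ x, IsTopologicalAddGroup (E' x)] [∀ x, ContinuousSMul ℝ (E' x)]

lemma BundleAction.fiberCast_map (A : BundleAction Γ n F E) (γ : Γ) {v w w' : V} (h : w = γ • v)
    (h' : w = w') (e : E v) : fiberCast E h' (A.map γ h e) = A.map γ (h' ▸ h) e := by
  subst h'
  simp

lemma BundleAction.smHom_map (A : BundleAction Γ n F E) (γ : Γ) {m : ℕ} {N : Type*}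
    [TopologicalSpace N] [ChartedSpace 𝔼[m] N] {a a' : N → V} {p : N} (ha : C∞At[m,n] a p)
    (h : ∀ q, a' q = γ • a q) : SmHom m n F E n F E a a' (fun q ↦ A.map γ (h q)) p := by
  obtain rfl : a' = fun q ↦ γ • a q := funext h
  exact SmHom.pull (a := fun v ↦ v) (b := fun v ↦ γ • v) (L := fun _ ↦ A.map γ rfl) ha
    contMDiffAt_id (A.base_smooth γ _) (A.map_smooth γ (a p))

/-- An equivariant family with values in `b^*(E')` can be transported, up to `O(s)`, to an
equivariant family with values in `c^*(E')` if `b = c + O(s)`: average a family obtained without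
equivariance. -/
theorem exists_equivariant_homCongAt {m : ℕ} {N : Type*} [TopologicalSpace N] [ChartedSpace 𝔼[m] N]
    [IsManifold (𝓡 m) ∞ N] [T2Space N] [SigmaCompactSpace N] [IsManifold (𝓡 n') ∞ V'] [T2Space V']
    (C : BundleAction Γ n F E) (A : BundleAction Γ' n' F' E') {G : Type*} [Group G] [Finite G]
    [MulAction G N] (hG : ∀ g : G, C∞[m,m] (fun p : N ↦ g • p)) (κ : G →* Γ) (l : G →* Γ')
    {a : N → V} {b c : N → V'} (ha : C∞[m,n] a) (hb : C∞[m,n'] b) (hc : C∞[m,n'] c)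
    (ha' : ∀ g p, a (g • p) = κ g • a p) (hb' : ∀ g p, b (g • p) = l g • b p)
    (hc' : ∀ g p, c (g • p) = l g • c p) {s : ∀ x, E x} (hs : SmSec n F E s)
    (hs' : ∀ γ {v w} (h : w = γ • v), C.map γ h (s v) = s w) (hbc : MapEqMod m n F E n' a s b c)
    {t : ∀ p, E (a p) →L[ℝ] E' (b p)} (ht : ∀ p, SmHom m n F E n' F' E' a b t p)
    (ht' : ∀ g p e, t (g • p) (C.map (κ g) (ha' g p) e) = A.map (l g) (hb' g p) (t p e)) :
    ∃ t' : ∀ p, E (a p) →L[ℝ] E' (c p), (∀ p, SmHom m n F E n' F' E' a c t' p) ∧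
    (∀ g p e, t' (g • p) (C.map (κ g) (ha' g p) e) = A.map (l g) (hc' g p) (t' p e)) ∧ ∀ p, s (a p)
    = 0 → HomCongAt m n F E n' F' E' a s b c t t' p := by
  have := Fintype.ofFinite G
  obtain ⟨t₀, h1, h2⟩ := exists_homCongAt ha hs hb hc hbc ht
  have hinv : ∀ {d : N → V'} (_ : ∀ g p, d (g • p) = l g • d p) (g : G) (p : N),
      d p = l g⁻¹ • d (g • p) := fun hd g p ↦ by rw [hd, ← mul_smul, ← map_mul]; simp
  let τ : G → ∀ p, E (a p) →L[ℝ] E' (c p) := fun g p ↦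
    (A.map (l g⁻¹) (hinv hc' g p)).comp ((t₀ (g • p)).comp (C.map (κ g) (ha' g p)))
  have hτ : ∀ g p, SmHom m n F E n' F' E' a c (τ g) p := fun g p ↦
    (A.smHom_map (l g⁻¹) (a := fun p ↦ c (g • p)) ((hc _).comp p (hG g p)) _).comp
      (SmHom.comp ((h1 (g • p)).pull (hG g p) (ha _) (hc _)) (C.smHom_map (κ g) (ha p) _))
  have hτt : ∀ g p, s (a p) = 0 → HomCongAt m n F E n' F' E' a s b c t (τ g) p := fun g p hp ↦ by
    have e0 : s (a (g • p)) = 0 := by rw [← hs' (κ g) (ha' g p), hp, map_zero]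
    have e1 := (h2 (g • p) e0).pull (k := m) ha (hG g)
    have hC : ∀ᶠ q in 𝓝 p, SmHom m n F E n F E a (fun q ↦ a (g • q))
        (fun q ↦ C.map (κ g) (ha' g q)) q ∧ s (a (g • q)) = C.map (κ g) (ha' g q) (s (a q)) :=
      .of_forall fun q ↦ ⟨C.smHom_map (κ g) (ha q) _, (hs' _ _).symm⟩
    have e2 := (e1.precomp _ hC (hC.mono fun _ h ↦ h.1)).base_map (A.base_smooth (l g⁻¹))
      (A.map_smooth (l g⁻¹))
    refine e2.cast (fun _ ↦ rfl) (fun q ↦ (hinv hb' g q).symm) (fun q ↦ (hinv hc' g q).symm)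
      (.of_forall fun q e ↦ ?_) (.of_forall fun q e ↦ ?_)
    · simp only [clm_comp_apply, fiberCast_rfl, clm_id_apply, BundleAction.fiberCast_map, ht']
      rw [← A.map_mul _ _ (hb' g q) _ (by simp)]
      have : ∀ δ : Γ', δ = 1 → ∀ h, A.map δ h (t q e) = t q e := by
        rintro _ rfl h
        rw [A.map_one rfl, fiberCast_rfl, clm_id_apply]
      exact this _ (by simp) _
    · simp only [clm_comp_apply, fiberCast_rfl, clm_id_apply, BundleAction.fiberCast_map, τ]
  refine ⟨fun p ↦ (Fintype.card G : ℝ)⁻¹ • ∑ g, τ g p, fun p ↦ (smHom_sum _ (hc p) fun g _ ↦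
    hτ g p).smul contMDiffAt_const, fun g p e ↦ ?_, fun p hp ↦ ?_⟩
  · simp only [smul_apply, sum_apply, map_smul, map_sum]
    congr 1
    refine Fintype.sum_equiv (Equiv.mulRight g) _ _ fun g' ↦ ?_
    have key : ∀ (q : N) (hq : q = (g' * g) • p) (k : a q = κ g' • a (g • p))
        (k' : c (g • p) = l g'⁻¹ • c q) (k'' : c p = l (g' * g)⁻¹ • c ((g' * g) • p)),
        A.map (l g'⁻¹) k' (t₀ q (C.map (κ g') k (C.map (κ g) (ha' g p) e))) =
        A.map (l g) (hc' g p) (A.map (l (g' * g)⁻¹) k'' (t₀ ((g' * g) • p)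
          (C.map (κ (g' * g)) (ha' _ _) e))) := by
      rintro q rfl k k' k''
      have e1 : ∀ γ, γ = κ g' * κ g → ∀ h, C.map γ h e = C.map (κ g') k (C.map (κ g) (ha' g p) e) :=
        by rintro _ rfl h; exact C.map_mul ..
      have e2 : ∀ δ, δ = l g * l (g' * g)⁻¹ → ∀ h w, A.map δ h w =
          A.map (l g) (hc' g p) (A.map (l (g' * g)⁻¹) k'' w) := by
        rintro _ rfl h w; exact A.map_mul ..
      rw [e1 _ (map_mul κ g' g), e2 _ (by rw [← map_mul]; simp)]
    exact key (g' • g • p) (mul_smul _ _ _).symm _ _ _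
  · have e1 := (homCongAt_sum Finset.univ (hτt 1 p hp).1 fun g _ ↦ hτt g p hp).smul
      (Fintype.card G : ℝ)⁻¹
    refine e1.congr (.of_forall fun q ↦ ?_) (.of_forall fun q ↦ rfl)
    simp only [Finset.sum_const, Finset.card_univ]
    rw [← Nat.cast_smul_eq_nsmul ℝ, smul_smul, inv_mul_cancel₀ (by simp), one_smul]

end Averaging

/-! ### Equivariant families and vertical composition -/

/-- Families of linear maps are compatible with the identifications of fibres. -/
lemma apply_fiberCast {ι B B' : Type*} {E : B → Type*} [∀ x, AddCommGroup (E x)]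
    [∀ x, Module ℝ (E x)] [∀ x, TopologicalSpace (E x)] {E' : B' → Type*} [∀ x, AddCommGroup (E' x)]
    [∀ x, Module ℝ (E' x)] [∀ x, TopologicalSpace (E' x)] {a : ι → B} {b : ι → B'}
    (t : ∀ i, E (a i) →L[ℝ] E' (b i)) {i j : ι} (h : i = j) (ha : a i = a j) (hb : b i = b j)
    (e : E (a i)) : t j (fiberCast E ha e) = fiberCast E' hb (t i e) := by
  subst h
  simp

/-- The given lift of the action of `Γ` to `E`. -/
def KurNbhd.actE (K : KurNbhd X) : BundleAction K.Γ K.dim K.F K.E where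
  map γ v w h := (fiberCast K.E h.symm).comp (K.lift γ v)
  map_one := by
    rintro v _ rfl h' e
    simpa using! K.lift_one v e
  map_mul := by
    rintro γ δ u _ _ rfl rfl h'' e
    simpa using! K.lift_mul γ δ u e
  base_smooth := K.smul_smooth
  map_smooth γ v := ((isSmoothHom_iff contMDiff_id (K.smul_smooth γ)).1 (K.lift_smooth γ) v).congr
    (.of_forall fun q ↦ by ext; simp)

/-- The action of `Γ` on `TV` by the derivatives of the maps `v ↦ γ • v`. -/
def KurNbhd.actT (K : KurNbhd X) : BundleAction K.Γ K.dim K.H K.T where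
  map γ v w h := (fiberCast K.T h.symm).comp (D[K.dim,K.dim] (fun w : K.V ↦ γ • w) v)
  map_one := by
    rintro v _ rfl h' e
    have key : ∀ g : K.V → K.V, g = id → ∀ h : g v = v,
        fiberCast K.T h (D[K.dim,K.dim] g v e) = e := by
      rintro _ rfl h
      simp [mfderiv_id]
    simpa using! key (fun w ↦ (1 : K.Γ) • w) (funext fun w ↦ one_smul _ w) h'.symm
  map_mul := by
    rintro γ δ u _ _ rfl rfl h'' e
    have h1 := mfderiv_comp_apply u ((K.smul_smooth γ) (δ • u)).mdiffAt
      ((K.smul_smooth δ) u).mdiffAt e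
    have key : ∀ g : K.V → K.V, g = (fun w ↦ γ • w) ∘ (fun w ↦ δ • w) → ∀ h : g u = γ • δ • u,
        fiberCast K.T h (D[K.dim,K.dim] g u e) = D[K.dim,K.dim] (fun w : K.V ↦ γ • w) (δ • u)
          (D[K.dim,K.dim] (fun w : K.V ↦ δ • w) u e) := by
      rintro _ rfl h
      simpa using! h1
    simpa using! key (fun w ↦ (γ * δ) • w) (funext fun w ↦ mul_smul _ _ w) h''.symm
  base_smooth := K.smul_smooth
  map_smooth γ v := (smHom_mfderiv (K.smul_smooth γ v)).congr (.of_forall fun q ↦ by ext; simp)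

lemma KurNbhd.actE_s (K : KurNbhd X) (γ : K.Γ) {v w : K.V} (h : w = γ • v) :
    K.actE.map γ h (K.s v) = K.s w := by
  subst h
  simpa [KurNbhd.actE] using K.s_equivariant γ v

lemma OneMor.hat_map (Φ : OneMor K L f S) (γ : K.Γ) (δ : L.Γ) {p p' : Φ.P}
    (hp : p' = Φ.actL γ (Φ.actR δ p)) (h : Φ.π p' = γ • Φ.π p) (h' : Φ.φ p' = δ • Φ.φ p)
    (e : K.E (Φ.π p)) : Φ.hat p' (K.actE.map γ h e) = L.actE.map δ h' (Φ.hat p e) := by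
  subst hp
  have h1 := Φ.hat_actL γ (Φ.actR δ p) (fiberCast K.E (Φ.π_actR δ p).symm e)
  rw [Φ.hat_actR] at h1
  have h2 : ∀ {v w : K.V} (hv : v = w) (h : γ • w = γ • v) (e : K.E v),
      K.lift γ w (fiberCast K.E hv e) = fiberCast K.E h.symm (K.lift γ v e) := by
    rintro v _ rfl h e
    simp
  rw [h2 (Φ.π_actR δ p).symm (by rw [Φ.π_actR])] at h1
  simpa [KurNbhd.actE] using h1

section Families

variable {n' : ℕ} {F' : Type*} [NormedAddCommGroup F'] [NormedSpace ℝ F'] {E' : L.V → Type*}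
  [∀ x, AddCommGroup (E' x)] [∀ x, Module ℝ (E' x)] [∀ x, TopologicalSpace (E' x)]
  [TopologicalSpace (TotalSpace F' E')] [FiberBundle F' E'] [VectorBundle ℝ F' E']
  [FiniteDimensional ℝ F'] [ContMDiffVectorBundle ∞ F' E' (𝓡 L.dim)]
  [∀ x, IsTopologicalAddGroup (E' x)] [∀ x, ContinuousSMul ℝ (E' x)]

/-- The family `t` of maps `π^*(E_K) → b^*(E')` on the open subset `D` of `P` is equivariant. -/
def OneMor.IsEquiv (Φ : OneMor K L f S) (D : Opens Φ.P) (A : BundleAction L.Γ L.dim F' E')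
    (b : D → L.V) (t : ∀ p : D, K.E (Φ.π p) →L[ℝ] E' (b p)) : Prop :=
  ∀ γ δ (p p' : D), (p' : Φ.P) = Φ.actL γ (Φ.actR δ p) → ∀ (h : Φ.π p' = γ • Φ.π p)
    (h' : b p' = δ • b p) (e : K.E (Φ.π p)), t p' (K.actE.map γ h e) = A.map δ h' (t p e)

/-- The map `b` on the open subset `D` of `P` is invariant under `Γ_K` and equivariant under `Γ_L`.
-/
def OneMor.IsEquivMap (Φ : OneMor K L f S) (D : Opens Φ.P) (b : D → L.V) : Prop :=
  ∀ γ δ (p p' : D), (p' : Φ.P) = Φ.actL γ (Φ.actR δ p) → b p' = δ • b p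

lemma OneMor.exists_transport (Φ : OneMor K L f S) {D : Opens Φ.P}
    (hL : ∀ γ, ∀ p ∈ D, Φ.actL γ p ∈ D) (hR : ∀ δ, ∀ p ∈ D, Φ.actR δ p ∈ D)
    (A : BundleAction L.Γ L.dim F' E') {b c : D → L.V} (hb : C∞[K.dim,L.dim] b)
    (hc : C∞[K.dim,L.dim] c) (hb' : Φ.IsEquivMap D b) (hc' : Φ.IsEquivMap D c)
    (hbc : MapEqMod K.dim K.dim K.F K.E L.dim (fun p : D ↦ Φ.π p) K.s b c)
    {t : ∀ p : D, K.E (Φ.π p) →L[ℝ] E' (b p)}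
    (ht : ∀ p, SmHom K.dim K.dim K.F K.E L.dim F' E' (fun p : D ↦ Φ.π p) b t p)
    (ht' : Φ.IsEquiv D A b t) : ∃ t' : ∀ p : D, K.E (Φ.π p) →L[ℝ] E' (c p),
    (∀ p, SmHom K.dim K.dim K.F K.E L.dim F' E' (fun p : D ↦ Φ.π p) c t' p) ∧ Φ.IsEquiv D A c t' ∧ ∀
    p :
    D, K.s (Φ.π p) = 0 → HomCongAt K.dim K.dim K.F K.E L.dim F' E' (fun p : D ↦ Φ.π p) K.s b c t t'
    p := by
  let _ : MulAction (K.Γ × L.Γ) D :=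
    { smul := fun g p ↦ ⟨Φ.actL g.1 (Φ.actR g.2 p), hL _ _ (hR _ _ p.2)⟩
      one_smul := fun p ↦ Subtype.ext (by
        change Φ.actL 1 (Φ.actR 1 p) = p
        simp)
      mul_smul := fun g g' p ↦ Subtype.ext (by
        change Φ.actL (g.1 * g'.1) (Φ.actR (g.2 * g'.2) p) =
          Φ.actL g.1 (Φ.actR g.2 (Φ.actL g'.1 (Φ.actR g'.2 p)))
        simp [Φ.act_comm]) }
  have hsm : ∀ (g : K.Γ × L.Γ) (p : D), ((g • p : D) : Φ.P) = Φ.actL g.1 (Φ.actR g.2 p) :=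
    fun _ _ ↦ rfl
  have hπ : ∀ (g : K.Γ × L.Γ) (p : D), Φ.π (g • p : D) = g.1 • Φ.π p := fun g p ↦ by
    rw [hsm, Φ.π_actL, Φ.π_actR]
  obtain ⟨t', h1, h2, h3⟩ := exists_equivariant_homCongAt K.actE A (G := K.Γ × L.Γ) (N := D)
    (fun g p ↦ contMDiffAt_of_lift (etale_val D _)
      (Continuous.subtype_mk ((Φ.actL_smooth g.1).continuous.comp
        ((Φ.actR_smooth g.2).continuous.comp continuous_subtype_val)) _).continuousAt
      (((Φ.actL_smooth g.1).comp ((Φ.actR_smooth g.2).comp contMDiff_subtype_val)) p))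
    (MonoidHom.fst K.Γ L.Γ) (MonoidHom.snd K.Γ L.Γ) (a := fun p : D ↦ Φ.π p)
    (Φ.smooth_π _) hb hc hπ (fun g p ↦ hb' g.1 g.2 _ _ (hsm g p))
    (fun g p ↦ hc' g.1 g.2 _ _ (hsm g p)) K.smVec_s (fun γ _ _ h ↦ K.actE_s γ h) hbc ht
    (fun g p e ↦ ht' g.1 g.2 _ _ (hsm g p) _ _ e)
  refine ⟨t', h1, fun γ δ p p' hp h h' e ↦ ?_, h3⟩
  obtain rfl : p' = (γ, δ) • p := Subtype.ext hp
  exact h2 (γ, δ) p e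

end Families

namespace TwoMorRep

lemma lam_map (x : TwoMorRep Φ Φ') {γ : K.Γ} {δ : L.Γ} {p p' : x.dom}
    (hp : (p' : Φ.P) = Φ.actL γ (Φ.actR δ p)) : x.lam p' = Φ'.actL γ (Φ'.actR δ (x.lam p)) := by
  rw [← x.lam_actR, ← x.lam_actL]
  exact congrArg x.lam (Subtype.ext hp)

lemma lamHat_isEquiv (x : TwoMorRep Φ Φ') : Φ.IsEquiv x.dom L.actT (fun p ↦ Φ.φ p) x.lamHat := by
  intro γ δ p p' hp h h' e
  obtain rfl : p' = ⟨Φ.actL γ (Φ.actR δ p), x.dom_actL _ _ (x.dom_actR _ _ p.2)⟩ := Subtype.ext hp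
  have h1 := x.lamHat_actL γ ⟨Φ.actR δ p, x.dom_actR _ _ p.2⟩ (fiberCast K.E (Φ.π_actR δ p).symm e)
  rw [x.lamHat_actR] at h1
  have h2 : ∀ {v w : K.V} (hv : v = w) (h : γ • w = γ • v) (e : K.E v),
      K.lift γ w (fiberCast K.E hv e) = fiberCast K.E h.symm (K.lift γ v e) := by
    rintro v _ rfl h e
    simp
  rw [h2 (Φ.π_actR δ p).symm (by rw [Φ.π_actR])] at h1
  simpa [KurNbhd.actE, KurNbhd.actT] using h1

/-- A representative of a 2-morphism, from congruences at the zeros of `π^*(s_K)`. -/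
def ofCong (dom : Opens Φ.P) (core_subset : Φ.core ⊆ dom)
    (dom_actL : ∀ γ, ∀ p ∈ dom, Φ.actL γ p ∈ dom) (dom_actR : ∀ δ, ∀ p ∈ dom, Φ.actR δ p ∈ dom)
    (lam : dom → Φ'.P) (lam_continuous : Continuous lam) (lam_π : ∀ p, Φ'.π (lam p) = Φ.π p)
    (lam_map : ∀ γ δ (p p' : dom), (p' : Φ.P) = Φ.actL γ (Φ.actR δ p) →
      lam p' = Φ'.actL γ (Φ'.actR δ (lam p))) (lamHat : ∀ p : dom, K.E (Φ.π p) →L[ℝ] L.T (Φ.φ p))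
    (smT : ∀ p, SmT K.dim K L (fun p : dom ↦ Φ.π p) (fun p : dom ↦ Φ.φ p) lamHat p)
    (equiv : Φ.IsEquiv dom L.actT (fun p ↦ Φ.φ p) lamHat)
    (mapCong : ∀ p : dom, K.s (Φ.π p) = 0 → MapCong K.dim K L (fun p : dom ↦ Φ.π p)
      (fun p : dom ↦ Φ'.φ (lam p)) (fun p : dom ↦ Φ.φ p) lamHat p)
    (congE : ∀ (nL : Conn[L])
      [nL.ContMDiffCovariantDerivative ∞] (p : dom), K.s (Φ.π p) = 0 →
      CongE K.dim K L (fun p : dom ↦ Φ.π p) (fun p : dom ↦ Φ'.φ (lam p)) (fun p : dom ↦ Φ.φ p)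
        (fun p : dom ↦ (Φ'.hat (lam p)).comp (fiberCast K.E (lam_π p).symm))
        (fun p : dom ↦ Φ.hat p + (nL L.s (Φ.φ p)).comp (lamHat p)) p) : TwoMorRep Φ Φ' :=
  have hπ := Φ.smooth_π dom
  have hφ := Φ.smooth_φ dom
  have hlam : C∞[K.dim,K.dim] lam := fun p ↦
    contMDiffAt_of_lift (Φ'.π_etale _) lam_continuous.continuousAt
      ((hπ p).congr_of_eventuallyEq (.of_forall lam_π))
  { dom := dom, core_subset := core_subset, dom_actL := dom_actL, dom_actR := dom_actR, lam := lam
    lam_smooth := hlam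
    lam_actL := fun γ p ↦ by simpa using lam_map γ 1 p ⟨_, dom_actL γ p p.2⟩ (by simp)
    lam_actR := fun δ p ↦ by simpa using lam_map 1 δ p ⟨_, dom_actR δ p p.2⟩ (by simp)
    lam_π := lam_π
    lamHat := lamHat
    lamHat_smooth := (isSmoothHom_iff hπ hφ).2 smT
    lamHat_actL := fun γ p e ↦ by
      have := equiv γ 1 p ⟨_, dom_actL γ p p.2⟩ (by simp) (Φ.π_actL γ p)
        (by simpa using Φ.φ_actL γ p) e
      rw [L.actT.map_one (Φ.φ_actL γ p).symm] at this
      exact this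
    lamHat_actR := fun δ p e ↦ by
      have := equiv 1 δ p ⟨_, dom_actR δ p p.2⟩ (by simp) (by simpa using Φ.π_actR δ p)
        (Φ.φ_actR δ p) e
      rw [K.actE.map_one (Φ.π_actR δ p).symm] at this
      exact this
    eq_φ := mapEqModSq_of_at hπ K.smVec_s (Φ'.φ_smooth.comp hlam) hφ smT mapCong
    eq_hat := fun nL _ ↦ homEqModAlong_of_at hπ K.smVec_s (Φ'.φ_smooth.comp hlam) hφ
      (fun p ↦ ((Φ'.smE_hat (lam p)).pull (hlam p) (Φ'.π_smooth _) (Φ'.φ_smooth _)).comp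
        (smHom_fiberCast _ p))
      (fun p ↦ ((Φ.smE_hat p).pull (contMDiff_subtype_val p) (Φ.π_smooth _) (Φ.φ_smooth _)).add
        (SmHom.comp ((smHom_connection nL (.of_forall L.smVec_s)).pull (hφ p)
          contMDiffAt_id contMDiffAt_id) (smT p))) (congE nL) }

end TwoMorRep

lemma OneMor.isEquivMap_φ (Φ : OneMor K L f S) (D : Opens Φ.P) :
    Φ.IsEquivMap D (fun p ↦ Φ.φ p) := by
  rintro γ δ p p' hp
  simp only [hp, Φ.φ_actL, Φ.φ_actR]

namespace TwoMorRep

lemma isEquivMap_φ_lam (x : TwoMorRep Φ Φ') : Φ.IsEquivMap x.dom (fun p ↦ Φ'.φ (x.lam p)) := by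
  rintro γ δ p p' hp
  simp only [x.lam_map hp, Φ'.φ_actL, Φ'.φ_actR]

lemma mapEqMod (x : TwoMorRep Φ Φ') : MapEqMod K.dim K.dim K.F K.E L.dim (fun p : x.dom ↦ Φ.π p) K.s
    (fun p : x.dom ↦ Φ'.φ (x.lam p)) (fun p : x.dom ↦ Φ.φ p) :=
  MapEqModSq.mapEqMod (Φ.smooth_π _) K.smVec_s
    (Φ.smooth_φ _) x.smT_lamHat x.eq_φ

/-- The domain `x.lam⁻¹(y.dom)` of a vertical composition. -/
def vertDom (x : TwoMorRep Φ Φ') (y : TwoMorRep Φ' Φ'') : Opens Φ.P :=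
  ⟨Subtype.val '' (x.lam ⁻¹' y.dom),
    x.dom.isOpen.isOpenMap_subtype_val _ (y.dom.isOpen.preimage x.lam_smooth.continuous)⟩

lemma mem_vertDom {x : TwoMorRep Φ Φ'} {y : TwoMorRep Φ' Φ''} {p : Φ.P} :
    p ∈ vertDom x y ↔ ∃ h : p ∈ x.dom, x.lam ⟨p, h⟩ ∈ y.dom :=
  ⟨by rintro ⟨p, hp, rfl⟩; exact ⟨p.2, hp⟩, fun ⟨h, h'⟩ ↦ ⟨⟨p, h⟩, h', rfl⟩⟩

lemma mem_vertDom_map {x : TwoMorRep Φ Φ'} {y : TwoMorRep Φ' Φ''} (γ : K.Γ) (δ : L.Γ) {p : Φ.P}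
    (hp : p ∈ vertDom x y) : Φ.actL γ (Φ.actR δ p) ∈ vertDom x y := by
  obtain ⟨h, h'⟩ := mem_vertDom.1 hp
  refine mem_vertDom.2 ⟨x.dom_actL _ _ (x.dom_actR _ _ h), ?_⟩
  rw [x.lam_map (p := ⟨p, h⟩) (γ := γ) (δ := δ) rfl]
  exact y.dom_actL _ _ (y.dom_actR _ _ h')

theorem exists_vert (x : TwoMorRep Φ Φ') (y : TwoMorRep Φ' Φ'') : ∃ z, IsVertRep x y z := by
  let D := vertDom x y
  have hDx : D ≤ x.dom := fun p hp ↦ (mem_vertDom.1 hp).1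
  let ix : D → x.dom := Opens.inclusion hDx
  have hix : C∞[K.dim,K.dim] ix := contMDiff_inclusion hDx
  let ly : D → y.dom := fun p ↦ ⟨x.lam (ix p), (mem_vertDom.1 p.2).2⟩
  have hlyc : C∞[K.dim,K.dim] (fun p ↦ x.lam (ix p)) := x.lam_smooth.comp hix
  have hly : C∞[K.dim,K.dim] ly := fun p ↦
    contMDiffAt_of_lift (etale_val y.dom _)
      (hlyc.continuous.subtype_mk _).continuousAt (hlyc p)
  have hL : ∀ γ, ∀ p ∈ D, Φ.actL γ p ∈ D := fun γ p hp ↦ by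
    simpa using mem_vertDom_map (x := x) (y := y) γ 1 hp
  have hR : ∀ δ, ∀ p ∈ D, Φ.actR δ p ∈ D := fun δ p hp ↦ by
    simpa using mem_vertDom_map (x := x) (y := y) 1 δ hp
  have hπ := Φ.smooth_π D
  have hπx := Φ.smooth_π x.dom
  have hπy := Φ'.smooth_π y.dom
  have hφ := Φ.smooth_φ D
  have hφx := Φ.smooth_φ x.dom
  have hφy := Φ'.smooth_φ y.dom
  have hφ' : C∞[K.dim,L.dim] (fun p : D ↦ Φ'.φ (x.lam (ix p))) := Φ'.φ_smooth.comp hlyc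
  have hc : ∀ p : D, Φ.π p = Φ'.π (ly p) := fun p ↦ (x.lam_π (ix p)).symm
  let t : ∀ p : D, K.E (Φ.π p) →L[ℝ] L.T (Φ'.φ (x.lam (ix p))) := fun p ↦
    (y.lamHat (ly p)).comp (fiberCast K.E (hc p))
  have ht : ∀ p, SmT K.dim K L (fun p : D ↦ Φ.π p) (fun p ↦ Φ'.φ (x.lam (ix p))) t p := fun p ↦
    ((y.smT_lamHat (ly p)).pull (hly p) (hπy _) (hφy _)).comp (smHom_fiberCast hc p)
  have hlymap : ∀ (γ : K.Γ) (δ : L.Γ) (p p' : D), (p' : Φ.P) = Φ.actL γ (Φ.actR δ p) →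
      (ly p' : Φ'.P) = Φ'.actL γ (Φ'.actR δ (ly p)) := fun γ δ p p' h ↦
    x.lam_map (p := ix p) (p' := ix p') h
  obtain ⟨check, h1, h2, h3⟩ := Φ.exists_transport hL hR L.actT hφ' hφ
    (fun γ δ p p' h ↦ x.isEquivMap_φ_lam γ δ (ix p) (ix p') h) (Φ.isEquivMap_φ D)
    (fun h hh p ↦ (x.mapEqMod h hh (ix p)).comp hπx hix) ht
    (fun γ δ p p' h hπ' hb e ↦ by
      have := y.lamHat_isEquiv γ δ (ly p) (ly p') (hlymap γ δ p p' h)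
        (by rw [← hc, ← hc, hπ']) hb (fiberCast K.E (hc p) e)
      simp only [t, clm_comp_apply]
      rw [← this]
      congr 1
      have : ∀ {v v' w w' : K.V} (h1 : v' = γ • v) (h2 : w' = γ • w) (hv : v = w) (hv' : v' = w')
        (e : K.E v), fiberCast K.E hv' (K.actE.map γ h1 e) =
          K.actE.map γ h2 (fiberCast K.E hv e) := by
        rintro v v' _ _ h1 h2 rfl rfl e
        simp
      exact this ..)
  have hlam : C∞[K.dim,K.dim] (fun p : D ↦ y.lam (ly p)) := y.lam_smooth.comp hly
  refine ⟨ofCong D (fun p hp ↦ mem_vertDom.2 ⟨x.core_subset hp, y.core_subset (x.mem_core_lam hp)⟩)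
    hL hR (fun p ↦ y.lam (ly p)) hlam.continuous
    (fun p ↦ (y.lam_π _).trans (x.lam_π _)) (fun γ δ p p' h ↦ y.lam_map (hlymap γ δ p p' h))
    (fun p ↦ x.lamHat (ix p) + check p) (fun p ↦ SmHom.add ((x.smT_lamHat (ix p)).pull (hix p)
      (hπx _) (hφx _)) (h1 p)) (fun γ δ p p' h hπ' hb e ↦ ?_) (fun p hp ↦ ?_) (fun nL _ p hp ↦ ?_),
    ⟨hDx, fun p ↦ (ly p).2, fun p hp ↦ mem_vertDom.2 ⟨p.2, hp⟩, fun p ↦ rfl, check,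
      (isSmoothHom_iff hπ hφ).2 h1, homEqModAlong_of_at hπ K.smVec_s hφ' hφ ht h1 h3, fun p ↦ rfl⟩⟩
  · simp only [add_apply, map_add]
    rw [x.lamHat_isEquiv γ δ (ix p) (ix p') h hπ' hb e, h2 γ δ p p' h hπ' hb e]
  · have hp' : K.s (Φ'.π (ly p)) = 0 := by rw [← hc, hp]
    have e1 := ((y.mapCong hp').pull (k := K.dim) hπy hly).cast (a' := fun p : D ↦ Φ.π p)
      (fun q ↦ (hc q).symm) (fun q ↦ rfl) (fun q ↦ rfl) (Λ' := t)
      (.of_forall fun q e ↦ by simp [t])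
    have e2 := MapCongAt.pull (k := K.dim) hπx hix (q := p) (x.mapCong (p := ix p) hp)
    exact e1.trans hφ' hφ (.of_forall ht) (.of_forall h1) e2 (h3 p hp)
  · have hp' : K.s (Φ'.π (ly p)) = 0 := by rw [← hc, hp]
    have e1 := (((y.congE hp' nL).pull (k := K.dim) hπy hly)).cast (a' := fun p : D ↦ Φ.π p)
      (fun q ↦ (hc q).symm) (fun q ↦ rfl) (fun q ↦ rfl)
      (t₁' := fun q ↦ (Φ''.hat (y.lam (ly q))).comp (fiberCast K.E
        ((y.lam_π (ly q)).trans (x.lam_π _)).symm))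
      (t₂' := fun q ↦ (Φ'.hat (ly q)).comp (fiberCast K.E (hc q)) + (nL L.s (Φ'.φ (ly q))).comp
        (t q))
      (.of_forall fun q e ↦ by simp)
      (.of_forall fun q e ↦ by simp [t])
    have e2 := HomCongAt.pull (k := K.dim) hπx hix (q := p) (x.congE (p := ix p) hp nL)
    have e3 := (h3 p hp).clm_comp (.of_forall fun w ↦ smHom_connection nL (.of_forall L.smVec_s))
    exact e1.trans ((e2.add e3).congr (.of_forall fun q ↦ rfl) (.of_forall fun q ↦ by
        rw [ContinuousLinearMap.comp_add, ← add_assoc]))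

/-! ### Values of bundle morphisms along maps -/

section At

variable {m : ℕ} {N : Type*} [TopologicalSpace N] [ChartedSpace 𝔼[m] N]

/-- The family `lamHat` pulled back along a map `j` to the domain, as a family of linear maps
`E_K (a u) → TV_L (c u)`, where `a` and `c` are other expressions for the maps `π ∘ j`, `φ ∘ j`. -/
def hatAt (x : TwoMorRep Φ Φ') {N : Type*} {j : N → Φ.P} (hj : ∀ u, j u ∈ x.dom) {a : N → K.V}
    (ha : ∀ u, a u = Φ.π (j u)) {c : N → L.V} (hc : ∀ u, Φ.φ (j u) = c u) (u : N) :
    K.E (a u) →L[ℝ] L.T (c u) :=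
  (fiberCast L.T (hc u)).comp ((x.lamHat ⟨j u, hj u⟩).comp (fiberCast K.E (ha u)))

lemma hatAt_rfl (x : TwoMorRep Φ Φ') {N : Type*} {j : N → Φ.P} (hj : ∀ u, j u ∈ x.dom) :
    x.hatAt hj (fun _ ↦ rfl) (fun _ ↦ rfl) = fun u ↦ x.lamHat ⟨j u, hj u⟩ := by
  funext u
  ext e
  simp [TwoMorRep.hatAt]

lemma smT_hatAt (x : TwoMorRep Φ Φ') {j : N → Φ.P} (hj : ∀ u, j u ∈ x.dom) (hjs : C∞[m,K.dim] j)
    {a : N → K.V} (ha : ∀ u, a u = Φ.π (j u)) {c : N → L.V} (hc : ∀ u, Φ.φ (j u) = c u) (u : N) :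
    SmT m K L a c (x.hatAt hj ha hc) u := by
  obtain rfl : a = fun u ↦ Φ.π (j u) := funext ha
  obtain rfl : (fun u ↦ Φ.φ (j u)) = c := funext hc
  rw [hatAt_rfl]
  have h : C∞[m,K.dim] (fun u ↦ (⟨j u, hj u⟩ : x.dom)) := fun u ↦
    contMDiffAt_of_lift (etale_val x.dom _)
      (hjs.continuous.subtype_mk _).continuousAt (hjs u)
  exact (x.smT_lamHat ⟨j u, hj u⟩).pull (h u) (Φ.smooth_π _ _)
    (Φ.smooth_φ _ _)

lemma Equiv.congT_hatAt {x y : TwoMorRep Φ Φ'} (h : x.Equiv y) {j : N → Φ.P} (hj : C∞[m,K.dim] j)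
    (hx : ∀ u, j u ∈ x.dom) (hy : ∀ u, j u ∈ y.dom) {q : N} (hq : j q ∈ Φ.core) {a : N → K.V}
    (ha : ∀ u, a u = Φ.π (j u)) {c : N → L.V} (hc : ∀ u, Φ.φ (j u) = c u) :
    CongT m K L a c c (x.hatAt hx ha hc) (y.hatAt hy ha hc) q := by
  obtain rfl : a = fun u ↦ Φ.π (j u) := funext ha
  obtain rfl : (fun u ↦ Φ.φ (j u)) = c := funext hc
  rw [hatAt_rfl, hatAt_rfl]
  exact h.congT hj hx hy hq

lemma equiv_of_hatAt (hS : IsOpen S) {x y : TwoMorRep Φ Φ'}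
    (h : ∀ p (hp : p ∈ Φ.core), x.lam ⟨p, x.core_subset hp⟩ = y.lam ⟨p, y.core_subset hp⟩ ∧
      ∃ (N : Type u) (_ : TopologicalSpace N) (_ : ChartedSpace 𝔼[K.dim] N)
        (j : N → Φ.P) (q : N) (hx : ∀ u, j u ∈ x.dom) (hy : ∀ u, j u ∈ y.dom) (a : N → K.V)
        (ha : ∀ u, a u = Φ.π (j u)) (c : N → L.V) (hc : ∀ u, Φ.φ (j u) = c u), j q = p ∧
        Étale[K.dim] j ∧
        CongT K.dim K L a c c (x.hatAt hx ha hc) (y.hatAt hy ha hc) q) : x.Equiv y := by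
  refine equiv_of_probe hS fun p hp ↦ ⟨(h p hp).1, ?_⟩
  obtain ⟨-, N, i₁, i₂, j, q, hx, hy, a, ha, c, hc, hq, hj, hh⟩ := h p hp
  obtain rfl : a = fun u ↦ Φ.π (j u) := funext ha
  obtain rfl : (fun u ↦ Φ.φ (j u)) = c := funext hc
  rw [hatAt_rfl, hatAt_rfl] at hh
  exact ⟨N, i₁, i₂, j, q, hx, hy, hq, hj, hh⟩

/-- The values of a vertical composition: `j'` plays the role of `x.lam ∘ j`. -/
lemma _root_.IsVertRep.hatAt {x : TwoMorRep Φ Φ'} {y : TwoMorRep Φ' Φ''} {z : TwoMorRep Φ Φ''}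
    (H : IsVertRep x y z) {j : N → Φ.P} (hj : C∞[m,K.dim] j) (hjx : ∀ u, j u ∈ x.dom)
    (hjz : ∀ u, j u ∈ z.dom) {j' : N → Φ'.P} (hj' : C∞[m,K.dim] j') (hjy : ∀ u, j' u ∈ y.dom)
    {a : N → K.V} (ha : ∀ u, a u = Φ.π (j u)) (ha' : ∀ u, a u = Φ'.π (j' u)) {c c' : N → L.V}
    (hc : ∀ u, Φ.φ (j u) = c u) (hc' : ∀ u, Φ'.φ (j' u) = c' u) {q : N} (hq : j q ∈ Φ.core)
    (hlam : x.lam ⟨j q, hjx q⟩ = j' q) :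
    ∃ ck : ∀ u, K.E (a u) →L[ℝ] L.T (c u), (∀ u, SmT m K L a c ck u) ∧ CongT m K L a c' c
    (y.hatAt hjy ha' hc') ck q ∧ ∀ u, z.hatAt hjz ha hc u = x.hatAt hjx ha hc u + ck u := by
  obtain rfl : a = fun u ↦ Φ.π (j u) := funext ha
  obtain rfl : (fun u ↦ Φ.φ (j u)) = c := funext hc
  obtain rfl : (fun u ↦ Φ'.φ (j' u)) = c' := funext hc'
  obtain ⟨check, h1, h2, h3⟩ := H.lamHat_eq
  have hπ := Φ.smooth_π z.dom
  have hφ := Φ.smooth_φ z.dom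
  have hlz : C∞[K.dim,K.dim] (fun p : z.dom ↦ x.lam ⟨p, H.dom_le p.2⟩) :=
    x.lam_smooth.comp (contMDiff_inclusion H.dom_le)
  let jz : N → z.dom := fun u ↦ ⟨j u, hjz u⟩
  have hjzs : C∞[m,K.dim] jz := fun u ↦ contMDiffAt_of_lift (etale_val z.dom _)
      (hj.continuous.subtype_mk _).continuousAt (hj u)
  have h0 : K.s (Φ.π (jz q)) = 0 := hq.1
  refine ⟨fun u ↦ check (jz u), fun u ↦ ((isSmoothHom_iff hπ hφ).1 h1 (jz u)).pull (hjzs u)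
    (hπ _) (hφ _), ?_, fun u ↦ ?_⟩
  · have hb : Φ'.φ (x.lam ⟨jz q, H.dom_le (jz q).2⟩) = Φ.φ (jz q) := x.φ_lam h0
    have e1 := (h2.at hπ (Φ'.φ_smooth.comp hlz).continuous hφ.continuous (p := jz q) hb).pull
      (k := m) hπ hjzs
    have e2 : ∀ᶠ u in 𝓝 q, x.lam ⟨j u, hjx u⟩ = j' u := by
      refine (Φ'.π_etale (j' q)).eventually_inj (f := fun u ↦ x.lam ⟨j u, hjx u⟩)
        ?_ hj'.continuous.continuousAt hlam rfl
        (.of_forall fun u ↦ (x.lam_π _).trans (ha' u))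
      exact (x.lam_smooth.continuous.comp (hj.continuous.subtype_mk _)).continuousAt
    refine HomCongAt.congr_left e1 (e2.mono fun u hu ↦ ⟨congrArg Φ'.φ hu, fun e ↦ ?_⟩)
    simp only [TwoMorRep.hatAt, clm_comp_apply]
    have := apply_fiberCast (ι := y.dom) (a := fun p ↦ Φ'.π p) (b := fun p ↦ Φ'.φ p)
      (E := K.E) (E' := L.T) y.lamHat
      (i := ⟨x.lam ⟨j u, hjx u⟩, H.lam_mem (jz u)⟩) (j := ⟨j' u, hjy u⟩) (Subtype.ext hu)
      (congrArg Φ'.π hu) (congrArg Φ'.φ hu) (fiberCast K.E (x.lam_π ⟨j u, hjx u⟩).symm e)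
    simpa using this.symm
  · rw [hatAt_rfl, hatAt_rfl]
    exact h3 (jz u)

lemma _root_.IsVertRep.lam_of_eq {x : TwoMorRep Φ Φ'} {y : TwoMorRep Φ' Φ''} {z : TwoMorRep Φ Φ''}
    (H : IsVertRep x y z) {p : Φ.P} (hz : p ∈ z.dom) (hx : p ∈ x.dom) {p' : Φ'.P} (hy : p' ∈ y.dom)
    (h : x.lam ⟨p, hx⟩ = p') : z.lam ⟨p, hz⟩ = y.lam ⟨p', hy⟩ := by
  subst h
  exact H.lam_eq _

end At

end TwoMorRep

/-! ### 2-morphisms form a groupoid under vertical composition -/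

namespace TwoMorRep

lemma vert_equiv (hS : IsOpen S) {x x' : TwoMorRep Φ Φ'} {y y' : TwoMorRep Φ' Φ''}
    {z z' : TwoMorRep Φ Φ''} (hx : x.Equiv x') (hy : y.Equiv y') (H : IsVertRep x y z)
    (H' : IsVertRep x' y' z') : z.Equiv z' := by
  refine equiv_of_hatAt hS fun p hp ↦ ?_
  have hxy' : p ∈ vertDom x y' := mem_vertDom.2
    ⟨x.core_subset hp, y'.core_subset (x.mem_core_lam hp)⟩
  have hxy : p ∈ vertDom x y := mem_vertDom.2 ⟨x.core_subset hp, y.core_subset (x.mem_core_lam hp)⟩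
  refine ⟨?_, ?_⟩
  · rw [H.lam_of_eq (z.core_subset hp) (x.core_subset hp) (mem_vertDom.1 hxy).2 rfl,
      H'.lam_of_eq (z'.core_subset hp) (x'.core_subset hp) (mem_vertDom.1 hxy').2
        (hx.lam_eq hp (x.core_subset hp) _).symm]
    exact hy.lam_eq (x.mem_core_lam (p := ⟨p, _⟩) hp) _ _
  let U : Opens Φ.P := z.dom ⊓ z'.dom ⊓ vertDom x y ⊓ vertDom x y'
  have hU : p ∈ U := ⟨⟨⟨z.core_subset hp, z'.core_subset hp⟩, hxy⟩, hxy'⟩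
  have hj := etale_val (n := K.dim) U
  have hj' : C∞[K.dim,K.dim] (fun u : U ↦ x.lam ⟨u, (mem_vertDom.1 u.2.2).1⟩) :=
    x.lam_smooth.comp (contMDiff_inclusion (U := U) (V := x.dom)
      (fun u hu ↦ (mem_vertDom.1 hu.2).1))
  obtain ⟨ck, -, h2, h3⟩ := H.hatAt (q := ⟨p, hU⟩) hj.contMDiff
    (fun u ↦ (mem_vertDom.1 u.2.2).1) (fun u ↦ u.2.1.1.1) hj' (fun u ↦ (mem_vertDom.1 u.2.1.2).2)
    (fun _ ↦ rfl) (fun u ↦ (x.lam_π ⟨u, _⟩).symm) (fun _ ↦ rfl) (fun _ ↦ rfl) hp rfl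
  obtain ⟨ck', -, h2', h3'⟩ := H'.hatAt (q := ⟨p, hU⟩) hj.contMDiff
    (fun u ↦ H'.dom_le u.2.1.1.2) (fun u ↦ u.2.1.1.2) hj' (fun u ↦ (mem_vertDom.1 u.2.2).2)
    (fun _ ↦ rfl) (fun u ↦ (x.lam_π ⟨u, _⟩).symm) (fun _ ↦ rfl) (fun _ ↦ rfl) hp
    (hx.lam_eq hp (x.core_subset hp) _).symm
  refine ⟨U, _, _, Subtype.val, ⟨p, hU⟩, fun u ↦ u.2.1.1.1, fun u ↦ u.2.1.1.2, _, fun _ ↦ rfl, _,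
    fun _ ↦ rfl, rfl, hj, ?_⟩
  refine ((hx.congT_hatAt hj.contMDiff _ _ (q := (⟨p, hU⟩ : U)) hp _ _).add (h2.symm.trans
    ((hy.congT_hatAt hj' _ _ (x.mem_core_lam (p := ⟨p, _⟩) hp) _ _).trans h2'))).congr
    (.of_forall h3) (.of_forall h3')

end TwoMorRep

/-- The representative `(P, id, 0)` of the identity 2-morphism. -/
def TwoMorRep.idRep (Φ : OneMor K L f S) : TwoMorRep Φ Φ :=
  ofCong ⊤ (Set.subset_univ _) (fun _ _ _ ↦ trivial) (fun _ _ _ ↦ trivial) Subtype.val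
    continuous_subtype_val (fun _ ↦ rfl) (fun _ _ _ _ h ↦ h) (fun _ ↦ 0)
    (fun p ↦ smHom_zero (Φ.smooth_φ _ p))
    (fun γ δ p p' _ _ _ e ↦ by simp) (fun p _ ↦ MapCongAt.refl)
    (fun nL _ p _ ↦ (HomCongAt.refl (t := fun p : (⊤ : Opens Φ.P) ↦ Φ.hat p)).congr
      (.of_forall fun q ↦ by ext; simp) (.of_forall fun q ↦ by simp))

lemma TwoMorRep.isIdRep_idRep (Φ : OneMor K L f S) : IsIdRep (idRep Φ) :=
  ⟨fun _ ↦ trivial, fun _ ↦ rfl, fun _ ↦ rfl⟩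

namespace TwoMor

/-- The identity 2-morphism. -/
def id (Φ : OneMor K L f S) : TwoMor Φ Φ := (idRep Φ).toTwoMor

/-- The vertical composition, written in diagrammatic order. -/
def comp (η : TwoMor Φ Φ') (θ : TwoMor Φ' Φ'') : TwoMor Φ Φ'' :=
  (exists_vert (Quotient.out η) (Quotient.out θ)).choose.toTwoMor

lemma toTwoMor_eq_iff {x y : TwoMorRep Φ Φ'} : x.toTwoMor = y.toTwoMor ↔ x.Equiv y :=
  Quotient.eq (r := ⟨TwoMorRep.Equiv, equiv_equivalence Φ Φ'⟩)

lemma exists_rep (η : TwoMor Φ Φ') : ∃ x : TwoMorRep Φ Φ', x.toTwoMor = η := Quotient.exists_rep η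

lemma comp_eq (hS : IsOpen S) {x : TwoMorRep Φ Φ'} {y : TwoMorRep Φ' Φ''} {z : TwoMorRep Φ Φ''}
    (H : IsVertRep x y z) : comp x.toTwoMor y.toTwoMor = z.toTwoMor :=
  toTwoMor_eq_iff.2 (vert_equiv hS (toTwoMor_eq_iff.1 (Quotient.out_eq _))
    (toTwoMor_eq_iff.1 (Quotient.out_eq _)) (exists_vert _ _).choose_spec H)

lemma id_comp (hS : IsOpen S) (η : TwoMor Φ Φ') : comp (id Φ) η = η := by
  obtain ⟨x, rfl⟩ := η.exists_rep
  obtain ⟨z, H⟩ := exists_vert (idRep Φ) x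
  rw [id, comp_eq hS H, toTwoMor_eq_iff]
  refine equiv_of_hatAt hS fun p hp ↦ ⟨?_, ?_⟩
  · exact H.lam_of_eq (z.core_subset hp) trivial (x.core_subset hp) rfl
  let U : Opens Φ.P := z.dom ⊓ x.dom
  have hU : p ∈ U := ⟨z.core_subset hp, x.core_subset hp⟩
  have hj := etale_val (n := K.dim) U
  obtain ⟨ck, -, h2, h3⟩ := H.hatAt (q := ⟨p, hU⟩) hj.contMDiff (fun _ ↦ trivial)
    (fun u ↦ u.2.1) hj.contMDiff (fun u ↦ u.2.2) (fun _ ↦ rfl) (fun _ ↦ rfl) (fun _ ↦ rfl)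
    (fun _ ↦ rfl) hp rfl
  refine ⟨U, _, _, Subtype.val, ⟨p, hU⟩, fun u ↦ u.2.1, fun u ↦ u.2.2, _, fun _ ↦ rfl, _,
    fun _ ↦ rfl, rfl, hj, h2.symm.congr (.of_forall fun u ↦ ?_)
    (.of_forall fun u ↦ rfl)⟩
  rw [h3]
  ext e
  simp [TwoMorRep.hatAt, (isIdRep_idRep Φ).lamHat_eq]

lemma comp_id (hS : IsOpen S) (η : TwoMor Φ Φ') : comp η (id Φ') = η := by
  obtain ⟨x, rfl⟩ := η.exists_rep
  obtain ⟨z, H⟩ := exists_vert x (idRep Φ')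
  rw [id, comp_eq hS H, toTwoMor_eq_iff]
  refine equiv_of_hatAt hS fun p hp ↦ ⟨?_, ?_⟩
  · exact H.lam_of_eq (z.core_subset hp) (x.core_subset hp) trivial rfl
  let U : Opens Φ.P := z.dom ⊓ x.dom
  have hU : p ∈ U := ⟨z.core_subset hp, x.core_subset hp⟩
  have hj := etale_val (n := K.dim) U
  have hj' : C∞[K.dim,K.dim] (fun u : U ↦ x.lam ⟨u, u.2.2⟩) :=
    x.lam_smooth.comp (contMDiff_inclusion (U := U) (V := x.dom) (fun u hu ↦ hu.2))
  obtain ⟨ck, -, h2, h3⟩ := H.hatAt (q := ⟨p, hU⟩) hj.contMDiff (fun u ↦ u.2.2)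
    (fun u ↦ u.2.1) hj' (fun u ↦ trivial) (fun _ ↦ rfl) (fun u ↦ (x.lam_π ⟨u, _⟩).symm)
    (fun _ ↦ rfl)
    (fun _ ↦ rfl) hp rfl
  refine ⟨U, _, _, Subtype.val, ⟨p, hU⟩, fun u ↦ u.2.1, fun u ↦ u.2.2, _, fun _ ↦ rfl, _,
    fun _ ↦ rfl, rfl, hj, (HomCongAt.refl.add (h2.symm.trans ?_)).congr
    (.of_forall h3)
    (.of_forall fun u ↦ (add_zero (x.hatAt (fun u : U ↦ u.2.2) _ _ u)).symm)⟩
  refine ⟨h2.1, fun β _ e _ ↦ inI_zero.congr (.of_forall fun u ↦ ?_)⟩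
  simp [TwoMorRep.hatAt, (isIdRep_idRep Φ').lamHat_eq]

lemma comp_assoc (hS : IsOpen S) (η : TwoMor Φ Φ') (θ : TwoMor Φ' Φ'') (κ : TwoMor Φ'' Φ''') :
    comp (comp η θ) κ = comp η (comp θ κ) := by
  obtain ⟨x, rfl⟩ := η.exists_rep
  obtain ⟨y, rfl⟩ := θ.exists_rep
  obtain ⟨w, rfl⟩ := κ.exists_rep
  obtain ⟨xy, H⟩ := exists_vert x y
  obtain ⟨yw, H'⟩ := exists_vert y w
  obtain ⟨z, Hz⟩ := exists_vert xy w
  obtain ⟨z', Hz'⟩ := exists_vert x yw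
  rw [comp_eq hS H, comp_eq hS H', comp_eq hS Hz, comp_eq hS Hz', toTwoMor_eq_iff]
  have hlam : ∀ {p} (hp : p ∈ xy.dom), xy.lam ⟨p, hp⟩ = y.lam ⟨_, H.lam_mem ⟨p, hp⟩⟩ := fun hp ↦
    H.lam_eq ⟨_, hp⟩
  refine equiv_of_hatAt hS fun p hp ↦ ?_
  have m1 := x.mem_core_lam (p := ⟨p, x.core_subset hp⟩) hp
  have m2 := y.mem_core_lam (p := ⟨_, y.core_subset m1⟩) m1
  have e1 := H.lam_of_eq (xy.core_subset hp) (x.core_subset hp) (y.core_subset m1) rfl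
  refine ⟨?_, ?_⟩
  · rw [Hz.lam_of_eq (z.core_subset hp) (xy.core_subset hp) (w.core_subset m2) e1,
      Hz'.lam_of_eq (z'.core_subset hp) (x.core_subset hp) (yw.core_subset m1) rfl,
      H'.lam_of_eq (yw.core_subset m1) (y.core_subset m1) (w.core_subset m2) rfl]
  let U : Opens Φ.P := z.dom ⊓ z'.dom ⊓ vertDom xy w ⊓ vertDom x yw
  have hU : p ∈ U := ⟨⟨⟨z.core_subset hp, z'.core_subset hp⟩, mem_vertDom.2
    ⟨xy.core_subset hp, e1 ▸ w.core_subset m2⟩⟩, mem_vertDom.2 ⟨_, yw.core_subset m1⟩⟩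
  have k1 : ∀ u : U, ∃ h : (u : Φ.P) ∈ x.dom, x.lam ⟨u, h⟩ ∈ yw.dom := fun u ↦
    mem_vertDom.1 u.2.2
  have k2 : ∀ u : U, ∃ h : (u : Φ.P) ∈ xy.dom, xy.lam ⟨u, h⟩ ∈ w.dom := fun u ↦
    mem_vertDom.1 u.2.1.2
  have hj := etale_val (n := K.dim) U
  have hj' : C∞[K.dim,K.dim] (fun u : U ↦ x.lam ⟨u, (k1 u).1⟩) :=
    x.lam_smooth.comp (contMDiff_inclusion (U := U) (V := x.dom) (fun u hu ↦ (k1 ⟨u, hu⟩).1))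
  have hj'' : C∞[K.dim,K.dim] (fun u : U ↦ xy.lam ⟨u, (k2 u).1⟩) :=
    xy.lam_smooth.comp (contMDiff_inclusion (U := U) (V := xy.dom) (fun u hu ↦ (k2 ⟨u, hu⟩).1))
  obtain ⟨c1, -, a1, b1⟩ := H.hatAt (q := ⟨p, hU⟩) hj.contMDiff (fun u ↦ (k1 u).1)
    (fun u ↦ (k2 u).1) hj' (fun u ↦ H'.dom_le (k1 u).2) (a := fun u : U ↦ Φ.π u)
    (c := fun u : U ↦ Φ.φ u) (fun _ ↦ rfl) (fun u ↦ (x.lam_π ⟨u, _⟩).symm) (fun _ ↦ rfl)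
    (fun _ ↦ rfl) hp rfl
  obtain ⟨c2, -, a2, b2⟩ := Hz.hatAt (q := ⟨p, hU⟩) hj.contMDiff (fun u ↦ (k2 u).1)
    (fun u ↦ u.2.1.1.1) hj'' (fun u ↦ (k2 u).2) (a := fun u : U ↦ Φ.π u)
    (c := fun u : U ↦ Φ.φ u) (fun _ ↦ rfl) (fun u ↦ (xy.lam_π ⟨u, _⟩).symm) (fun _ ↦ rfl)
    (fun _ ↦ rfl) hp rfl
  obtain ⟨c3, -, a3, b3⟩ := Hz'.hatAt (q := ⟨p, hU⟩) hj.contMDiff (fun u ↦ (k1 u).1)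
    (fun u ↦ u.2.1.1.2) hj' (fun u ↦ (k1 u).2) (a := fun u : U ↦ Φ.π u)
    (c := fun u : U ↦ Φ.φ u) (fun _ ↦ rfl) (fun u ↦ (x.lam_π ⟨u, _⟩).symm) (fun _ ↦ rfl)
    (fun _ ↦ rfl) hp rfl
  obtain ⟨c4, -, a4, b4⟩ := H'.hatAt (q := (⟨p, hU⟩ : U)) hj' (fun u ↦ H'.dom_le (k1 u).2)
    (fun u ↦ (k1 u).2) hj'' (fun u ↦ (k2 u).2) (a := fun u : U ↦ Φ.π u)
    (fun u ↦ (x.lam_π ⟨u, _⟩).symm) (fun u ↦ (xy.lam_π ⟨u, _⟩).symm) (fun _ ↦ rfl) (fun _ ↦ rfl) m1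
    (hlam _).symm
  refine ⟨U, _, _, Subtype.val, ⟨p, hU⟩, fun u ↦ u.2.1.1.1, fun u ↦ u.2.1.1.2, _, fun _ ↦ rfl, _,
    fun _ ↦ rfl, rfl, hj, (HomCongAt.refl.add ((a1.symm.add (a2.symm.trans a4)).trans
      (a3.congr (.of_forall fun u ↦ (b4 u).symm) (.of_forall fun u ↦ rfl)))).congr
      (.of_forall fun u ↦ ?_) (.of_forall b3)⟩
  rw [b2, b1, add_assoc]

end TwoMor

namespace TwoMorRep

lemma lam_etale (x : TwoMorRep Φ Φ') : Étale[K.dim] x.lam := fun p ↦ by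
  refine isLocalDiffeomorphAt_of_lift (Φ'.π_etale _) x.lam_smooth.continuous ?_
  have h : (fun p : x.dom ↦ Φ'.π (x.lam p)) = fun p : x.dom ↦ Φ.π p := funext x.lam_π
  rw [h]
  exact (Φ.π_etale p).fun_comp (etale_val x.dom p)

lemma lam_injective (x : TwoMorRep Φ Φ') : Function.Injective x.lam := by
  intro p q h
  obtain ⟨δ, hδ⟩ := Φ.π_fibre p q (by rw [← x.lam_π, ← x.lam_π, h])
  have h1 := x.lam_map (γ := 1) (δ := δ) (p := p) (p' := q) (by simp [hδ])
  rw [map_one, Equiv.Perm.one_apply, ← h] at h1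
  have h2 := Φ'.actR_free δ _ h1.symm
  subst h2
  exact Subtype.ext (by simpa using hδ)

/-- The map `lam` is an open embedding; the inverse 2-morphism is given by its inverse and by
transporting `-lamHat`. -/
lemma exists_inverse (hS : IsOpen S) (x : TwoMorRep Φ Φ') :
    ∃ y : TwoMor Φ' Φ, TwoMor.comp x.toTwoMor y = TwoMor.id Φ := by
  have hemb : Topology.IsOpenEmbedding x.lam :=
    .of_continuous_injective_isOpenMap x.lam_smooth.continuous x.lam_injective x.lam_etale.isOpenMap
  let D : Opens Φ'.P := ⟨Set.range x.lam, hemb.isOpen_range⟩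
  let μ : D → x.dom := hemb.isEmbedding.toHomeomorph.symm
  have hμc : Continuous μ := hemb.isEmbedding.toHomeomorph.symm.continuous
  have hlμ : ∀ p : D, x.lam (μ p) = p := fun p ↦
    congrArg Subtype.val (hemb.isEmbedding.toHomeomorph.apply_symm_apply p)
  have hμl : ∀ (p : x.dom) (h : x.lam p ∈ D), μ ⟨x.lam p, h⟩ = p := fun p h ↦
    x.lam_injective (hlμ _)
  have hmap : ∀ γ δ, ∀ p ∈ D, Φ'.actL γ (Φ'.actR δ p) ∈ D := by
    rintro γ δ _ ⟨p, rfl⟩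
    exact ⟨⟨_, x.dom_actL γ _ (x.dom_actR δ _ p.2)⟩, x.lam_map rfl⟩
  have hμmap : ∀ γ δ (p p' : D), (p' : Φ'.P) = Φ'.actL γ (Φ'.actR δ p) →
      (μ p' : Φ.P) = Φ.actL γ (Φ.actR δ (μ p)) := fun γ δ p p' h ↦ by
    have : μ p' = ⟨Φ.actL γ (Φ.actR δ (μ p)), x.dom_actL γ _ (x.dom_actR δ _ (μ p).2)⟩ :=
      x.lam_injective (by rw [hlμ, h, x.lam_map (p := μ p) rfl, hlμ])
    rw [this]
  have hL : ∀ γ, ∀ p ∈ D, Φ'.actL γ p ∈ D := fun γ p hp ↦ by simpa using hmap γ 1 p hp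
  have hR : ∀ δ, ∀ p ∈ D, Φ'.actR δ p ∈ D := fun δ p hp ↦ by simpa using hmap 1 δ p hp
  have hπ := Φ'.smooth_π D
  have hφ := Φ'.smooth_φ D
  have hπx := Φ.smooth_π x.dom
  have hφx := Φ.smooth_φ x.dom
  have ha : ∀ p : D, Φ'.π p = Φ.π (μ p) := fun p ↦ by rw [← x.lam_π, hlμ]
  have hμ : C∞[K.dim,K.dim] μ := fun p ↦ contMDiffAt_of_lift (x.lam_etale _) hμc.continuousAt
      ((contMDiff_subtype_val p).congr_of_eventuallyEq (.of_forall hlμ))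
  have hφμ : C∞[K.dim,L.dim] (fun p : D ↦ Φ.φ (μ p)) := hφx.comp hμ
  let t : ∀ p : D, K.E (Φ'.π p) →L[ℝ] L.T (Φ.φ (μ p)) := fun p ↦
    -(x.lamHat (μ p)).comp (fiberCast K.E (ha p))
  have ht0 : ∀ p, SmT K.dim K L (fun p : D ↦ Φ'.π p) (fun p ↦ Φ.φ (μ p)) (fun p : D ↦
      (x.lamHat (μ p)).comp (fiberCast K.E (ha p))) p := fun p ↦
    ((x.smT_lamHat (μ p)).pull (hμ p) (hπx _) (hφx _)).comp (smHom_fiberCast ha p)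
  have ht : ∀ p, SmT K.dim K L (fun p : D ↦ Φ'.π p) (fun p ↦ Φ.φ (μ p)) t p := fun p ↦
    ((ht0 p).smul (f := fun _ ↦ (-1 : ℝ)) contMDiffAt_const).congr (.of_forall fun q ↦ by simp [t])
  have hmem : MapEqMod K.dim K.dim K.F K.E L.dim (fun p : D ↦ Φ'.π p) K.s (fun p ↦ Φ.φ (μ p))
      (fun p ↦ Φ'.φ p) := by
    have e1 : (fun p : D ↦ Φ'.π p) = fun p ↦ Φ.π (μ p) := funext ha
    have e2 : (fun p : D ↦ Φ'.φ p) = fun p ↦ Φ'.φ (x.lam (μ p)) :=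
      funext fun p ↦ by rw [hlμ]
    rw [e1, e2]
    exact fun h hh p ↦ (x.mapEqMod.symm h hh (μ p)).comp hπx hμ
  obtain ⟨t', h1, h2, h3⟩ := Φ'.exists_transport hL hR L.actT hφμ hφ
    (fun γ δ p p' h ↦ by rw [hμmap γ δ p p' h, Φ.φ_actL, Φ.φ_actR]) (Φ'.isEquivMap_φ D) hmem ht
    (fun γ δ p p' h hπ' hb e ↦ by
      have := x.lamHat_isEquiv γ δ (μ p) (μ p') (hμmap γ δ p p' h)
        (by rw [← ha, ← ha, hπ']) hb (fiberCast K.E (ha p) e)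
      simp only [t, neg_apply, map_neg, clm_comp_apply]
      rw [← this]
      congr 2
      have : ∀ {v v' w w' : K.V} (h1 : v' = γ • v) (h2 : w' = γ • w) (hv : v = w) (hv' : v' = w')
        (e : K.E v), fiberCast K.E hv' (K.actE.map γ h1 e) =
          K.actE.map γ h2 (fiberCast K.E hv e) := by
        rintro v v' _ _ h1 h2 rfl rfl e
        simp
      exact this ..)
  have hzero : ∀ p : D, K.s (Φ'.π p) = 0 → K.s (Φ.π (μ p)) = 0 := fun p hp ↦ by rw [← ha, hp]
  have hcore : ∀ p ∈ Φ'.core, p ∈ D := fun p hp ↦ by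
    obtain ⟨q, hq⟩ := Φ.π_image _ hp.1 hp.2
    have hqc : q ∈ Φ.core := by
      have key : ∀ {v w : K.V}, v = w → (∃ h : K.s v = 0, K.psiBar v h ∈ S) →
          ∃ h : K.s w = 0, K.psiBar w h ∈ S := by
        rintro v _ rfl h
        exact h
      exact key hq.symm hp
    obtain ⟨δ, hδ⟩ := Φ'.π_fibre (x.lam ⟨q, x.core_subset hqc⟩) p (by rw [x.lam_π, hq])
    rw [← hδ]
    exact hR δ _ ⟨_, rfl⟩
  let y : TwoMorRep Φ' Φ := ofCong D hcore hL hR (fun p ↦ μ p) (continuous_subtype_val.comp hμc)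
    (fun p ↦ (ha p).symm) hμmap t' h1 h2
    (fun p hp ↦ by
      have e1 := ((x.mapCong (hzero p hp)).pull (k := K.dim) hπx hμ).cast
        (a' := fun p : D ↦ Φ'.π p) (b' := fun p : D ↦ Φ'.φ p) (c' := fun p ↦ Φ.φ (μ p))
        (fun q ↦ (ha q).symm) (fun q ↦ by rw [hlμ]) (fun _ ↦ rfl)
        (Λ' := fun p : D ↦ (x.lamHat (μ p)).comp (fiberCast K.E (ha p)))
        (.of_forall fun q e ↦ by simp)
      exact e1.symm hφ hφμ (.of_forall ht0) (.of_forall h1) (h3 p hp))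
    (fun nL _ p hp ↦ by
      have e1 := ((x.congE (hzero p hp) nL).pull (k := K.dim) hπx hμ).cast
        (a' := fun p : D ↦ Φ'.π p) (b' := fun p : D ↦ Φ'.φ p) (c' := fun p ↦ Φ.φ (μ p))
        (fun q ↦ (ha q).symm) (fun q ↦ by rw [hlμ]) (fun _ ↦ rfl)
        (t₁' := fun p ↦ Φ'.hat p)
        (t₂' := fun p : D ↦ (Φ.hat (μ p)).comp (fiberCast K.E (ha p)) -
          (nL L.s (Φ.φ (μ p))).comp (t p))
        (.of_forall fun q e ↦ by
          have := apply_fiberCast Φ'.hat (hlμ q) (congrArg Φ'.π (hlμ q)) (congrArg Φ'.φ (hlμ q))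
            (fiberCast K.E (x.lam_π (μ q)).symm e)
          rw [fiberCast_fiberCast] at this
          exact this.symm)
        (.of_forall fun q e ↦ by simp [t])
      have e2 := (h3 p hp).clm_comp (.of_forall fun w ↦ smHom_connection nL (.of_forall L.smVec_s))
      refine (e1.symm.add e2).congr (.of_forall fun q ↦ ?_) (.of_forall fun q ↦ rfl)
      exact (sub_add_cancel _ _).symm)
  obtain ⟨z, H⟩ := exists_vert x y
  refine ⟨y.toTwoMor, ?_⟩
  rw [TwoMor.id, TwoMor.comp_eq hS H, TwoMor.toTwoMor_eq_iff]
  refine equiv_of_hatAt hS fun p hp ↦ ⟨?_, ?_⟩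
  · rw [H.lam_of_eq (z.core_subset hp) (x.core_subset hp) (⟨_, rfl⟩ : x.lam _ ∈ D) rfl]
    exact congrArg Subtype.val (hμl _ _)
  let U : Opens Φ.P := z.dom
  have hU : p ∈ U := z.core_subset hp
  have hj := etale_val (n := K.dim) U
  have hj' : C∞[K.dim,K.dim] (fun u : U ↦ x.lam ⟨u, H.dom_le u.2⟩) :=
    x.lam_smooth.comp (contMDiff_inclusion (U := U) (V := x.dom) H.dom_le)
  have hD : ∀ u : U, x.lam ⟨u, H.dom_le u.2⟩ ∈ D := fun u ↦ ⟨_, rfl⟩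
  obtain ⟨ck, -, a1, b1⟩ := H.hatAt (q := ⟨p, hU⟩) hj.contMDiff (fun u ↦ H.dom_le u.2)
    (fun u ↦ u.2) hj' hD (a := fun u : U ↦ Φ.π u) (c := fun u : U ↦ Φ.φ u)
    (fun _ ↦ rfl) (fun u ↦ (x.lam_π ⟨u, _⟩).symm) (fun _ ↦ rfl) (fun _ ↦ rfl) hp rfl
  have hz' : K.s (Φ'.π (x.lam ⟨p, H.dom_le hU⟩)) = 0 := by
    rw [x.lam_π]
    exact hp.1
  have hj'D : C∞[K.dim,K.dim] (fun u : U ↦ (⟨x.lam ⟨u, H.dom_le u.2⟩, hD u⟩ : D)) := fun u ↦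
    contMDiffAt_of_lift (etale_val D _)
      (hj'.continuous.subtype_mk _).continuousAt (hj' u)
  have a2 := ((h3 ⟨_, hD ⟨p, hU⟩⟩ hz').pull (k := K.dim) hπ hj'D (q := (⟨p, hU⟩ : U))).cast
    (a' := fun u : U ↦ Φ.π u) (b' := fun u : U ↦ Φ.φ u)
    (c' := fun u : U ↦ Φ'.φ (x.lam ⟨u, H.dom_le u.2⟩)) (fun u ↦ x.lam_π ⟨u, _⟩)
    (fun u ↦ congrArg (fun p : x.dom ↦ Φ.φ p) (hμl _ _)) (fun _ ↦ rfl)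
    (t₁' := fun u : U ↦ -(x.hatAt (j := (Subtype.val : U → Φ.P)) (fun u ↦ H.dom_le u.2)
      (fun _ ↦ rfl) (fun _ ↦ rfl) u))
    (t₂' := y.hatAt (j := fun u : U ↦ x.lam ⟨u, H.dom_le u.2⟩) hD
      (fun u ↦ (x.lam_π ⟨u, _⟩).symm) (fun _ ↦ rfl))
    (.of_forall fun u e ↦ by
      have := apply_fiberCast (ι := x.dom) (a := fun p ↦ Φ.π p) (b := fun p ↦ Φ.φ p)
        (E := K.E) (E' := L.T) x.lamHat (hμl ⟨u, H.dom_le u.2⟩ (hD u))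
        (congrArg (fun p : x.dom ↦ Φ.π p) (hμl _ _)) (congrArg (fun p : x.dom ↦ Φ.φ p) (hμl _ _))
        (fiberCast K.E (ha _) e)
      simp only [t, hatAt, neg_apply, map_neg, clm_comp_apply, fiberCast_fiberCast] at this ⊢
      rw [← this, fiberCast_rfl]
      rfl)
    (.of_forall fun u e ↦ by simp [TwoMorRep.hatAt, y, ofCong])
  refine ⟨U, _, _, Subtype.val, ⟨p, hU⟩, fun u ↦ u.2, fun _ ↦ trivial, _, fun _ ↦ rfl, _,
    fun _ ↦ rfl, rfl, hj, (HomCongAt.refl.add (a1.symm.trans a2.symm)).congr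
    (.of_forall b1) (.of_forall fun u ↦ ?_)⟩
  ext e
  simp [TwoMorRep.hatAt, (isIdRep_idRep Φ).lamHat_eq]

end TwoMorRep

lemma TwoMor.exists_inverse (hS : IsOpen S) (η : TwoMor Φ Φ') :
    ∃ θ : TwoMor Φ' Φ, η.comp θ = TwoMor.id Φ ∧ θ.comp η = TwoMor.id Φ' := by
  have key : ∀ {f f' : C(X, Y)} {Φ : OneMor K L f S} {Φ' : OneMor K L f' S} (η : TwoMor Φ Φ'),
      ∃ θ : TwoMor Φ' Φ, η.comp θ = TwoMor.id Φ := fun η ↦ by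
    obtain ⟨x, rfl⟩ := η.exists_rep
    exact x.exists_inverse hS
  obtain ⟨θ, h⟩ := key η
  obtain ⟨η', h'⟩ := key θ
  have : η = η' := by
    rw [← comp_id hS η, ← h', ← comp_assoc hS, h, id_comp hS]
  exact ⟨θ, h, this ▸ h'⟩

section TangentMap

variable {m : ℕ} {N : Type*} [TopologicalSpace N] [ChartedSpace 𝔼[m] N]

/-! ### The tangent map of a 1-morphism -/

/-- The composition `dφ ∘ (dπ)⁻¹`, a morphism of vector bundles `π^*(TV_K) → φ^*(TV_L)`. -/
def OneMor.tangentMap (Φ : OneMor K L f S) (p : Φ.P) : K.T (Φ.π p) →L[ℝ] L.T (Φ.φ p) :=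
  (D[K.dim,L.dim] Φ.φ p).comp (D[K.dim,K.dim] Φ.π p).inverse

lemma OneMor.tangentMap_mfderiv (Φ : OneMor K L f S) {j : N → Φ.P} {u : N}
    (hj : MDifferentiableAt (𝓡 m) (𝓡 K.dim) j u) (w : TangentSpace (𝓡 m) u) :
    Φ.tangentMap (j u) (D[m,K.dim] (fun u ↦ Φ.π (j u)) u w) = D[m,L.dim] (fun u ↦ Φ.φ (j u)) u w :=
    by
  have h1 : D[m,K.dim] (fun u ↦ Φ.π (j u)) u = (D[K.dim,K.dim] Φ.π (j u)).comp (D[m,K.dim] j u) :=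
    mfderiv_comp u (Φ.π_smooth _).mdiffAt hj
  have h2 : D[m,L.dim] (fun u ↦ Φ.φ (j u)) u = (D[K.dim,L.dim] Φ.φ (j u)).comp (D[m,K.dim] j u) :=
    mfderiv_comp u (Φ.φ_smooth _).mdiffAt hj
  rw [h1, h2, OneMor.tangentMap]
  simp only [clm_comp_apply]
  rw [(Φ.π_etale (j u)).inverse_mfderiv]

lemma fiberCast_mfderiv {n : ℕ} {V : Type*} [TopologicalSpace V] [ChartedSpace 𝔼[n] V] {b c : N → V}
    (h : ∀ u, b u = c u) {u : N} (w : TangentSpace (𝓡 m) u) :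
    fiberCast (TangentSpace (𝓡 n)) (h u) (D[m,n] b u w) = D[m,n] c u w := by
  obtain rfl : b = c := funext h
  simp

lemma smHom_mfderiv_inverse {n : ℕ} {V Q : Type*} [TopologicalSpace V] [ChartedSpace 𝔼[n] V]
    [TopologicalSpace Q] [ChartedSpace 𝔼[n] Q] [IsManifold (𝓡 n) ∞ V] [IsManifold (𝓡 n) ∞ Q]
    {π : Q → V} (hπ : Étale[n] π) (p : Q) :
    SmHom n n 𝔼[n] T[n,V] n 𝔼[n] T[n,Q] π (fun q ↦ q) (fun q ↦ (D[n,n] π q).inverse) p := by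
  have hs := hπ.contMDiff
  obtain ⟨σ, h0, h1, h2, h3⟩ := (hπ p).exists_inverse
  have hσ : ∀ᶠ q in 𝓝 p, C∞At[n,n] σ (π q) := (hs p).continuousAt.eventually h3
  have h1' : ∀ᶠ q in 𝓝 p, ∀ᶠ x in 𝓝 (π q), π (σ x) = x :=
    (hs p).continuousAt.eventually h1.eventually_nhds
  have h4 := (smHom_mfderiv h3.self_of_nhds).pull (hs p) contMDiffAt_id h3.self_of_nhds
  intro e he
  refine ContMDiffAt.congr_of_eventuallyEq (h4 e he) ?_
  filter_upwards [h2, hσ, h1'] with q hq hσ h1'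
  have h5 : D[n,n] (fun x ↦ π (σ x)) (π q) = (D[n,n] π (σ (π q))).comp (D[n,n] σ (π q)) :=
    mfderiv_comp (π q) (hs _).mdiffAt hσ.mdiffAt
  have h6 : D[n,n] (fun x ↦ π (σ x)) (π q) =
      ContinuousLinearMap.id ℝ (TangentSpace (𝓡 n) (π q)) := by
    rw [Filter.EventuallyEq.mfderiv_eq (f := id) h1', mfderiv_id]
  have key : ∀ q' (e' : TangentSpace (𝓡 n) (π q')) (w : TangentSpace (𝓡 n) q'), q' = q →
      (e' : 𝔼[n]) = e q → D[n,n] π q' w = e' →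
      (TotalSpace.mk' 𝔼[n] q ((D[n,n] π q).inverse (e q)) : TotalSpace 𝔼[n] T[n,Q]) =
      TotalSpace.mk' 𝔼[n] q' w := by
    rintro _ _ w rfl rfl hw
    rw [← hw, (hπ _).inverse_mfderiv]
  refine key (σ (π q)) (e q) _ hq rfl ?_
  have h7 := congrArg (fun l ↦ l (e q)) (h5.symm.trans h6)
  exact h7

lemma OneMor.smHom_tangentMap (Φ : OneMor K L f S) (p : Φ.P) :
    SmHom K.dim K.dim K.H K.T L.dim L.H L.T Φ.π Φ.φ Φ.tangentMap p :=
  (smHom_mfderiv (Φ.φ_smooth p)).comp (smHom_mfderiv_inverse Φ.π_etale p)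

lemma OneMor.tangentMap_map (Φ : OneMor K L f S) (γ : K.Γ) (δ : L.Γ) {p p' : Φ.P}
    (hp : p' = Φ.actL γ (Φ.actR δ p)) (h : Φ.π p' = γ • Φ.π p) (h' : Φ.φ p' = δ • Φ.φ p)
    (v : K.T (Φ.π p)) :
    Φ.tangentMap p' (K.actT.map γ h v) = L.actT.map δ h' (Φ.tangentMap p v) := by
  subst hp
  have hg : C∞[K.dim,K.dim] (fun q ↦ Φ.actL γ (Φ.actR δ q)) :=
    (Φ.actL_smooth γ).comp (Φ.actR_smooth δ)
  have hπ : ∀ q, γ • Φ.π q = Φ.π (Φ.actL γ (Φ.actR δ q)) := fun q ↦ by rw [Φ.π_actL, Φ.π_actR]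
  have hφ : ∀ q, δ • Φ.φ q = Φ.φ (Φ.actL γ (Φ.actR δ q)) := fun q ↦ by rw [Φ.φ_actL, Φ.φ_actR]
  set w := (D[K.dim,K.dim] Φ.π p).inverse v with hw
  have hv : v = D[K.dim,K.dim] Φ.π p w := ((Φ.π_etale p).mfderiv_inverse v).symm
  have h1 := Φ.tangentMap_mfderiv (u := p) (hg p).mdiffAt w
  rw [← fiberCast_mfderiv hπ, ← fiberCast_mfderiv hφ] at h1
  have h2 : D[K.dim,K.dim] (fun q ↦ γ • Φ.π q) p =
      (D[K.dim,K.dim] (fun w : K.V ↦ γ • w) (Φ.π p)).comp (D[K.dim,K.dim] Φ.π p) :=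
    mfderiv_comp p (K.smul_smooth γ _).mdiffAt (Φ.π_smooth p).mdiffAt
  have h3 : D[K.dim,L.dim] (fun q ↦ δ • Φ.φ q) p =
      (D[L.dim,L.dim] (fun w : L.V ↦ δ • w) (Φ.φ p)).comp (D[K.dim,L.dim] Φ.φ p) :=
    mfderiv_comp p (L.smul_smooth δ _).mdiffAt (Φ.φ_smooth p).mdiffAt
  rw [h2, h3] at h1
  simp only [clm_comp_apply] at h1
  rw [← hv] at h1
  exact h1

end TangentMap

section EtaleExtension

/-! ### Extension of equivariant lifts through étale maps -/

/-- Let the finite group `H` and the finite family `G` of homeomorphisms act on a normal space, and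
let `C` be a closed `H`-invariant set that is disjoint from its translates under `G`. Then `C` has
an open `H`-invariant neighbourhood that is disjoint from its translates. -/
lemma exists_invariant_separated {A : Type*} [TopologicalSpace A] [NormalSpace A] {H : Type*}
    [Group H] [Finite H] (h : H → A → A) (hc : ∀ i, Continuous (h i)) (h1 : ∀ x, h 1 x = x)
    (hmul : ∀ i j x, h (i * j) x = h i (h j x)) {G : Type*} [Finite G] (g g' : G → A → A)
    (gc : ∀ i, Continuous (g i)) (gc' : ∀ i, Continuous (g' i)) (hg : ∀ i x, g' i (g i x) = x)
    {C : Set A} (hC : IsClosed C) (hCH : ∀ i, ∀ x ∈ C, h i x ∈ C) (hCG : ∀ i, ∀ x ∈ C, g i x ∉ C)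
    (hg' : ∀ i x, g i (g' i x) = x) :
    ∃ N : Set A, IsOpen N ∧ C ⊆ N ∧ (∀ i, ∀ x ∈ N, h i x ∈ N) ∧ ∀ i, ∀ x ∈ N, g i x ∉ N := by
  have hC' : IsClosed (⋃ i, g' i ⁻¹' C) := isClosed_iUnion_of_finite fun i ↦ hC.preimage (gc' i)
  obtain ⟨N₀, N₁, o₀, o₁, c₀, c₁, hd⟩ := normal_separation hC hC' (Set.disjoint_left.2
    fun x hx hx' ↦ by
      obtain ⟨i, hi⟩ := Set.mem_iUnion.1 hx'
      exact hCG i _ hi (by rwa [hg']))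
  let N₂ : Set A := N₀ ∩ ⋂ i, g i ⁻¹' N₁
  have o₂ : IsOpen N₂ := o₀.inter (isOpen_iInter_of_finite fun i ↦ o₁.preimage (gc i))
  refine ⟨⋂ i, h i ⁻¹' N₂, isOpen_iInter_of_finite fun i ↦ o₂.preimage (hc i),
    fun x hx ↦ Set.mem_iInter.2 fun i ↦ ⟨c₀ (hCH i x hx), Set.mem_iInter.2 fun j ↦ c₁
      (Set.mem_iUnion.2 ⟨j, ?_⟩)⟩, fun i x hx ↦ Set.mem_iInter.2 fun j ↦ ?_, fun i x hx hx' ↦ ?_⟩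
  · rw [Set.mem_preimage, hg]
    exact hCH i x hx
  · rw [Set.mem_preimage, ← hmul]
    exact Set.mem_iInter.1 hx _
  · have e1 := Set.mem_iInter.1 hx 1
    have e2 := Set.mem_iInter.1 hx' 1
    rw [Set.mem_preimage, h1] at e1 e2
    exact Set.disjoint_left.1 hd e2.1 (Set.mem_iInter.1 e1.2 i)

variable {S' : Set X}

lemma KurNbhd.isClosed_zero (K : KurNbhd X) : IsClosed {v : K.V | K.s v = 0} := by
  rw [← isOpen_compl_iff, isOpen_iff_mem_nhds]
  intro v hv
  have hb := mem_baseSet_trivializationAt K.F K.E v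
  have h1 := ((smVec_iff hb).1 (K.smVec_s v)).2.continuousAt
  have e : ∀ w ∈ (trivializationAt K.F K.E v).baseSet, ((trivializationAt K.F K.E v
      ).continuousLinearMapAt ℝ w (K.s w) = 0 ↔ K.s w = 0) := fun w hw ↦ by
    rw [← (trivializationAt K.F K.E v).coe_continuousLinearEquivAt_eq (R := ℝ) hw]
    exact map_eq_zero_iff _ (ContinuousLinearEquiv.injective _)
  filter_upwards [h1.eventually_ne (mt (e v hb).1 hv),
    (trivializationAt K.F K.E v).open_baseSet.mem_nhds hb] with w hw hw'
  exact mt (e w hw').2 hw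

/-- A continuous equivariant lift through `Φ'.π` that is defined on the zeros of `π^*(s_K)` in an
invariant open set `D` extends to an invariant open neighbourhood of these zeros: the graph of the
lift is a closed set in the fibre product over `V_K`, disjoint from its translates under `Γ_L`, and
an open neighbourhood with this property is the graph of an extension. -/
theorem OneMor.exists_lift_extension (Φ : OneMor K L f S) (Φ' : OneMor K L f' S') (D : Opens Φ.P)
    (hL : ∀ γ, ∀ p ∈ D, Φ.actL γ p ∈ D) (hR : ∀ δ, ∀ p ∈ D, Φ.actR δ p ∈ D)
    (l : {p : Φ.P // p ∈ D ∧ K.s (Φ.π p) = 0} → Φ'.P) (hl : Continuous l)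
    (hlπ : ∀ p, Φ'.π (l p) = Φ.π p)
    (hlmap : ∀ γ δ (p p' : {p : Φ.P // p ∈ D ∧ K.s (Φ.π p) = 0}),
      (p' : Φ.P) = Φ.actL γ (Φ.actR δ p) → l p' = Φ'.actL γ (Φ'.actR δ (l p))) :
    ∃ (O : Opens Φ.P) (lam : O → Φ'.P), O ≤ D ∧ (∀ p ∈ D, K.s (Φ.π p) = 0 → p ∈ O) ∧
    (∀ γ, ∀ p ∈ O, Φ.actL γ p ∈ O) ∧ (∀ δ, ∀ p ∈ O, Φ.actR δ p ∈ O) ∧ Continuous lam ∧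
    (∀ p, Φ'.π (lam p) = Φ.π p) ∧
    (∀ γ δ (p p' : O), (p' : Φ.P) = Φ.actL γ (Φ.actR δ p) → lam p' = Φ'.actL γ (Φ'.actR δ (lam p)))
    ∧ ∀ (p : O) (hp : (p : Φ.P) ∈ D ∧ K.s (Φ.π p) = 0), lam p = l ⟨p, hp⟩ := by
  have := Manifold.locallyCompact_of_finiteDimensional (M := Φ.P) (𝓡 K.dim)
  have := Manifold.locallyCompact_of_finiteDimensional (M := Φ'.P) (𝓡 K.dim)
  let A := {g : Φ.P × Φ'.P // g.1 ∈ D ∧ Φ.π g.1 = Φ'.π g.2}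
  have hs : ∀ (γ : K.Γ) {v w : K.V}, w = γ • v → K.s v = 0 → K.s w = 0 := by
    rintro γ v _ rfl h
    rw [← K.s_equivariant, h, map_zero]
  let h : K.Γ × L.Γ → A → A := fun i g ↦ ⟨(Φ.actL i.1 (Φ.actR i.2 g.1.1),
    Φ'.actL i.1 (Φ'.actR i.2 g.1.2)), hL _ _ (hR _ _ g.2.1), by
      simp only [Φ.π_actL, Φ.π_actR, Φ'.π_actL, Φ'.π_actR, g.2.2]⟩
  let g : {δ : L.Γ // δ ≠ 1} → A → A := fun i g ↦ ⟨(g.1.1, Φ'.actR i.1 g.1.2), g.2.1, by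
    simp only [Φ'.π_actR, g.2.2]⟩
  let g' : {δ : L.Γ // δ ≠ 1} → A → A := fun i g ↦ ⟨(g.1.1, Φ'.actR i.1⁻¹ g.1.2), g.2.1, by
    simp only [Φ'.π_actR, g.2.2]⟩
  let C : Set A := {g | ∃ hz : K.s (Φ.π g.1.1) = 0, l ⟨g.1.1, g.2.1, hz⟩ = g.1.2}
  have hfst : Continuous fun g : A ↦ g.1.1 := continuous_fst.comp continuous_subtype_val
  have hsnd : Continuous fun g : A ↦ g.1.2 := continuous_snd.comp continuous_subtype_val
  have hC : IsClosed C := by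
    let Z : Set A := {g | K.s (Φ.π g.1.1) = 0}
    have hZ : IsClosed Z := K.isClosed_zero.preimage (Φ.π_smooth.continuous.comp hfst)
    have h2 : IsClosed {g : Z | l ⟨g.1.1.1, g.1.2.1, g.2⟩ = g.1.1.2} :=
      isClosed_eq (hl.comp ((hfst.comp continuous_subtype_val).subtype_mk _))
        (hsnd.comp continuous_subtype_val)
    convert hZ.isClosedEmbedding_subtypeVal.isClosedMap _ h2
    ext g
    constructor
    · rintro ⟨hz, hg⟩
      exact ⟨⟨g, hz⟩, hg, rfl⟩
    · rintro ⟨⟨g, hz⟩, hg, rfl⟩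
      exact ⟨hz, hg⟩
  obtain ⟨N, hN, hCN, hNh, hNg⟩ := exists_invariant_separated h
    (fun i ↦ ((((Φ.actL_smooth _).continuous.comp (Φ.actR_smooth _).continuous).comp hfst).prodMk
      (((Φ'.actL_smooth _).continuous.comp (Φ'.actR_smooth _).continuous).comp hsnd)).subtype_mk _)
    (fun x ↦ by simp [h])
    (fun i j x ↦ by
      refine Subtype.ext (Prod.ext ?_ ?_)
      · simp [h, Φ.act_comm]
      · simp [h, Φ'.act_comm]) g g'
    (fun i ↦ (hfst.prodMk ((Φ'.actR_smooth _).continuous.comp hsnd)).subtype_mk _)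
    (fun i ↦ (hfst.prodMk ((Φ'.actR_smooth _).continuous.comp hsnd)).subtype_mk _)
    (fun i x ↦ by simp [g, g']) hC
    (fun i x ⟨hz, hx⟩ ↦ ⟨by
      exact hs i.1 ((Φ.π_actL _ _).trans (by rw [Φ.π_actR])) hz, by
      simp only [h]
      rw [← hx]
      exact hlmap _ _ _ _ rfl⟩)
    (fun i x ⟨hz, hx⟩ ⟨hz', hx'⟩ ↦ i.2 (Φ'.actR_free _ _ (hx'.symm.trans hx)))
    (fun i x ↦ by simp [g, g'])
  have hinj : ∀ g₁ ∈ N, ∀ g₂ ∈ N, g₁.1.1 = g₂.1.1 → g₁ = g₂ := fun g₁ h₁ g₂ h₂ h ↦ by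
    obtain ⟨δ, hδ⟩ := Φ'.π_fibre g₁.1.2 g₂.1.2 (by rw [← g₁.2.2, ← g₂.2.2, h])
    by_cases hδ1 : δ = 1
    · refine Subtype.ext (Prod.ext h ?_)
      rw [← hδ, hδ1]
      simp
    · refine (hNg ⟨δ, hδ1⟩ g₁ h₁ ?_).elim
      convert h₂
      exact Subtype.ext (Prod.ext h hδ)
  -- the projection of the fibre product to `P` is open, since `Φ'.π` is étale
  have hopen : ∀ g₀ : A, ∀ U ∈ 𝓝 g₀, (fun g : A ↦ g.1.1) '' U ∈ 𝓝 g₀.1.1 := fun g₀ U hU ↦ by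
    obtain ⟨σ, h0, h1, h2, h3⟩ := (Φ'.π_etale g₀.1.2).exists_inverse
    rw [← g₀.2.2] at h0 h1 h3
    have hc := (Φ.π_smooth g₀.1.1).continuousAt
    have hτ : Filter.Tendsto (fun p ↦ (p, σ (Φ.π p))) (𝓝 g₀.1.1) (𝓝 (g₀ : Φ.P × Φ'.P)) := by
      have : ContinuousAt (fun p ↦ (p, σ (Φ.π p))) g₀.1.1 :=
        continuousAt_id.prodMk (ContinuousAt.comp h3.self_of_nhds.continuousAt hc)
      rwa [ContinuousAt, h0] at this
    obtain ⟨U', hU', hUU⟩ := mem_nhds_subtype _ _ _ |>.1 hU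
    filter_upwards [hτ hU', hc.eventually h1, D.isOpen.mem_nhds g₀.2.1] with p hp hp' hpD
    exact ⟨⟨(p, σ (Φ.π p)), hpD, hp'.symm⟩, hUU hp, rfl⟩
  let O : Opens Φ.P := ⟨(fun g : A ↦ g.1.1) '' N, isOpen_iff_mem_nhds.2 (by
    rintro _ ⟨g, hg, rfl⟩
    exact hopen g N (hN.mem_nhds hg))⟩
  choose σ hσN hσ using fun p : O ↦ p.2
  have hcl : ∀ (p : O) (q : Φ'.P) (h1 : (p : Φ.P) ∈ D) (h2 : Φ.π p = Φ'.π q),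
      (⟨(p, q), h1, h2⟩ : A) ∈ N → (σ p).1.2 = q := fun p q h1 h2 hN ↦ by
    rw [hinj _ (hσN p) _ hN (hσ p)]
  have hπ : ∀ p : O, Φ.π p = Φ'.π (σ p).1.2 := fun p ↦ by
    rw [← (σ p).2.2]
    exact congrArg _ (hσ p).symm
  have hD : ∀ p : O, (p : Φ.P) ∈ D := fun p ↦ by rw [← hσ p]; exact (σ p).2.1
  have hσ' : ∀ p : O, (⟨(p, (σ p).1.2), hD p, hπ p⟩ : A) ∈ N := fun p ↦ by
    have e : (⟨(p, (σ p).1.2), hD p, hπ p⟩ : A) = σ p := Subtype.ext (Prod.ext (hσ p).symm rfl)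
    rw [e]
    exact hσN p
  have hmap : ∀ γ δ (p : O), ∃ hp : Φ.actL γ (Φ.actR δ p) ∈ O,
      (σ ⟨_, hp⟩).1.2 = Φ'.actL γ (Φ'.actR δ (σ p).1.2) := fun γ δ p ↦ by
    have := hNh (γ, δ) _ (hσ' p)
    have hp : Φ.actL γ (Φ.actR δ p) ∈ O := ⟨_, this, rfl⟩
    exact ⟨hp, hcl ⟨_, hp⟩ _ (hL _ _ (hR _ _ (hD p))) (by
      simp only [Φ.π_actL, Φ.π_actR, Φ'.π_actL, Φ'.π_actR, hπ]) this⟩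
  refine ⟨O, fun p ↦ (σ p).1.2, fun p hp ↦ hD ⟨p, hp⟩, fun p hp hz ↦
    ⟨⟨(p, l ⟨p, hp, hz⟩), hp, (hlπ ⟨p, hp, hz⟩).symm⟩, hCN ⟨hz, rfl⟩, rfl⟩, fun γ p hp ↦ ?_, fun δ p
    hp ↦ ?_,
    ?_, fun p ↦ (hπ p).symm, fun γ δ p p' h ↦ ?_, fun p hp ↦ ?_⟩
  · simpa using (hmap γ 1 ⟨p, hp⟩).1
  · simpa using (hmap 1 δ ⟨p, hp⟩).1
  · refine hsnd.comp (continuous_iff_continuousAt.2 fun p U hU ↦ ?_)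
    change σ ⁻¹' U ∈ 𝓝 p
    have h1 : {p | ∃ g ∈ U ∩ N, g.1.1 = p} ∈ 𝓝 (σ p).1.1 :=
      hopen (σ p) (U ∩ N) (inter_mem hU (hN.mem_nhds (hσN p)))
    rw [show (σ p).1.1 = p from hσ p] at h1
    filter_upwards [continuous_subtype_val.continuousAt.eventually h1] with q hq
    obtain ⟨g, hg, hgq⟩ := hq
    rw [Set.mem_preimage, hinj _ (hσN q) g hg.2 ((hσ q).trans hgq.symm)]
    exact hg.1
  · obtain ⟨hp, e⟩ := hmap γ δ p
    obtain rfl : p' = ⟨_, hp⟩ := Subtype.ext h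
    exact e
  · exact hcl p _ hp.1 (hlπ ⟨p, hp⟩).symm (hCN ⟨hp.2, rfl⟩)

end EtaleExtension

/-! ### The projection to a composite 1-morphism -/

lemma BundleAction.map_fiberCast {Γ : Type*} [Group Γ] {n : ℕ} {V : Type*} [TopologicalSpace V]
    [ChartedSpace 𝔼[n] V] [MulAction Γ V] {F : Type*} [NormedAddCommGroup F] [NormedSpace ℝ F]
    {E : V → Type*} [∀ x, AddCommGroup (E x)] [∀ x, Module ℝ (E x)] [∀ x, TopologicalSpace (E x)]
    [TopologicalSpace (TotalSpace F E)] [FiberBundle F E] [VectorBundle ℝ F E]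
    (A : BundleAction Γ n F E) (γ : Γ) {v v' w : V} (h : v = v') (h' : w = γ • v') (e : E v) :
    A.map γ h' (fiberCast E h e) = A.map γ (h ▸ h') e := by
  subst h
  simp

/-- The action of `Γ_K × Γ_L × Γ_M` on the fibre product. -/
def FibProd.map (γ : K.Γ) (δ : L.Γ) (ε : M.Γ) (w : FibProd Φ Ψ) : FibProd Φ Ψ :=
  ⟨(Φ.actL γ (Φ.actR δ w.1.1), Ψ.actL δ (Ψ.actR ε w.1.2)), by
    rw [Φ.φ_actL, Φ.φ_actR, Ψ.π_actL, Ψ.π_actR, w.2]⟩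

namespace CompData

variable (c : CompData Φ Ψ Ξ)

lemma proj_eq {w w' : FibProd Φ Ψ} (h : c.proj w = c.proj w') :
    ∃ δ : L.Γ, w' = FibProd.map 1 δ 1 w := by
  obtain ⟨δ, h1, h2⟩ := (c.proj_eq_iff w w').1 h
  exact ⟨δ, Subtype.ext (Prod.ext (by simp [FibProd.map, h1]) (by simp [FibProd.map, h2]))⟩

lemma proj_map (γ : K.Γ) (δ : L.Γ) (ε : M.Γ) (w : FibProd Φ Ψ) :
    c.proj (FibProd.map γ δ ε w) = Ξ.actL γ (Ξ.actR ε (c.proj w)) := by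
  have h1 : c.proj (FibProd.map 1 δ 1 w) = c.proj w :=
    ((c.proj_eq_iff w (FibProd.map 1 δ 1 w)).2
    ⟨δ, by simp [FibProd.map], by simp [FibProd.map]⟩).symm
  rw [← h1, c.proj_actR ε _ (FibProd.map 1 δ ε w) (by simp [FibProd.map])
    (by simp [FibProd.map, Ψ.act_comm]), c.proj_actL γ _ (FibProd.map γ δ ε w)
    (by simp [FibProd.map])
    (by simp [FibProd.map])]

lemma surj (p : Ξ.P) : ∃ w, c.proj w = p := c.isQuotientMap.surjective p

lemma isOpenQuotientMap : IsOpenQuotientMap c.proj where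
  surjective := c.surj
  continuous := c.isQuotientMap.continuous
  isOpenMap U hU := by
    rw [← c.isQuotientMap.isOpen_preimage]
    have h : c.proj ⁻¹' (c.proj '' U) = ⋃ δ : L.Γ, FibProd.map 1 δ 1 ⁻¹' U := by
      ext w
      simp only [Set.mem_preimage, Set.mem_image, Set.mem_iUnion]
      constructor
      · rintro ⟨w', hw', e⟩
        obtain ⟨δ, rfl⟩ := c.proj_eq e.symm
        exact ⟨δ, hw'⟩
      · rintro ⟨δ, hδ⟩
        exact ⟨_, hδ, by simp [c.proj_map]⟩
    rw [h]
    refine isOpen_iUnion fun δ ↦ hU.preimage (Continuous.subtype_mk (Continuous.prodMk ?_ ?_) _)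
    · exact ((Φ.actL_smooth _).continuous.comp (Φ.actR_smooth _).continuous).comp
        (continuous_fst.comp continuous_subtype_val)
    · exact ((Ψ.actL_smooth _).continuous.comp (Ψ.actR_smooth _).continuous).comp
        (continuous_snd.comp continuous_subtype_val)

section Probe

variable {m : ℕ} {N : Type*} [TopologicalSpace N] [ChartedSpace 𝔼[m] N] {P : N → Φ.P} {Q : N → Ψ.P}
  (hPQ : ∀ u, Φ.φ (P u) = Ψ.π (Q u))

lemma continuous_probe (hP : Continuous P) (hQ : Continuous Q) :
    Continuous fun u ↦ c.proj ⟨(P u, Q u), hPQ u⟩ :=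
  c.isQuotientMap.continuous.comp ((hP.prodMk hQ).subtype_mk _)

lemma contMDiff_probe (hP : C∞[m,K.dim] P) (hQ : Continuous Q) :
    C∞[m,K.dim] fun u ↦ c.proj ⟨(P u, Q u), hPQ u⟩ := fun u ↦ by
  refine contMDiffAt_of_lift (Ξ.π_etale _) (c.continuous_probe hPQ hP.continuous hQ).continuousAt ?_
  simp only [c.proj_π]
  exact (Φ.π_smooth.comp hP) u

lemma etale_probe {N : Type*} [TopologicalSpace N] [ChartedSpace 𝔼[K.dim] N] {P : N → Φ.P}
    {Q : N → Ψ.P} (hPQ : ∀ u, Φ.φ (P u) = Ψ.π (Q u)) (hP : Étale[K.dim] P) (hQ : Continuous Q) :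
    Étale[K.dim] fun u ↦ c.proj ⟨(P u, Q u), hPQ u⟩ := fun u ↦ by
  refine isLocalDiffeomorphAt_of_lift (Ξ.π_etale _)
    (c.continuous_probe hPQ hP.contMDiff.continuous hQ) ?_
  simp only [c.proj_π]
  exact (Φ.π_etale (P u)).fun_comp (hP u)

end Probe

/-- Through each point of the fibre product there is a local section of its projection to `P_{KL}`.
-/
lemma _root_.FibProd.exists_slice (w : FibProd Φ Ψ) {O : Set (FibProd Φ Ψ)} (hO : O ∈ 𝓝 w) : ∃
    (U : Opens Φ.P) (hU : w.1.1 ∈ U) (Q : U → Ψ.P) (hQ : ∀ u : U, Φ.φ u = Ψ.π (Q u)),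
    C∞[K.dim,L.dim] Q ∧ Q ⟨w.1.1, hU⟩ = w.1.2 ∧ ∀ u : U, (⟨(u, Q u), hQ u⟩ : FibProd Φ Ψ) ∈ O := by
  obtain ⟨O', hO', h⟩ := mem_nhds_subtype _ _ _ |>.1 hO
  obtain ⟨O₁, h₁, O₂, h₂, h'⟩ := mem_nhds_prod_iff.1 hO'
  obtain ⟨U, hU, Q, hQ, hQ', hQw, hO₁, hO₂⟩ :=
    exists_local_lift (Ψ.π_etale w.1.2) Φ.φ_smooth w.2 h₁ h₂
  exact ⟨U, hU, Q, hQ', hQ, hQw, fun u ↦ h (h' ⟨hO₁ u.2, hO₂ u⟩)⟩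

lemma mem_core_left {w : FibProd Φ Ψ} : c.proj w ∈ Ξ.core ↔ w.1.1 ∈ Φ.core := by
  have : ∀ v, v = Φ.π w.1.1 → ((∃ h : K.s v = 0, K.psiBar v h ∈ S) ↔ w.1.1 ∈ Φ.core) := by
    rintro _ rfl
    rfl
  exact this _ (c.proj_π w)

lemma _root_.FibProd.mem_core_right (hST : MapsTo f S T) {w : FibProd Φ Ψ} (h : w.1.1 ∈ Φ.core) :
    w.1.2 ∈ Ψ.core := by
  obtain ⟨h0, h1⟩ := h
  obtain ⟨h', e⟩ := Φ.footprint_map _ h0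
  have : ∀ v (hv : Φ.φ w.1.1 = v), ∃ h : L.s v = 0, L.psiBar v h ∈ T := by
    rintro _ rfl
    exact ⟨h', e ▸ hST h1⟩
  exact this _ w.2

/-- An invariant family of linear maps on the part of the fibre product over `D` descends to `D`. -/
lemma exists_descend {D : Opens Ξ.P} {D' : Set (FibProd Φ Ψ)} (hD : ∀ w, c.proj w ∈ D ↔ w ∈ D')
    (t : ∀ w : D', K.E (Φ.π w.1.1.1) →L[ℝ] M.T (Ψ.φ w.1.1.2))
    (ht : ∀ γ δ ε (w w' : D'), (w' : FibProd Φ Ψ) = FibProd.map γ δ ε w →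
      ∀ (h : Φ.π w'.1.1.1 = γ • Φ.π w.1.1.1) (h' : Ψ.φ w'.1.1.2 = ε • Ψ.φ w.1.1.2) e,
      t w' (K.actE.map γ h e) = M.actT.map ε h' (t w e)) :
    ∃ t' : ∀ p : D, K.E (Ξ.π p) →L[ℝ] M.T (Ξ.φ p), Ξ.IsEquiv D M.actT (fun p ↦ Ξ.φ p) t' ∧
    ∀ (w : D') e, t' ⟨c.proj w, (hD w).2 w.2⟩ (fiberCast K.E (c.proj_π w).symm e) =
    fiberCast M.T (c.proj_φ w).symm
    (t w e) := by
  choose σ hσ using fun p : D ↦ c.surj p.1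
  have hσD : ∀ p : D, σ p ∈ D' := fun p ↦ (hD _).1 (by rw [hσ p]; exact p.2)
  let t' : ∀ p : D, K.E (Ξ.π p) →L[ℝ] M.T (Ξ.φ p) := fun p ↦
    (fiberCast M.T ((c.proj_φ (σ p)).symm.trans (congrArg Ξ.φ (hσ p)))).comp
      ((t ⟨σ p, hσD p⟩).comp (fiberCast K.E ((congrArg Ξ.π (hσ p)).symm.trans (c.proj_π (σ p)))))
  have ht' : ∀ (w : D') e, t' ⟨c.proj w, (hD w).2 w.2⟩ (fiberCast K.E (c.proj_π w).symm e) =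
      fiberCast M.T (c.proj_φ w).symm (t w e) := fun w e ↦ by
    obtain ⟨δ, hδ⟩ := c.proj_eq (hσ ⟨c.proj w, (hD w).2 w.2⟩).symm
    have hπ : Φ.π (σ ⟨c.proj w, (hD w).2 w.2⟩).1.1 = Φ.π w.1.1.1 := by
      rw [hδ]; simp [FibProd.map, Φ.π_actR]
    have hφ : Ψ.φ (σ ⟨c.proj w, (hD w).2 w.2⟩).1.2 = Ψ.φ w.1.1.2 := by
      rw [hδ]; simp [FibProd.map, Ψ.φ_actL]
    have h1 := ht 1 δ 1 w ⟨_, hσD ⟨c.proj w, (hD w).2 w.2⟩⟩ hδ (by rw [one_smul, hπ])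
      (by rw [one_smul, hφ]) e
    rw [K.actE.map_one hπ.symm, M.actT.map_one hφ.symm] at h1
    simp only [t', clm_comp_apply, fiberCast_fiberCast, h1]
  refine ⟨t', fun γ ε p p' hp h h' e ↦ ?_, ht'⟩
  obtain ⟨⟨w, hw⟩, rfl⟩ : ∃ w : D', p = ⟨c.proj w, (hD w).2 w.2⟩ :=
    ⟨⟨σ p, hσD p⟩, Subtype.ext (hσ p).symm⟩
  have e1 : c.proj (FibProd.map γ 1 ε w) = p' := by rw [c.proj_map, hp]
  obtain ⟨⟨w', hw'⟩, rfl, hww⟩ : ∃ w' : D', p' = ⟨c.proj w', (hD w').2 w'.2⟩ ∧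
      (w' : FibProd Φ Ψ) = FibProd.map γ 1 ε w :=
    ⟨⟨FibProd.map γ 1 ε w, (hD _).1 (by rw [e1]; exact p'.2)⟩, Subtype.ext e1.symm, rfl⟩
  have hπ : Φ.π w'.1.1 = γ • Φ.π w.1.1 := by rw [← c.proj_π, ← c.proj_π]; exact h
  have hφ : Ψ.φ w'.1.2 = ε • Ψ.φ w.1.2 := by rw [← c.proj_φ, ← c.proj_φ]; exact h'
  have h2 := ht γ 1 ε ⟨w, hw⟩ ⟨w', hw'⟩ hww hπ hφ (fiberCast K.E (c.proj_π w) e)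
  have h3 := ht' ⟨w', hw'⟩ (K.actE.map γ hπ (fiberCast K.E (c.proj_π w) e))
  have h4 := ht' ⟨w, hw⟩ (fiberCast K.E (c.proj_π w) e)
  rw [h2] at h3
  rw [K.actE.fiberCast_map, K.actE.map_fiberCast, M.actT.fiberCast_map] at h3
  rw [fiberCast_fiberCast, fiberCast_rfl, clm_id_apply] at h4
  rw [h4, M.actT.map_fiberCast]
  exact h3

end CompData

section HorizontalCongruence

variable {m : ℕ} {N : Type*} [TopologicalSpace N] [ChartedSpace 𝔼[m] N]

/-! ### The congruences of a horizontal composition -/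

/-- The family `φhat` pulled back along a map `j`, as a family of linear maps
`E_K (a u) → E_L (b u)`, where `a` and `b` are other expressions for the maps `π ∘ j`, `φ ∘ j`. -/
def OneMor.hatAlong (Φ : OneMor K L f S) {N : Type*} {j : N → Φ.P} {a : N → K.V}
    (ha : ∀ u, a u = Φ.π (j u)) {b : N → L.V} (hb : ∀ u, Φ.φ (j u) = b u) (u : N) :
    K.E (a u) →L[ℝ] L.E (b u) :=
  (fiberCast L.E (hb u)).comp ((Φ.hat (j u)).comp (fiberCast K.E (ha u)))

lemma OneMor.hatAlong_rfl (Φ : OneMor K L f S) {N : Type*} (j : N → Φ.P) :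
    Φ.hatAlong (j := j) (fun _ ↦ rfl) (fun _ ↦ rfl) = fun u ↦ Φ.hat (j u) := by
  funext u
  ext e
  simp [OneMor.hatAlong]

lemma OneMor.smE_hatAlong (Φ : OneMor K L f S) {j : N → Φ.P} (hj : C∞[m,K.dim] j) {a : N → K.V}
    (ha : ∀ u, a u = Φ.π (j u)) {b : N → L.V} (hb : ∀ u, Φ.φ (j u) = b u) (u : N) :
    SmE m K L a b (Φ.hatAlong ha hb) u := by
  obtain rfl : a = fun u ↦ Φ.π (j u) := funext ha
  obtain rfl : (fun u ↦ Φ.φ (j u)) = b := funext hb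
  rw [hatAlong_rfl]
  exact (Φ.smE_hat (j u)).pull (hj u) (Φ.π_smooth _) (Φ.φ_smooth _)

lemma OneMor.exists_hatAlong_exact (Φ : OneMor K L f S) {j : N → Φ.P} (hj : C∞[m,K.dim] j)
    {a : N → K.V} (ha : ∀ u, a u = Φ.π (j u)) {b : N → L.V} (hb : ∀ u, Φ.φ (j u) = b u) :
    ∃ τ : ∀ u, K.E (a u) →L[ℝ] L.E (b u), (∀ u, SmE m K L a b τ u) ∧
    (∀ u, L.s (b u) = τ u (K.s (a u))) ∧
    ∀ u, CongE m K L a b b τ (Φ.hatAlong ha hb) u := by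
  obtain rfl : a = fun u ↦ Φ.π (j u) := funext ha
  obtain rfl : (fun u ↦ Φ.φ (j u)) = b := funext hb
  obtain ⟨τ, h1, h2, h3⟩ := Φ.exists_hat_exact
  rw [hatAlong_rfl]
  exact ⟨fun u ↦ τ (j u), fun u ↦ (h1 _).pull (hj u) (Φ.π_smooth _) (Φ.φ_smooth _),
    fun u ↦ h2 (j u), fun u ↦ (h3 (j u)).pull (k := m) Φ.π_smooth hj⟩

namespace TwoMorRep

lemma contMDiff_codRestrict {n : ℕ} {V : Type*} [TopologicalSpace V] [ChartedSpace 𝔼[n] V]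
    [IsManifold (𝓡 n) ∞ V] {U : Opens V} {j : N → V} (hj : C∞[m,n] j) (h : ∀ u, j u ∈ U) :
    C∞[m,n] (fun u ↦ (⟨j u, h u⟩ : U)) := fun u ↦
  contMDiffAt_of_lift (etale_val U _) (hj.continuous.subtype_mk _).continuousAt
    (hj u)

lemma contMDiff_lam_comp (x : TwoMorRep Φ Φ') {j : N → Φ.P} (hj : C∞[m,K.dim] j)
    (hjx : ∀ u, j u ∈ x.dom) : C∞[m,K.dim] (fun u ↦ x.lam ⟨j u, hjx u⟩) :=
  x.lam_smooth.comp (contMDiff_codRestrict hj hjx)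

variable (x : TwoMorRep Φ Φ') {j : N → Φ.P} (hj : C∞[m,K.dim] j) (hjx : ∀ u, j u ∈ x.dom)
  {a : N → K.V} (ha : ∀ u, a u = Φ.π (j u)) {b c : N → L.V}
  (hb : ∀ u, Φ'.φ (x.lam ⟨j u, hjx u⟩) = b u) (hc : ∀ u, Φ.φ (j u) = c u) {q : N}
  (hq : K.s (Φ.π (j q)) = 0)

lemma mapCong_hatAt (hj : C∞[m,K.dim] j) (hb : ∀ u, Φ'.φ (x.lam ⟨j u, hjx u⟩) = b u)
    (hq : K.s (Φ.π (j q)) = 0) : MapCong m K L a b c (x.hatAt hjx ha hc) q := by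
  obtain rfl : a = fun u ↦ Φ.π (j u) := funext ha
  obtain rfl : (fun u ↦ Φ.φ (j u)) = c := funext hc
  obtain rfl : (fun u ↦ Φ'.φ (x.lam ⟨j u, hjx u⟩)) = b := funext hb
  rw [hatAt_rfl]
  exact (x.mapCong (p := ⟨j q, hjx q⟩) hq).pull (k := m) (Φ.smooth_π _)
    (contMDiff_codRestrict hj hjx)

lemma congE_hatAt (hj : C∞[m,K.dim] j) (hq : K.s (Φ.π (j q)) = 0)
    (nL : Conn[L]) [nL.ContMDiffCovariantDerivative ∞] :
    CongE m K L a b c (Φ'.hatAlong (fun u ↦ (ha u).trans (x.lam_π ⟨j u, hjx u⟩).symm) hb)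
    (fun u ↦ Φ.hatAlong ha hc u + (nL L.s (c u)).comp (x.hatAt hjx ha hc u)) q := by
  obtain rfl : a = fun u ↦ Φ.π (j u) := funext ha
  obtain rfl : (fun u ↦ Φ.φ (j u)) = c := funext hc
  obtain rfl : (fun u ↦ Φ'.φ (x.lam ⟨j u, hjx u⟩)) = b := funext hb
  rw [hatAt_rfl, OneMor.hatAlong_rfl]
  refine ((x.congE (p := ⟨j q, hjx q⟩) hq nL).pull (k := m)
    (Φ.smooth_π _) (contMDiff_codRestrict hj hjx)).congr
    (.of_forall fun u ↦ ?_) (.of_forall fun u ↦ rfl)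
  ext e
  simp [OneMor.hatAlong]

end TwoMorRep

lemma OneMor.homCongAt_hat_connection (Ψ : OneMor L M g T)
    (nL : Conn[L]) [nL.ContMDiffCovariantDerivative ∞]
    (nM : Conn[M]) [nM.ContMDiffCovariantDerivative ∞] {Q : N → Ψ.P}
    (hQ : C∞[m,L.dim] Q) {a : N → K.V} (τ : ∀ u, K.E (a u) →L[ℝ] L.E (Ψ.π (Q u)))
    (hτ : ∀ u, SmE m K L a (fun u ↦ Ψ.π (Q u)) τ u) (hτ' : ∀ u, L.s (Ψ.π (Q u)) = τ u (K.s (a u)))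
    {t : ∀ u, K.E (a u) →L[ℝ] L.T (Ψ.π (Q u))} (ht : ∀ u, SmT m K L a (fun u ↦ Ψ.π (Q u)) t u)
    (q : N) :
    CongE m K M a (fun u ↦ Ψ.φ (Q u)) (fun u ↦ Ψ.φ (Q u))
    (fun u ↦ ((Ψ.hat (Q u)).comp (nL L.s (Ψ.π (Q u)))).comp (t u))
    (fun u ↦ ((nM M.s (Ψ.φ (Q u))).comp (Ψ.tangentMap (Q u))).comp (t u)) q := by
  refine homCongAt_of_along (c := Ψ.π) (s := L.s) (b₁ := Ψ.φ) (b₂ := Ψ.φ)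
    (R₁ := fun r ↦ (Ψ.hat r).comp (nL L.s (Ψ.π r)))
    (R₂ := fun r ↦ (nM M.s (Ψ.φ r)).comp (Ψ.tangentMap r)) Ψ.π_smooth Ψ.π_smooth hQ rfl
    (fun β hβ v hv ↦ ?_) τ (.of_forall fun u ↦ ⟨hτ u, hτ' u⟩)
    (.of_forall ht)
  have h1 := Ψ.inI_hat_connection nL nM (p := Q q) (ζ := fun r ↦ β (Ψ.φ r))
    (v := fun r ↦ (D[L.dim,L.dim] Ψ.π r).inverse (v r))
    (by
      filter_upwards [(Ψ.φ_smooth (Q q)).continuousAt.eventually hβ] with r hr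
      exact SmCov.comp (a := fun w ↦ w) (ξ := β) (Ψ.φ_smooth r) contMDiffAt_id hr)
    (by
      filter_upwards [hv] with r hr
      exact smHom_mfderiv_inverse Ψ.π_etale r _ hr)
  refine h1.congr (.of_forall fun r ↦ ?_)
  simp only [clm_comp_apply, (Ψ.π_etale r).mfderiv_inverse, OneMor.tangentMap]

section

variable (x : TwoMorRep Φ Φ') (y : TwoMorRep Ψ Ψ') {P : N → Φ.P} {Q Q₁ : N → Ψ.P}
  (hP : ∀ u, P u ∈ x.dom) (hQ : ∀ u, Q u ∈ y.dom) (hQ₁ : ∀ u, Q₁ u ∈ y.dom) {a : N → K.V}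
  (ha : ∀ u, a u = Φ.π (P u)) (hPQ : ∀ u, Φ.φ (P u) = Ψ.π (Q u))
  (hPQ₁ : ∀ u, Φ'.φ (x.lam ⟨P u, hP u⟩) = Ψ.π (Q₁ u))

/-- The family `dφ ∘ (dπ)⁻¹ ∘ x.lamHat + y.lamHat ∘ rho` of the horizontal composition, along maps
`P` and `Q` to the manifolds of `Φ` and `Ψ`. -/
def horizHat (rho : ∀ u, K.E (a u) →L[ℝ] L.E (Ψ.π (Q u))) (u : N) :
    K.E (a u) →L[ℝ] M.T (Ψ.φ (Q u)) :=
  (Ψ.tangentMap (Q u)).comp (x.hatAt hP ha hPQ u) + (y.lamHat ⟨Q u, hQ u⟩).comp (rho u)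

variable {rho : ∀ u, K.E (a u) →L[ℝ] L.E (Ψ.π (Q u))}

lemma smT_horizHat (hPs : C∞[m,K.dim] P) (hQs : C∞[m,L.dim] Q)
    (hrho : ∀ u, SmE m K L a (fun u ↦ Ψ.π (Q u)) rho u) (u : N) :
    SmT m K M a (fun u ↦ Ψ.φ (Q u)) (horizHat x y hP hQ ha hPQ rho) u :=
  SmHom.add (SmHom.comp ((Ψ.smHom_tangentMap (Q u)).pull (hQs u) (Ψ.π_smooth _) (Ψ.φ_smooth _))
    (x.smT_hatAt hP hPs ha hPQ u))
    (SmHom.comp ((y.smT_lamHat ⟨Q u, hQ u⟩).pull (contMDiff_codRestrict hQs hQ u)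
    (Ψ.smooth_π _ _) (Ψ.smooth_φ _ _))
    (hrho u))

/-- Composition of a congruence along `π_{LM}` with `y.lamHat`. -/
lemma HomCongAt.lamHat_comp (hQs : C∞[m,L.dim] Q) (hQs₁ : C∞[m,L.dim] Q₁) {q : N} (hq : Q₁ q = Q q)
    {t₁ : ∀ u, K.E (a u) →L[ℝ] L.E (Ψ.π (Q₁ u))} {t₂ : ∀ u, K.E (a u) →L[ℝ] L.E (Ψ.π (Q u))}
    (h : CongE m K L a (fun u ↦ Ψ.π (Q₁ u)) (fun u ↦ Ψ.π (Q u)) t₁ t₂ q) :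
    CongT m K M a (fun u ↦ Ψ.φ (Q₁ u)) (fun u ↦ Ψ.φ (Q u))
    (fun u ↦ (y.lamHat ⟨Q₁ u, hQ₁ u⟩).comp (t₁ u)) (fun u ↦ (y.lamHat ⟨Q u, hQ u⟩).comp (t₂ u)) q :=
  HomCongAt.etale_comp (Q := y.dom) (b := fun u ↦ ⟨Q₁ u, hQ₁ u⟩) (c := fun u ↦ ⟨Q u, hQ u⟩)
    (hQs₁.continuous.subtype_mk _).continuousAt (hQs.continuous.subtype_mk _).continuousAt
    (Subtype.ext hq) (π := fun q ↦ Ψ.π q) (ψ := fun q ↦ Ψ.φ q) h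
    ((Ψ.π_etale _).fun_comp (etale_val y.dom _))
    (Ψ.smooth_φ _) y.smT_lamHat

theorem mapCong_horizHat (hPs : C∞[m,K.dim] P) (hQs : C∞[m,L.dim] Q) (hQs₁ : C∞[m,L.dim] Q₁)
    (hrho : ∀ u, SmE m K L a (fun u ↦ Ψ.π (Q u)) rho u) {q : N} (hq : K.s (Φ.π (P q)) = 0)
    (hqq : Q₁ q = Q q) (hrho' : CongE m K L a (fun u ↦ Ψ.π (Q₁ u)) (fun u ↦ Ψ.π (Q u))
      (Φ'.hatAlong (fun u ↦ (ha u).trans (x.lam_π ⟨P u, hP u⟩).symm) hPQ₁) rho q) :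
    MapCong m K M a (fun u ↦ Ψ'.φ (y.lam ⟨Q₁ u, hQ₁ u⟩)) (fun u ↦ Ψ.φ (Q u))
    (horizHat x y hP hQ ha hPQ rho) q := by
  obtain ⟨τ, hτ, hτs, hτc⟩ := Φ'.exists_hatAlong_exact (x.contMDiff_lam_comp hPs hP)
    (fun u ↦ (ha u).trans (x.lam_π ⟨P u, hP u⟩).symm) hPQ₁
  have hq' : L.s (Ψ.π (Q₁ q)) = 0 := hqq ▸ hPQ q ▸ Φ.s_zero hq
  have e1 := ((y.mapCong_hatAt hQ₁ (fun _ ↦ rfl) (fun _ ↦ rfl) hQs₁ (fun _ ↦ rfl) hq').of_section τ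
    (.of_forall fun u ↦ ⟨hτ u, hτs u⟩))
  have e2 := ((x.mapCong_hatAt hP ha hPQ hPs hPQ₁ hq).etale (Ψ.π_etale _) (hQs₁ q).continuousAt
    (hQs q).continuousAt hqq).map (hQs q).continuousAt (.of_forall fun r ↦ Ψ.φ_smooth r)
  refine e1.trans (Ψ.φ_smooth.comp hQs₁) (Ψ.φ_smooth.comp hQs) ?_ ?_ e2 ?_
  · exact .of_forall fun u ↦ (y.smT_hatAt hQ₁ hQs₁ _ _ u).comp (hτ u)
  · exact .of_forall fun u ↦ SmHom.comp ((y.smT_lamHat ⟨Q u, hQ u⟩).pull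
      (contMDiff_codRestrict hQs hQ u) (Ψ.smooth_π _ _)
      (Ψ.smooth_φ _ _)) (hrho u)
  · rw [hatAt_rfl]
    exact HomCongAt.lamHat_comp y hQ hQ₁ hQs hQs₁ hqq ((hτc q).trans hrho')

theorem congE_horizHat (hPs : C∞[m,K.dim] P) (hQs : C∞[m,L.dim] Q) (hQs₁ : C∞[m,L.dim] Q₁) {q : N}
    (hq : K.s (Φ.π (P q)) = 0) (hqq : Q₁ q = Q q)
    (hrho' : CongE m K L a (fun u ↦ Ψ.π (Q₁ u)) (fun u ↦ Ψ.π (Q u))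
      (Φ'.hatAlong (fun u ↦ (ha u).trans (x.lam_π ⟨P u, hP u⟩).symm) hPQ₁) rho q)
    (nM : Conn[M]) [nM.ContMDiffCovariantDerivative ∞] :
    CongE m K M a (fun u ↦ Ψ'.φ (y.lam ⟨Q₁ u, hQ₁ u⟩)) (fun u ↦ Ψ.φ (Q u))
    (fun u ↦ (Ψ'.hatAlong (fun u ↦ (y.lam_π ⟨Q₁ u, hQ₁ u⟩).symm) (fun _ ↦ rfl) u).comp
        (Φ'.hatAlong (fun u ↦ (ha u).trans (x.lam_π ⟨P u, hP u⟩).symm) hPQ₁ u))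
    (fun u ↦ (Ψ.hat (Q u)).comp (Φ.hatAlong ha hPQ u) +
        (nM M.s (Ψ.φ (Q u))).comp (horizHat x y hP hQ ha hPQ rho u)) q := by
  obtain ⟨nL, hnL⟩ := exists_connection (n := L.dim) (B := L.V) (F := L.F) (E := L.E)
  obtain ⟨τ', hτ', hτs', hτc'⟩ := Φ'.exists_hatAlong_exact (x.contMDiff_lam_comp hPs hP)
    (fun u ↦ (ha u).trans (x.lam_π ⟨P u, hP u⟩).symm) hPQ₁
  obtain ⟨τ, hτ, hτs, -⟩ := Φ.exists_hatAlong_exact hPs ha hPQ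
  have hq' : L.s (Ψ.π (Q₁ q)) = 0 := hqq ▸ hPQ q ▸ Φ.s_zero hq
  have hat' := Φ'.smE_hatAlong (x.contMDiff_lam_comp hPs hP)
    (fun u ↦ (ha u).trans (x.lam_π ⟨P u, hP u⟩).symm) hPQ₁
  have e1 := (y.congE_hatAt (a := fun u ↦ Ψ.π (Q₁ u)) (c := fun u ↦ Ψ.φ (Q₁ u)) hQ₁ (fun _ ↦ rfl)
    (fun _ ↦ rfl) (fun _ ↦ rfl) hQs₁ hq' nM).precomp τ'
    (.of_forall fun u ↦ ⟨hτ' u, hτs' u⟩) (.of_forall hat')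
  rw [hatAt_rfl, OneMor.hatAlong_rfl Ψ Q₁] at e1
  have e2 := HomCongAt.etale_comp (hQs₁ q).continuousAt (hQs q).continuousAt hqq
    (x.congE_hatAt hP ha hPQ₁ hPQ hPs hq nL) (Ψ.π_etale _) Ψ.φ_smooth Ψ.smE_hat
  have e3 := (HomCongAt.lamHat_comp y hQ hQ₁ hQs hQs₁ hqq hrho').clm_comp (L := nM M.s)
    (.of_forall fun w ↦ smHom_connection nM (.of_forall M.smVec_s))
  have e4 := Ψ.homCongAt_hat_connection nL nM hQs τ hτ hτs (x.smT_hatAt hP hPs ha hPQ) q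
  refine (e1.congr (.of_forall fun u ↦ rfl) (.of_forall fun u ↦
    (ContinuousLinearMap.add_comp _ _ _).symm)).trans
    ((e2.add e3).trans (((HomCongAt.refl (t := fun u ↦
      (Ψ.hat (Q u)).comp (Φ.hatAlong ha hPQ u) + (nM M.s (Ψ.φ (Q u))).comp
        ((y.lamHat ⟨Q u, hQ u⟩).comp (rho u)))).add e4).congr
    (.of_forall fun u ↦ ?_) (.of_forall fun u ↦ ?_)))
  · ext e
    simp only [add_apply, clm_comp_apply, map_add]
    abel
  · ext e
    simp only [add_apply, clm_comp_apply, map_add, horizHat]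
    abel

end

end HorizontalCongruence

section HorizontalComposition

variable {c : CompData Φ Ψ Ξ} {c' : CompData Φ' Ψ' Ξ'} {x : TwoMorRep Φ Φ'} {y : TwoMorRep Ψ Ψ'}

/-! ### Existence of horizontal compositions -/

/-- A parametrized neighbourhood of the point `w` of the fibre product of `Φ` and `Ψ`: maps `P`, `Q`
to the two factors, with `P` étale, and a map `Q₁` that lifts `φ' ∘ x.lam ∘ P` as `Q` lifts `φ ∘ P`.
-/
structure HorizProbe (x : TwoMorRep Φ Φ') (y : TwoMorRep Ψ Ψ') (w : FibProd Φ Ψ) where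
  N : Type u
  [top : TopologicalSpace N]
  [chart : ChartedSpace 𝔼[K.dim] N]
  P : N → Φ.P
  Q : N → Ψ.P
  Q₁ : N → Ψ.P
  q : N
  etale_P : Étale[K.dim] P
  smooth_Q : C∞[K.dim,L.dim] Q
  smooth_Q₁ : C∞[K.dim,L.dim] Q₁
  P_q : P q = w.1.1
  Q_q : Q q = w.1.2
  Q₁_q : Q₁ q = w.1.2
  mem_P : ∀ u, P u ∈ x.dom
  mem_Q : ∀ u, Q u ∈ y.dom
  mem_Q₁ : ∀ u, Q₁ u ∈ y.dom
  hPQ : ∀ u, Φ.φ (P u) = Ψ.π (Q u)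
  hPQ₁ : ∀ u, Φ'.φ (x.lam ⟨P u, mem_P u⟩) = Ψ.π (Q₁ u)

attribute [instance] HorizProbe.top HorizProbe.chart

namespace HorizProbe

variable {w : FibProd Φ Ψ} (r : HorizProbe x y w)

/-- The parametrization of the fibre product. -/
def pt (u : r.N) : FibProd Φ Ψ := ⟨(r.P u, r.Q u), r.hPQ u⟩

lemma pt_q : r.pt r.q = w := Subtype.ext (Prod.ext r.P_q r.Q_q)

/-- The image under `x.lam` and `y.lam`. -/
def pt' (u : r.N) : FibProd Φ' Ψ' :=
  ⟨(x.lam ⟨r.P u, r.mem_P u⟩, y.lam ⟨r.Q₁ u, r.mem_Q₁ u⟩), by rw [y.lam_π, r.hPQ₁]⟩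

lemma smooth_P : C∞[K.dim,K.dim] r.P := r.etale_P.contMDiff

lemma etale_pt (c : CompData Φ Ψ Ξ) : Étale[K.dim] fun u ↦ c.proj (r.pt u) :=
  c.etale_probe r.hPQ r.etale_P r.smooth_Q.continuous

lemma smooth_lam_P : C∞[K.dim,K.dim] fun u ↦ x.lam ⟨r.P u, r.mem_P u⟩ :=
  x.contMDiff_lam_comp r.smooth_P r.mem_P

lemma smooth_lam_Q₁ : C∞[K.dim,L.dim] fun u ↦ y.lam ⟨r.Q₁ u, r.mem_Q₁ u⟩ :=
  y.contMDiff_lam_comp r.smooth_Q₁ r.mem_Q₁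

lemma continuous_pt' (c' : CompData Φ' Ψ' Ξ') : Continuous fun u ↦ c'.proj (r.pt' u) :=
  c'.isQuotientMap.continuous.comp
    ((r.smooth_lam_P.continuous.prodMk r.smooth_lam_Q₁.continuous).subtype_mk _)

lemma _root_.FibProd.exists_probe {w : FibProd Φ Ψ} (hx : w.1.1 ∈ x.dom) (hy : w.1.2 ∈ y.dom)
    (h0 : K.s (Φ.π w.1.1) = 0) {O : Set (FibProd Φ Ψ)} (hO : O ∈ 𝓝 w) {V : Set Ψ.P}
    (hV : V ∈ 𝓝 w.1.2) : ∃ r : HorizProbe x y w, (∀ u, r.pt u ∈ O) ∧ ∀ u, r.Q₁ u ∈ V := by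
  have hO' : O ∩ {w | w.1.1 ∈ x.dom ∧ w.1.2 ∈ y.dom} ∈ 𝓝 w := inter_mem hO
    (((x.dom.isOpen.preimage (continuous_fst.comp continuous_subtype_val)).inter
      (y.dom.isOpen.preimage (continuous_snd.comp continuous_subtype_val))).mem_nhds ⟨hx, hy⟩)
  obtain ⟨U, hU, Q, hPQ, hQs, hQ, hO⟩ := w.exists_slice hO'
  have hs : C∞[K.dim,L.dim] (fun u : U ↦ Φ'.φ (x.lam ⟨u, (hO u).2.1⟩)) :=
    Φ'.φ_smooth.comp (x.contMDiff_lam_comp contMDiff_subtype_val _)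
  obtain ⟨U', hU', Q₁, hQ₁s, hPQ₁, hQ₁, -, hV'⟩ := exists_local_lift (Ψ.π_etale w.1.2) hs
    (x₀ := ⟨w.1.1, hU⟩) ((x.φ_lam h0).trans w.2) univ_mem
    (inter_mem hV (y.dom.isOpen.mem_nhds hy))
  exact ⟨
  { N := U', P := fun u ↦ u.1.1, Q := fun u ↦ Q u.1, Q₁ := Q₁, q := ⟨⟨w.1.1, hU⟩, hU'⟩
    etale_P := fun u ↦ IsLocalDiffeomorphAt.fun_comp (π := (Subtype.val : U → Φ.P))
      (f := (Subtype.val : U' → U)) (etale_val U u.1)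
      (etale_val U' u)
    smooth_Q := hQs.comp contMDiff_subtype_val
    smooth_Q₁ := hQ₁s
    P_q := rfl
    Q_q := hQ
    Q₁_q := hQ₁
    mem_P := fun u ↦ (hO u.1).2.1
    mem_Q := fun u ↦ (hO u.1).2.2
    mem_Q₁ := fun u ↦ (hV' u).2
    hPQ := fun u ↦ hPQ u.1
    hPQ₁ := hPQ₁ }, fun u ↦ (hO u.1).1, fun u ↦ (hV' u).1⟩

end HorizProbe

lemma TwoMorRep.congE_rho {rho : ∀ p : x.dom, K.E (Φ.π p) →L[ℝ] L.E (Φ.φ p)}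
    (hr : HomEqModAlong K.dim K.F K.E L.F L.E L.dim (fun p : x.dom ↦ Φ.π p) K.s
      (fun p : x.dom ↦ Φ'.φ (x.lam p)) (fun p : x.dom ↦ Φ.φ p)
      (fun p : x.dom ↦ (Φ'.hat (x.lam p)).comp (fiberCast K.E (x.lam_π p).symm)) rho) {m : ℕ}
    {N : Type*} [TopologicalSpace N] [ChartedSpace 𝔼[m] N] {P : N → Φ.P} (hPs : C∞[m,K.dim] P)
    (hP : ∀ u, P u ∈ x.dom) {b c : N → L.V} (hb : ∀ u, Φ'.φ (x.lam ⟨P u, hP u⟩) = b u)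
    (hc : ∀ u, Φ.φ (P u) = c u) {q : N} (hq : K.s (Φ.π (P q)) = 0) :
    CongE m K L (fun u ↦ Φ.π (P u)) b c (Φ'.hatAlong (fun u ↦ (x.lam_π ⟨P u, hP u⟩).symm) hb)
    (fun u ↦ (fiberCast L.E (hc u)).comp (rho ⟨P u, hP u⟩)) q := by
  have hπ := Φ.smooth_π x.dom
  have h4 := (hr.at hπ (Φ'.φ_smooth.comp x.lam_smooth).continuous
    (Φ.φ_smooth.continuous.comp continuous_subtype_val)
    (x.φ_lam (p := ⟨P q, hP q⟩) hq)).pull (k := m) hπ (contMDiff_codRestrict hPs hP)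
  refine h4.cast (fun _ ↦ rfl) hb hc (.of_forall fun u e ↦ ?_) (.of_forall fun u e ↦ ?_)
  · simp [OneMor.hatAlong]
  · simp

lemma IsHorizRep.hatAt {z : TwoMorRep Ξ Ξ'} (H : IsHorizRep c c' x y z) {m : ℕ} {N : Type*}
    [TopologicalSpace N] [ChartedSpace 𝔼[m] N] {P : N → Φ.P} {Q : N → Ψ.P} (hPs : C∞[m,K.dim] P)
    (hPQ : ∀ u, Φ.φ (P u) = Ψ.π (Q u)) (hz : ∀ u, c.proj ⟨(P u, Q u), hPQ u⟩ ∈ z.dom)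
    (hP : ∀ u, P u ∈ x.dom) (hQ : ∀ u, Q u ∈ y.dom) {a : N → K.V} (ha : ∀ u, a u = Φ.π (P u))
    (ha' : ∀ u, a u = Ξ.π (c.proj ⟨(P u, Q u), hPQ u⟩)) :
    ∃ rho : ∀ u, K.E (a u) →L[ℝ] L.E (Ψ.π (Q u)), (∀ u, SmE m K L a (fun u ↦ Ψ.π (Q u)) rho u) ∧
    (∀ (b : N → L.V) (hb : ∀ u, Φ'.φ (x.lam ⟨P u, hP u⟩) = b u) (q : N),
        K.s (Φ.π (P q)) = 0 → CongE m K L a b (fun u ↦ Ψ.π (Q u))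
          (Φ'.hatAlong (fun u ↦ (ha u).trans (x.lam_π ⟨P u, hP u⟩).symm) hb) rho q) ∧ ∀ u, z.hatAt
    hz ha' (fun u ↦ c.proj_φ ⟨(P u, Q u), hPQ u⟩) u = horizHat x y hP hQ ha hPQ rho u := by
  obtain rfl : a = fun u ↦ Φ.π (P u) := funext ha
  obtain ⟨rho, h1, -, -, h2, h3⟩ := H.lamHat_eq
  have hπ := Φ.smooth_π x.dom
  have hφ := Φ.smooth_φ x.dom
  have h1' := (isSmoothHom_iff hπ hφ).1 h1
  have hPc := contMDiff_codRestrict hPs hP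
  refine ⟨fun u ↦ (fiberCast L.E (hPQ u)).comp (rho ⟨P u, hP u⟩), fun u ↦
    (smHom_fiberCast hPQ u).comp ((h1' _).pull (hPc u) (hπ _) (hφ _)), fun b hb q hq ↦
    congE_rho h2 hPs hP hb hPQ hq, fun u ↦ ?_⟩
  · ext e
    have h5 := h3 ⟨(P u, Q u), hPQ u⟩ (hz u) e
    simp only [TwoMorRep.hatAt, horizHat, clm_comp_apply, fiberCast_rfl,
      clm_id_apply, add_apply, OneMor.tangentMap]
    rw [h5, fiberCast_fiberCast, fiberCast_rfl]
    rfl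

lemma IsHorizRep.eventually_lam {z : TwoMorRep Ξ Ξ'} (H : IsHorizRep c c' x y z) {w : FibProd Φ Ψ}
    (h0 : K.s (Φ.π w.1.1) = 0) (r : HorizProbe x y w) (hz : ∀ u, c.proj (r.pt u) ∈ z.dom) :
    z.lam ⟨c.proj (r.pt r.q), hz r.q⟩ = c'.proj (r.pt' r.q) ∧ ∀ᶠ u in 𝓝 r.q, z.lam
    ⟨c.proj (r.pt u), hz u⟩ = c'.proj (r.pt' u) := by
  have h1 : z.lam ⟨c.proj (r.pt r.q), hz r.q⟩ = c'.proj (r.pt' r.q) := by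
    obtain ⟨h1, h2⟩ := H.lam_eq (r.pt r.q) (hz r.q) (by rw [r.pt_q]; exact h0)
    rw [h2]
    congr 3
    simp only [HorizProbe.pt, r.Q_q, r.Q₁_q]
  refine ⟨h1, (Ξ'.π_etale _).eventually_inj
    (z.contMDiff_lam_comp (r.etale_pt c).contMDiff hz).continuous.continuousAt
    (r.continuous_pt' c').continuousAt h1 rfl (.of_forall fun u ↦ ?_)⟩
  rw [z.lam_π, c.proj_π, c'.proj_π]
  exact (x.lam_π ⟨r.P u, r.mem_P u⟩).symm

end HorizontalComposition

section HorizontalExistence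

lemma KurNbhd.s_smul_eq_zero (K : KurNbhd X) (γ : K.Γ) {v w : K.V} (hw : w = γ • v)
    (hv : K.s v = 0) : K.s w = 0 := by
  rw [← K.actE_s γ hw, hv, map_zero]

lemma TwoMorRep.dom_map (x : TwoMorRep Φ Φ') (γ : K.Γ) (δ : L.Γ) {p : Φ.P} (hp : p ∈ x.dom) :
    Φ.actL γ (Φ.actR δ p) ∈ x.dom :=
  x.dom_actL _ _ (x.dom_actR _ _ hp)

/-- The smooth equivariant family `rho = lam^*(φhat') + O(π^*(s))`. -/
lemma TwoMorRep.exists_rho (x : TwoMorRep Φ Φ') :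
    ∃ rho : ∀ p : x.dom, K.E (Φ.π p) →L[ℝ] L.E (Φ.φ p),
    (∀ p, SmE K.dim K L (fun p : x.dom ↦ Φ.π p) (fun p : x.dom ↦ Φ.φ p) rho p) ∧ Φ.IsEquiv x.dom
    L.actE (fun p ↦ Φ.φ p) rho ∧ HomEqModAlong K.dim K.F K.E L.F L.E L.dim (fun p : x.dom ↦ Φ.π p)
    K.s (fun p : x.dom ↦ Φ'.φ (x.lam p)) (fun p : x.dom ↦ Φ.φ p)
    (fun p : x.dom ↦ (Φ'.hat (x.lam p)).comp (fiberCast K.E (x.lam_π p).symm)) rho := by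
  have hφ := Φ.smooth_φ x.dom
  have hφ' : C∞[K.dim,L.dim] (fun p : x.dom ↦ Φ'.φ (x.lam p)) := Φ'.φ_smooth.comp x.lam_smooth
  have ht : ∀ p : x.dom, SmE K.dim K L (fun p : x.dom ↦ Φ.π p) (fun p : x.dom ↦ Φ'.φ (x.lam p))
      (fun p : x.dom ↦ (Φ'.hat (x.lam p)).comp (fiberCast K.E (x.lam_π p).symm)) p := fun p ↦
    ((Φ'.smE_hat _).pull (x.lam_smooth p) (Φ'.π_smooth _) (Φ'.φ_smooth _)).comp
      (smHom_fiberCast (fun p ↦ (x.lam_π p).symm) p)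
  obtain ⟨rho, h1, h2, h3⟩ := Φ.exists_transport x.dom_actL x.dom_actR L.actE hφ' hφ
    x.isEquivMap_φ_lam (Φ.isEquivMap_φ x.dom) x.mapEqMod ht (fun γ δ p p' hp h h' e ↦ by
      simp only [clm_comp_apply]
      rw [K.actE.fiberCast_map, ← Φ'.hat_map γ δ (x.lam_map hp) (by rw [x.lam_π, x.lam_π, h]),
        K.actE.map_fiberCast])
  exact ⟨rho, h1, h2, homEqModAlong_of_at (Φ.smooth_π _) K.smVec_s hφ' hφ
    ht h1 h3⟩

variable (c : CompData Φ Ψ Ξ) (c' : CompData Φ' Ψ' Ξ') (x : TwoMorRep Φ Φ') (y : TwoMorRep Ψ Ψ')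

/-- The part of the fibre product over the domains of `x` and `y`. -/
def horizDom : Set (FibProd Φ Ψ) := {w | w.1.1 ∈ x.dom ∧ w.1.2 ∈ y.dom}

variable {x y} in
lemma map_mem_horizDom (γ : K.Γ) (δ : L.Γ) (ε : M.Γ) {w : FibProd Φ Ψ} (hw : w ∈ horizDom x y) :
    FibProd.map γ δ ε w ∈ horizDom x y := ⟨x.dom_map _ _ hw.1, y.dom_map _ _ hw.2⟩

variable {x y} in
/-- On the zero set, `x.lam` and `y.lam` map the fibre product of `Φ` and `Ψ` to that of `Φ'` and
`Ψ'`. -/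
def horizLam (w : FibProd Φ Ψ) (hw : w ∈ horizDom x y) (h0 : K.s (Φ.π w.1.1) = 0) : FibProd Φ' Ψ' :=
  ⟨(x.lam ⟨w.1.1, hw.1⟩, y.lam ⟨w.1.2, hw.2⟩), by
    rw [x.φ_lam (p := ⟨w.1.1, hw.1⟩) h0, y.lam_π, w.2]⟩

/-- The open subset of the composite 1-morphism over the domains of `x` and `y`. -/
def horizOpens : Opens Ξ.P :=
  ⟨c.proj '' horizDom x y, c.isOpenQuotientMap.isOpenMap _
    ((x.dom.isOpen.preimage (continuous_fst.comp continuous_subtype_val)).inter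
      (y.dom.isOpen.preimage (continuous_snd.comp continuous_subtype_val)))⟩

variable {c x y} in
lemma proj_mem_horizOpens {w : FibProd Φ Ψ} : c.proj w ∈ horizOpens c x y ↔ w ∈ horizDom x y := by
  refine ⟨fun ⟨w', hw', e⟩ ↦ ?_, fun hw ↦ ⟨w, hw, rfl⟩⟩
  obtain ⟨δ, rfl⟩ := c.proj_eq e
  exact map_mem_horizDom _ _ _ hw'

/-- The map induced by `x.lam` and `y.lam` over the zero set extends to an étale map near it. -/
lemma exists_horizLam :
    ∃ (O : Opens Ξ.P) (lam : O → Ξ'.P), O ≤ horizOpens c x y ∧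
    (∀ p ∈ horizOpens c x y, K.s (Ξ.π p) = 0 → p ∈ O) ∧ (∀ γ, ∀ p ∈ O, Ξ.actL γ p ∈ O) ∧
    (∀ δ, ∀ p ∈ O, Ξ.actR δ p ∈ O) ∧ Continuous lam ∧ (∀ p, Ξ'.π (lam p) = Ξ.π p) ∧
    (∀ γ δ (p p' : O), (p' : Ξ.P) = Ξ.actL γ (Ξ.actR δ p) → lam p' = Ξ'.actL γ (Ξ'.actR δ (lam p)))
    ∧ ∀ (w : FibProd Φ Ψ) (hw : c.proj w ∈ O) (hw' : w ∈ horizDom x y) (h0 : K.s (Φ.π w.1.1) = 0),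
    lam ⟨c.proj w, hw⟩ = c'.proj (horizLam w hw' h0) := by
  let Zs : Set Ξ.P := {p | p ∈ horizOpens c x y ∧ K.s (Ξ.π p) = 0}
  choose σ hσ using fun p : Zs ↦ c.surj p.1
  have hz : ∀ {w p}, c.proj w = p → K.s (Ξ.π p) = 0 → K.s (Φ.π w.1.1) = 0 := by
    rintro w _ rfl hw
    exact K.s_smul_eq_zero 1 (by rw [one_smul, c.proj_π]) hw
  let l : Zs → Ξ'.P := fun p ↦ c'.proj (horizLam (σ p)
    (proj_mem_horizOpens.1 (by rw [hσ p]; exact p.2.1)) (hz (hσ p) p.2.2))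
  have hmap : ∀ γ δ ε (w w' : FibProd Φ Ψ) (hw : w ∈ horizDom x y) (hw' : w' ∈ horizDom x y)
      (h0 : K.s (Φ.π w.1.1) = 0) (h0' : K.s (Φ.π w'.1.1) = 0), w' = FibProd.map γ δ ε w →
      horizLam (x := x) (y := y) w' hw' h0' = FibProd.map γ δ ε (horizLam w hw h0) := by
    rintro γ δ ε w _ hw hw' h0 h0' rfl
    exact Subtype.ext (Prod.ext (x.lam_map (p := ⟨w.1.1, hw.1⟩) rfl)
      (y.lam_map (p := ⟨w.1.2, hw.2⟩) rfl))
  have hl : ∀ (w : FibProd Φ Ψ) (hw : c.proj w ∈ Zs) hw' h0,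
      l ⟨c.proj w, hw⟩ = c'.proj (horizLam w hw' h0) := fun w hw hw' h0 ↦ by
    obtain ⟨δ, e⟩ := c.proj_eq (hσ ⟨c.proj w, hw⟩).symm
    simp only [l]
    rw [hmap 1 δ 1 w _ hw' _ h0 _ e, c'.proj_map]
    simp
  have hlc : Continuous l := by
    have h1 := (c.isOpenQuotientMap.restrictPreimage Zs).isQuotientMap
    rw [h1.continuous_iff]
    have hD : ∀ w : c.proj ⁻¹' Zs, w.1 ∈ horizDom x y ∧ K.s (Φ.π w.1.1.1) = 0 := fun w ↦
      ⟨proj_mem_horizOpens.1 w.2.1, hz rfl w.2.2⟩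
    have h2 : l ∘ Zs.restrictPreimage c.proj = fun w ↦ c'.proj (horizLam w.1 (hD w).1 (hD w).2) :=
      funext fun w ↦ hl w.1 w.2 (hD w).1 (hD w).2
    rw [h2]
    refine c'.isQuotientMap.continuous.comp (Continuous.subtype_mk (Continuous.prodMk ?_ ?_) _)
    · exact x.lam_smooth.continuous.comp (((continuous_fst.comp continuous_subtype_val).comp
        continuous_subtype_val).subtype_mk _)
    · exact y.lam_smooth.continuous.comp (((continuous_snd.comp continuous_subtype_val).comp
        continuous_subtype_val).subtype_mk _)
  have hinv : ∀ γ δ, ∀ p ∈ horizOpens c x y, Ξ.actL γ (Ξ.actR δ p) ∈ horizOpens c x y := by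
    rintro γ δ _ ⟨w, hw, rfl⟩
    exact ⟨_, map_mem_horizDom γ 1 δ hw, c.proj_map ..⟩
  obtain ⟨O, lam, h1, h2, h3, h4, h5, h6, h7, h8⟩ := Ξ.exists_lift_extension Ξ' (horizOpens c x y)
    (fun γ p hp ↦ by simpa using hinv γ 1 p hp) (fun δ p hp ↦ by simpa using hinv 1 δ p hp) l hlc
    (fun p ↦ by
      simp only [l, c'.proj_π]
      refine (x.lam_π _).trans ?_
      rw [← c.proj_π, hσ])
    (fun γ δ p p' hp ↦ by
      obtain ⟨w, hw⟩ := c.surj p.1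
      have hw' : c.proj (FibProd.map γ 1 δ w) = p'.1 := by rw [c.proj_map, hw, hp]
      obtain ⟨p, hpz⟩ := p
      obtain ⟨p', hpz'⟩ := p'
      subst hw hw'
      rw [hl w hpz (proj_mem_horizOpens.1 hpz.1) (hz rfl hpz.2), hl _ hpz'
        (proj_mem_horizOpens.1 hpz'.1) (hz rfl hpz'.2), hmap γ 1 δ w _ _ _ _ _ rfl, c'.proj_map])
  exact ⟨O, lam, h1, h2, h3, h4, h5, h6, h7, fun w hw hw' h0 ↦
    (h8 ⟨_, hw⟩ ⟨proj_mem_horizOpens.2 hw',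
    K.s_smul_eq_zero 1 (by rw [one_smul, c.proj_π]) h0⟩).trans (hl w _ hw' h0)⟩

/-- The data of a horizontal composition of `x` and `y` on the invariant open set `O`. -/
structure IsHorizData {O : Opens Ξ.P} (lam : O → Ξ'.P)
    (rho : ∀ p : x.dom, K.E (Φ.π p) →L[ℝ] L.E (Φ.φ p))
    (hat : ∀ p : O, K.E (Ξ.π p) →L[ℝ] M.T (Ξ.φ p)) : Prop where
  mem : ∀ {w}, c.proj w ∈ O → w ∈ horizDom x y
  lam_continuous : Continuous lam
  lam_π : ∀ p, Ξ'.π (lam p) = Ξ.π p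
  lam_eq : ∀ (w : FibProd Φ Ψ) (hw : c.proj w ∈ O) (h0 : K.s (Φ.π w.1.1) = 0),
    lam ⟨c.proj w, hw⟩ = c'.proj (horizLam w (mem hw) h0)
  rho_smooth : ∀ p, SmE K.dim K L (fun p : x.dom ↦ Φ.π p) (fun p : x.dom ↦ Φ.φ p) rho p
  rho_eq : HomEqModAlong K.dim K.F K.E L.F L.E L.dim (fun p : x.dom ↦ Φ.π p) K.s
    (fun p : x.dom ↦ Φ'.φ (x.lam p)) (fun p : x.dom ↦ Φ.φ p)
    (fun p : x.dom ↦ (Φ'.hat (x.lam p)).comp (fiberCast K.E (x.lam_π p).symm)) rho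
  hat_eq : ∀ (w : FibProd Φ Ψ) (hw : c.proj w ∈ O) e,
    hat ⟨c.proj w, hw⟩ (fiberCast K.E (c.proj_π w).symm e) = fiberCast M.T (c.proj_φ w).symm
      (Ψ.tangentMap w.1.2 (fiberCast L.T w.2 (x.lamHat ⟨w.1.1, (mem hw).1⟩ e)) +
        y.lamHat ⟨w.1.2, (mem hw).2⟩ (fiberCast L.E w.2 (rho ⟨w.1.1, (mem hw).1⟩ e)))

lemma CompData.zero_of_proj {w : FibProd Φ Ψ} (hw : K.s (Ξ.π (c.proj w)) = 0) :
    K.s (Φ.π w.1.1) = 0 :=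
  K.s_smul_eq_zero 1 (by rw [one_smul, c.proj_π]) hw

namespace IsHorizData

variable {c c' x y} {O : Opens Ξ.P} {lam : O → Ξ'.P}
  {rho : ∀ p : x.dom, K.E (Φ.π p) →L[ℝ] L.E (Φ.φ p)} {hat : ∀ p : O, K.E (Ξ.π p) →L[ℝ] M.T (Ξ.φ p)}

lemma hat_horizHat (H : IsHorizData c c' x y lam rho hat) {N : Type u} [TopologicalSpace N]
    {P : N → Φ.P} {Q : N → Ψ.P} (hPQ : ∀ u, Φ.φ (P u) = Ψ.π (Q u))
    (hO : ∀ u, c.proj ⟨(P u, Q u), hPQ u⟩ ∈ O) (u : N) (e : K.E (Φ.π (P u))) :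
    fiberCast M.T (c.proj_φ ⟨(P u, Q u), hPQ u⟩).symm
    (horizHat x y (fun u ↦ (H.mem (hO u)).1) (fun u ↦ (H.mem (hO u)).2) (fun _ ↦ rfl) hPQ
        (fun u ↦ (fiberCast L.E (hPQ u)).comp (rho ⟨P u, (H.mem (hO u)).1⟩)) u e) = hat
    ⟨c.proj ⟨(P u, Q u), hPQ u⟩, hO u⟩ (fiberCast K.E (c.proj_π ⟨(P u, Q u), hPQ u⟩).symm e) := by
  rw [H.hat_eq _ (hO u) e]
  simp only [horizHat, hatAt, add_apply, clm_comp_apply, fiberCast_rfl, clm_id_apply]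

lemma etale_codRestrict {N : Type u} [TopologicalSpace N] [ChartedSpace 𝔼[K.dim] N] {j : N → Ξ.P}
    (hj : Étale[K.dim] j) (hjO : ∀ u, j u ∈ O) :
    Étale[K.dim] (fun u ↦ (⟨j u, hjO u⟩ : O)) := fun u ↦
  isLocalDiffeomorphAt_of_lift (etale_val O _)
    (hj.contMDiff.continuous.subtype_mk _) (hj u)

lemma smE_rho (H : IsHorizData c c' x y lam rho hat) {N : Type u} [TopologicalSpace N]
    [ChartedSpace 𝔼[K.dim] N] {P : N → Φ.P} {Q : N → Ψ.P} (hP : C∞[K.dim,K.dim] P)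
    (hPQ : ∀ u, Φ.φ (P u) = Ψ.π (Q u)) (hPx : ∀ u, P u ∈ x.dom) (u : N) :
    SmE K.dim K L (fun u ↦ Φ.π (P u)) (fun u ↦ Ψ.π (Q u))
    (fun u ↦ (fiberCast L.E (hPQ u)).comp (rho ⟨P u, hPx u⟩)) u :=
  (smHom_fiberCast hPQ u).comp ((H.rho_smooth _).pull (contMDiff_codRestrict hP hPx u)
    (Φ.smooth_π _ _) (Φ.smooth_φ _ _))

lemma exists_proj (c : CompData Φ Ψ Ξ) (p : O) : ∃ w, ∃ hw : c.proj w ∈ O, p = ⟨c.proj w, hw⟩ := by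
  obtain ⟨w, hw⟩ := c.surj p.1
  exact ⟨w, by rw [hw]; exact p.2, Subtype.ext hw.symm⟩

lemma smT (H : IsHorizData c c' x y lam rho hat) (p : O) :
    SmT K.dim K M (fun p : O ↦ Ξ.π p) (fun p : O ↦ Ξ.φ p) hat p := by
  obtain ⟨w, hw, rfl⟩ := exists_proj c p
  obtain ⟨U, hU, Q, hPQ, hQs, hQ, hUO⟩ := w.exists_slice
    ((O.isOpen.preimage c.isQuotientMap.continuous).mem_nhds hw)
  have hj := etale_codRestrict (c.etale_probe hPQ (etale_val U) hQs.continuous)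
    hUO
  have e1 : (⟨c.proj w, hw⟩ : O) = ⟨_, hUO ⟨w.1.1, hU⟩⟩ :=
    Subtype.ext (congrArg c.proj (Subtype.ext (Prod.ext rfl hQ.symm)))
  rw [e1]
  exact SmHom.of_pull (hj ⟨w.1.1, hU⟩) (SmHom.cast (fun u ↦ (c.proj_π _).symm)
    (fun u ↦ (c.proj_φ _).symm) (.of_forall fun u e ↦ H.hat_horizHat hPQ hUO u e)
    (smT_horizHat x y (fun u ↦ (H.mem (hUO u)).1) (fun u ↦ (H.mem (hUO u)).2) (fun _ ↦ rfl) hPQ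
      contMDiff_subtype_val hQs (H.smE_rho contMDiff_subtype_val hPQ _) _))

lemma eventually_lam (H : IsHorizData c c' x y lam rho hat) {w : FibProd Φ Ψ}
    (h0 : K.s (Φ.π w.1.1) = 0) (r : HorizProbe x y w) (hr : ∀ u, c.proj (r.pt u) ∈ O) :
    ∀ᶠ u in 𝓝 r.q, lam ⟨c.proj (r.pt u), hr u⟩ = c'.proj (r.pt' u) := by
  have h0' : K.s (Φ.π (r.pt r.q).1.1) = 0 := by rw [r.pt_q]; exact h0
  refine (Ξ'.π_etale _).eventually_inj (H.lam_continuous.comp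
    ((r.etale_pt c).contMDiff.continuous.subtype_mk _)).continuousAt
    (r.continuous_pt' c').continuousAt ((H.lam_eq (r.pt r.q) (hr r.q) h0').trans ?_) rfl
    (.of_forall fun u ↦ ?_)
  · congr 1
    refine Subtype.ext (Prod.ext rfl ?_)
    simp only [horizLam, HorizProbe.pt, HorizProbe.pt', r.Q_q, r.Q₁_q]
  · rw [c'.proj_π]
    exact ((H.lam_π _).trans (c.proj_π _)).trans (x.lam_π ⟨r.P u, r.mem_P u⟩).symm

lemma exists_probe (H : IsHorizData c c' x y lam rho hat) {p : O} (hp : K.s (Ξ.π p) = 0) :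
    ∃ (w : FibProd Φ Ψ) (r : HorizProbe x y w) (hr : ∀ u, c.proj (r.pt u) ∈ O), p =
    ⟨c.proj (r.pt r.q), hr r.q⟩ ∧ K.s (Φ.π w.1.1) = 0 ∧ K.s (Φ.π (r.P r.q)) = 0 := by
  obtain ⟨w, hw, rfl⟩ := exists_proj c p
  have h0 := c.zero_of_proj hp
  obtain ⟨r, hr, -⟩ := FibProd.exists_probe (H.mem hw).1 (H.mem hw).2 h0
    ((O.isOpen.preimage c.isQuotientMap.continuous).mem_nhds hw) univ_mem
  exact ⟨w, r, hr, Subtype.ext (congrArg c.proj r.pt_q.symm), h0, by rw [r.P_q]; exact h0⟩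

lemma mapCong (H : IsHorizData c c' x y lam rho hat) {p : O} (hp : K.s (Ξ.π p) = 0) :
    MapCong K.dim K M (fun p : O ↦ Ξ.π p) (fun p : O ↦ Ξ'.φ (lam p)) (fun p : O ↦ Ξ.φ p) hat p := by
  obtain ⟨w, r, hr, rfl, h0, hq⟩ := H.exists_probe hp
  have h1 := mapCong_horizHat x y r.mem_P r.mem_Q r.mem_Q₁ (fun _ ↦ rfl) r.hPQ r.hPQ₁ r.smooth_P
    r.smooth_Q r.smooth_Q₁ (H.smE_rho r.smooth_P r.hPQ r.mem_P) hq (r.Q₁_q.trans r.Q_q.symm)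
    (congE_rho H.rho_eq r.smooth_P r.mem_P r.hPQ₁ r.hPQ hq)
  have h2 := h1.cast (fun u ↦ (c.proj_π (r.pt u)).symm) (fun u ↦ (c'.proj_φ (r.pt' u)).symm)
    (fun u ↦ (c.proj_φ (r.pt u)).symm)
    (.of_forall fun u e ↦ H.hat_horizHat r.hPQ hr u e)
  refine MapCongAt.of_pull (etale_codRestrict (r.etale_pt c) hr r.q) (h2.congr ?_
    (.of_forall fun u ↦ rfl))
  filter_upwards [H.eventually_lam h0 r hr] with u hu
  rw [hu]

lemma congE (H : IsHorizData c c' x y lam rho hat) {p : O} (hp : K.s (Ξ.π p) = 0)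
    (nM : Conn[M]) [nM.ContMDiffCovariantDerivative ∞] :
    CongE K.dim K M (fun p : O ↦ Ξ.π p) (fun p : O ↦ Ξ'.φ (lam p)) (fun p : O ↦ Ξ.φ p)
    (fun p : O ↦ (Ξ'.hat (lam p)).comp (fiberCast K.E (H.lam_π p).symm))
    (fun p : O ↦ Ξ.hat p + (nM M.s (Ξ.φ p)).comp (hat p)) p := by
  obtain ⟨w, r, hr, rfl, h0, hq⟩ := H.exists_probe hp
  have h1 := congE_horizHat x y r.mem_P r.mem_Q r.mem_Q₁ (fun _ ↦ rfl) r.hPQ r.hPQ₁ r.smooth_P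
    r.smooth_Q r.smooth_Q₁ hq (r.Q₁_q.trans r.Q_q.symm)
    (congE_rho H.rho_eq r.smooth_P r.mem_P r.hPQ₁ r.hPQ hq) nM
  have h2 := h1.cast (fun u ↦ (c.proj_π (r.pt u)).symm) (fun u ↦ (c'.proj_φ (r.pt' u)).symm)
    (fun u ↦ (c.proj_φ (r.pt u)).symm)
    (t₁' := fun u ↦ (Ξ'.hat (c'.proj (r.pt' u))).comp (fiberCast K.E ((c.proj_π (r.pt u)).trans
      ((c'.proj_π (r.pt' u)).trans (x.lam_π ⟨r.P u, r.mem_P u⟩)).symm)))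
    (t₂' := fun u ↦ Ξ.hat (c.proj (r.pt u)) + (nM M.s (Ξ.φ (c.proj (r.pt u)))).comp
      (hat ⟨c.proj (r.pt u), hr u⟩))
    (.of_forall fun u e ↦ ?_) (.of_forall fun u e ↦ ?_)
  · refine HomCongAt.of_pull (etale_codRestrict (r.etale_pt c) hr r.q) (h2.congr_left ?_)
    filter_upwards [H.eventually_lam h0 r hr] with u hu
    refine ⟨by rw [hu], fun e ↦ ?_⟩
    have h3 := apply_fiberCast Ξ'.hat hu (by rw [hu]) (by rw [hu])
      (fiberCast K.E (H.lam_π ⟨_, hr u⟩).symm e)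
    rw [fiberCast_fiberCast] at h3
    simp only [clm_comp_apply]
    rw [h3]
    simp
  · have h3 := c'.proj_hat (r.pt' u) (fiberCast K.E (x.lam_π ⟨r.P u, r.mem_P u⟩).symm e)
    erw [fiberCast_fiberCast] at h3
    simp only [clm_comp_apply, fiberCast_fiberCast]
    erw [h3]
    exact congrArg (fun v ↦ fiberCast M.E _ (Ψ'.hat _ v)) (fiberCast_fiberCast ..)
  · have h3 := c.proj_hat (r.pt u) e
    have h4 := H.hat_horizHat r.hPQ hr u e
    have h5 := apply_fiberCast (fun v ↦ nM M.s v) (c.proj_φ (r.pt u)).symm (c.proj_φ (r.pt u)).symm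
      (c.proj_φ (r.pt u)).symm
    refine (map_add (fiberCast M.E (c.proj_φ (r.pt u)).symm) _ _).trans ?_
    refine (congrArg₂ (· + ·) ?_ ?_).trans (congrArg (· + _) h3.symm)
    · simp [OneMor.hatAlong, HorizProbe.pt]
      rfl
    · exact (h5 _).symm.trans (congrArg _ h4)

end IsHorizData

theorem exists_horiz (hST : MapsTo f S T) : ∃ z, IsHorizRep c c' x y z := by
  obtain ⟨rho, r1, r2, r3⟩ := x.exists_rho
  obtain ⟨O, lam, o1, o2, o3, o4, o5, o6, o7, o8⟩ := exists_horizLam c c' x y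
  have hD : ∀ {w}, c.proj w ∈ O → w ∈ horizDom x y := fun hw ↦ proj_mem_horizOpens.1 (o1 hw)
  obtain ⟨hat, hat1, hat2⟩ := c.exists_descend (D := O) (D' := c.proj ⁻¹' O) (fun w ↦ Iff.rfl)
    (fun w ↦ (Ψ.tangentMap w.1.1.2).comp ((fiberCast L.T w.1.2).comp
      (x.lamHat ⟨w.1.1.1, (hD w.2).1⟩)) + (y.lamHat ⟨w.1.1.2, (hD w.2).2⟩).comp
        ((fiberCast L.E w.1.2).comp (rho ⟨w.1.1.1, (hD w.2).1⟩)))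
    (fun γ δ ε w w' hw h h' e ↦ by
      have e1 : w'.1.1.1 = Φ.actL γ (Φ.actR δ w.1.1.1) := congrArg (fun w ↦ w.1.1) hw
      have e2 : w'.1.1.2 = Ψ.actL δ (Ψ.actR ε w.1.1.2) := congrArg (fun w ↦ w.1.2) hw
      have hφ : Φ.φ w'.1.1.1 = δ • Φ.φ w.1.1.1 := by rw [e1, Φ.φ_actL, Φ.φ_actR]
      have hπ : Ψ.π w'.1.1.2 = δ • Ψ.π w.1.1.2 := by rw [← w'.1.2, ← w.1.2, hφ]
      have a1 := x.lamHat_isEquiv γ δ ⟨_, (hD w.2).1⟩ ⟨_, (hD w'.2).1⟩ e1 h hφ e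
      have a2 := r2 γ δ ⟨_, (hD w.2).1⟩ ⟨_, (hD w'.2).1⟩ e1 h hφ e
      have a3 := Ψ.tangentMap_map δ ε e2 hπ h'
      have a4 := y.lamHat_isEquiv δ ε ⟨_, (hD w.2).2⟩ ⟨_, (hD w'.2).2⟩ e2 hπ h'
      simp only [add_apply, clm_comp_apply, map_add]
      rw [a1, a2, L.actT.fiberCast_map, L.actE.fiberCast_map, ← a3, ← a4, L.actT.map_fiberCast,
        L.actE.map_fiberCast])
  have H : IsHorizData c c' x y lam rho hat :=
    ⟨hD, o5, o6, fun w hw h0 ↦ o8 w hw (hD hw) h0, r1, r3, fun w hw e ↦ hat2 ⟨w, hw⟩ e⟩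
  refine ⟨ofCong O (fun p hp ↦ ?_) o3 o4 lam o5 o6 o7 hat H.smT hat1 (fun p ↦ H.mapCong)
    (fun nM _ p hp ↦ H.congE hp nM), fun w hw ↦ (hD hw).1, fun w hw ↦ (hD hw).2, fun w hw h0 ↦
    ⟨(horizLam w (hD hw) h0).2, o8 w hw (hD hw) h0⟩, rho,
    (isSmoothHom_iff (Φ.smooth_π _)
      (Φ.smooth_φ _)).2 r1,
    fun γ p e ↦ ?_, fun δ p e ↦ ?_, r3, fun w hw e ↦ H.hat_eq w hw e⟩
  · obtain ⟨w, rfl⟩ := c.surj p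
    have hw := c.mem_core_left.1 hp
    exact o2 _ (proj_mem_horizOpens.2 ⟨x.core_subset hw,
      y.core_subset (FibProd.mem_core_right hST hw)⟩) hp.1
  · have h1 := r2 γ 1 p ⟨_, x.dom_actL γ p p.2⟩ (by simp) (Φ.π_actL γ p)
      ((Φ.φ_actL γ p).trans (one_smul _ _).symm) e
    rw [L.actE.map_one (Φ.φ_actL γ p).symm] at h1
    exact h1
  · have h1 := r2 1 δ p ⟨_, x.dom_actR δ p p.2⟩ (by simp) ((Φ.π_actR δ p).trans (one_smul _ _).symm)
      (Φ.φ_actR δ p) e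
    rw [K.actE.map_one (Φ.π_actR δ p).symm] at h1
    exact h1

end HorizontalExistence

section HorizontalUniqueness

variable {c : CompData Φ Ψ Ξ} {c' : CompData Φ' Ψ' Ξ'} {x x' : TwoMorRep Φ Φ'}
  {y y' : TwoMorRep Ψ Ψ'} {z z' : TwoMorRep Ξ Ξ'}

/-! ### Horizontal composition of 2-morphisms -/

lemma IsHorizRep.lam_of_eq (H : IsHorizRep c c' x y z) {w : FibProd Φ Ψ} (hz : c.proj w ∈ z.dom)
    (h0 : K.s (Φ.π w.1.1) = 0) {w' : FibProd Φ' Ψ'} (h₁ : x.lam ⟨w.1.1, H.dom_left w hz⟩ = w'.1.1)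
    (h₂ : y.lam ⟨w.1.2, H.dom_right w hz⟩ = w'.1.2) : z.lam ⟨c.proj w, hz⟩ = c'.proj w' := by
  obtain ⟨h3, h4⟩ := H.lam_eq w hz h0
  rw [h4]
  exact congrArg c'.proj (Subtype.ext (Prod.ext h₁ h₂))

section

variable {m : ℕ} {N : Type*} [TopologicalSpace N] [ChartedSpace 𝔼[m] N] {P : N → Φ.P} {Q : N → Ψ.P}
  {a : N → K.V} {q : N}

lemma OneMor.hatAlong_congr (Φ : OneMor K L f S) {N : Type*} {j j' : N → Φ.P} {a : N → K.V}
    (ha : ∀ u, a u = Φ.π (j u)) (ha' : ∀ u, a u = Φ.π (j' u)) {b b' : N → L.V}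
    (hb : ∀ u, Φ.φ (j u) = b u) (hb' : ∀ u, Φ.φ (j' u) = b' u) {u : N} (h : j u = j' u) :
    ∃ e : b u = b' u, ∀ v, fiberCast L.E e (Φ.hatAlong ha hb u v) = Φ.hatAlong ha' hb' u v := by
  refine ⟨by rw [← hb, ← hb', h], fun v ↦ ?_⟩
  have := apply_fiberCast Φ.hat h (congrArg Φ.π h) (congrArg Φ.φ h) (fiberCast K.E (ha u) v)
  simp only [fiberCast_fiberCast] at this
  simp [hatAlong, this]

/-- Families with values in the pullback of `TV_L` along `π_Ψ` may be transported along `Ψ`. -/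
lemma OneMor.tangentMap_congT (Ψ : OneMor L M g T) {Q Q' : N → Ψ.P} (hQs : C∞[m,L.dim] Q)
    (hQs' : C∞[m,L.dim] Q') (hq : Q q = Q' q) {t₁ : ∀ u, K.E (a u) →L[ℝ] L.T (Ψ.π (Q u))}
    {t₂ : ∀ u, K.E (a u) →L[ℝ] L.T (Ψ.π (Q' u))}
    (h : CongT m K L a (fun u ↦ Ψ.π (Q u)) (fun u ↦ Ψ.π (Q' u)) t₁ t₂ q) :
    CongT m K M a (fun u ↦ Ψ.φ (Q u)) (fun u ↦ Ψ.φ (Q' u))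
    (fun u ↦ (Ψ.tangentMap (Q u)).comp (t₁ u)) (fun u ↦ (Ψ.tangentMap (Q' u)).comp (t₂ u)) q :=
  HomCongAt.etale_comp hQs.continuous.continuousAt hQs'.continuous.continuousAt hq h
    (Ψ.π_etale _) Ψ.φ_smooth Ψ.smHom_tangentMap

lemma horizHat_congT (hx : x.Equiv x') (hy : y.Equiv y') (hPs : C∞[m,K.dim] P) (hQs : C∞[m,L.dim] Q)
    (hP : ∀ u, P u ∈ x.dom) (hP' : ∀ u, P u ∈ x'.dom) (hQ : ∀ u, Q u ∈ y.dom)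
    (hQ' : ∀ u, Q u ∈ y'.dom) (ha : ∀ u, a u = Φ.π (P u)) (hPQ : ∀ u, Φ.φ (P u) = Ψ.π (Q u))
    {rho rho' : ∀ u, K.E (a u) →L[ℝ] L.E (Ψ.π (Q u))}
    (hrho : ∀ u, SmE m K L a (fun u ↦ Ψ.π (Q u)) rho' u) (hq : P q ∈ Φ.core) (hq' : Q q ∈ Ψ.core)
    (h : CongE m K L a (fun u ↦ Ψ.π (Q u)) (fun u ↦ Ψ.π (Q u)) rho rho' q) :
    CongT m K M a (fun u ↦ Ψ.φ (Q u)) (fun u ↦ Ψ.φ (Q u)) (horizHat x y hP hQ ha hPQ rho)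
    (horizHat x' y' hP' hQ' ha hPQ rho') q := by
  obtain ⟨τ, h1, h2, -⟩ := Φ.exists_hatAlong_exact hPs ha hPQ
  have h3 := hy.congT_hatAt hQs hQ hQ' hq' (fun _ ↦ rfl) (fun _ ↦ rfl)
  rw [hatAt_rfl, hatAt_rfl] at h3
  exact HomCongAt.add (Ψ.tangentMap_congT hQs hQs rfl (hx.congT_hatAt hPs hP hP' hq ha hPQ))
    ((HomCongAt.lamHat_comp y hQ hQ hQs hQs rfl h).trans (HomCongAt.precomp h3 τ
      (.of_forall fun u ↦ ⟨h1 u, h2 u⟩) (.of_forall hrho)))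

end

/-- The restriction of a probe to an open neighbourhood of its centre. -/
def HorizProbe.restrict {w : FibProd Φ Ψ} (r : HorizProbe x y w) (U : Opens r.N) (hU : r.q ∈ U) :
    HorizProbe x y w where
  N := U
  P u := r.P u
  Q u := r.Q u
  Q₁ u := r.Q₁ u
  q := ⟨r.q, hU⟩
  etale_P u := (r.etale_P u).fun_comp (etale_val U u)
  smooth_Q := r.smooth_Q.comp contMDiff_subtype_val
  smooth_Q₁ := r.smooth_Q₁.comp contMDiff_subtype_val
  P_q := r.P_q
  Q_q := r.Q_q
  Q₁_q := r.Q₁_q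
  mem_P u := r.mem_P u
  mem_Q u := r.mem_Q u
  mem_Q₁ u := r.mem_Q₁ u
  hPQ u := r.hPQ u
  hPQ₁ u := r.hPQ₁ u

lemma CompData.proj_mem (c : CompData Φ Ψ Ξ) (U : Opens Ξ.P) {w : FibProd Φ Ψ} (h : c.proj w ∈ U) :
    c.proj ⁻¹' U ∈ 𝓝 w := c.isQuotientMap.continuous.continuousAt.preimage_mem_nhds (U.2.mem_nhds h)

theorem IsHorizRep.equiv (hS : IsOpen S) (hST : MapsTo f S T) (hx : x.Equiv x') (hy : y.Equiv y')
    (H : IsHorizRep c c' x y z) (H' : IsHorizRep c c' x' y' z') : z.Equiv z' := by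
  refine equiv_of_hatAt hS fun p hp ↦ ?_
  obtain ⟨w, rfl⟩ := c.surj p
  have m1 := c.mem_core_left.1 hp
  have m2 := FibProd.mem_core_right hST m1
  refine ⟨?_, ?_⟩
  · rw [H.lam_of_eq (z.core_subset hp) m1.1 (w' := ⟨(_, _), (H.lam_eq w (z.core_subset hp)
      m1.1).1⟩) rfl rfl]
    exact (H'.lam_of_eq (z'.core_subset hp) m1.1 (hx.lam_eq m1 _ _).symm
      (hy.lam_eq m2 _ _).symm).symm
  obtain ⟨r, hr, -⟩ := FibProd.exists_probe (x := x) (y := y) (x.core_subset m1) (y.core_subset m2)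
    m1.1 (c.proj_mem (z.dom ⊓ z'.dom) ⟨z.core_subset hp, z'.core_subset hp⟩) univ_mem
  have hP' := fun u ↦ H'.dom_left _ (hr u).2
  have hQ' := fun u ↦ H'.dom_right _ (hr u).2
  have k1 : r.P r.q ∈ Φ.core := by rw [r.P_q]; exact m1
  obtain ⟨rho, -, b1, c1⟩ := H.hatAt r.smooth_P r.hPQ (fun u ↦ (hr u).1) r.mem_P r.mem_Q
    (fun _ ↦ rfl) (fun u ↦ (c.proj_π (r.pt u)).symm)
  obtain ⟨rho', a2, b2, c2⟩ := H'.hatAt r.smooth_P r.hPQ (fun u ↦ (hr u).2) hP' hQ'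
    (fun _ ↦ rfl) (fun u ↦ (c.proj_π (r.pt u)).symm)
  refine ⟨r.N, _, _, fun u ↦ c.proj (r.pt u), r.q, fun u ↦ (hr u).1, fun u ↦ (hr u).2, _,
    fun u ↦ (c.proj_π (r.pt u)).symm, _, fun u ↦ c.proj_φ (r.pt u), congrArg c.proj r.pt_q,
    r.etale_pt c, ?_⟩
  refine (horizHat_congT hx hy r.smooth_P r.smooth_Q _ hP' _ hQ' _ _ a2 k1
    (by rw [r.Q_q]; exact m2) ?_).congr (.of_forall c1)
    (.of_forall c2)
  refine (b1 _ r.hPQ₁ _ k1.1).symm.trans (HomCongAt.congr_left (b2 _ (fun _ ↦ rfl) _ k1.1) ?_)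
  obtain ⟨U, u1, u2, u3, u4, -⟩ := hx
  filter_upwards [r.smooth_P.continuous.continuousAt.preimage_mem_nhds (U.2.mem_nhds (u3 k1))]
    with u hu
  exact Φ'.hatAlong_congr (fun u ↦ (x'.lam_π ⟨r.P u, hP' u⟩).symm)
    (fun u ↦ (x.lam_π ⟨r.P u, r.mem_P u⟩).symm) (fun _ ↦ rfl) r.hPQ₁ (u4 ⟨_, hu⟩).symm

/-- The horizontal composition `θ * η` of 2-morphisms. -/
def TwoMor.hcomp (c : CompData Φ Ψ Ξ) (c' : CompData Φ' Ψ' Ξ') (hST : MapsTo f S T)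
    (η : TwoMor Φ Φ') (θ : TwoMor Ψ Ψ') : TwoMor Ξ Ξ' :=
  (Classical.choose (exists_horiz c c' η.exists_rep.choose θ.exists_rep.choose hST)).toTwoMor

lemma TwoMor.hcomp_eq (hS : IsOpen S) (hST : MapsTo f S T) (H : IsHorizRep c c' x y z) :
    hcomp c c' hST x.toTwoMor y.toTwoMor = z.toTwoMor :=
  toTwoMor_eq_iff.2 (IsHorizRep.equiv hS hST (toTwoMor_eq_iff.1 (exists_rep _).choose_spec)
    (toTwoMor_eq_iff.1 (exists_rep _).choose_spec)
    (Classical.choose_spec (exists_horiz (hST := hST) ..)) H)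

/-- Two representatives agree if their components `lamHat` vanish and they agree over `S`. -/
lemma TwoMorRep.equiv_of_flat (hS : IsOpen S) {x y : TwoMorRep Φ Φ'} (hx : ∀ p, x.lamHat p = 0)
    (hy : ∀ p, y.lamHat p = 0)
    (h : ∀ p (hp : p ∈ Φ.core), x.lam ⟨p, x.core_subset hp⟩ = y.lam ⟨p, y.core_subset hp⟩) :
    x.Equiv y := by
  refine equiv_of_hatAt hS fun p hp ↦ ⟨h p hp, ↥(x.dom ⊓ y.dom), _, _, Subtype.val,
    ⟨p, x.core_subset hp, y.core_subset hp⟩, fun u ↦ u.2.1, fun u ↦ u.2.2, _, fun _ ↦ rfl, _,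
    fun _ ↦ rfl, rfl, etale_val _, HomCongAt.refl.congr
    (.of_forall fun u ↦ ?_) (.of_forall fun u ↦ rfl)⟩
  simp only [TwoMorRep.hatAt, hx, hy]

end HorizontalUniqueness

section Interchange

/-! ### The interchange law -/

section

variable {m : ℕ} {N : Type*} [TopologicalSpace N] [ChartedSpace 𝔼[m] N] {Q Q₁ : N → Ψ.P}
  {a : N → K.V} {q : N}

/-- The derivative of the congruence `φ' ∘ lam = φ + lamHat · s + O(s²)`. -/
lemma TwoMorRep.congT_tangentMap (y : TwoMorRep Ψ Ψ') (hQs : C∞[m,L.dim] Q) (hQ : ∀ u, Q u ∈ y.dom)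
    (hq : L.s (Ψ.π (Q q)) = 0) (nL : Conn[L])
    [nL.ContMDiffCovariantDerivative ∞] (τ : ∀ u, K.E (a u) →L[ℝ] L.E (Ψ.π (Q u)))
    (hτ : ∀ u, SmE m K L a (fun u ↦ Ψ.π (Q u)) τ u) (hτ' : ∀ u, L.s (Ψ.π (Q u)) = τ u (K.s (a u)))
    {t : ∀ u, K.E (a u) →L[ℝ] L.T (Ψ.π (Q u))} (ht : ∀ u, SmT m K L a (fun u ↦ Ψ.π (Q u)) t u) :
    CongT m K M a (fun u ↦ Ψ'.φ (y.lam ⟨Q u, hQ u⟩)) (fun u ↦ Ψ.φ (Q u))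
    (fun u ↦ ((Ψ'.tangentMap (y.lam ⟨Q u, hQ u⟩)).comp
        (fiberCast L.T (y.lam_π ⟨Q u, hQ u⟩).symm)).comp (t u))
    (fun u ↦ (Ψ.tangentMap (Q u) + (y.lamHat ⟨Q u, hQ u⟩).comp (nL L.s (Ψ.π (Q u)))).comp (t u)) q
    := by
  have hπ : Étale[L.dim] (fun p : y.dom ↦ Ψ.π p) := fun p ↦
    (Ψ.π_etale p).fun_comp (etale_val y.dom p)
  refine homCongAt_of_along (c := fun p : y.dom ↦ Ψ.π p) (a := fun p : y.dom ↦ Ψ.π p) (s := L.s)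
    (b₁ := fun p : y.dom ↦ Ψ'.φ (y.lam p)) (b₂ := fun p : y.dom ↦ Ψ.φ p)
    (R₁ := fun p ↦ (Ψ'.tangentMap (y.lam p)).comp (fiberCast L.T (y.lam_π p).symm))
    (R₂ := fun p ↦ Ψ.tangentMap p + (y.lamHat p).comp (nL L.s (Ψ.π p)))
    hπ.contMDiff hπ.contMDiff (contMDiff_codRestrict hQs hQ) (y.φ_lam (p := ⟨Q q, hQ q⟩) hq)
    (fun β hβ v hv ↦ ?_) τ (.of_forall fun u ↦ ⟨hτ u, hτ' u⟩)
    (.of_forall ht)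
  refine (MapCongAt.inI_mfderiv (v := fun p ↦ (D[L.dim,L.dim]
    (fun p : y.dom ↦ Ψ.π p) p).inverse (v p)) hπ.contMDiff L.smVec_s nL
    (Ψ'.φ_smooth.comp y.lam_smooth) (Ψ.smooth_φ _)
    (.of_forall y.smT_lamHat) (y.mapCong (p := ⟨Q q, hQ q⟩) hq) hβ
    (hv.mono fun r hr ↦ smHom_mfderiv_inverse hπ r _ hr)).congr
    (.of_forall fun r ↦ ?_)
  have e1 := Ψ'.tangentMap_mfderiv (y.lam_smooth.mdifferentiable (by simp) r)
    ((D[L.dim,L.dim] (fun p : y.dom ↦ Ψ.π p) r).inverse (v r))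
  have e2 := Ψ.tangentMap_mfderiv ((contMDiff_subtype_val (U := y.dom)).mdifferentiable
    (I := 𝓡 L.dim) (n := ∞) (by simp) r)
    ((D[L.dim,L.dim] (fun p : y.dom ↦ Ψ.π p) r).inverse (v r))
  have e3 := fiberCast_mfderiv (m := L.dim) (n := L.dim) (fun p ↦ (y.lam_π p).symm) (u := r)
    ((D[L.dim,L.dim] (fun p : y.dom ↦ Ψ.π p) r).inverse (v r))
  rw [(hπ r).mfderiv_inverse] at e2 e3
  simp only [clm_comp_apply, add_apply]
  erw [e3, e1, e2, (hπ r).mfderiv_inverse]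
  rfl

end

variable {x : TwoMorRep Φ Φ'} {y : TwoMorRep Ψ Ψ'} {x' : TwoMorRep Φ' Φ''} {y' : TwoMorRep Ψ' Ψ''}
  {w : FibProd Φ Ψ}

/-- The effect of a vertical composition on the family `horizHat`. -/
lemma HorizProbe.congT_horizHat (r : HorizProbe x y w) (h0 : K.s (Φ.π w.1.1) = 0)
    (hx' : ∀ u, x.lam ⟨r.P u, r.mem_P u⟩ ∈ x'.dom) (hy' : ∀ u, y.lam ⟨r.Q₁ u, r.mem_Q₁ u⟩ ∈ y'.dom)
    (hy : ∀ u, y.lam ⟨r.Q u, r.mem_Q u⟩ ∈ y'.dom) (nL : Conn[L])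
    [nL.ContMDiffCovariantDerivative ∞] {ck : ∀ u, K.E (Φ.π (r.P u)) →L[ℝ] L.T (Ψ.π (r.Q u))}
    (h₁ : CongT K.dim K L (fun u ↦ Φ.π (r.P u)) (fun u ↦ Ψ.π (r.Q₁ u)) (fun u ↦ Ψ.π (r.Q u))
      (x'.hatAt hx' (fun u ↦ (x.lam_π ⟨r.P u, r.mem_P u⟩).symm) r.hPQ₁) ck r.q)
    {ck' : ∀ u, L.E (Ψ.π (r.Q u)) →L[ℝ] M.T (Ψ.φ (r.Q u))}
    (h₂ : CongT K.dim L M (fun u ↦ Ψ.π (r.Q u)) (fun u ↦ Ψ'.φ (y.lam ⟨r.Q u, r.mem_Q u⟩))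
      (fun u ↦ Ψ.φ (r.Q u))
      (y'.hatAt hy (fun u ↦ (y.lam_π ⟨r.Q u, r.mem_Q u⟩).symm) (fun _ ↦ rfl)) ck' r.q)
    {rho rho'' : ∀ u, K.E (Φ.π (r.P u)) →L[ℝ] L.E (Ψ.π (r.Q u))}
    {rho' : ∀ u, K.E (Φ.π (r.P u)) →L[ℝ] L.E (Ψ'.π (r.pt' u).1.2)}
    (hs : ∀ u, SmE K.dim K L (fun u ↦ Φ.π (r.P u)) (fun u ↦ Ψ.π (r.Q u)) rho'' u)
    (h₃ : CongE K.dim K L (fun u ↦ Φ.π (r.P u)) (fun u ↦ Ψ.π (r.Q u)) (fun u ↦ Ψ.π (r.Q u))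
      rho'' (fun u ↦ rho u + (nL L.s (Ψ.π (r.Q u))).comp (ck u)) r.q)
    (h₄ : CongE K.dim K L (fun u ↦ Φ.π (r.P u)) (fun u ↦ Ψ'.π (r.pt' u).1.2)
      (fun u ↦ Ψ.π (r.Q u)) rho' rho'' r.q) :
    CongT K.dim K M (fun u ↦ Φ.π (r.P u)) (fun u ↦ Ψ'.φ (r.pt' u).1.2) (fun u ↦ Ψ.φ (r.Q u))
    (horizHat x' y' hx' hy' (fun u ↦ (x.lam_π ⟨r.P u, r.mem_P u⟩).symm) (fun u ↦ (r.pt' u).2) rho')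
    (fun u ↦ (Ψ.tangentMap (r.Q u)).comp (ck u) +
        ((y.lamHat ⟨r.Q u, r.mem_Q u⟩).comp (rho'' u - rho u) + (ck' u).comp (rho'' u))) r.q := by
  have hq : K.s (Φ.π (r.P r.q)) = 0 := by rw [r.P_q]; exact h0
  have hqq : r.Q₁ r.q = r.Q r.q := r.Q₁_q.trans r.Q_q.symm
  have hPs' := r.smooth_lam_P
  obtain ⟨τ, t1, t2, -⟩ := Φ'.exists_hatAlong_exact hPs'
    (fun u ↦ (x.lam_π ⟨r.P u, r.mem_P u⟩).symm) r.hPQ₁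
  obtain ⟨τ', t1', t2', -⟩ := Φ.exists_hatAlong_exact r.smooth_P (fun _ ↦ rfl) r.hPQ
  have hL : L.s (Ψ.π (r.Q₁ r.q)) = 0 := by rw [t2, hq, map_zero]
  have a1 := y.congT_tangentMap (q := r.q) r.smooth_Q₁ r.mem_Q₁ hL nL τ t1 t2
    (x'.smT_hatAt hx' hPs' (fun u ↦ (x.lam_π ⟨r.P u, r.mem_P u⟩).symm) r.hPQ₁)
  have a2 := Ψ.tangentMap_congT r.smooth_Q₁ r.smooth_Q hqq h₁
  have a3 := HomCongAt.lamHat_comp y r.mem_Q r.mem_Q₁ r.smooth_Q r.smooth_Q₁ hqq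
    (h₁.clm_comp (.of_forall fun w ↦ smHom_connection nL (.of_forall L.smVec_s)))
  have a4 := HomCongAt.lamHat_comp y r.mem_Q r.mem_Q r.smooth_Q r.smooth_Q rfl
    ((h₃.add (HomCongAt.refl (t := rho)).neg).congr (t₁' := fun u ↦ rho'' u - rho u)
      (t₂' := fun u ↦ (nL L.s (Ψ.π (r.Q u))).comp (ck u))
      (.of_forall fun u ↦ sub_eq_add_neg _ _)
      (.of_forall fun u ↦ (by simp)))
  have a5 := HomCongAt.lamHat_comp (t₁ := rho') (t₂ := fun u ↦ (fiberCast L.E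
    (y.lam_π ⟨r.Q u, r.mem_Q u⟩).symm).comp (rho'' u)) y' hy hy'
    (y.contMDiff_lam_comp r.smooth_Q r.mem_Q) r.smooth_lam_Q₁ (congrArg y.lam (Subtype.ext hqq))
    (h₄.cast (fun _ ↦ rfl) (fun _ ↦ rfl) (fun u ↦ (y.lam_π ⟨r.Q u, r.mem_Q u⟩).symm)
      (.of_forall fun u e ↦ by simp)
      (.of_forall fun u e ↦ by simp))
  have a6 := h₂.precomp τ' (s := K.s) (.of_forall fun u ↦ ⟨t1' u, t2' u⟩) (.of_forall hs)
  have a7 := (a1.trans ((a2.add (a3.trans a4.symm)).congr (.of_forall fun u ↦ by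
      rw [ContinuousLinearMap.add_comp, ContinuousLinearMap.comp_assoc])
      (.of_forall fun u ↦ rfl))).add
    (a5.trans (a6.congr (.of_forall fun u ↦ by
      ext e
      simp [TwoMorRep.hatAt]) (.of_forall fun u ↦ rfl)))
  refine a7.congr (.of_forall fun u ↦ ?_) (.of_forall fun u ↦ (add_assoc _ _ _).symm)
  ext e
  simp [horizHat, TwoMorRep.hatAt]

lemma IsHorizRep.lamHat_eq_zero {c : CompData Φ Ψ Ξ} {c' : CompData Φ' Ψ' Ξ'} {z : TwoMorRep Ξ Ξ'}
    (H : IsHorizRep c c' x y z) (hx : ∀ p, x.lamHat p = 0) (hy : ∀ p, y.lamHat p = 0) (p : z.dom) :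
    z.lamHat p = 0 := by
  obtain ⟨rho, -, -, -, -, h⟩ := H.lamHat_eq
  obtain ⟨p, hp⟩ := p
  obtain ⟨w, rfl⟩ := c.surj p
  ext e
  have := h w hp (fiberCast K.E (c.proj_π w) e)
  simpa [hx, hy] using this

variable {c : CompData Φ Ψ Ξ} {c' : CompData Φ' Ψ' Ξ'} {c'' : CompData Φ'' Ψ'' Ξ''}
  {z : TwoMorRep Ξ Ξ'} {z' : TwoMorRep Ξ' Ξ''} {vx : TwoMorRep Φ Φ''} {vy : TwoMorRep Ψ Ψ''}
  {vz zz : TwoMorRep Ξ Ξ''}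

theorem IsHorizRep.interchange (hS : IsOpen S) (hST : MapsTo f S T) (H : IsHorizRep c c' x y z)
    (H' : IsHorizRep c' c'' x' y' z') (Hx : IsVertRep x x' vx) (Hy : IsVertRep y y' vy)
    (Hz : IsVertRep z z' vz) (HH : IsHorizRep c c'' vx vy zz) : vz.Equiv zz := by
  refine equiv_of_hatAt hS fun p hp ↦ ?_
  obtain ⟨w, rfl⟩ := c.surj p
  have m1 := c.mem_core_left.1 hp
  have m2 := FibProd.mem_core_right hST m1
  have mz := z.mem_core_lam (p := ⟨_, z.core_subset hp⟩) hp
  have zw := H.lam_of_eq (z.core_subset hp) m1.1 (w' := ⟨(_, _), (H.lam_eq w (z.core_subset hp)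
    m1.1).1⟩) rfl rfl
  have mz' := z'.core_subset mz
  rw [zw] at mz'
  refine ⟨?_, ?_⟩
  · rw [Hz.lam_of_eq (vz.core_subset hp) (z.core_subset hp) mz' zw,
      H'.lam_of_eq mz' (x.mem_core_lam (p := ⟨_, x.core_subset m1⟩) m1).1 (w' := ⟨(_, _),
        (H'.lam_eq _ mz' (x.mem_core_lam (p := ⟨_, x.core_subset m1⟩) m1).1).1⟩) rfl rfl]
    exact (HH.lam_of_eq (zz.core_subset hp) m1.1 (Hx.lam_of_eq _ _ _ rfl)
      (Hy.lam_of_eq _ _ _ rfl)).symm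
  obtain ⟨r₀, hr₀, hr₁⟩ := FibProd.exists_probe (x := x) (y := y) (x.core_subset m1)
    (y.core_subset m2) m1.1 (c.proj_mem (z.dom ⊓ zz.dom ⊓ vz.dom)
      ⟨⟨z.core_subset hp, zz.core_subset hp⟩, vz.core_subset hp⟩)
    (vy.dom.2.mem_nhds (vy.core_subset m2))
  have e0 := (H.eventually_lam m1.1 r₀ fun u ↦ (hr₀ u).1.1).1
  have e0' : c.proj (r₀.pt r₀.q) ∈ Ξ.core := by rw [r₀.pt_q]; exact hp
  obtain ⟨r, hr, hQ₁, hz'⟩ : ∃ r : HorizProbe x y w,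
    (∀ u, c.proj (r.pt u) ∈ z.dom ⊓ zz.dom ⊓ vz.dom) ∧
      (∀ u, r.Q₁ u ∈ vy.dom) ∧ ∀ u, c'.proj (r.pt' u) ∈ z'.dom := by
    refine ⟨r₀.restrict ⟨_, z'.dom.2.preimage (r₀.continuous_pt' c')⟩ ?_, fun u ↦ hr₀ u.1,
      fun u ↦ hr₁ u.1, fun u ↦ u.2⟩
    change c'.proj (r₀.pt' r₀.q) ∈ z'.dom
    rw [← e0]
    exact z'.core_subset (z.mem_core_lam (p := ⟨_, _⟩) e0')
  have hPx : ∀ u, r.P u ∈ vx.dom := fun u ↦ HH.dom_left _ (hr u).1.2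
  have hQy : ∀ u, r.Q u ∈ vy.dom := fun u ↦ HH.dom_right _ (hr u).1.2
  have k1 : r.P r.q ∈ Φ.core := by rw [r.P_q]; exact m1
  have k2 : r.Q r.q ∈ Ψ.core := by rw [r.Q_q]; exact m2
  have k3 : c.proj (r.pt r.q) ∈ Ξ.core := by rw [r.pt_q]; exact hp
  have hπ : ∀ u, Φ.π (r.P u) = Ξ.π (c.proj (r.pt u)) := fun u ↦ (c.proj_π (r.pt u)).symm
  have hπ' : ∀ u, Φ.π (r.P u) = Φ'.π (x.lam ⟨r.P u, r.mem_P u⟩) := fun u ↦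
    (x.lam_π ⟨r.P u, r.mem_P u⟩).symm
  have ez := H.eventually_lam m1.1 r fun u ↦ (hr u).1.1
  obtain ⟨rho, -, b1, c1⟩ := H.hatAt r.smooth_P r.hPQ (fun u ↦ (hr u).1.1) r.mem_P r.mem_Q
    (fun _ ↦ rfl) hπ
  obtain ⟨rho', -, b2, c2⟩ := H'.hatAt r.smooth_lam_P (fun u ↦ (r.pt' u).2) hz'
    (fun u ↦ Hx.lam_mem ⟨_, hPx u⟩) (fun u ↦ Hy.lam_mem ⟨_, hQ₁ u⟩) hπ'
    (fun u ↦ (hπ' u).trans (c'.proj_π (r.pt' u)).symm)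
  obtain ⟨rho'', a3, b3, c3⟩ := HH.hatAt r.smooth_P r.hPQ (fun u ↦ (hr u).1.2) hPx hQy
    (fun _ ↦ rfl) hπ
  obtain ⟨ck, -, d1, d2⟩ := Hx.hatAt r.smooth_P r.mem_P hPx r.smooth_lam_P
    (fun u ↦ Hx.lam_mem ⟨_, hPx u⟩) (fun _ ↦ rfl) hπ' r.hPQ r.hPQ₁ k1 rfl
  obtain ⟨ck', -, d3, d4⟩ := Hy.hatAt r.smooth_Q r.mem_Q hQy (y.contMDiff_lam_comp r.smooth_Q
    r.mem_Q) (fun u ↦ Hy.lam_mem ⟨_, hQy u⟩) (fun _ ↦ rfl)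
    (fun u ↦ (y.lam_π ⟨r.Q u, r.mem_Q u⟩).symm) (fun _ ↦ rfl) (fun _ ↦ rfl) k2 rfl
  obtain ⟨cz, -, d5, d6⟩ := Hz.hatAt (r.etale_pt c).contMDiff (fun u ↦ (hr u).1.1)
    (fun u ↦ (hr u).2) (c'.contMDiff_probe _ r.smooth_lam_P r.smooth_lam_Q₁.continuous) hz' hπ
    (fun u ↦ (hπ' u).trans (c'.proj_π (r.pt' u)).symm) (fun u ↦ c.proj_φ (r.pt u))
    (fun u ↦ c'.proj_φ (r.pt' u)) k3 ez.1
  obtain ⟨nL, _⟩ := exists_connection (n := L.dim) (B := L.V) (F := L.F) (E := L.E)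
  have e1 : CongE K.dim K L (fun u ↦ Φ.π (r.P u)) (fun u ↦ Ψ.π (r.Q u)) (fun u ↦ Ψ.π (r.Q u))
      rho'' (fun u ↦ rho u + (nL L.s (Ψ.π (r.Q u))).comp (ck u)) r.q := by
    refine (b3 _ (fun _ ↦ rfl) r.q k1.1).symm.trans (HomCongAt.trans (HomCongAt.congr_left
      (x'.congE_hatAt (fun u ↦ Hx.lam_mem ⟨_, hPx u⟩) hπ' (fun _ ↦ rfl) r.hPQ₁ r.smooth_lam_P
        (x.mem_core_lam (p := ⟨_, r.mem_P r.q⟩) k1).1 nL) (.of_forall fun u ↦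
      Φ''.hatAlong_congr (fun u ↦ (hπ' u).trans (x'.lam_π ⟨_, Hx.lam_mem ⟨_, hPx u⟩⟩).symm)
        (fun u ↦ (vx.lam_π ⟨_, hPx u⟩).symm) (fun _ ↦ rfl) (fun _ ↦ rfl)
        (Hx.lam_eq ⟨_, hPx u⟩).symm)) ((b1 _ r.hPQ₁ r.q k1.1).add (d1.clm_comp
        (.of_forall fun w ↦ smHom_connection nL (.of_forall L.smVec_s)))))
  have e2 : CongE K.dim K L (fun u ↦ Φ.π (r.P u)) (fun u ↦ Ψ'.π (r.pt' u).1.2)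
      (fun u ↦ Ψ.π (r.Q u)) rho' rho'' r.q :=
    (b2 _ (fun _ ↦ rfl) r.q (x.mem_core_lam (p := ⟨_, r.mem_P r.q⟩) k1).1).symm.trans
      (HomCongAt.congr_left (b3 _ (fun _ ↦ rfl) r.q k1.1) (.of_forall fun u ↦
      Φ''.hatAlong_congr (fun u ↦ (vx.lam_π ⟨_, hPx u⟩).symm)
        (fun u ↦ (hπ' u).trans (x'.lam_π ⟨_, Hx.lam_mem ⟨_, hPx u⟩⟩).symm) (fun _ ↦ rfl)
        (fun _ ↦ rfl) (Hx.lam_eq ⟨_, hPx u⟩)))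
  have e3 := r.congT_horizHat m1.1 (fun u ↦ Hx.lam_mem ⟨_, hPx u⟩) (fun u ↦ Hy.lam_mem ⟨_, hQ₁ u⟩)
    (fun u ↦ Hy.lam_mem ⟨_, hQy u⟩) nL d1 d3 a3 e1 e2
  refine ⟨r.N, _, _, fun u ↦ c.proj (r.pt u), r.q, fun u ↦ (hr u).2, fun u ↦ (hr u).1.2, _, hπ, _,
    fun u ↦ c.proj_φ (r.pt u), congrArg c.proj r.pt_q, r.etale_pt c, ?_⟩
  refine (HomCongAt.refl.add ((d5.congr (.of_forall fun u ↦ (c2 u).symm)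
    (.of_forall fun u ↦ rfl)).symm.trans e3)).congr
    (.of_forall d6) (.of_forall fun u ↦ ?_)
  refine (c3 u).trans ?_
  have e4 : ∀ v, vy.lamHat ⟨r.Q u, hQy u⟩ v = y.lamHat ⟨r.Q u, r.mem_Q u⟩ v + ck' u v := fun v ↦ by
    have := congrArg (fun t ↦ t v) (d4 u)
    simpa [TwoMorRep.hatAt] using this
  refine ContinuousLinearMap.ext fun e ↦ ?_
  have e5 := congrArg (fun t ↦ t e) (c1 u)
  have e6 : vx.hatAt (a := fun u ↦ Φ.π (r.P u)) hPx (fun _ ↦ rfl) r.hPQ u e =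
    x.hatAt r.mem_P (fun _ ↦ rfl) r.hPQ u e +
    ck u e := congrArg (fun t ↦ t e) (d2 u)
  refine Eq.trans ?_ (congrArg (· + (Ψ.tangentMap (r.Q u) (ck u e) + (y.lamHat ⟨r.Q u, r.mem_Q u⟩
    (rho'' u e - rho u e) + ck' u (rho'' u e)))) e5.symm)
  change Ψ.tangentMap (r.Q u) (vx.hatAt (a := fun u ↦ Φ.π (r.P u)) hPx _ r.hPQ u e) + vy.lamHat
    ⟨r.Q u, hQy u⟩ (rho'' u e) = _
  rw [e6, e4, map_add, map_sub]
  simp only [horizHat, add_apply, clm_comp_apply]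
  abel

lemma TwoMor.comp_hcomp (hS : IsOpen S) (hT : IsOpen T) (hST : MapsTo f S T) (hST' : MapsTo f' S T)
    (η : TwoMor Φ Φ') (θ : TwoMor Ψ Ψ') (η' : TwoMor Φ' Φ'') (θ' : TwoMor Ψ' Ψ'') :
    hcomp c c'' hST (η.comp η') (θ.comp θ') = (hcomp c c' hST η θ).comp (hcomp c' c'' hST' η' θ') :=
    by
  obtain ⟨x, rfl⟩ := η.exists_rep
  obtain ⟨y, rfl⟩ := θ.exists_rep
  obtain ⟨x', rfl⟩ := η'.exists_rep
  obtain ⟨y', rfl⟩ := θ'.exists_rep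
  obtain ⟨vx, Hx⟩ := exists_vert x x'
  obtain ⟨vy, Hy⟩ := exists_vert y y'
  obtain ⟨z, H⟩ := exists_horiz c c' x y hST
  obtain ⟨z', H'⟩ := exists_horiz c' c'' x' y' hST'
  obtain ⟨vz, Hz⟩ := exists_vert z z'
  obtain ⟨zz, HH⟩ := exists_horiz c c'' vx vy hST
  rw [comp_eq hS Hx, comp_eq hT Hy, hcomp_eq hS hST H, hcomp_eq hS hST' H', comp_eq hS Hz,
    hcomp_eq hS hST HH, toTwoMor_eq_iff.2 (IsHorizRep.interchange hS hST H H' Hx Hy Hz HH)]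

/-- The horizontal composition of identities is the identity. -/
lemma TwoMor.hcomp_id (hS : IsOpen S) (hST : MapsTo f S T) :
    hcomp c c hST (id Φ) (id Ψ) = id Ξ := by
  obtain ⟨z, H⟩ := exists_horiz c c (idRep Φ) (idRep Ψ) hST
  have e1 := isIdRep_idRep Φ
  have e2 := isIdRep_idRep Ψ
  have e3 := isIdRep_idRep Ξ
  refine (hcomp_eq hS hST H).trans (toTwoMor_eq_iff.2 (equiv_of_flat hS
    (H.lamHat_eq_zero e1.lamHat_eq e2.lamHat_eq) e3.lamHat_eq fun p hp ↦ ?_))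
  obtain ⟨w, rfl⟩ := c.surj p
  rw [H.lam_of_eq (z.core_subset hp) (c.mem_core_left.1 hp).1 (e1.lam_eq _) (e2.lam_eq _),
    e3.lam_eq]

end Interchange

section Unitors

/-! ### Naturality of the unitors -/

lemma fiberCast_id_mfderiv {n : ℕ} {V : Type*} [TopologicalSpace V] [ChartedSpace 𝔼[n] V]
    {b : V → V} (h : ∀ v, b v = v) {v : V} (e : TangentSpace (𝓡 n) v) :
    fiberCast (TangentSpace (𝓡 n)) (h v) (D[n,n] b v e) = e := by
  refine (fiberCast_mfderiv (c := id) h e).trans ?_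
  rw [mfderiv_id]
  rfl

lemma congT_zero_left {m : ℕ} {N : Type*} [TopologicalSpace N] [ChartedSpace 𝔼[m] N] {a : N → K.V}
    {b c : N → L.V} {t : ∀ u, K.E (a u) →L[ℝ] L.T (b u)} {t' : ∀ u, K.E (a u) →L[ℝ] L.T (c u)}
    {q : N} (h : CongT m K L a b c t t' q) (ht : ∀ u, t u = 0) :
    CongT m K L a c c (fun _ ↦ 0) t' q :=
  ⟨rfl, fun β hβ e he ↦ (h.2 β hβ e he).congr (.of_forall fun u ↦ by simp [ht])⟩

lemma horizHat_apply {f f' : C(X, Y)} {g g' : C(Y, Z)} {Φ : OneMor K L f S} {Φ' : OneMor K L f' S}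
    {Ψ : OneMor L M g T} {Ψ' : OneMor L M g' T} (x : TwoMorRep Φ Φ') (y : TwoMorRep Ψ Ψ')
    {N : Type*} {P : N → Φ.P} {Q : N → Ψ.P} (hP : ∀ u, P u ∈ x.dom) (hQ : ∀ u, Q u ∈ y.dom)
    {a : N → K.V} (ha : ∀ u, a u = Φ.π (P u)) (hPQ : ∀ u, Φ.φ (P u) = Ψ.π (Q u))
    (rho : ∀ u, K.E (a u) →L[ℝ] L.E (Ψ.π (Q u))) (u : N) (e : K.E (a u)) :
    horizHat x y hP hQ ha hPQ rho u e = Ψ.tangentMap (Q u) (fiberCast L.T (hPQ u)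
      (x.lamHat ⟨P u, hP u⟩ (fiberCast K.E (ha u) e))) + y.lamHat ⟨Q u, hQ u⟩ (rho u e) := by
  simp [horizHat, TwoMorRep.hatAt]

namespace IdData

variable {i : C(Y, Y)} {I : OneMor L L i T} (d : IdData I)

lemma smooth_e (γ : L.Γ) : C∞[L.dim,L.dim] fun v ↦ d.e (v, γ) :=
  (d.e_smooth γ).contMDiff

lemma φ_one (v : L.V) : I.φ (d.e (v, 1)) = v := (d.e_φ v 1).trans (one_smul _ v)

lemma tangentMap_one (v : L.V) (e : L.T (I.π (d.e (v, 1)))) :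
    fiberCast L.T (d.φ_one v) (I.tangentMap (d.e (v, 1)) e) = fiberCast L.T (d.e_π v 1) e := by
  have h1 := I.tangentMap_mfderiv ((d.smooth_e 1).mdifferentiable (by simp) v)
    (fiberCast L.T (d.e_π v 1) e)
  have h2 := fiberCast_id_mfderiv (fun v ↦ d.e_π v 1) (fiberCast L.T (d.e_π v 1) e)
  have h3 := fiberCast_id_mfderiv d.φ_one (fiberCast L.T (d.e_π v 1) e)
  have h4 := congrArg (fiberCast L.T (d.e_π v 1).symm) h2
  simp only [fiberCast_fiberCast, fiberCast_rfl, clm_id_apply] at h4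
  rw [← h1, h4] at h3
  exact h3

lemma hat_one (v : L.V) (e : L.E (I.π (d.e (v, 1)))) :
    fiberCast L.E (d.φ_one v) (I.hat (d.e (v, 1)) e) = fiberCast L.E (d.e_π v 1) e := by
  have h1 := d.e_hat v 1 (fiberCast L.E (d.e_π v 1) e)
  simp only [fiberCast_fiberCast, fiberCast_rfl, clm_id_apply] at h1
  rw [h1, fiberCast_fiberCast]
  exact L.lift_one v _

end IdData

variable {h h' : C(X, Y)} {Ξ : OneMor K L h S} {Ξ' : OneMor K L h' S} {x : TwoMorRep Φ Φ'}

theorem IsBetaRep.naturality (hS : IsOpen S) {i : C(X, X)} {I : OneMor K K i S} {d : IdData I}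
    {c : CompData I Φ Ξ} {c' : CompData I Φ' Ξ'} {y : TwoMorRep I I} (hy : IsIdRep y)
    {v : TwoMorRep Ξ Ξ'} (H : IsHorizRep c c' y x v) {z : TwoMorRep Ξ Φ} (Z : IsBetaRep d c z)
    {z' : TwoMorRep Ξ' Φ'} (Z' : IsBetaRep d c' z') {V V' : TwoMorRep Ξ Φ'} (hV : IsVertRep z x V)
    (hV' : IsVertRep v z' V') : V.Equiv V' := by
  have hP : Étale[K.dim] fun u : Φ.P ↦ d.e (Φ.π u, 1) := fun u ↦
    (d.e_smooth 1 _).fun_comp (Φ.π_etale u)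
  have hj := c.etale_probe (fun u ↦ d.φ_one (Φ.π u)) hP continuous_id
  have hz : ∀ u, z.lam ⟨c.proj ⟨(d.e (Φ.π u, 1), u), d.φ_one (Φ.π u)⟩, Z.mem _⟩ = u := fun u ↦ by
    simpa using Z.lam_eq _ 1 u (d.φ_one (Φ.π u))
  refine equiv_of_hatAt hS fun p hp ↦ ?_
  obtain ⟨⟨⟨a, p₀⟩, hw⟩, rfl⟩ := c.surj p
  obtain ⟨⟨b, γ⟩, rfl⟩ := d.e.surjective a
  obtain ⟨p, hp'⟩ : ∃ p, c.proj ⟨(d.e (b, γ), p₀), hw⟩ =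
      c.proj ⟨(d.e (Φ.π p, 1), p), d.φ_one (Φ.π p)⟩ := by
    refine ⟨Φ.actL γ⁻¹ p₀, (c.proj_eq_iff _ _).2 ⟨γ⁻¹, ?_, rfl⟩⟩
    simp only [d.e_actR, Φ.π_actL, ← hw, d.e_φ, inv_smul_smul, inv_mul_cancel]
  rw [hp'] at hp
  simp only [hp']
  have hpc : p ∈ Φ.core := by
    have := z.mem_core_lam (p := ⟨_, Z.mem _⟩) hp
    rwa [hz] at this
  have hv : v.lam ⟨_, v.core_subset hp⟩ = c'.proj ⟨(d.e (Φ'.π (x.lam ⟨p, x.core_subset hpc⟩), 1),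
      x.lam ⟨p, x.core_subset hpc⟩), d.φ_one _⟩ :=
    H.lam_of_eq (v.core_subset hp) (c.mem_core_left.1 hp).1 ((hy.lam_eq _).trans
      (by simp only [x.lam_π])) rfl
  have hVz : ∀ u : Φ.P, c.proj ⟨(d.e (Φ.π u, 1), u), d.φ_one (Φ.π u)⟩ ∈ V.dom → u ∈ x.dom :=
    fun u hu ↦ hz u ▸ hV.lam_mem ⟨_, hu⟩
  refine ⟨?_, ?_⟩
  · rw [hV.lam_of_eq _ (Z.mem _) (x.core_subset hpc) (hz p),
      hV'.lam_of_eq _ (v.core_subset hp) (Z'.mem _) hv, Z'.lam_eq]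
    simp
  let U : Opens Φ.P := ⟨_, (V.dom ⊓ V'.dom).2.preimage hj.contMDiff.continuous⟩
  have hU : p ∈ U := ⟨V.core_subset hp, V'.core_subset hp⟩
  have hUs := contMDiff_subtype_val (U := U) (I := 𝓡 K.dim) (n := ∞)
  have hj' : Étale[K.dim] fun u : U ↦ c.proj ⟨(d.e (Φ.π u, 1), u.1), d.φ_one (Φ.π u)⟩ := fun u ↦
    (hj u).fun_comp (etale_val U u)
  have hπ : ∀ u : U, Φ.π u = Ξ.π (c.proj ⟨(d.e (Φ.π u, 1), u.1), d.φ_one (Φ.π u)⟩) := fun u ↦ by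
    rw [c.proj_π, d.e_π]
  have hφ := fun u : U ↦ c.proj_φ ⟨(d.e (Φ.π u, 1), u.1), d.φ_one (Φ.π u)⟩
  have hxd : ∀ u : U, (u : Φ.P) ∈ x.dom := fun u ↦ hVz u u.2.1
  obtain ⟨ck, -, b1, b2⟩ := hV.hatAt (q := (⟨p, hU⟩ : U)) hj'.contMDiff (fun u ↦ Z.mem _)
    (fun u ↦ u.2.1) hUs hxd hπ (fun _ ↦ rfl) hφ (fun _ ↦ rfl) hp (hz p)
  obtain ⟨ck', -, b1', b2'⟩ := hV'.hatAt (q := (⟨p, hU⟩ : U)) hj'.contMDiff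
    (fun u ↦ hV'.dom_le u.2.2) (fun u ↦ u.2.2) (v.contMDiff_lam_comp hj'.contMDiff
    (fun u ↦ hV'.dom_le u.2.2)) (fun u ↦ Z'.mem _) hπ
    (fun u ↦ (hπ u).trans (v.lam_π ⟨_, hV'.dom_le u.2.2⟩).symm) hφ (fun _ ↦ rfl) hp rfl
  obtain ⟨rho, -, r1, r2⟩ := H.hatAt (P := fun u : U ↦ d.e (Φ.π u, 1)) (Q := fun u : U ↦ u.1)
    (hP.contMDiff.comp hUs) (fun u ↦ d.φ_one (Φ.π u)) (fun u ↦ hV'.dom_le u.2.2)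
    (fun u ↦ hy.mem _) hxd (a := fun u ↦ Φ.π u) (fun u ↦ (d.e_π _ _).symm) hπ
  refine ⟨U, _, _, _, ⟨p, hU⟩, fun u ↦ u.2.1, fun u ↦ u.2.2, _, hπ, _, hφ, rfl, hj', ?_⟩
  have r3 := r1 (fun u ↦ Φ.π u) (fun u ↦ by rw [hy.lam_eq, d.φ_one]) ⟨p, hU⟩
    (c.mem_core_left.1 hp).1
  have r4 := HomCongAt.lamHat_comp x hxd hxd hUs hUs rfl r3
  refine ((b1.symm.trans (r4.congr (.of_forall fun u ↦ ?_) (.of_forall fun u ↦ rfl))).add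
    (congT_zero_left b1' fun u ↦ by simp [TwoMorRep.hatAt, Z'.lamHat_eq])).congr
    (.of_forall fun u ↦ ?_) (.of_forall fun u ↦ ?_)
  · ext e
    have e1 := apply_fiberCast I.hat (hy.lam_eq ⟨d.e (Φ.π u, 1), hy.mem _⟩).symm
      (by rw [hy.lam_eq]) (by rw [hy.lam_eq]) (fiberCast K.E (d.e_π (Φ.π u) 1).symm e)
    have e2 := d.hat_one (Φ.π u) (fiberCast K.E (d.e_π (Φ.π u) 1).symm e)
    simp only [fiberCast_fiberCast, fiberCast_rfl, clm_id_apply] at e1 e2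
    simp [OneMor.hatAlong, e1, e2, TwoMorRep.hatAt]
  · rw [b2, add_zero]
    simp [TwoMorRep.hatAt, Z.lamHat_eq]
  · rw [b2']
    refine (congrArg (· + ck' u) (r2 u)).trans (congrArg (· + ck' u) ?_)
    ext e
    simp [horizHat_apply, hy.lamHat_eq]

theorem IsGammaRep.naturality (hS : IsOpen S) {i : C(Y, Y)} {I : OneMor L L i T} {d : IdData I}
    {c : CompData Φ I Ξ} {c' : CompData Φ' I Ξ'} {y : TwoMorRep I I} (hy : IsIdRep y)
    {v : TwoMorRep Ξ Ξ'} (H : IsHorizRep c c' x y v) {z : TwoMorRep Ξ Φ} (Z : IsGammaRep d c z)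
    {z' : TwoMorRep Ξ' Φ'} (Z' : IsGammaRep d c' z') {V V' : TwoMorRep Ξ Φ'} (hV : IsVertRep z x V)
    (hV' : IsVertRep v z' V') : V.Equiv V' := by
  have hQ : C∞[K.dim,L.dim] fun u : Φ.P ↦ d.e (Φ.φ u, 1) := (d.smooth_e 1).comp Φ.φ_smooth
  have hPQ : ∀ u : Φ.P, Φ.φ u = I.π (d.e (Φ.φ u, 1)) := fun u ↦ (d.e_π _ _).symm
  have hid : Étale[K.dim] (id : Φ.P → Φ.P) := (Diffeomorph.refl (𝓡 K.dim) Φ.P ∞).isLocalDiffeomorph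
  have hj := c.etale_probe (P := id) hPQ hid hQ.continuous
  have hz : ∀ u, z.lam ⟨c.proj ⟨(u, d.e (Φ.φ u, 1)), hPQ u⟩, Z.mem _⟩ = u := fun u ↦ by
    simpa using Z.lam_eq u _ 1 (hPQ u)
  refine equiv_of_hatAt hS fun p hp ↦ ?_
  obtain ⟨⟨⟨p₀, a⟩, hw⟩, rfl⟩ := c.surj p
  obtain ⟨⟨b, γ⟩, rfl⟩ := d.e.surjective a
  obtain ⟨p, hp'⟩ : ∃ p, c.proj ⟨(p₀, d.e (b, γ)), hw⟩ = c.proj ⟨(p, d.e (Φ.φ p, 1)), hPQ p⟩ := by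
    refine ⟨Φ.actR γ p₀, (c.proj_eq_iff _ _).2 ⟨γ, rfl, ?_⟩⟩
    simp only [d.e_actL, Φ.φ_actR, hw, d.e_π, mul_inv_cancel]
  rw [hp'] at hp
  simp only [hp']
  have hpc : p ∈ Φ.core := c.mem_core_left.1 hp
  have hv : v.lam ⟨_, v.core_subset hp⟩ = c'.proj ⟨(x.lam ⟨p, x.core_subset hpc⟩,
      d.e (Φ'.φ (x.lam ⟨p, x.core_subset hpc⟩), 1)), (d.e_π _ _).symm⟩ :=
    H.lam_of_eq (v.core_subset hp) hpc.1 rfl ((hy.lam_eq _).trans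
      (by simp only [x.φ_lam (p := ⟨p, x.core_subset hpc⟩) hpc.1]))
  have hVz : ∀ u : Φ.P, c.proj ⟨(u, d.e (Φ.φ u, 1)), hPQ u⟩ ∈ V.dom → u ∈ x.dom :=
    fun u hu ↦ hz u ▸ hV.lam_mem ⟨_, hu⟩
  refine ⟨?_, ?_⟩
  · rw [hV.lam_of_eq _ (Z.mem _) (x.core_subset hpc) (hz p),
      hV'.lam_of_eq _ (v.core_subset hp) (Z'.mem _) hv, Z'.lam_eq]
    simp
  let U : Opens Φ.P := ⟨_, (V.dom ⊓ V'.dom).2.preimage hj.contMDiff.continuous⟩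
  have hU : p ∈ U := ⟨V.core_subset hp, V'.core_subset hp⟩
  have hUs := contMDiff_subtype_val (U := U) (I := 𝓡 K.dim) (n := ∞)
  have hj' : Étale[K.dim] fun u : U ↦ c.proj ⟨(u.1, d.e (Φ.φ u, 1)), hPQ u⟩ := fun u ↦
    (hj u).fun_comp (etale_val U u)
  have hπ : ∀ u : U, Φ.π u = Ξ.π (c.proj ⟨(u.1, d.e (Φ.φ u, 1)), hPQ u⟩) := fun u ↦
    (c.proj_π ⟨(u.1, d.e (Φ.φ u, 1)), hPQ u⟩).symm
  have hφ := fun u : U ↦ (c.proj_φ ⟨(u.1, d.e (Φ.φ u, 1)), hPQ u⟩).trans (d.φ_one _)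
  have hxd : ∀ u : U, (u : Φ.P) ∈ x.dom := fun u ↦ hVz u u.2.1
  obtain ⟨ck, -, b1, b2⟩ := hV.hatAt (q := (⟨p, hU⟩ : U)) hj'.contMDiff (fun u ↦ Z.mem _)
    (fun u ↦ u.2.1) hUs hxd hπ (fun _ ↦ rfl) hφ (fun _ ↦ rfl) hp (hz p)
  obtain ⟨ck', -, b1', b2'⟩ := hV'.hatAt (q := (⟨p, hU⟩ : U)) hj'.contMDiff
    (fun u ↦ hV'.dom_le u.2.2) (fun u ↦ u.2.2) (v.contMDiff_lam_comp hj'.contMDiff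
    (fun u ↦ hV'.dom_le u.2.2)) (fun u ↦ Z'.mem _) hπ
    (fun u ↦ (hπ u).trans (v.lam_π ⟨_, hV'.dom_le u.2.2⟩).symm) hφ (fun _ ↦ rfl) hp rfl
  obtain ⟨rho, -, -, r2⟩ := H.hatAt (P := fun u : U ↦ u.1) (Q := fun u : U ↦ d.e (Φ.φ u, 1))
    hUs (fun u ↦ hPQ u) (fun u ↦ hV'.dom_le u.2.2) hxd (fun u ↦ hy.mem _) (fun _ ↦ rfl) hπ
  refine ⟨U, _, _, _, ⟨p, hU⟩, fun u ↦ u.2.1, fun u ↦ u.2.2, _, hπ, _, hφ, rfl, hj', ?_⟩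
  refine (b1.symm.add (congT_zero_left b1' fun u ↦ by simp [TwoMorRep.hatAt, Z'.lamHat_eq])).congr
    (.of_forall fun u ↦ ?_) (.of_forall fun u ↦ ?_)
  · rw [b2, add_zero]
    simp [TwoMorRep.hatAt, Z.lamHat_eq]
  · rw [b2']
    refine congrArg (· + ck' u) (ContinuousLinearMap.ext fun e ↦ ?_)
    have e1 := congrArg (fun t ↦ fiberCast L.T (d.φ_one (Φ.φ u)) (t e)) (r2 u)
    have e2 := d.tangentMap_one (Φ.φ u) (fiberCast L.T (hPQ u) (x.lamHat ⟨u, hxd u⟩ e))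
    simp only [horizHat_apply, hy.lamHat_eq, zero_apply, add_zero, fiberCast_rfl,
      clm_id_apply] at e1
    rw [e2] at e1
    simpa [TwoMorRep.hatAt] using e1

end Unitors

section Associator

variable {O : KurNbhd W} {k k' : C(Z, W)} {gf gf' : C(X, Z)} {kg kg' : C(Y, W)}
  {h h' h₁ h₁' : C(X, W)} {Θ : OneMor M O k R} {Θ' : OneMor M O k' R} {ΨΦ : OneMor K M gf S}
  {ΨΦ' : OneMor K M gf' S} {ΘΨ : OneMor L O kg T} {ΘΨ' : OneMor L O kg' T}

/-! ### Naturality of the associator -/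

lemma CompData.tangentMap_proj (c : CompData Φ Ψ ΨΦ) (w : FibProd Φ Ψ) (v : K.T (Φ.π w.1.1)) :
    ΨΦ.tangentMap (c.proj w) (fiberCast K.T (c.proj_π w).symm v) = fiberCast M.T (c.proj_φ w).symm
    (Ψ.tangentMap w.1.2 (fiberCast L.T w.2 (Φ.tangentMap w.1.1 v))) := by
  obtain ⟨U, hU, Q, hQ, hQs, hQw, -⟩ := FibProd.exists_slice w univ_mem
  obtain ⟨p, hp⟩ : ∃ p : U, w = ⟨(p, Q p), hQ p⟩ := ⟨⟨_, hU⟩, Subtype.ext (Prod.ext rfl hQw.symm)⟩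
  clear hQw
  subst hp
  have hUs := contMDiff_subtype_val (U := U) (I := 𝓡 K.dim) (n := ∞)
  have hπ := (Φ.π_etale p).fun_comp (etale_val U p)
  obtain ⟨e, rfl⟩ : ∃ e, D[K.dim,K.dim] (fun u : U ↦ Φ.π u) p e = v := ⟨_, hπ.mfderiv_inverse v⟩
  have e1 := Φ.tangentMap_mfderiv (hUs.mdifferentiable (by simp) p) e
  have e2 := Ψ.tangentMap_mfderiv (hQs.mdifferentiable (by simp) p) e
  have e3 := ΨΦ.tangentMap_mfderiv ((c.contMDiff_probe hQ hUs hQs.continuous).mdifferentiable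
    (by simp) p) e
  have e4 := fiberCast_mfderiv (m := K.dim) (n := L.dim) hQ e
  have e5 := fiberCast_mfderiv (m := K.dim) (n := K.dim)
    (fun u ↦ (c.proj_π ⟨(u.1, Q u), hQ u⟩).symm) e
  have e6 := fiberCast_mfderiv (m := K.dim) (n := M.dim)
    (fun u ↦ (c.proj_φ ⟨(u.1, Q u), hQ u⟩).symm) e
  rw [← e5] at e3
  rw [← e6, ← e2, ← e4, ← e1] at e3
  exact e3

variable {x : TwoMorRep Φ Φ'} {y : TwoMorRep Ψ Ψ'} {t : TwoMorRep Θ Θ'}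

/-- Congruences may be composed with the bundle morphism `lam^*(φhat')`. -/
lemma HomCongAt.hat_lam_comp {m : ℕ} {N : Type*} [TopologicalSpace N] [ChartedSpace 𝔼[m] N]
    {a : N → K.V} {q : N} {Q Q₁ : N → Ψ.P} (y : TwoMorRep Ψ Ψ') (hQ : ∀ u, Q u ∈ y.dom)
    (hQ₁ : ∀ u, Q₁ u ∈ y.dom) (hQs : C∞[m,L.dim] Q) (hQs₁ : C∞[m,L.dim] Q₁) (hq : Q₁ q = Q q)
    {t₁ : ∀ u, K.E (a u) →L[ℝ] L.E (Ψ.π (Q₁ u))} {t₂ : ∀ u, K.E (a u) →L[ℝ] L.E (Ψ.π (Q u))}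
    (h : CongE m K L a (fun u ↦ Ψ.π (Q₁ u)) (fun u ↦ Ψ.π (Q u)) t₁ t₂ q) :
    CongE m K M a (fun u ↦ Ψ'.φ (y.lam ⟨Q₁ u, hQ₁ u⟩)) (fun u ↦ Ψ'.φ (y.lam ⟨Q u, hQ u⟩))
    (fun u ↦ (Ψ'.hatAlong (fun u ↦ (y.lam_π ⟨Q₁ u, hQ₁ u⟩).symm) (fun _ ↦ rfl) u).comp (t₁ u))
    (fun u ↦ (Ψ'.hatAlong (fun u ↦ (y.lam_π ⟨Q u, hQ u⟩).symm) (fun _ ↦ rfl) u).comp (t₂ u)) q := by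
  have hR : ∀ p : y.dom, SmHom L.dim L.dim L.F L.E M.dim M.F M.E (fun p : y.dom ↦ Ψ.π p)
      (fun p : y.dom ↦ Ψ'.φ (y.lam p)) (Ψ'.hatAlong (fun p ↦ (y.lam_π p).symm) fun _ ↦ rfl) p :=
    Ψ'.smE_hatAlong y.lam_smooth _ _
  exact HomCongAt.etale_comp (b := fun u ↦ (⟨Q₁ u, hQ₁ u⟩ : y.dom)) (c := fun u ↦ ⟨Q u, hQ u⟩)
    (π := fun p : y.dom ↦ Ψ.π p) (ψ := fun p : y.dom ↦ Ψ'.φ (y.lam p))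
    (R := Ψ'.hatAlong (fun p ↦ (y.lam_π p).symm) fun _ ↦ rfl)
    (hQs₁.continuous.subtype_mk _).continuousAt (hQs.continuous.subtype_mk _).continuousAt
    (Subtype.ext hq) h ((Ψ.π_etale _).fun_comp (etale_val y.dom _))
    (Ψ'.φ_smooth.comp y.lam_smooth) hR

variable {c : CompData Φ Ψ ΨΦ} {c' : CompData Φ' Ψ' ΨΦ'} {xy : TwoMorRep ΨΦ ΨΦ'}

/-- In a horizontal composition of three 2-morphisms, the bundle morphism `rho` chosen for the
composition `xy` of the first two is the composition of those chosen for the factors. -/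
lemma IsHorizRep.congE_rho (H : IsHorizRep c c' x y xy) {w : FibProd Φ Ψ} (h0 : K.s (Φ.π w.1.1) = 0)
    (r : HorizProbe x y w) (hxy : ∀ u, c.proj (r.pt u) ∈ xy.dom) {b : r.N → M.V}
    {rho₁ : ∀ u, K.E (Φ.π (r.P u)) →L[ℝ] M.E (b u)}
    (h₁ : CongE K.dim K M (fun u ↦ Φ.π (r.P u)) (fun u ↦ ΨΦ'.φ (xy.lam ⟨_, hxy u⟩)) b
      (ΨΦ'.hatAlong (fun u ↦ (c.proj_π (r.pt u)).symm.trans (xy.lam_π ⟨_, hxy u⟩).symm)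
        fun _ ↦ rfl) rho₁ r.q) {sigma : ∀ u, K.E (Φ.π (r.P u)) →L[ℝ] L.E (Ψ.π (r.Q u))}
    (hs : ∀ u, SmE K.dim K L (fun u ↦ Φ.π (r.P u)) (fun u ↦ Ψ.π (r.Q u)) sigma u)
    (h₂ : CongE K.dim K L (fun u ↦ Φ.π (r.P u)) (fun u ↦ Ψ.π (r.Q₁ u)) (fun u ↦ Ψ.π (r.Q u))
      (Φ'.hatAlong (fun u ↦ (x.lam_π ⟨r.P u, r.mem_P u⟩).symm) r.hPQ₁) sigma r.q)
    {rho : ∀ u, L.E (Ψ.π (r.Q u)) →L[ℝ] M.E (b u)}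
    (h₃ : CongE K.dim L M (fun u ↦ Ψ.π (r.Q u)) (fun u ↦ Ψ'.φ (y.lam ⟨r.Q u, r.mem_Q u⟩)) b
      (Ψ'.hatAlong (fun u ↦ (y.lam_π ⟨r.Q u, r.mem_Q u⟩).symm) fun _ ↦ rfl) rho r.q) :
    CongE K.dim K M (fun u ↦ Φ.π (r.P u)) b b rho₁ (fun u ↦ (rho u).comp (sigma u)) r.q := by
  obtain ⟨τ, t1, t2, -⟩ := Φ.exists_hatAlong_exact r.smooth_P (fun _ ↦ rfl) r.hPQ
  have hqq : r.Q₁ r.q = r.Q r.q := r.Q₁_q.trans r.Q_q.symm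
  have a1 := HomCongAt.hat_lam_comp y r.mem_Q r.mem_Q₁ r.smooth_Q r.smooth_Q₁ hqq h₂
  have a2 := h₃.precomp τ (s := K.s) (.of_forall fun u ↦ ⟨t1 u, t2 u⟩) (.of_forall hs)
  refine (HomCongAt.congr_left h₁ ?_).symm.trans (a1.trans a2)
  filter_upwards [(H.eventually_lam h0 r hxy).2] with u hu
  obtain ⟨e, he⟩ := ΨΦ'.hatAlong_congr (j := fun u ↦ xy.lam ⟨_, hxy u⟩)
    (j' := fun u ↦ c'.proj (r.pt' u))
    (fun u ↦ (c.proj_π (r.pt u)).symm.trans (xy.lam_π ⟨_, hxy u⟩).symm)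
    (fun u ↦ (x.lam_π ⟨r.P u, r.mem_P u⟩).symm.trans (c'.proj_π (r.pt' u)).symm)
    (fun _ ↦ rfl) (fun u ↦ c'.proj_φ (r.pt' u)) hu
  refine ⟨e, fun v ↦ (he v).trans ?_⟩
  have := c'.proj_hat (r.pt' u) (fiberCast K.E (x.lam_π ⟨r.P u, r.mem_P u⟩).symm v)
  erw [fiberCast_fiberCast] at this
  refine (congrArg (fiberCast M.E (c'.proj_φ (r.pt' u))) this).trans ?_
  refine (fiberCast_fiberCast ..).trans ?_
  exact congrArg (fun v ↦ fiberCast M.E rfl (Ψ'.hat (y.lam ⟨r.Q₁ u, r.mem_Q₁ u⟩) v))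
    (fiberCast_fiberCast L.E (r.hPQ₁ u) (y.lam_π ⟨r.Q₁ u, r.mem_Q₁ u⟩).symm _).symm

variable {Ξ : OneMor K O h S} {Ξ' : OneMor K O h' S} {Ξ₁ : OneMor K O h₁ S} {Ξ₁' : OneMor K O h₁' S}
  {c₁ : CompData ΨΦ Θ Ξ₁} {c₁' : CompData ΨΦ' Θ' Ξ₁'} {d : CompData Ψ Θ ΘΨ}
  {d' : CompData Ψ' Θ' ΘΨ'} {d₁ : CompData Φ ΘΨ Ξ} {d₁' : CompData Φ' ΘΨ' Ξ'}
  {yt : TwoMorRep ΘΨ ΘΨ'} {v : TwoMorRep Ξ₁ Ξ₁'} {v' : TwoMorRep Ξ Ξ'} {z : TwoMorRep Ξ Ξ₁}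
  {z' : TwoMorRep Ξ' Ξ₁'} {V V' : TwoMorRep Ξ Ξ₁'}

/-- A parametrized neighbourhood of a point of the iterated fibre product. -/
lemma exists_assoc_probe (d : CompData Ψ Θ ΘΨ) (d₁ : CompData Φ ΘΨ Ξ) {w : FibProd Φ Ψ} {r₀ : Θ.P}
    (hw : Ψ.φ w.1.2 = Θ.π r₀) (hx : w.1.1 ∈ x.dom) (hy : w.1.2 ∈ y.dom) (h0 : K.s (Φ.π w.1.1) = 0)
    (D : Opens Ξ.P) (hD : d₁.proj ⟨(w.1.1, d.proj ⟨(w.1.2, r₀), hw⟩),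
      w.2.trans (d.proj_π ⟨(w.1.2, r₀), hw⟩).symm⟩ ∈ D) :
    ∃ (r : HorizProbe x y w) (R : r.N → Θ.P) (hR : ∀ u, Ψ.φ (r.Q u) = Θ.π (R u)), C∞[K.dim,M.dim] R
    ∧ R r.q = r₀ ∧ ∀ u, d₁.proj
    ⟨(r.P u, d.proj ⟨(r.Q u, R u), hR u⟩), (r.hPQ u).trans (d.proj_π ⟨(r.Q u, R u), hR u⟩).symm⟩ ∈ D
    := by
  obtain ⟨r, -, -⟩ := FibProd.exists_probe hx hy h0 univ_mem univ_mem
  obtain ⟨U, hU, σ, s1, s2, s3, -, -⟩ := exists_local_lift (Θ.π_etale r₀)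
    (Ψ.φ_smooth.comp r.smooth_Q) (x₀ := r.q) (by simpa [r.Q_q] using hw) univ_mem
    univ_mem
  have hJ := d₁.continuous_probe (P := fun u : U ↦ r.P u)
    (Q := fun u : U ↦ d.proj ⟨(r.Q u, σ u), s2 u⟩)
    (fun u ↦ (r.hPQ u).trans (d.proj_π ⟨(r.Q u, σ u), s2 u⟩).symm)
    (r.smooth_P.continuous.comp continuous_subtype_val)
    (d.continuous_probe _ (r.smooth_Q.continuous.comp continuous_subtype_val) s1.continuous)
  refine ⟨(r.restrict U hU).restrict ⟨_, D.2.preimage hJ⟩ ?_, fun u ↦ σ u.1, fun u ↦ s2 u.1,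
    s1.comp contMDiff_subtype_val, s3, fun u ↦ u.2⟩
  refine (congrArg (· ∈ D) (congrArg d₁.proj (Subtype.ext (Prod.ext r.P_q ?_)))).mpr hD
  exact congrArg d.proj (Subtype.ext (Prod.ext r.Q_q s3))

theorem IsAssocRep.naturality (hS : IsOpen S) (hST : MapsTo f S T) (Z : IsAssocRep c c₁ d d₁ z)
    (Z' : IsAssocRep c' c₁' d' d₁' z') (Hxy : IsHorizRep c c' x y xy) (H : IsHorizRep c₁ c₁' xy t v)
    (Hyt : IsHorizRep d d' y t yt) (H' : IsHorizRep d₁ d₁' x yt v') (hV : IsVertRep z v V)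
    (hV' : IsVertRep v' z' V') : V.Equiv V' := by
  refine equiv_of_hatAt hS fun p hp ↦ ?_
  obtain ⟨⟨⟨p, b⟩, hb⟩, rfl⟩ := d₁.surj p
  obtain ⟨⟨⟨q, r₀⟩, hqr⟩, rfl⟩ := d.surj b
  have hpq : Φ.φ p = Ψ.π q := hb.trans (d.proj_π _)
  have m1 : p ∈ Φ.core := d₁.mem_core_left.1 hp
  have m2 : q ∈ Ψ.core := FibProd.mem_core_right hST (w := ⟨(p, q), hpq⟩) m1
  have ez := Z.lam_eq p q r₀ hpq hqr
  have mz := z.mem_core_lam (p := ⟨_, Z.mem _⟩) hp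
  rw [ez] at mz
  have mv' := v'.core_subset hp
  have i1 := H.dom_left _ (v.core_subset mz)
  have i2 := H'.dom_right _ mv'
  have e1 := Hxy.lam_of_eq (w := ⟨(p, q), hpq⟩) i1 m1.1 (w' := ⟨(_, _), (Hxy.lam_eq _ i1 m1.1).1⟩)
    rfl rfl
  have h0 : K.s (ΨΦ.π (c.proj ⟨(p, q), hpq⟩)) = 0 := (c.mem_core_left.2 m1).1
  have e2 := (H.lam_eq _ (v.core_subset mz) h0).1
  have e3 := (congrArg ΨΦ'.φ e1).symm.trans e2
  rw [c'.proj_φ] at e3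
  have hL : L.s (Ψ.π q) = 0 := m2.1
  have e4 := H.lam_of_eq (v.core_subset mz) h0 (w' := ⟨(_, _), (c'.proj_φ _).trans e3⟩) e1 rfl
  have e5 := Hyt.lam_of_eq i2 hL (w' := ⟨(_, _), e3⟩) rfl rfl
  have e6 := H'.lam_of_eq mv' m1.1 (w' := ⟨(_, _), (Hxy.lam_eq _ i1 m1.1).1.trans
    (d'.proj_π ⟨(_, _), e3⟩).symm⟩) rfl e5
  refine ⟨?_, ?_⟩
  · rw [hV.lam_of_eq _ (Z.mem _) (v.core_subset mz) ez, e4, hV'.lam_of_eq _ mv' (Z'.mem _) e6,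
      Z'.lam_eq]
  obtain ⟨r, R, hR, hRs, hRq, hr⟩ := exists_assoc_probe (x := x) (y := y) (w := ⟨(p, q), hpq⟩) d d₁
    hqr (x.core_subset m1) (y.core_subset m2) m1.1 (V.dom ⊓ V'.dom)
    ⟨V.core_subset hp, V'.core_subset hp⟩
  have hPd := fun u ↦ (r.hPQ u).trans (d.proj_π ⟨(r.Q u, R u), hR u⟩).symm
  have hc := fun u ↦ (c.proj_φ (r.pt u)).trans (hR u)
  have hdc := d.continuous_probe hR r.smooth_Q.continuous hRs.continuous
  have hj := d₁.etale_probe hPd r.etale_P hdc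
  have hcs := c.contMDiff_probe r.hPQ r.smooth_P r.smooth_Q.continuous
  have hj₁ := c₁.contMDiff_probe hc hcs hRs.continuous
  have hz := fun u ↦ Z.lam_eq (r.P u) (r.Q u) (R u) (r.hPQ u) (hR u)
  have mv : ∀ u, c₁.proj ⟨(c.proj (r.pt u), R u), hc u⟩ ∈ v.dom := fun u ↦ by
    have := hV.lam_mem ⟨_, (hr u).1⟩
    rwa [hz] at this
  have mxy : ∀ u, c.proj (r.pt u) ∈ xy.dom := fun u ↦ H.dom_left _ (mv u)
  have mt : ∀ u, R u ∈ t.dom := fun u ↦ H.dom_right _ (mv u)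
  have mv' := fun u ↦ hV'.dom_le (hr u).2
  have myt : ∀ u, d.proj ⟨(r.Q u, R u), hR u⟩ ∈ yt.dom := fun u ↦ H'.dom_right _ (mv' u)
  have hπ : ∀ u, Φ.π (r.P u) = ΨΦ.π (c.proj (r.pt u)) := fun u ↦ (c.proj_π (r.pt u)).symm
  have hπj := fun u ↦ (d₁.proj_π ⟨(r.P u, d.proj ⟨(r.Q u, R u), hR u⟩), hPd u⟩).symm
  have hφj := fun u ↦ (d₁.proj_φ ⟨(r.P u, d.proj ⟨(r.Q u, R u), hR u⟩), hPd u⟩).trans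
    (d.proj_φ ⟨(r.Q u, R u), hR u⟩)
  have hπ₁ := fun u ↦ (hπ u).trans (c₁.proj_π ⟨(c.proj (r.pt u), R u), hc u⟩).symm
  have hcore : r.P r.q ∈ Φ.core := by rw [r.P_q]; exact m1
  have hjq : d₁.proj ⟨(r.P r.q, d.proj ⟨(r.Q r.q, R r.q), hR r.q⟩), hPd r.q⟩ ∈ Ξ.core :=
    d₁.mem_core_left.2 hcore
  obtain ⟨ck, -, b1, b2⟩ := hV.hatAt hj.contMDiff (fun u ↦ Z.mem _) (fun u ↦ (hr u).1) hj₁ mv hπj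
    hπ₁ hφj (fun u ↦ c₁.proj_φ ⟨(c.proj (r.pt u), R u), hc u⟩) hjq (hz r.q)
  obtain ⟨ck', -, b1', b2'⟩ := hV'.hatAt hj.contMDiff mv' (fun u ↦ (hr u).2)
    (v'.contMDiff_lam_comp hj.contMDiff mv') (fun u ↦ Z'.mem _) hπj
    (fun u ↦ (hπj u).trans (v'.lam_π ⟨_, mv' u⟩).symm) hφj (fun _ ↦ rfl) hjq rfl
  obtain ⟨rho₁, -, B₁, C₁⟩ := H.hatAt hcs hc mv mxy mt hπ hπ₁
  obtain ⟨rhox, -, Bx, Cx⟩ := Hxy.hatAt r.smooth_P r.hPQ mxy r.mem_P r.mem_Q (fun _ ↦ rfl) hπ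
  obtain ⟨rhoy, -, By, Cy⟩ := Hyt.hatAt r.smooth_Q hR myt r.mem_Q mt (fun _ ↦ rfl)
    (fun u ↦ (d.proj_π ⟨(r.Q u, R u), hR u⟩).symm)
  obtain ⟨rho₂, s2, B₂, C₂⟩ := H'.hatAt r.smooth_P hPd mv' r.mem_P myt (fun _ ↦ rfl) hπj
  have hd := fun u ↦ d.proj_π ⟨(r.Q u, R u), hR u⟩
  have Bs : ∀ (b : r.N → L.V) (hb : ∀ u, Φ'.φ (x.lam ⟨r.P u, r.mem_P u⟩) = b u),
      CongE K.dim K L (fun u ↦ Φ.π (r.P u)) b (fun u ↦ Ψ.π (r.Q u))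
        (Φ'.hatAlong (fun u ↦ (x.lam_π ⟨r.P u, r.mem_P u⟩).symm) hb)
        (fun u ↦ (fiberCast L.E (hd u)).comp (rho₂ u)) r.q := fun b hb ↦
    (B₂ b hb r.q hcore.1).cast (fun _ ↦ rfl) (fun _ ↦ rfl) hd (.of_forall fun u e ↦ by simp)
      (.of_forall fun u e ↦ by simp)
  have hL : L.s (Ψ.π (r.Q r.q)) = 0 := by rw [r.Q_q]; exact m2.1
  have hs : ∀ u, SmE K.dim K L (fun u ↦ Φ.π (r.P u)) (fun u ↦ Ψ.π (r.Q u))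
      (fun u ↦ (fiberCast L.E (hd u)).comp (rho₂ u)) u := fun u ↦
    SmHom.comp (smHom_fiberCast hd u) (s2 u)
  have k₁ := Hxy.congE_rho m1.1 r mxy (B₁ _ (fun _ ↦ rfl) r.q (c.mem_core_left.2 hcore).1) hs
    (Bs _ r.hPQ₁) (By _ (fun _ ↦ rfl) r.q hL)
  have k₂ := HomCongAt.lamHat_comp y r.mem_Q r.mem_Q r.smooth_Q r.smooth_Q rfl
    ((Bx _ (fun _ ↦ rfl) r.q hcore.1).symm.trans (Bs _ fun _ ↦ rfl))
  have k₃ := Θ.tangentMap_congT hRs hRs rfl (k₂.cast (fun _ ↦ rfl) hR hR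
    (t₁' := fun u ↦ (fiberCast M.T (hR u)).comp ((y.lamHat ⟨r.Q u, r.mem_Q u⟩).comp (rhox u)))
    (t₂' := fun u ↦ (fiberCast M.T (hR u)).comp ((y.lamHat ⟨r.Q u, r.mem_Q u⟩).comp
      ((fiberCast L.E (hd u)).comp (rho₂ u))))
    (.of_forall fun u e ↦ by simp) (.of_forall fun u e ↦ by simp))
  have k₄ := HomCongAt.lamHat_comp t mt mt hRs hRs rfl k₁
  refine ⟨r.N, _, _, _, r.q, fun u ↦ (hr u).1, fun u ↦ (hr u).2, _, hπj, _, hφj,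
    congrArg d₁.proj (Subtype.ext (Prod.ext r.P_q (congrArg d.proj
      (Subtype.ext (Prod.ext r.Q_q hRq))))), hj, ?_⟩
  refine ((b1.symm.trans (((HomCongAt.refl (t := fun u ↦ (Θ.tangentMap (R u)).comp
    ((fiberCast M.T (hR u)).comp ((Ψ.tangentMap (r.Q u)).comp
      (x.hatAt r.mem_P (fun _ ↦ rfl) r.hPQ u))))).add (k₃.add k₄)).congr
    (t₂' := v'.hatAt mv' hπj hφj)
    (.of_forall fun u ↦ ?_) (.of_forall fun u ↦ ?_))).add
    (congT_zero_left b1' fun u ↦ by simp [TwoMorRep.hatAt, Z'.lamHat_eq])).congr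
    (.of_forall fun u ↦ ?_) (.of_forall b2')
  · refine ContinuousLinearMap.ext fun e ↦ ((congrArg (fun t ↦ t e) (C₁ u)).trans
      (horizHat_apply ..)).trans ?_
    have e1 := (congrArg (fun t ↦ fiberCast M.T (hR u) (t e)) (Cx u)).trans
      (congrArg (fiberCast M.T (hR u)) (horizHat_apply ..))
    simp only [TwoMorRep.hatAt, clm_comp_apply, fiberCast_fiberCast] at e1
    refine (congrArg (fun w ↦ Θ.tangentMap (R u) w + t.lamHat ⟨R u, mt u⟩ (rho₁ u e)) e1).trans ?_
    simp only [map_add, add_apply, clm_comp_apply, hatAt, add_assoc]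
  · refine ContinuousLinearMap.ext fun e ↦ ?_
    have e1 := (congrArg (fun t ↦ fiberCast O.T (d.proj_φ ⟨(r.Q u, R u), hR u⟩) (t e)) (C₂ u)).trans
      (congrArg (fiberCast O.T (d.proj_φ ⟨(r.Q u, R u), hR u⟩)) (horizHat_apply ..))
    have e2 := (congrArg (fun t ↦ t (fiberCast L.E (hd u) (rho₂ u e))) (Cy u)).trans
      (horizHat_apply ..)
    have e3 := congrArg (fiberCast O.T (d.proj_φ ⟨(r.Q u, R u), hR u⟩)) (d.tangentMap_proj
      ⟨(r.Q u, R u), hR u⟩ (fiberCast L.T (r.hPQ u) (x.lamHat ⟨r.P u, r.mem_P u⟩ e)))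
    simp only [TwoMorRep.hatAt, clm_comp_apply, fiberCast_fiberCast, map_add,
      fiberCast_rfl, clm_id_apply] at e1 e2 e3
    refine Eq.trans ?_ (e1.trans ((congrArg₂ (· + ·) e3 e2).trans ?_))
    · rfl
    · simp only [TwoMorRep.hatAt, add_apply, clm_comp_apply, fiberCast_rfl, clm_id_apply]
  · rw [b2, add_zero]
    simp [TwoMorRep.hatAt, Z.lamHat_eq]

end Associator

section EtalePullback

/-! ### Manifolds étale over a manifold -/

variable {n : ℕ} {V : Type*} [TopologicalSpace V] [ChartedSpace 𝔼[n] V] {P : Type*}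
  [TopologicalSpace P] {π : P → V}

lemma isLocalHomeomorph_of_locally_injective (hc : Continuous π) (ho : IsOpenMap π)
    (h : ∀ p, ∃ U : Set P, IsOpen U ∧ p ∈ U ∧ U.InjOn π) : IsLocalHomeomorph π := by
  refine isLocalHomeomorph_iff_isOpenEmbedding_restrict.2 fun p ↦ ?_
  obtain ⟨U, hU, hp, hi⟩ := h p
  exact ⟨U, hU.mem_nhds hp, .of_continuous_injective_isOpenMap (hc.comp continuous_subtype_val)
    (Set.injOn_iff_injective.1 hi) (ho.domRestrict hU)⟩

/-- The charts of a space that is étale over a manifold. -/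
abbrev etaleCharts (hπ : IsLocalHomeomorph π) : ChartedSpace 𝔼[n] P where
  atlas := Set.range fun p ↦ (hπ p).choose.trans (chartAt 𝔼[n] (π p))
  chartAt p := (hπ p).choose.trans (chartAt 𝔼[n] (π p))
  mem_chart_source p := by
    obtain ⟨h1, h2⟩ := (hπ p).choose_spec
    have h3 : (hπ p).choose p ∈ (chartAt 𝔼[n] (π p)).source :=
      Set.mem_of_eq_of_mem (congrFun h2 p).symm (mem_chart_source _ _)
    exact ⟨h1, h3⟩
  chart_mem_atlas p := ⟨p, rfl⟩

variable [IsManifold (𝓡 n) ∞ V] (hπ : IsLocalHomeomorph π)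

lemma isManifold_etaleCharts : let _ := etaleCharts (n := n) hπ; IsManifold (𝓡 n) ∞ P := by
  let _ := etaleCharts (n := n) hπ
  refine { compatible := ?_ }
  rintro _ _ ⟨p, rfl⟩ ⟨p', rfl⟩
  obtain ⟨h1, h2⟩ := (hπ p).choose_spec
  obtain ⟨h1', h2'⟩ := (hπ p').choose_spec
  set e := (hπ p).choose
  set e' := (hπ p').choose
  set c := chartAt 𝔼[n] (π p)
  set c' := chartAt 𝔼[n] (π p')
  have key : ∀ x ∈ e.target, e' (e.symm x) = x := fun x hx ↦ by
    rw [← h2', h2]; exact e.right_inv hx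
  refine StructureGroupoid.mem_of_eqOnSource _ (closedUnderRestriction' (e := c.symm.trans c')
    (StructureGroupoid.compatible _ (chart_mem_atlas _ _) (chart_mem_atlas _ _))
    ((e.trans c).symm.trans (e'.trans c')).open_source) ⟨?_, fun x hx ↦ ?_⟩
  · ext x
    rw [OpenPartialHomeomorph.restr_source' _ _ ((e.trans c).symm.trans (e'.trans c')).open_source]
    refine ⟨fun hx ↦ ⟨?_, hx⟩, fun hx ↦ hx.2⟩
    obtain ⟨⟨h3, h4⟩, -, h5⟩ := hx
    refine ⟨h3, ?_⟩
    have := key _ h4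
    change e' (e.symm (c.symm x)) ∈ c'.source at h5
    rwa [this] at h5
  · obtain ⟨⟨-, h4⟩, -⟩ := hx
    exact congrArg c' (key _ h4)

lemma isLocalDiffeomorph_etaleCharts : let _ := etaleCharts (n := n) hπ; Étale[n] π := fun p ↦ by
  let _ := etaleCharts (n := n) hπ
  have := isManifold_etaleCharts (n := n) hπ
  obtain ⟨h1, h2⟩ := (hπ p).choose_spec
  set e := (hπ p).choose with he
  set c := chartAt 𝔼[n] (π p) with hc
  have hch : chartAt 𝔼[n] p = e.trans c := rfl
  have hm := mem_chart_source 𝔼[n] p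
  have hm' := mem_chart_source 𝔼[n] (π p)
  rw [hch] at hm
  refine isLocalDiffeomorphAt_of_inverse (g := e.symm) ?_ ?_ ?_ ?_
  · filter_upwards [(e.trans c).open_source.mem_nhds hm] with y hy
    have h3 := (contMDiffOn_chart (I := 𝓡 n) (n := ∞) (x := p)).contMDiffAt
      ((e.trans c).open_source.mem_nhds hy)
    have h4 : c (e y) ∈ c.target := c.map_source hy.2
    have h5 := (contMDiffOn_chart_symm (I := 𝓡 n) (n := ∞) (x := π p)).contMDiffAt
      (c.open_target.mem_nhds h4)
    refine (ContMDiffAt.comp y h5 h3).congr_of_eventuallyEq ?_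
    filter_upwards [(e.trans c).open_source.mem_nhds hy] with z hz
    exact (congrFun h2 z).trans (c.left_inv hz.2).symm
  · have h6 : π p ∈ e.target := by
      rw [show π p = e p from congrFun h2 p]; exact e.map_source h1
    filter_upwards [c.open_source.mem_nhds hm', e.open_target.mem_nhds h6] with y hy hy'
    have h3 := (contMDiffOn_chart (I := 𝓡 n) (n := ∞) (x := π p)).contMDiffAt
      (c.open_source.mem_nhds hy)
    have h7 : c.symm (c y) ∈ e.target := Set.mem_of_eq_of_mem (c.left_inv hy) hy'
    have h4 : c y ∈ (e.trans c).target := ⟨c.map_source hy, h7⟩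
    have h5 := (contMDiffOn_chart_symm (I := 𝓡 n) (n := ∞) (x := p)).contMDiffAt
      ((e.trans c).open_target.mem_nhds h4)
    refine (ContMDiffAt.comp y h5 h3).congr_of_eventuallyEq ?_
    filter_upwards [c.open_source.mem_nhds hy] with z hz
    exact congrArg e.symm (c.left_inv hz).symm
  · filter_upwards [e.open_source.mem_nhds h1] with y hy
    rw [h2]; exact e.left_inv hy
  · have h6 : π p ∈ e.target := by
      rw [show π p = e p from congrFun h2 p]; exact e.map_source h1
    filter_upwards [e.open_target.mem_nhds h6] with y hy
    rw [h2]; exact e.right_inv hy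

end EtalePullback

/-! ### Identity and composite 1-morphisms -/

/-- The homomorphism to permutations given by a group action. -/
def permHom {G P : Type*} [Group G] (a : G → P → P) (h1 : ∀ p, a 1 p = p)
    (hm : ∀ g h p, a (g * h) p = a g (a h p)) : G →* Equiv.Perm P :=
  @MulAction.toPermHom G P _ { smul := a, one_smul := h1, mul_smul := hm }

/-- A 1-morphism is determined by a local homeomorphism `π : P → V_K` together with maps and
actions whose smoothness, and whose compatibility with the sections, are tested after pullback along
maps `j : N → P` for which `π ∘ j` is étale. -/
def OneMor.ofEtale {P : Type u} [TopologicalSpace P] [T2Space P] [SecondCountableTopology P]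
    (π : P → K.V) (hπ : IsLocalHomeomorph π) (φ : P → L.V) (hat : ∀ p, K.E (π p) →L[ℝ] L.E (φ p))
    (aL : K.Γ →* Equiv.Perm P) (aR : L.Γ →* Equiv.Perm P)
    (ha : ∀ γ δ, Continuous fun p ↦ aL γ (aR δ p)) (comm : ∀ γ δ p, aL γ (aR δ p) = aR δ (aL γ p))
    (free : ∀ δ p, aR δ p = p → δ = 1) (π_map : ∀ γ δ p, π (aL γ (aR δ p)) = γ • π p)
    (φ_map : ∀ γ δ p, φ (aL γ (aR δ p)) = δ • φ p)
    (hat_map : ∀ γ δ p p', p' = aL γ (aR δ p) → ∀ (h : π p' = γ • π p) (h' : φ p' = δ • φ p) e,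
      hat p' (K.actE.map γ h e) = L.actE.map δ h' (hat p e))
    (π_image : ∀ (v : K.V) (h : K.s v = 0), K.psiBar v h ∈ S → v ∈ Set.range π)
    (π_fibre : ∀ p q, π p = π q → ∃ δ, aR δ p = q)
    (footprint_map : ∀ p (h : K.s (π p) = 0), ∃ h' : L.s (φ p) = 0,
      f (K.psiBar (π p) h) = L.psiBar (φ p) h')
    (probe : ∀ p, ∃ (N : Type u) (_ : TopologicalSpace N)
      (_ : ChartedSpace 𝔼[K.dim] N) (j : N → P) (q : N), j q = p ∧
      Continuous j ∧ Étale[K.dim] (fun u ↦ π (j u)) ∧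
      C∞[K.dim,L.dim] (fun u ↦ φ (j u)) ∧
      (∀ u, SmE K.dim K L (fun u ↦ π (j u)) (fun u ↦ φ (j u)) (fun u ↦ hat (j u)) u) ∧
      ∃ τ, (∀ u, SmE K.dim K L (fun u ↦ π (j u)) (fun u ↦ φ (j u)) τ u) ∧
        (∀ u, L.s (φ (j u)) = τ u (K.s (π (j u)))) ∧
        CongE K.dim K L (fun u ↦ π (j u)) (fun u ↦ φ (j u)) (fun u ↦ φ (j u)) τ
          (fun u ↦ hat (j u)) q) : OneMor K L f S :=
  letI := etaleCharts (n := K.dim) hπ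
  have : IsManifold (𝓡 K.dim) ∞ P := isManifold_etaleCharts hπ
  have : SigmaCompactSpace P := sigmaCompactSpace_of_euclidean K.dim P
  have hloc : Étale[K.dim] π := isLocalDiffeomorph_etaleCharts hπ
  have hact : ∀ γ δ, C∞[K.dim,K.dim] fun p ↦ aL γ (aR δ p) := fun γ δ p ↦
    contMDiffAt_of_lift (hloc _) (ha γ δ).continuousAt (by
      simp only [π_map]; exact (K.smul_smooth γ).comp hloc.contMDiff p)
  have hφ : C∞[K.dim,L.dim] φ := fun p ↦ by
    obtain ⟨N, _, _, j, q, rfl, h1, h2, h3, -⟩ := probe p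
    obtain ⟨σ, h4, h5, -, h6⟩ := (isLocalDiffeomorphAt_of_lift (hloc _) h1 (h2 q)).exists_inverse
    refine (ContMDiffAt.comp (j q) (h3 _) h6.self_of_nhds).congr_of_eventuallyEq ?_
    filter_upwards [h5] with x hx
    simp [hx]
  { P := P, actL := aL, actR := aR, act_comm := comm, actL_smooth := fun γ ↦ by simpa using hact γ 1
    actR_smooth := fun δ ↦ by simpa using hact 1 δ
    actR_free := free
    π := π
    π_etale := hloc
    π_actL := fun γ p ↦ by simpa using π_map γ 1 p
    π_actR := fun δ p ↦ by simpa using π_map 1 δ p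
    π_image := π_image
    π_fibre := π_fibre
    φ := φ
    φ_smooth := hφ
    φ_actL := fun γ p ↦ by simpa using φ_map γ 1 p
    φ_actR := fun δ p ↦ by simpa using φ_map 1 δ p
    hat := hat
    hat_smooth := (isSmoothHom_iff hloc.contMDiff hφ).2 fun p ↦ by
      obtain ⟨N, _, _, j, q, rfl, h1, h2, h3, h4, -⟩ := probe p
      exact SmHom.of_pull (isLocalDiffeomorphAt_of_lift (hloc _) h1 (h2 q)) (h4 q)
    hat_actL := fun γ p e ↦ by
      have h : φ (aL γ p) = φ p := by simpa using φ_map γ 1 p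
      have := hat_map γ 1 p (aL γ p) (by simp) (by simpa using π_map γ 1 p) (by simp [h]) e
      rw [L.actE.map_one h.symm] at this
      exact this
    hat_actR := fun δ p e ↦ by
      have h : π (aR δ p) = π p := by simpa using π_map 1 δ p
      have := hat_map 1 δ p (aR δ p) (by simp) (by simp [h]) (by simpa using φ_map 1 δ p) e
      rw [K.actE.map_one h.symm] at this
      exact this
    hat_s := (sectionEqModSq_iff hloc.contMDiff hφ K.smVec_s).2 fun p ζ hζ ↦ by
      obtain ⟨N, _, _, j, q, rfl, h1, h2, h3, h4, τ, h5, h6, h7⟩ := probe p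
      have hj : Étale[K.dim] j := fun u ↦ isLocalDiffeomorphAt_of_lift (hloc _) h1 (h2 u)
      have hζ' : ∀ᶠ u in 𝓝 q, SmCov K.dim L.dim L.F L.E (fun u ↦ φ (j u)) (fun u ↦ ζ (j u)) u :=
        (h1.continuousAt.eventually hζ).mono fun u hu ↦ hu.comp (hj.contMDiff u) (hφ _)
      refine InI2.of_comp (hj q) ((inI2_of_cov (ξ := fun u ↦ (ζ (j u)).comp (hat (j u)) +
        (-1 : ℝ) • (ζ (j u)).comp (τ u)) (hζ'.mono fun u hu ↦ (hu.comp_smHom (h4 u)).add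
          (.smul contMDiffAt_const (hu.comp_smHom (h5 u)))) fun e he ↦ ?_).congr
        (.of_forall fun u ↦ ?_))
      · exact (h7.symm.cov h3 hζ' he).congr (.of_forall fun u ↦ by simp; ring)
      · simp only [h6]; simp; ring
    footprint_map := footprint_map }

theorem OneMor.exists_id (K : KurNbhd X) (S : Set X) (i : C(X, X)) (hi : i = ContinuousMap.id X) : ∃
    I : OneMor K K i S, Nonempty (IdData I) := by
  let _ : TopologicalSpace K.Γ := ⊥
  have : DiscreteTopology K.Γ := ⟨rfl⟩
  have hc : ∀ γ : K.Γ, Continuous fun v : K.V ↦ (v, γ) := fun γ ↦ by fun_prop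
  let I : OneMor K K i S := OneMor.ofEtale (P := K.V × K.Γ) Prod.fst
    (isLocalHomeomorph_of_locally_injective continuous_fst isOpenMap_fst fun p ↦
      ⟨Prod.snd ⁻¹' {p.2}, (isOpen_discrete _).preimage continuous_snd, rfl, fun a h b h' e ↦
        Prod.ext e (Eq.trans h (Eq.symm h'))⟩)
    (fun p ↦ p.2 • p.1) (fun p ↦ K.lift p.2 p.1)
    (permHom (fun γ p ↦ (γ • p.1, p.2 * γ⁻¹)) (by simp) (by simp [mul_smul, mul_assoc]))
    (permHom (fun δ p ↦ (p.1, δ * p.2)) (by simp) (by simp [mul_assoc]))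
    (fun γ δ ↦ Continuous.prodMk ((K.smul_smooth γ).continuous.comp continuous_fst)
      ((continuous_of_discreteTopology (f := fun x : K.Γ ↦ δ * x * γ⁻¹)).comp continuous_snd))
    (fun γ δ p ↦ Prod.ext rfl (mul_assoc _ _ _))
    (fun δ p h ↦ mul_eq_right.1 (congrArg Prod.snd h)) (fun _ _ _ ↦ rfl)
    (fun γ δ p ↦ by
      change (δ * p.2 * γ⁻¹) • γ • p.1 = δ • p.2 • p.1
      simp [mul_smul])
    (fun γ δ p p' hp h h' e ↦ by
      subst hp
      have e1 := K.actE.map_mul (δ * p.2 * γ⁻¹) γ (u := p.1) rfl rfl (by simp [mul_smul]) e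
      have e2 := K.actE.map_mul δ p.2 (u := p.1) rfl h' (h'.trans (mul_smul _ _ _).symm) e
      rw [show K.lift p.2 p.1 e = K.actE.map p.2 rfl e by simp [KurNbhd.actE], ← e2]
      refine Eq.trans ?_ (e1.symm.trans ?_)
      · simp [KurNbhd.actE]
        rfl
      · have : ∀ (x y : K.Γ) (w : K.V) (h : w = x • p.1) (h' : w = y • p.1), x = y →
            K.actE.map x h e = K.actE.map y h' e := by rintro x _ w h h' rfl; rfl
        exact this _ _ _ _ _ (by simp))
    (fun v _ _ ↦ ⟨(v, 1), rfl⟩)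
    (fun p q h ↦ ⟨q.2 * p.2⁻¹, Prod.ext h (inv_mul_cancel_right _ _)⟩)
    (fun p h ↦ ⟨by rw [← K.s_equivariant, h, map_zero], by
      subst hi
      exact congrArg K.ψ (Quotient.sound ⟨p.2⁻¹, by simp⟩)⟩)
    (fun p ↦ ⟨K.V, _, _, fun v ↦ (v, p.2), p.1, rfl, hc _, fun v ↦
      (isLocalDiffeomorphAt_of_inverse (g := fun v ↦ v) (.of_forall fun _ ↦ contMDiffAt_id)
        (.of_forall fun _ ↦ contMDiffAt_id) (.of_forall fun _ ↦ rfl) (.of_forall fun _ ↦ rfl)),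
      K.smul_smooth _, (isSmoothHom_iff contMDiff_id (K.smul_smooth _)).1 (K.lift_smooth p.2),
      fun v ↦ K.lift p.2 v, (isSmoothHom_iff contMDiff_id (K.smul_smooth _)).1 (K.lift_smooth p.2),
      fun v ↦ (K.s_equivariant _ _).symm, .refl⟩)
  exact ⟨I, ⟨
  { e := Equiv.refl _
    e_smooth := fun γ v ↦ isLocalDiffeomorphAt_of_lift (I.π_etale _) (hc γ)
      (isLocalDiffeomorphAt_of_inverse (g := fun v ↦ v) (.of_forall fun _ ↦ contMDiffAt_id)
        (.of_forall fun _ ↦ contMDiffAt_id) (.of_forall fun _ ↦ rfl) (.of_forall fun _ ↦ rfl))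
    e_actL := fun _ _ _ ↦ rfl
    e_actR := fun _ _ _ ↦ rfl
    e_π := fun _ _ ↦ rfl
    e_φ := fun _ _ ↦ rfl
    e_hat := fun _ _ _ ↦ rfl }⟩⟩

namespace FibProd

lemma map_map (γ γ' : K.Γ) (δ δ' : L.Γ) (ε ε' : M.Γ) (w : FibProd Φ Ψ) :
    map γ δ ε (map γ' δ' ε' w) = map (γ * γ') (δ * δ') (ε * ε') w :=
  Subtype.ext (Prod.ext (by simp [map, Φ.act_comm]) (by simp [map, Ψ.act_comm]))

lemma map_one (w : FibProd Φ Ψ) : map 1 1 1 w = w :=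
  Subtype.ext (Prod.ext (by simp [map]) (by simp [map]))

lemma continuous_map (γ : K.Γ) (δ : L.Γ) (ε : M.Γ) :
    Continuous (map γ δ ε : FibProd Φ Ψ → FibProd Φ Ψ) :=
  .subtype_mk (.prodMk (((Φ.actL_smooth _).continuous.comp (Φ.actR_smooth _).continuous).comp
    (continuous_fst.comp continuous_subtype_val))
    (((Ψ.actL_smooth _).continuous.comp (Ψ.actR_smooth _).continuous).comp
    (continuous_snd.comp continuous_subtype_val))) _

/-- The action of `Γ_L` on the fibre product over `V_L`. -/
instance (Φ : OneMor K L f S) (Ψ : OneMor L M g T) : MulAction L.Γ (FibProd Φ Ψ) where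
  smul δ := map 1 δ 1
  one_smul := map_one
  mul_smul δ δ' w := by
    change map 1 (δ * δ') 1 w = map 1 δ 1 (map 1 δ' 1 w)
    simp [map_map]

instance (Φ : OneMor K L f S) (Ψ : OneMor L M g T) : ContinuousConstSMul L.Γ (FibProd Φ Ψ) :=
  ⟨fun δ ↦ continuous_map 1 δ 1⟩

instance (Φ : OneMor K L f S) (Ψ : OneMor L M g T) : LocallyCompactSpace (FibProd Φ Ψ) :=
  have := ChartedSpace.locallyCompactSpace 𝔼[K.dim] Φ.P
  have := ChartedSpace.locallyCompactSpace 𝔼[L.dim] Ψ.P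
  (isClosed_eq (Φ.φ_smooth.continuous.comp continuous_fst)
    (Ψ.π_smooth.continuous.comp continuous_snd)).isClosedEmbedding_subtypeVal.locallyCompactSpace

/-- The composition of the bundle morphisms on the fibre product. -/
def hat (w : FibProd Φ Ψ) : K.E (Φ.π w.1.1) →L[ℝ] M.E (Ψ.φ w.1.2) :=
  (Ψ.hat w.1.2).comp ((fiberCast L.E w.2).comp (Φ.hat w.1.1))

lemma hat_map (γ : K.Γ) (δ : L.Γ) (ε : M.Γ) {w w' : FibProd Φ Ψ} (hw : w' = map γ δ ε w)
    (h : Φ.π w'.1.1 = γ • Φ.π w.1.1) (h' : Ψ.φ w'.1.2 = ε • Ψ.φ w.1.2) (e : K.E (Φ.π w.1.1)) :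
    w'.hat (K.actE.map γ h e) = M.actE.map ε h' (w.hat e) := by
  have h1 : Φ.φ w'.1.1 = δ • Φ.φ w.1.1 := by simp [hw, map, Φ.φ_actL, Φ.φ_actR]
  have h2 : Ψ.π w'.1.2 = δ • Ψ.π w.1.2 := by simp [hw, map, Ψ.π_actL, Ψ.π_actR]
  simp only [hat, clm_comp_apply]
  rw [Φ.hat_map γ δ (congrArg (·.1.1) hw) h h1, L.actE.fiberCast_map,
    ← Ψ.hat_map δ ε (congrArg (·.1.2) hw) h2 h', L.actE.map_fiberCast]

end FibProd

lemma ndrec_hom {P B B' : Type*} {E : B → Type*} [∀ x, AddCommGroup (E x)] [∀ x, Module ℝ (E x)]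
    [∀ x, TopologicalSpace (E x)] {E' : B' → Type*} [∀ x, AddCommGroup (E' x)]
    [∀ x, Module ℝ (E' x)] [∀ x, TopologicalSpace (E' x)] {a : P → B} {b : P → B'} {p p' : P}
    (h : p = p') (t : E (a p) →L[ℝ] E' (b p)) (t' : E (a p') →L[ℝ] E' (b p'))
    (H : ∀ e, t' (fiberCast E (congrArg a h) e) = fiberCast E' (congrArg b h) (t e)) :
    Eq.ndrec (motive := fun p ↦ E (a p) →L[ℝ] E' (b p)) t h = t' := by
  subst h
  ext e
  exact (H e).symm

theorem OneMor.exists_comp (Φ : OneMor K L f S) (Ψ : OneMor L M g T) (hST : MapsTo f S T)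
    {k : C(X, Z)} (hk : k = g.comp f) : ∃ Ξ : OneMor K M k S, Nonempty (CompData Φ Ψ Ξ) := by
  subst hk
  let mk : FibProd Φ Ψ → Quotient (MulAction.orbitRel L.Γ (FibProd Φ Ψ)) := Quotient.mk _
  have hmk : IsOpenQuotientMap mk := MulAction.isOpenQuotientMap_quotientMk
  have sound : ∀ δ w, mk (.map 1 δ 1 w) = mk w := fun δ w ↦ Quotient.sound ⟨δ, rfl⟩
  have exact' : ∀ {w w'}, mk w = mk w' → ∃ δ, w = .map 1 δ 1 w' := fun h ↦ by
    obtain ⟨δ, h⟩ := Quotient.exact h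
    exact ⟨δ, h.symm⟩
  let b : K.Γ → M.Γ → Quotient (MulAction.orbitRel L.Γ (FibProd Φ Ψ)) →
      Quotient (MulAction.orbitRel L.Γ (FibProd Φ Ψ)) := fun γ ε ↦ Quotient.lift
    (fun w ↦ mk (.map γ 1 ε w)) (by
      rintro _ w ⟨δ, rfl⟩
      rw [← sound δ (.map γ 1 ε w), FibProd.map_map]
      exact congrArg mk ((FibProd.map_map γ 1 1 δ ε 1 w).trans (by simp)))
  let π : Quotient (MulAction.orbitRel L.Γ (FibProd Φ Ψ)) → K.V := Quotient.lift
    (fun w ↦ Φ.π w.1.1) (by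
      rintro _ w ⟨δ, rfl⟩
      exact (Φ.π_actL _ _).trans (by simp [Φ.π_actR]))
  let φ : Quotient (MulAction.orbitRel L.Γ (FibProd Φ Ψ)) → M.V := Quotient.lift
    (fun w ↦ Ψ.φ w.1.2) (by
      rintro _ w ⟨δ, rfl⟩
      exact (Ψ.φ_actL _ _).trans (by simp))
  let hat : ∀ p, K.E (π p) →L[ℝ] M.E (φ p) := fun p ↦ Quotient.rec
    (motive := fun p ↦ K.E (π p) →L[ℝ] M.E (φ p)) (fun w ↦ w.hat) (by
      rintro w' w ⟨δ, rfl⟩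
      refine ndrec_hom (a := π) (b := φ) _ _ _ fun e ↦ ?_
      have h1 : Φ.π (FibProd.map 1 δ 1 w).1.1 = Φ.π w.1.1 := congrArg π (sound δ w)
      have h2 : Ψ.φ (FibProd.map 1 δ 1 w).1.2 = Ψ.φ w.1.2 := congrArg φ (sound δ w)
      have key : ∀ e, w.hat (fiberCast K.E h1 e) =
          fiberCast M.E h2 ((FibProd.map 1 δ 1 w).hat e) := fun e ↦ by
        have h3 := FibProd.hat_map 1 δ 1 rfl (by simp [h1]) (by simp [h2]) (fiberCast K.E h1 e)
        rw [K.actE.map_one h1.symm, M.actE.map_one h2.symm, fiberCast_fiberCast, fiberCast_rfl,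
          clm_id_apply] at h3
        rw [h3, fiberCast_fiberCast, fiberCast_rfl, clm_id_apply]
      exact key e) p
  have hπ : IsLocalHomeomorph π := by
    have ho : IsOpenMap fun w : FibProd Φ Ψ ↦ w.1.1 := isOpenMap_iff_nhds_le.2 fun w O hO ↦ by
      obtain ⟨U, hU, Q, hQ, -, -, h⟩ := FibProd.exists_slice w hO
      filter_upwards [U.isOpen.mem_nhds hU] with u hu using h ⟨u, hu⟩
    refine isLocalHomeomorph_of_locally_injective (hmk.isQuotientMap.continuous_iff.2
      (Φ.π_smooth.continuous.comp (continuous_fst.comp continuous_subtype_val))) (fun O hO ↦ ?_)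
      fun p ↦ ?_
    · have := Φ.π_etale.isOpenMap _ (ho _ (hO.preimage hmk.continuous))
      convert this using 1
      ext v
      constructor
      · rintro ⟨p, hp, rfl⟩
        obtain ⟨w, rfl⟩ := hmk.surjective p
        exact ⟨_, ⟨w, hp, rfl⟩, rfl⟩
      · rintro ⟨_, ⟨w, hw, rfl⟩, rfl⟩
        exact ⟨mk w, hw, rfl⟩
    · obtain ⟨w, rfl⟩ := hmk.surjective p
      obtain ⟨e, he, h⟩ := Φ.π_etale.isLocalHomeomorph w.1.1
      obtain ⟨e', he', h'⟩ := Ψ.π_etale.isLocalHomeomorph w.1.2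
      refine ⟨mk '' (Subtype.val ⁻¹' e.source ×ˢ e'.source), hmk.isOpenMap _
        ((e.open_source.prod e'.open_source).preimage continuous_subtype_val),
        ⟨w, ⟨he, he'⟩, rfl⟩, ?_⟩
      rintro _ ⟨w, ⟨h1, h2⟩, rfl⟩ _ ⟨w', ⟨h1', h2'⟩, rfl⟩ hw
      have h3 : w.1.1 = w'.1.1 := e.injOn h1 h1' (by rw [← h]; exact hw)
      exact congrArg mk (Subtype.ext (Prod.ext h3 (e'.injOn h2 h2' (by
        rw [← h', ← w.2, ← w'.2, h3]))))
  have hb : ∀ γ ε γ' ε' p, b (γ * γ') (ε * ε') p = b γ ε (b γ' ε' p) := fun γ ε γ' ε' p ↦ by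
    obtain ⟨w, rfl⟩ := hmk.surjective p
    exact congrArg mk ((FibProd.map_map γ γ' 1 1 ε ε' w).trans (by simp)).symm
  have hb1 : ∀ p, b 1 1 p = p := fun p ↦ by
    obtain ⟨w, rfl⟩ := hmk.surjective p
    exact congrArg mk (FibProd.map_one w)
  let aL : K.Γ →* Equiv.Perm _ := permHom (fun γ ↦ b γ 1) hb1 fun γ γ' p ↦ by
    simpa using hb γ 1 γ' 1 p
  let aR : M.Γ →* Equiv.Perm _ := permHom (fun ε ↦ b 1 ε) hb1 fun ε ε' p ↦ by
    simpa using hb 1 ε 1 ε' p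
  have hab : ∀ γ ε p, aL γ (aR ε p) = b γ ε p := fun γ ε p ↦ (hb γ 1 1 ε p).symm.trans (by simp)
  have : SecondCountableTopology (FibProd Φ Ψ) :=
    Topology.IsEmbedding.subtypeVal.secondCountableTopology
  have : SecondCountableTopology (Quotient (MulAction.orbitRel L.Γ (FibProd Φ Ψ))) :=
    ContinuousConstSMul.secondCountableTopology
  refine ⟨OneMor.ofEtale π hπ φ hat aL aR (fun γ ε ↦ ?_) (fun γ ε p ↦ ?_) (fun ε p h ↦ ?_)
    (fun γ ε p ↦ ?_) (fun γ ε p ↦ ?_) (fun γ ε p p' hp h h' e ↦ ?_) (fun v h hv ↦ ?_)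
    (fun p q h ↦ ?_) (fun p h ↦ ?_) (fun p ↦ ?_), ⟨{
    proj := mk
    isQuotientMap := hmk.isQuotientMap
    proj_eq_iff := ?_
    proj_actL := fun γ w w' h h' ↦ congrArg mk (Subtype.ext (Prod.ext ?_ ?_))
    proj_actR := fun ε w w' h h' ↦ congrArg mk (Subtype.ext (Prod.ext ?_ ?_))
    proj_π := fun _ ↦ rfl
    proj_φ := fun _ ↦ rfl
    proj_hat := fun w e ↦ Eq.trans (b := w.hat e)
      (congrArg w.hat (rfl : fiberCast K.E (rfl : Φ.π w.1.1 = _) e = e))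
      (by
        change w.hat e = fiberCast M.E (rfl : Ψ.φ w.1.2 = Ψ.φ w.1.2) (w.hat e)
        rw [fiberCast_rfl, clm_id_apply]) }⟩⟩
  · simp only [hab]
    exact hmk.isQuotientMap.continuous_iff.2 (hmk.continuous.comp (FibProd.continuous_map γ 1 ε))
  · exact (hab γ ε p).trans ((congrArg₂ (b · · p) (by simp) (by simp)).trans (hb 1 ε γ 1 p))
  · obtain ⟨w, rfl⟩ := hmk.surjective p
    obtain ⟨δ, hδ⟩ := exact' h
    have h1 := congrArg (fun w ↦ w.1.1) hδ
    have h2 := congrArg (fun w ↦ w.1.2) hδ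
    simp only [FibProd.map, map_one, Equiv.Perm.one_apply] at h1 h2
    obtain rfl := Φ.actR_free _ _ h1.symm
    exact Ψ.actR_free _ _ (by simpa using h2)
  · obtain ⟨w, rfl⟩ := hmk.surjective p
    rw [hab]
    exact (Φ.π_actL _ _).trans (by simp [π, mk])
  · obtain ⟨w, rfl⟩ := hmk.surjective p
    rw [hab]
    exact (Ψ.φ_actL _ _).trans (by simp [φ, mk, Ψ.φ_actR])
  · obtain ⟨w, rfl⟩ := hmk.surjective p
    obtain rfl : p' = mk (.map γ 1 ε w) := hp.trans (hab _ _ _)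
    exact FibProd.hat_map γ 1 ε rfl h h' e
  · obtain ⟨p, rfl⟩ := Φ.π_image v h hv
    obtain ⟨h', e⟩ := Φ.footprint_map p h
    obtain ⟨q, hq⟩ := Ψ.π_image (Φ.φ p) h' (e ▸ hST hv)
    exact ⟨mk ⟨(p, q), hq.symm⟩, rfl⟩
  · obtain ⟨w, rfl⟩ := hmk.surjective p
    obtain ⟨w', rfl⟩ := hmk.surjective q
    obtain ⟨δ, h1⟩ := Φ.π_fibre _ _ h
    obtain ⟨ε, h2⟩ := Ψ.π_fibre (Ψ.actL δ w.1.2) w'.1.2 (by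
      rw [Ψ.π_actL, ← w.2, ← w'.2, ← h1, Φ.φ_actR])
    refine ⟨ε, ((sound δ _).symm.trans (congrArg mk ((FibProd.map_map 1 1 δ 1 1 ε w).trans ?_)))⟩
    exact Subtype.ext (Prod.ext (by simp [FibProd.map, h1]) (by
      simp [FibProd.map, Ψ.act_comm, h2]))
  · obtain ⟨w, rfl⟩ := hmk.surjective p
    obtain ⟨h1, e1⟩ := Φ.footprint_map w.1.1 h
    have : ∀ v (hv : Φ.φ w.1.1 = v), ∃ h : L.s v = 0, L.psiBar v h = L.psiBar _ h1 := by
      rintro _ rfl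
      exact ⟨h1, rfl⟩
    obtain ⟨h2, e2⟩ := this _ w.2
    obtain ⟨h3, e3⟩ := Ψ.footprint_map w.1.2 h2
    exact ⟨h3, (congrArg g (e1.trans e2.symm)).trans e3⟩
  · obtain ⟨w, rfl⟩ := hmk.surjective p
    obtain ⟨U, hU, Q, hQ, hQs, hQw, -⟩ := FibProd.exists_slice w univ_mem
    obtain ⟨τ, hτ, hτs, hτc⟩ := Φ.exists_hat_exact
    obtain ⟨σ, hσ, hσs, hσc⟩ := Ψ.exists_hat_exact
    have hj := etale_val (n := K.dim) U
    have e1 : ∀ t : ∀ p, K.E (Φ.π p) →L[ℝ] L.E (Φ.φ p), (∀ p, SmE K.dim K L Φ.π Φ.φ t p) →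
        ∀ u : U, SmE K.dim K L (fun u : U ↦ Φ.π u) (fun u ↦ Ψ.π (Q u))
          (fun u ↦ (fiberCast L.E (hQ u)).comp (t u)) u := fun t ht u ↦
      (smHom_fiberCast hQ u).comp ((ht u).pull (hj.contMDiff u) (Φ.π_smooth _) (Φ.φ_smooth _))
    have e2 : ∀ t : ∀ p, L.E (Ψ.π p) →L[ℝ] M.E (Ψ.φ p), (∀ p, SmE L.dim L M Ψ.π Ψ.φ t p) →
        ∀ u : U, SmE K.dim L M (fun u ↦ Ψ.π (Q u)) (fun u ↦ Ψ.φ (Q u)) (fun u ↦ t (Q u)) u :=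
      fun t ht u ↦ (ht _).pull (hQs u) (Ψ.π_smooth _) (Ψ.φ_smooth _)
    have e3 : ∀ u : U, L.s (Ψ.π (Q u)) = fiberCast L.E (hQ u) (τ u (K.s (Φ.π u))) := fun u ↦ by
      rw [← hτs]
      have : ∀ v (hv : Φ.φ u = v), L.s v = fiberCast L.E hv (L.s (Φ.φ u)) := by
        rintro _ rfl
        rfl
      exact this _ _
    refine ⟨U, _, _, fun u ↦ mk ⟨(u, Q u), hQ u⟩, ⟨w.1.1, hU⟩,
      congrArg mk (Subtype.ext (Prod.ext rfl hQw)), hmk.continuous.comp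
        ((continuous_subtype_val.prodMk hQs.continuous).subtype_mk _),
      fun u ↦ (Φ.π_etale u).fun_comp (hj u), Ψ.φ_smooth.comp hQs,
      fun u ↦ (e2 _ Ψ.smE_hat u).comp (e1 _ Φ.smE_hat u),
      fun u ↦ (σ (Q u)).comp ((fiberCast L.E (hQ u)).comp (τ u)),
      fun u ↦ (e2 σ hσ u).comp (e1 τ hτ u), fun u ↦ ?_, ?_⟩
    · exact (hσs _).trans (congrArg (σ (Q u)) (e3 u))
    · have c1 := ((hσc (Q ⟨w.1.1, hU⟩)).pull (k := K.dim) Ψ.π_smooth hQs).precomp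
        (fun u ↦ (fiberCast L.E (hQ u)).comp (τ u)) (.of_forall fun u ↦ ⟨e1 τ hτ u, e3 u⟩)
        (.of_forall (e1 τ hτ))
      refine c1.trans (.of_cov ((Ψ.φ_smooth.comp hQs) _) (fun ζ hζ e he ↦ ?_)
        (.of_forall (Ψ.φ_smooth.comp hQs)))
      have c2 := ((hτc w.1.1).pull (k := K.dim) (q := (⟨w.1.1, hU⟩ : U)) Φ.π_smooth hj.contMDiff)
      exact c2.cov (Φ.φ_smooth.comp hj.contMDiff) (ζ := fun u ↦ (ζ u).comp
        ((Ψ.hat (Q u)).comp (fiberCast L.E (hQ u)))) (hζ.mono fun u hu ↦ hu.comp_smHom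
          ((e2 _ Ψ.smE_hat u).comp (smHom_fiberCast hQ u))) he
  · intro w w'
    refine ⟨fun h ↦ ?_, fun ⟨δ, h1, h2⟩ ↦ ((sound δ w).symm.trans (congrArg mk
      (Subtype.ext (Prod.ext (by simp [FibProd.map, h1]) (by simp [FibProd.map, h2])))))⟩
    obtain ⟨δ, rfl⟩ := exact' h.symm
    exact ⟨δ, by simp [FibProd.map], by simp [FibProd.map]⟩
  all_goals simp [FibProd.map, h, h']

/-! ### Existence of the coherence 2-isomorphisms -/

section CoherenceExistence

variable {N : KurNbhd W}

/-- A map of the manifolds of two 1-morphisms that preserves all the structure strictly gives a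
2-morphism with `lamHat = 0`. The map is given as `q w ↦ F w` for a quotient map `q`. -/
theorem TwoMorRep.exists_flat {A : Type*} [TopologicalSpace A] {q : A → Φ.P}
    (hq : Topology.IsQuotientMap q) {F : A → Φ'.P} (hF : Continuous F)
    (hmap : ∀ γ δ w w', q w' = Φ.actL γ (Φ.actR δ (q w)) → F w' = Φ'.actL γ (Φ'.actR δ (F w)))
    (hπ : ∀ w, Φ.π (q w) = Φ'.π (F w)) (hφ : ∀ w, Φ.φ (q w) = Φ'.φ (F w))
    (hhat : ∀ w e, fiberCast L.E (hφ w) (Φ.hat (q w) e) = Φ'.hat (F w) (fiberCast K.E (hπ w) e)) : ∃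
    z : TwoMorRep Φ Φ', (∀ p, p ∈ z.dom) ∧ (∀ p, z.lamHat p = 0) ∧ ∀ w h, z.lam ⟨q w, h⟩ = F w := by
  let l : Φ.P → Φ'.P := F ∘ Function.surjInv hq.surjective
  have hl : ∀ w, l (q w) = F w := fun w ↦ by
    have := hmap 1 1 w _ ((Function.surjInv_eq hq.surjective (q w)).trans (by simp))
    simpa only [map_one] using! this
  have lc : Continuous l := hq.continuous_iff.2 (hF.congr fun w ↦ (hl w).symm)
  have lπ : ∀ p, Φ.π p = Φ'.π (l p) := hq.surjective.forall.2 fun w ↦ by rw [hl, hπ]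
  have lφ : ∀ p, Φ.φ p = Φ'.φ (l p) := hq.surjective.forall.2 fun w ↦ by rw [hl, hφ]
  have lhat : ∀ p e, fiberCast L.E (lφ p) (Φ.hat p e) = Φ'.hat (l p) (fiberCast K.E (lπ p) e) :=
    hq.surjective.forall.2 fun w e ↦ by
      have := hhat w e
      revert this
      generalize_proofs a b c d
      revert a b c d
      rw [hl]
      exact fun _ _ _ _ h ↦ h
  refine ⟨.ofCong ⊤ (Set.subset_univ _) (fun _ _ _ ↦ trivial) (fun _ _ _ ↦ trivial) (fun p ↦ l p)
    (lc.comp continuous_subtype_val) (fun p ↦ (lπ p).symm) (fun γ δ p p' h ↦ ?_) (fun _ ↦ 0)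
    (fun p ↦ smHom_zero (Φ.smooth_φ _ p)) (fun γ δ p p' _ _ _ e ↦ by simp)
    (fun p _ ↦ MapCongAt.refl.congr (.of_forall fun u ↦ (lφ u).symm) (.of_forall fun _ ↦ rfl))
    (fun nL _ p _ ↦ ((HomCongAt.refl (t := fun p : (⊤ : Opens Φ.P) ↦ Φ.hat p)).congr_left
      (.of_forall fun u ↦ ⟨lφ u, fun e ↦ ?_⟩)).congr (.of_forall fun _ ↦ rfl)
      (.of_forall fun _ ↦ by simp)), fun _ ↦ trivial, fun _ ↦ rfl, fun w _ ↦ hl w⟩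
  · obtain ⟨w, hw⟩ := hq.surjective p
    obtain ⟨w', hw'⟩ := hq.surjective p'
    rw [← hw, ← hw', hl, hl]
    exact hmap γ δ w w' (by rw [hw, hw', h])
  · exact lhat u e

lemma CompData.proj_eq_act (c : CompData Φ Ψ Ξ) {γ : K.Γ} {ε : M.Γ} {w w' : FibProd Φ Ψ}
    (H : c.proj w' = Ξ.actL γ (Ξ.actR ε (c.proj w))) : ∃ δ, w' = FibProd.map γ δ ε w := by
  rw [← c.proj_map γ 1 ε w] at H
  obtain ⟨δ, hδ⟩ := c.proj_eq H.symm
  exact ⟨δ, hδ.trans ((FibProd.map_map ..).trans (by simp))⟩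

lemma CompData.hat_proj (c : CompData Φ Ψ Ξ) (w : FibProd Φ Ψ) (e : K.E (Ξ.π (c.proj w))) :
    Ξ.hat (c.proj w) e = fiberCast M.E (c.proj_φ w).symm
    (Ψ.hat w.1.2 (fiberCast L.E w.2 (Φ.hat w.1.1 (fiberCast K.E (c.proj_π w) e)))) := by
  have := c.proj_hat w (fiberCast K.E (c.proj_π w) e)
  rwa [fiberCast_fiberCast, fiberCast_rfl, clm_id_apply] at this

theorem exists_isBetaRep {i : C(X, X)} {h : C(X, Y)} {I : OneMor K K i S} {Ξ : OneMor K L h S}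
    (d : IdData I) (c : CompData I Φ Ξ) : ∃ z : TwoMorRep Ξ Φ, IsBetaRep d c z := by
  have key : ∀ v γ p (h : I.φ (d.e (v, γ)) = Φ.π p), c.proj ⟨(d.e (v, γ), p), h⟩ =
      c.proj ⟨(d.e (Φ.π (Φ.actL γ⁻¹ p), 1), Φ.actL γ⁻¹ p), d.φ_one _⟩ := fun v γ p h ↦ by
    refine (c.proj_eq_iff _ _).2 ⟨γ⁻¹, ?_, rfl⟩
    simp only [d.e_actR, Φ.π_actL, ← h, d.e_φ, inv_smul_smul, inv_mul_cancel]
  have hj := c.etale_probe (fun u ↦ d.φ_one (Φ.π u)) (fun u ↦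
    (d.e_smooth 1 _).fun_comp (Φ.π_etale u)) continuous_id
  have hs : Function.Surjective fun u ↦ c.proj ⟨(d.e (Φ.π u, 1), u), d.φ_one (Φ.π u)⟩ := fun p ↦ by
    obtain ⟨⟨⟨a, p⟩, hw⟩, rfl⟩ := c.surj p
    obtain ⟨⟨v, γ⟩, rfl⟩ := d.e.surjective a
    exact ⟨_, (key v γ p hw).symm⟩
  obtain ⟨z, z1, z2, z3⟩ := exists_flat (Φ' := Φ) (F := fun p ↦ p)
    (hj.isOpenMap.isQuotientMap hj.contMDiff.continuous hs) continuous_id (fun γ δ p p' hp ↦ by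
      obtain ⟨ε, hε⟩ := c.proj_eq_act hp
      have h1 : d.e (_, 1) = _ := congrArg (·.1.1) hε
      have h2 : p' = _ := congrArg (·.1.2) hε
      simp only [FibProd.map, d.e_actR, d.e_actL, d.e.apply_eq_iff_eq, Prod.mk.injEq] at h1 h2
      rw [h2, show ε = γ from mul_inv_eq_one.1 (by simpa using h1.2.symm)])
    (fun p ↦ (c.proj_π _).trans (d.e_π _ _)) (fun p ↦ c.proj_φ _) (fun p e ↦ by
      rw [c.hat_proj, fiberCast_fiberCast, fiberCast_rfl, clm_id_apply]
      exact congrArg _ ((d.hat_one (Φ.π p) _).trans (fiberCast_fiberCast ..)))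
  refine ⟨z, z1, fun v γ p h ↦ ?_, z2⟩
  simp only [key v γ p h]
  exact z3 _ _

theorem exists_isGammaRep {i : C(Y, Y)} {h : C(X, Y)} {I : OneMor L L i T} {Ξ : OneMor K L h S}
    (d : IdData I) (c : CompData Φ I Ξ) : ∃ z : TwoMorRep Ξ Φ, IsGammaRep d c z := by
  have key : ∀ p v γ (h : Φ.φ p = I.π (d.e (v, γ))), c.proj ⟨(p, d.e (v, γ)), h⟩ =
      c.proj ⟨(Φ.actR γ p, d.e (Φ.φ (Φ.actR γ p), 1)), (d.e_π _ _).symm⟩ := fun p v γ h ↦ by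
    refine (c.proj_eq_iff _ _).2 ⟨γ, rfl, ?_⟩
    rw [d.e_π] at h
    simp only [d.e_actL, Φ.φ_actR, ← h, mul_inv_cancel]
  have hj := c.etale_probe (P := fun u ↦ u) (fun u ↦ (d.e_π (Φ.φ u) 1).symm)
    (Diffeomorph.refl _ _ _).isLocalDiffeomorph ((d.smooth_e 1).comp Φ.φ_smooth).continuous
  have hs : Function.Surjective fun u ↦ c.proj ⟨(u, d.e (Φ.φ u, 1)), (d.e_π (Φ.φ u) 1).symm⟩ :=
    fun p ↦ by
    obtain ⟨⟨⟨p, a⟩, hw⟩, rfl⟩ := c.surj p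
    obtain ⟨⟨v, γ⟩, rfl⟩ := d.e.surjective a
    exact ⟨_, (key p v γ hw).symm⟩
  obtain ⟨z, z1, z2, z3⟩ := exists_flat (Φ' := Φ) (F := fun p ↦ p)
    (hj.isOpenMap.isQuotientMap hj.contMDiff.continuous hs) continuous_id (fun γ δ p p' hp ↦ by
      obtain ⟨ε, hε⟩ := c.proj_eq_act hp
      have h1 : p' = _ := congrArg (·.1.1) hε
      have h2 : d.e (_, 1) = _ := congrArg (·.1.2) hε
      simp only [FibProd.map, d.e_actR, d.e_actL, d.e.apply_eq_iff_eq, Prod.mk.injEq] at h1 h2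
      rw [h1, show ε = δ by simpa using eq_mul_inv_iff_mul_eq.1 h2.2])
    (fun p ↦ c.proj_π _) (fun p ↦ (c.proj_φ _).trans (d.φ_one _)) (fun p e ↦ by
      rw [c.hat_proj, fiberCast_fiberCast]
      refine (d.hat_one (Φ.φ p) _).trans ((fiberCast_fiberCast ..).trans ?_)
      rw [fiberCast_rfl, clm_id_apply])
  refine ⟨z, z1, fun p v γ h ↦ ?_, z2⟩
  simp only [key p v γ h]
  exact z3 _ _

theorem exists_isAssocRep {k : C(Z, W)} {gf : C(X, Z)} {kg : C(Y, W)} {h h' : C(X, W)}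
    {Θ : OneMor M N k R} {ΨΦ : OneMor K M gf S} {ΘΨ : OneMor L N kg T} {Ξ : OneMor K N h S}
    {Ξ' : OneMor K N h' S} (c : CompData Φ Ψ ΨΦ) (c₁ : CompData ΨΦ Θ Ξ') (d : CompData Ψ Θ ΘΨ)
    (d₁ : CompData Φ ΘΨ Ξ) : ∃ z : TwoMorRep Ξ Ξ', IsAssocRep c c₁ d d₁ z := by
  -- the triple fibre product, as the preimage of `P_{KL} ×_{V_L} P_{LN}` under `id × d.proj`
  let s : Set (Φ.P × ΘΨ.P) := {x | Φ.φ x.1 = ΘΨ.π x.2}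
  let j : Φ.P × FibProd Ψ Θ → Φ.P × ΘΨ.P := Prod.map id d.proj
  have hj : IsOpenQuotientMap j := .prodMap .id d.isOpenQuotientMap
  have hj' : Topology.IsQuotientMap (s.restrictPreimage j) :=
    (hj.isOpenMap.restrictPreimage s).isQuotientMap (hj.continuous.restrictPreimage)
      (s.restrictPreimage_surjective hj.surjective)
  have h1 : ∀ w : j ⁻¹' s, Φ.φ w.1.1 = Ψ.π w.1.2.1.1 := fun w ↦ w.2.trans (d.proj_π _)
  have h2 : ∀ w : j ⁻¹' s, ΨΦ.φ (c.proj ⟨(w.1.1, w.1.2.1.1), h1 w⟩) = Θ.π w.1.2.1.2 := fun w ↦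
    (c.proj_φ _).trans w.1.2.2
  obtain ⟨z, z1, z2, z3⟩ := exists_flat (Φ' := Ξ') (d₁.isQuotientMap.comp hj')
    (F := fun w ↦ c₁.proj ⟨(c.proj ⟨(w.1.1, w.1.2.1.1), h1 w⟩, w.1.2.1.2), h2 w⟩)
    (c₁.continuous_probe _ (c.continuous_probe _ (by fun_prop) (by fun_prop)) (by fun_prop))
    (fun γ δ w w' hw ↦ by
      obtain ⟨ε, hε⟩ := d₁.proj_eq_act hw
      have e1 : w'.1.1 = _ := congrArg (·.1.1) hε
      have e2 : d.proj w'.1.2 = _ := congrArg (·.1.2) hε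
      obtain ⟨ζ, hζ⟩ := d.proj_eq_act e2
      rw [← c₁.proj_map γ ζ δ]
      refine congrArg c₁.proj (Subtype.ext (Prod.ext ?_ (congrArg (·.1.2) hζ)))
      refine (congrArg c.proj ?_).trans (c.proj_map γ ε ζ _)
      exact Subtype.ext (Prod.ext e1 (congrArg (·.1.1) hζ)))
    (fun w ↦ (d₁.proj_π _).trans ((c₁.proj_π _).trans (c.proj_π _)).symm)
    (fun w ↦ ((d₁.proj_φ _).trans (d.proj_φ _)).trans (c₁.proj_φ _).symm) (fun w e ↦ by
      rw [c₁.hat_proj, c.hat_proj]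
      refine (congrArg _ (d₁.hat_proj _ _)).trans ((fiberCast_fiberCast ..).trans
        ((congrArg _ (d.hat_proj _ _)).trans ((fiberCast_fiberCast ..).trans ?_)))
      simp only [fiberCast_fiberCast]
      exact congrArg (fun x ↦ fiberCast N.E _ (Θ.hat _ (fiberCast M.E _ (Ψ.hat _ x))))
        (fiberCast_fiberCast ..))
  refine ⟨z, z1, fun p q r h₁ h₂ ↦ ?_, z2⟩
  exact z3 ⟨(p, ⟨(q, r), h₂⟩), h₁.trans (d.proj_π ⟨(q, r), h₂⟩).symm⟩ _

end CoherenceExistence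

/-! ### Essential smallness of the categories of 1-morphisms -/

lemma essentiallySmall_of_code {C : Type (u + 1)} [Category.{u} C] {T : Type u} (code : C → T)
    (h : ∀ x y, code x = code y → Nonempty (x ≅ y)) : EssentiallySmall.{u} C := by
  refine (essentiallySmall_iff C).2 ⟨small_of_injective
    (f := fun x : Skeleton C ↦ code ((fromSkeleton C).obj x)) fun x y hxy ↦ ?_, inferInstance⟩
  obtain ⟨e⟩ := h _ _ hxy
  exact skeleton_skeletal C ⟨(fromSkeleton C).preimageIso e⟩

lemma OneMor.exists_injective (Φ : OneMor K L f S) :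
    ∃ ι : Φ.P → K.V × L.Γ, Function.Injective ι := by
  let r : Φ.P → Φ.P := fun p ↦ Quotient.out (Quotient.mk (Setoid.ker Φ.π) p)
  have hr : ∀ p, ∃ δ, Φ.actR δ (r p) = p := fun p ↦
    Φ.π_fibre _ _ (Quotient.exact (Quotient.out_eq (Quotient.mk (Setoid.ker Φ.π) p)))
  choose δ hδ using hr
  refine ⟨fun p ↦ (Φ.π p, δ p), fun p q h ↦ ?_⟩
  have h1 : r p = r q := congrArg Quotient.out (Quotient.sound (congrArg Prod.fst h :))
  rw [← hδ p, ← hδ q, h1, show δ p = δ q from congrArg Prod.snd h]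

/-- An injection of the manifold `P` of a 1-morphism into `V_K × Γ_L`. -/
def OneMor.inj (Φ : OneMor K L f S) : Φ.P → K.V × L.Γ := Φ.exists_injective.choose

lemma OneMor.inj_injective (Φ : OneMor K L f S) : Function.Injective Φ.inj :=
  Φ.exists_injective.choose_spec

/-- The structure of a 1-morphism transported to a subset of `V_K × Γ_L`: the maps `π`, `φ` and
`hat`, the actions and the topology. It determines the 1-morphism up to isomorphism. -/
def OneMor.code (Φ : OneMor K L f S) :
    Set (Σ x : (K.V × L.Γ) × K.V × L.V, K.E x.2.1 →L[ℝ] L.E x.2.2) × Set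
    (K.Γ × L.Γ × (K.V × L.Γ) × (K.V × L.Γ)) × Set (Set (K.V × L.Γ)) :=
  (Set.range fun p ↦ ⟨(Φ.inj p, Φ.π p, Φ.φ p), Φ.hat p⟩,
    {x | ∃ p, Φ.inj p = x.2.2.1 ∧ Φ.inj (Φ.actL x.1 (Φ.actR x.2.1 p)) = x.2.2.2},
    {U | IsOpen (Φ.inj ⁻¹' U)})

theorem OneMor.nonempty_twoMor_of_code_eq (h : Φ.code = Φ'.code) : Nonempty (TwoMor Φ Φ') := by
  obtain ⟨h1, h2⟩ := Prod.ext_iff.1 h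
  obtain ⟨h2, h3⟩ := Prod.ext_iff.1 h2
  choose F hF using fun p ↦ (h1.subset ⟨p, rfl⟩ : _ ∈ Set.range _)
  have hι : ∀ p, Φ'.inj (F p) = Φ.inj p := fun p ↦ congrArg (·.1.1) (hF p)
  have hcast : ∀ {x y : (K.V × L.Γ) × K.V × L.V} {s : K.E x.2.1 →L[ℝ] L.E x.2.2}
      {t : K.E y.2.1 →L[ℝ] L.E y.2.2}, (⟨x, s⟩ : Σ x : (K.V × L.Γ) × K.V × L.V,
        K.E x.2.1 →L[ℝ] L.E x.2.2) = ⟨y, t⟩ → ∀ (ha : y.2.1 = x.2.1) (hb : y.2.2 = x.2.2) e,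
      fiberCast L.E hb (t e) = s (fiberCast K.E ha e) := by
    rintro x _ s _ ⟨⟩ _ _ e
    rfl
  suffices H : ∃ z : TwoMorRep Φ Φ', (∀ p, p ∈ z.dom) ∧ (∀ p, z.lamHat p = 0) ∧
      ∀ w h, z.lam ⟨w, h⟩ = F w from ⟨H.choose.toTwoMor⟩
  refine exists_flat (Φ := Φ) (Φ' := Φ') (F := F) .id ?_ (fun γ δ p p' hp ↦ ?_)
    (fun p ↦ congrArg (·.1.2.1) (hF p).symm) (fun p ↦ congrArg (·.1.2.2) (hF p).symm)
    fun p e ↦ hcast (hF p) _ _ e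
  · refine ⟨fun U hU ↦ ?_⟩
    have := h3.superset (show Φ'.inj '' U ∈ _ from ?_)
    · refine (congrArg IsOpen (Set.ext fun p ↦ ?_)).mp this
      change Φ.inj p ∈ Φ'.inj '' U ↔ _
      rw [← hι, Φ'.inj_injective.mem_set_image]
      rfl
    · change IsOpen _
      rwa [Set.preimage_image_eq _ Φ'.inj_injective]
  · obtain ⟨x, hx, hx'⟩ := h2.subset (show (γ, δ, Φ.inj p, Φ.inj p') ∈ _ from
      ⟨p, rfl, congrArg Φ.inj hp.symm⟩)
    rw [Φ'.inj_injective (hx.trans (hι p).symm)] at hx'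
    exact Φ'.inj_injective ((hι p').trans hx'.symm)

/-! ### The coherence 2-isomorphisms -/

section Coherence

variable {N : KurNbhd W}

/-- The component `lamHat` is `0` modulo `O(s)` near the preimage of `S`. -/
def TwoMorRep.IsFlat (x : TwoMorRep Φ Φ') : Prop :=
  ∀ p (hp : p ∈ Φ.core), CongT K.dim K L (fun u : x.dom ↦ Φ.π u) (fun u ↦ Φ.φ u) (fun u ↦ Φ.φ u)
    x.lamHat (fun _ ↦ 0) ⟨p, x.core_subset hp⟩

lemma TwoMorRep.isFlat_of_eq_zero {x : TwoMorRep Φ Φ'} (h : ∀ p, x.lamHat p = 0) : x.IsFlat :=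
  fun _ _ ↦ HomCongAt.refl.congr (.of_forall h) (.of_forall fun _ ↦ rfl)

lemma TwoMorRep.IsFlat.congT_hatAt {x : TwoMorRep Φ Φ'} (hx : x.IsFlat) {m : ℕ} {N : Type*}
    [TopologicalSpace N] [ChartedSpace 𝔼[m] N] {j : N → Φ.P} (hj : C∞[m,K.dim] j)
    (hjx : ∀ u, j u ∈ x.dom) {q : N} (hq : j q ∈ Φ.core) :
    CongT m K L (fun u ↦ Φ.π (j u)) (fun u ↦ Φ.φ (j u)) (fun u ↦ Φ.φ (j u))
    (x.hatAt hjx (fun _ ↦ rfl) fun _ ↦ rfl) (fun _ ↦ 0) q := by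
  rw [hatAt_rfl]
  exact (hx _ hq).pull (k := m) (j := fun u ↦ (⟨j u, hjx u⟩ : x.dom))
    (Φ.smooth_π _) (contMDiff_codRestrict hj hjx)

lemma IsVertRep.isFlat {x : TwoMorRep Φ Φ'} {y : TwoMorRep Φ' Φ''} {z : TwoMorRep Φ Φ''}
    (H : IsVertRep x y z) (hx : x.IsFlat) (hy : ∀ p, y.lamHat p = 0) : z.IsFlat := fun p hp ↦ by
  have hj := etale_val (n := K.dim) z.dom
  have hxj := fun u : z.dom ↦ H.dom_le u.2
  obtain ⟨ck, -, h1, h2⟩ := H.hatAt (q := ⟨p, z.core_subset hp⟩) hj.contMDiff hxj (fun u ↦ u.2)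
    (x.contMDiff_lam_comp hj.contMDiff hxj) (fun u ↦ H.lam_mem u) (fun _ ↦ rfl)
    (fun u ↦ (x.lam_π ⟨u, hxj u⟩).symm) (fun _ ↦ rfl) (fun _ ↦ rfl) hp rfl
  refine ((hx.congT_hatAt hj.contMDiff hxj hp).add (congT_zero_left h1 fun u ↦ by
    simp [TwoMorRep.hatAt, hy]).symm).congr (.of_forall fun u ↦ ?_) (.of_forall fun u ↦ ?_)
  · rw [← h2]
    exact (congrFun (z.hatAt_rfl fun u : z.dom ↦ u.2) u).symm
  · exact (add_zero (0 : K.E (Φ.π u) →L[ℝ] L.T (Φ.φ u))).symm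

/-- Two flat representatives agree if they agree over `S`. -/
lemma TwoMorRep.IsFlat.equiv (hS : IsOpen S) {x y : TwoMorRep Φ Φ'} (hx : x.IsFlat) (hy : y.IsFlat)
    (h : ∀ p (hp : p ∈ Φ.core), x.lam ⟨p, x.core_subset hp⟩ = y.lam ⟨p, y.core_subset hp⟩) :
    x.Equiv y := equiv_of_hatAt hS fun p hp ↦
  have hj := etale_val (n := K.dim) (x.dom ⊓ y.dom)
  ⟨h p hp, ↥(x.dom ⊓ y.dom), _, _, Subtype.val, ⟨p, x.core_subset hp, y.core_subset hp⟩,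
    fun u ↦ u.2.1, fun u ↦ u.2.2, _, fun _ ↦ rfl, _, fun _ ↦ rfl, rfl, hj,
    (hx.congT_hatAt hj.contMDiff _ hp).trans (hy.congT_hatAt hj.contMDiff _ hp).symm⟩

namespace TwoMor

/-- The coherence 2-isomorphism `(Θ ∘ Ψ) ∘ Φ ⇒ Θ ∘ (Ψ ∘ Φ)`. -/
def assoc {k : C(Z, W)} {gf : C(X, Z)} {kg : C(Y, W)} {h h' : C(X, W)} {Θ : OneMor M N k R}
    {ΨΦ : OneMor K M gf S} {ΘΨ : OneMor L N kg T} {Ξ : OneMor K N h S} {Ξ' : OneMor K N h' S}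
    (c : CompData Φ Ψ ΨΦ) (c₁ : CompData ΨΦ Θ Ξ') (d : CompData Ψ Θ ΘΨ) (d₁ : CompData Φ ΘΨ Ξ) :
    TwoMor Ξ Ξ' :=
  (exists_isAssocRep c c₁ d d₁).choose.toTwoMor

/-- The coherence 2-isomorphism `Φ ∘ id ⇒ Φ`. -/
def beta {h : C(X, Y)} {i : C(X, X)} {I : OneMor K K i S} {Ξ : OneMor K L h S} (d : IdData I)
    (c : CompData I Φ Ξ) : TwoMor Ξ Φ :=
  (exists_isBetaRep d c).choose.toTwoMor

/-- The coherence 2-isomorphism `id ∘ Φ ⇒ Φ`. -/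
def gamma {h : C(X, Y)} {i : C(Y, Y)} {I : OneMor L L i T} {Ξ : OneMor K L h S} (d : IdData I)
    (c : CompData Φ I Ξ) : TwoMor Ξ Φ :=
  (exists_isGammaRep d c).choose.toTwoMor

lemma beta_naturality (hS : IsOpen S) {h h' : C(X, Y)} {i : C(X, X)} {I : OneMor K K i S}
    {Ξ : OneMor K L h S} {Ξ' : OneMor K L h' S}
    (d : IdData I) (c : CompData I Φ Ξ) (c' : CompData I Φ' Ξ') (hi : MapsTo i S S)
    (η : TwoMor Φ Φ') : (hcomp c c' hi (id I) η).comp (beta d c') = (beta d c).comp η := by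
  obtain ⟨x, rfl⟩ := η.exists_rep
  obtain ⟨v, H⟩ := exists_horiz c c' (idRep I) x hi
  obtain ⟨V, hV⟩ := exists_vert (exists_isBetaRep d c).choose x
  obtain ⟨V', hV'⟩ := exists_vert v (exists_isBetaRep d c').choose
  rw [id, hcomp_eq hS hi H, beta, beta, comp_eq hS hV, comp_eq hS hV', toTwoMor_eq_iff.2]
  exact (equiv_equivalence _ _).symm (IsBetaRep.naturality hS (isIdRep_idRep I) H
    (exists_isBetaRep d c).choose_spec (exists_isBetaRep d c').choose_spec hV hV')

lemma gamma_naturality (hS : IsOpen S) {h h' : C(X, Y)} {i : C(Y, Y)} {I : OneMor L L i T}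
    {Ξ : OneMor K L h S} {Ξ' : OneMor K L h' S}
    (d : IdData I) (c : CompData Φ I Ξ) (c' : CompData Φ' I Ξ') (hST : MapsTo f S T)
    (η : TwoMor Φ Φ') : (hcomp c c' hST η (id I)).comp (gamma d c') = (gamma d c).comp η := by
  obtain ⟨x, rfl⟩ := η.exists_rep
  obtain ⟨v, H⟩ := exists_horiz c c' x (idRep I) hST
  obtain ⟨V, hV⟩ := exists_vert (exists_isGammaRep d c).choose x
  obtain ⟨V', hV'⟩ := exists_vert v (exists_isGammaRep d c').choose
  rw [id, hcomp_eq hS hST H, gamma, gamma, comp_eq hS hV, comp_eq hS hV', toTwoMor_eq_iff.2]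
  exact (equiv_equivalence _ _).symm (IsGammaRep.naturality hS (isIdRep_idRep I) H
    (exists_isGammaRep d c).choose_spec (exists_isGammaRep d c').choose_spec hV hV')

lemma assoc_naturality (hS : IsOpen S) (hT : IsOpen T) {k k' : C(Z, W)} {gf gf' : C(X, Z)}
    {kg kg' : C(Y, W)} {h h' h₁ h₁' : C(X, W)} {Θ : OneMor M N k R} {Θ' : OneMor M N k' R}
    {ΨΦ : OneMor K M gf S} {ΨΦ' : OneMor K M gf' S} {ΘΨ : OneMor L N kg T} {ΘΨ' : OneMor L N kg' T}
    {Ξ : OneMor K N h S} {Ξ' : OneMor K N h' S} {Ξ₁ : OneMor K N h₁ S} {Ξ₁' : OneMor K N h₁' S}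
    (c : CompData Φ Ψ ΨΦ) (c' : CompData Φ' Ψ' ΨΦ') (c₁ : CompData ΨΦ Θ Ξ₁)
    (c₁' : CompData ΨΦ' Θ' Ξ₁') (d : CompData Ψ Θ ΘΨ) (d' : CompData Ψ' Θ' ΘΨ')
    (d₁ : CompData Φ ΘΨ Ξ) (d₁' : CompData Φ' ΘΨ' Ξ') (hST : MapsTo f S T) (hgf : MapsTo gf S R)
    (hTR : MapsTo g T R) (η : TwoMor Φ Φ') (θ : TwoMor Ψ Ψ') (κ : TwoMor Θ Θ') :
    (hcomp d₁ d₁' hST η (hcomp d d' hTR θ κ)).comp (assoc c' c₁' d' d₁') = (assoc c c₁ d d₁).comp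
    (hcomp c₁ c₁' hgf (hcomp c c' hST η θ) κ) := by
  obtain ⟨x, rfl⟩ := η.exists_rep
  obtain ⟨y, rfl⟩ := θ.exists_rep
  obtain ⟨t, rfl⟩ := κ.exists_rep
  obtain ⟨xy, Hxy⟩ := exists_horiz c c' x y hST
  obtain ⟨yt, Hyt⟩ := exists_horiz d d' y t hTR
  obtain ⟨v, H⟩ := exists_horiz c₁ c₁' xy t hgf
  obtain ⟨v', H'⟩ := exists_horiz d₁ d₁' x yt hST
  obtain ⟨V, hV⟩ := exists_vert (exists_isAssocRep c c₁ d d₁).choose v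
  obtain ⟨V', hV'⟩ := exists_vert v' (exists_isAssocRep c' c₁' d' d₁').choose
  rw [hcomp_eq hS hST Hxy, hcomp_eq hT hTR Hyt, hcomp_eq hS hgf H, hcomp_eq hS hST H', assoc, assoc,
    comp_eq hS hV, comp_eq hS hV', toTwoMor_eq_iff.2]
  exact (equiv_equivalence _ _).symm (IsAssocRep.naturality hS hST
    (exists_isAssocRep c c₁ d d₁).choose_spec (exists_isAssocRep c' c₁' d' d₁').choose_spec
    Hxy H Hyt H' hV hV')

/-- The triangle identity. -/
lemma triangle (hS : IsOpen S) {i : C(Y, Y)} {fi : C(X, Y)} {ig : C(Y, Z)} {k : C(X, Z)}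
    {I : OneMor L L i T} {IΦ : OneMor K L fi S} {ΨI : OneMor L M ig T} {ΨΦ : OneMor K M k S}
    (e : IdData I) (c : CompData Φ I IΦ) (c₁ : CompData IΦ Ψ Ξ') (d : CompData I Ψ ΨI)
    (d₁ : CompData Φ ΨI Ξ) (a : CompData Φ Ψ ΨΦ) (hST : MapsTo f S T) (hfi : MapsTo fi S T) :
    (assoc c c₁ d d₁).comp (hcomp c₁ a hfi (gamma e c) (id Ψ)) = hcomp d₁ a hST (id Φ) (beta e d) :=
    by
  obtain ⟨v, H⟩ := exists_horiz c₁ a (exists_isGammaRep e c).choose (idRep Ψ) hfi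
  obtain ⟨v', H'⟩ := exists_horiz d₁ a (idRep Φ) (exists_isBetaRep e d).choose hST
  obtain ⟨V, hV⟩ := exists_vert (exists_isAssocRep c c₁ d d₁).choose v
  have A := (exists_isAssocRep c c₁ d d₁).choose_spec
  have B := (exists_isBetaRep e d).choose_spec
  have G := (exists_isGammaRep e c).choose_spec
  have iΦ := isIdRep_idRep Φ
  have iΨ := isIdRep_idRep Ψ
  rw [id, id, gamma, beta, assoc, hcomp_eq hS hfi H, hcomp_eq hS hST H', comp_eq hS hV,
    toTwoMor_eq_iff]
  refine TwoMorRep.IsFlat.equiv hS (hV.isFlat (isFlat_of_eq_zero A.lamHat_eq)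
    (H.lamHat_eq_zero G.lamHat_eq iΨ.lamHat_eq))
    (isFlat_of_eq_zero (H'.lamHat_eq_zero iΦ.lamHat_eq B.lamHat_eq)) fun p hp ↦ ?_
  obtain ⟨⟨⟨p, b⟩, hb⟩, rfl⟩ := d₁.surj p
  obtain ⟨⟨⟨b, q⟩, hbq⟩, rfl⟩ := d.surj b
  obtain ⟨⟨w, γ⟩, rfl⟩ := e.e.surjective b
  have hp0 := (d₁.mem_core_left.1 hp).1
  have hpb : Φ.φ p = I.π (e.e (w, γ)) := hb.trans (d.proj_π _)
  have e1 := A.lam_eq p _ q hpb hbq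
  have m1 := A.mem (d₁.proj ⟨(p, d.proj ⟨(e.e (w, γ), q), hbq⟩), hb⟩)
  have hm := mem_core_lam _ (p := ⟨_, m1⟩) hp
  rw [e1] at hm
  have hq : Φ.φ p = Ψ.π (Ψ.actL γ⁻¹ q) := by
    rw [Ψ.π_actL, ← hbq, e.e_φ, inv_smul_smul, hpb, e.e_π]
  rw [hV.lam_of_eq (V.core_subset hp) m1 (v.core_subset hm) e1,
    H'.lam_of_eq (v'.core_subset hp) hp0 (w' := ⟨(p, Ψ.actL γ⁻¹ q), hq⟩) (iΦ.lam_eq _)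
      (B.lam_eq w γ q hbq),
    H.lam_of_eq (v.core_subset hm) (by rw [c.proj_π]; exact hp0) (w' := ⟨(Φ.actR γ p, q), by
      rw [Φ.φ_actR, hq, ← Ψ.π_actL]; simp⟩) (G.lam_eq p w γ hpb) (iΨ.lam_eq _), a.proj_eq_iff]
  exact ⟨γ⁻¹, by simp, rfl⟩

end TwoMor

end Coherence

end Kuranishi

/-! ### The bicategories -/

section Bicategories

/-- The 1-morphisms of a weak 2-category of Kuranishi neighbourhoods, with chosen identities and
compositions; both `Kur_S(X)` and `GKur` are of this form. Each object `A` has an underlying space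
`sp A`, a Kuranishi neighbourhood `nb A` and an open set `S A`. -/
structure KurFrame {C : Type (u + 1)} (sp : C → Type u) [∀ A, TopologicalSpace (sp A)]
    (nb : ∀ A, KurNbhd (sp A)) (S : ∀ A, Set (sp A)) where
  isOpen : ∀ A, IsOpen (S A)
  Hom : C → C → Type (u + 1)
  base : ∀ {A B}, Hom A B → C(sp A, sp B)
  one : ∀ {A B} (f : Hom A B), OneMor (nb A) (nb B) (base f) (S A)
  mapsTo : ∀ {A B} (f : Hom A B), MapsTo (base f) (S A) (S B)
  id : ∀ A, Hom A A
  comp : ∀ {A B D}, Hom A B → Hom B D → Hom A D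
  base_id : ∀ A, base (id A) = ContinuousMap.id (sp A)
  base_comp : ∀ {A B D} (f : Hom A B) (g : Hom B D), base (comp f g) = (base g).comp (base f)
  idData : ∀ A, IdData (one (id A))
  compData : ∀ {A B D} (f : Hom A B) (g : Hom B D), CompData (one f) (one g) (one (comp f g))

namespace KurFrame

variable {C : Type (u + 1)} {sp : C → Type u} [∀ A, TopologicalSpace (sp A)]
  {nb : ∀ A, KurNbhd (sp A)} {S : ∀ A, Set (sp A)} (F : KurFrame sp nb S) {A B D G H : C}

/-- The 2-morphisms: they exist only between 1-morphisms over the same continuous map. -/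
@[ext] structure Hom₂ (f g : F.Hom A B) : Type u where
  base_eq : F.base f = F.base g
  mor : TwoMor (F.one f) (F.one g)

instance (A B : C) : Category.{u} (F.Hom A B) where
  Hom f g := F.Hom₂ f g
  id _ := ⟨rfl, .id _⟩
  comp η θ := ⟨η.base_eq.trans θ.base_eq, η.mor.comp θ.mor⟩
  id_comp η := Hom₂.ext (η.mor.id_comp (F.isOpen A))
  comp_id η := Hom₂.ext (η.mor.comp_id (F.isOpen A))
  assoc η θ κ := Hom₂.ext (TwoMor.comp_assoc (F.isOpen A) η.mor θ.mor κ.mor)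

instance isIso {f g : F.Hom A B} (η : f ⟶ g) : IsIso η := by
  obtain ⟨θ, h1, h2⟩ := TwoMor.exists_inverse (F.isOpen A) η.mor
  exact ⟨⟨η.base_eq.symm, θ⟩, Hom₂.ext h1, Hom₂.ext h2⟩

/-- The horizontal composition. -/
def hcomp {f f' : F.Hom A B} {g g' : F.Hom B D} (η : f ⟶ f') (θ : g ⟶ g') :
    F.comp f g ⟶ F.comp f' g' :=
  ⟨by rw [F.base_comp, F.base_comp, η.base_eq, θ.base_eq],
    TwoMor.hcomp (F.compData f g) (F.compData f' g') (F.mapsTo f) η.mor θ.mor⟩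

/-- The inverse of the associator. -/
def assoc (f : F.Hom A B) (g : F.Hom B D) (k : F.Hom D G) :
    F.comp f (F.comp g k) ⟶ F.comp (F.comp f g) k :=
  ⟨by simp only [F.base_comp, ContinuousMap.comp_assoc], TwoMor.assoc (F.compData f g)
    (F.compData (F.comp f g) k) (F.compData g k) (F.compData f (F.comp g k))⟩

/-- The left unitor, in diagrammatic order. -/
def beta (f : F.Hom A B) : F.comp (F.id A) f ⟶ f :=
  ⟨by rw [F.base_comp, F.base_id, ContinuousMap.comp_id],
    TwoMor.beta (F.idData A) (F.compData (F.id A) f)⟩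

/-- The right unitor, in diagrammatic order. -/
def gamma (f : F.Hom A B) : F.comp f (F.id B) ⟶ f :=
  ⟨by rw [F.base_comp, F.base_id, ContinuousMap.id_comp],
    TwoMor.gamma (F.idData B) (F.compData f (F.id B))⟩

lemma hcomp_id (f : F.Hom A B) (g : F.Hom B D) : F.hcomp (𝟙 f) (𝟙 g) = 𝟙 (F.comp f g) :=
  Hom₂.ext (TwoMor.hcomp_id (F.isOpen A) (F.mapsTo f))

lemma hcomp_comp {f f' f'' : F.Hom A B} {g g' g'' : F.Hom B D} (η : f ⟶ f') (η' : f' ⟶ f'')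
    (θ : g ⟶ g') (θ' : g' ⟶ g'') : F.hcomp (η ≫ η') (θ ≫ θ') = F.hcomp η θ ≫ F.hcomp η' θ' :=
  Hom₂.ext (TwoMor.comp_hcomp (F.isOpen A) (F.isOpen B) (F.mapsTo f) (F.mapsTo f') ..)

lemma assoc_naturality {f f' : F.Hom A B} {g g' : F.Hom B D} {k k' : F.Hom D G} (η : f ⟶ f')
    (θ : g ⟶ g') (κ : k ⟶ k') :
    F.hcomp η (F.hcomp θ κ) ≫ F.assoc f' g' k' = F.assoc f g k ≫ F.hcomp (F.hcomp η θ) κ :=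
  Hom₂.ext (TwoMor.assoc_naturality (F.isOpen A) (F.isOpen B) _ _ _ _ _ _ _ _ (F.mapsTo f)
    (F.mapsTo _) (F.mapsTo g) ..)

lemma beta_naturality {f f' : F.Hom A B} (η : f ⟶ f') :
    F.hcomp (𝟙 (F.id A)) η ≫ F.beta f' = F.beta f ≫ η :=
  Hom₂.ext (TwoMor.beta_naturality (F.isOpen A) _ _ _ (F.mapsTo _) _)

lemma gamma_naturality {f f' : F.Hom A B} (η : f ⟶ f') :
    F.hcomp η (𝟙 (F.id B)) ≫ F.gamma f' = F.gamma f ≫ η :=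
  Hom₂.ext (TwoMor.gamma_naturality (F.isOpen A) _ _ _ (F.mapsTo _) _)

lemma triangle (f : F.Hom A B) (g : F.Hom B D) :
    F.assoc f (F.id B) g ≫ F.hcomp (F.gamma f) (𝟙 g) = F.hcomp (𝟙 f) (F.beta g) :=
  Hom₂.ext (TwoMor.triangle (F.isOpen A) _ _ _ _ _ _ (F.mapsTo f) (F.mapsTo _))

/-- The representative of the inverse of the associator. -/
def assocRep (f : F.Hom A B) (g : F.Hom B D) (k : F.Hom D G) :
    TwoMorRep (F.one (F.comp f (F.comp g k))) (F.one (F.comp (F.comp f g) k)) :=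
  (exists_isAssocRep (F.compData f g) (F.compData (F.comp f g) k) (F.compData g k)
    (F.compData f (F.comp g k))).choose

lemma isAssocRep (f : F.Hom A B) (g : F.Hom B D) (k : F.Hom D G) :
    IsAssocRep (F.compData f g) (F.compData (F.comp f g) k) (F.compData g k)
    (F.compData f (F.comp g k)) (F.assocRep f g k) :=
  (exists_isAssocRep (F.compData f g) (F.compData (F.comp f g) k) (F.compData g k)
    (F.compData f (F.comp g k))).choose_spec

lemma pentagon (f : F.Hom A B) (g : F.Hom B D) (k : F.Hom D G) (l : F.Hom G H) :
    (F.hcomp (𝟙 f) (F.assoc g k l) ≫ F.assoc f (F.comp g k) l) ≫ F.hcomp (F.assoc f g k) (𝟙 l) =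
    F.assoc f g (F.comp k l) ≫ F.assoc (F.comp f g) k l := by
  have hS := F.isOpen A
  obtain ⟨v, V⟩ := exists_horiz (F.compData f _) (F.compData f _) (idRep (F.one f))
    (F.assocRep g k l) (F.mapsTo f)
  obtain ⟨w, W⟩ := exists_horiz (F.compData _ l) (F.compData _ l) (F.assocRep f g k)
    (idRep (F.one l)) (F.mapsTo _)
  obtain ⟨x, hx⟩ := exists_vert v (F.assocRep f (F.comp g k) l)
  obtain ⟨y, hy⟩ := exists_vert x w
  obtain ⟨z, hz⟩ := exists_vert (F.assocRep f g (F.comp k l))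
    (F.assocRep (F.comp f g) k l)
  have i1 := isIdRep_idRep (F.one f)
  have i2 := isIdRep_idRep (F.one l)
  have e1 := TwoMor.hcomp_eq hS (F.mapsTo f) V
  have e2 := TwoMor.hcomp_eq hS (F.mapsTo _) W
  have fv := V.lamHat_eq_zero i1.lamHat_eq (F.isAssocRep g k l).lamHat_eq
  have fy := hy.isFlat (hx.isFlat (isFlat_of_eq_zero fv) (F.isAssocRep f _ l).lamHat_eq)
    (W.lamHat_eq_zero (F.isAssocRep f g k).lamHat_eq i2.lamHat_eq)
  have fz := hz.isFlat (isFlat_of_eq_zero (F.isAssocRep f g _).lamHat_eq)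
    (F.isAssocRep _ k l).lamHat_eq
  have key : y.Equiv z := fy.equiv hS fz fun p hp ↦ by
    obtain ⟨⟨⟨p, b⟩, hb⟩, rfl⟩ := (F.compData f _).surj p
    obtain ⟨⟨⟨q, b⟩, hb'⟩, rfl⟩ := (F.compData g _).surj b
    obtain ⟨⟨⟨r, t⟩, hrt⟩, rfl⟩ := (F.compData k l).surj b
    have hpq := hb.trans ((F.compData g _).proj_π _)
    have hqr := hb'.trans ((F.compData k l).proj_π _)
    have hp0 := ((F.compData f _).mem_core_left.1 hp).1
    have a1 := V.lam_of_eq (v.core_subset hp) hp0 (w' := ⟨(p, _), by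
      rw [(F.compData (F.comp g k) l).proj_π, (F.compData g k).proj_π]; exact hpq⟩) (i1.lam_eq _)
      ((F.isAssocRep g k l).lam_eq q r t hqr hrt)
    have m1 := v.mem_core_lam (p := ⟨_, v.core_subset hp⟩) hp
    rw [a1] at m1
    have a2 := (F.isAssocRep f (F.comp g k) l).lam_eq p ((F.compData g k).proj ⟨(q, r), hqr⟩) t
      (hpq.trans ((F.compData g k).proj_π ⟨(q, r), hqr⟩).symm)
      (((F.compData g k).proj_φ ⟨(q, r), hqr⟩).trans hrt)
    have a2' := (hx.lam_of_eq (x.core_subset hp) (v.core_subset hp)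
      ((F.isAssocRep f (F.comp g k) l).mem _) a1).trans a2
    have m2 := x.mem_core_lam (p := ⟨_, x.core_subset hp⟩) hp
    rw [a2'] at m2
    have a3 := W.lam_of_eq (w.core_subset m2) ((F.compData _ l).mem_core_left.1 m2).1
      (w' := ⟨(_, t), ((F.compData _ k).proj_φ _).trans hrt⟩)
      ((F.isAssocRep f g k).lam_eq p q r hpq hqr) (i2.lam_eq _)
    rw [hy.lam_of_eq _ (x.core_subset hp) (w.core_subset m2) a2', a3,
      hz.lam_of_eq _ ((F.isAssocRep f g _).mem _) ((F.isAssocRep _ k l).mem _)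
        ((F.isAssocRep f g (F.comp k l)).lam_eq p q _ hpq hb')]
    exact ((F.isAssocRep (F.comp f g) k l).lam_eq _ r t (((F.compData f g).proj_φ _).trans hqr)
      hrt).symm
  refine Hom₂.ext (Eq.trans (b := (v.toTwoMor.comp (F.assocRep f (F.comp g k) l).toTwoMor).comp
    w.toTwoMor) (congrArg₂ (fun a b ↦ (a.comp (F.assocRep f (F.comp g k) l).toTwoMor).comp b) e1 e2)
    ?_)
  rw [TwoMor.comp_eq hS hx, TwoMor.comp_eq hS hy, TwoMor.toTwoMor_eq_iff.2 key]
  exact (TwoMor.comp_eq hS hz).symm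

lemma inv_hcomp {f f' : F.Hom A B} {g g' : F.Hom B D} (η : f ⟶ f') (θ : g ⟶ g') :
    inv (F.hcomp η θ) = F.hcomp (inv η) (inv θ) := IsIso.inv_eq_of_hom_inv_id (by
  rw [← F.hcomp_comp, IsIso.hom_inv_id, IsIso.hom_inv_id, F.hcomp_id])

/-- The bicategory. -/
@[reducible] def bicategory : Bicategory.{u, u + 1} C where
  Hom := F.Hom
  id := F.id
  comp := F.comp
  homCategory := inferInstance
  whiskerLeft f _ _ η := F.hcomp (𝟙 f) η
  whiskerRight η g := F.hcomp η (𝟙 g)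
  associator f g k := (asIso (F.assoc f g k)).symm
  leftUnitor f := asIso (F.beta f)
  rightUnitor f := asIso (F.gamma f)
  whiskerLeft_id f g := F.hcomp_id f g
  whiskerLeft_comp f _ _ _ η θ := by rw [← F.hcomp_comp, Category.comp_id]
  id_whiskerLeft {_ _ f g} η := by
    change _ = F.beta f ≫ η ≫ inv (F.beta g)
    rw [← Category.assoc, IsIso.eq_comp_inv, F.beta_naturality]
  comp_whiskerLeft f g h h' η := by
    change _ = inv (F.assoc f g h) ≫ _ ≫ F.assoc f g h'
    rw [IsIso.eq_inv_comp, F.assoc_naturality, F.hcomp_id]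
  id_whiskerRight f g := F.hcomp_id f g
  comp_whiskerRight η θ g := by rw [← F.hcomp_comp, Category.comp_id]
  whiskerRight_id {_ _ f g} η := by
    change _ = F.gamma f ≫ η ≫ inv (F.gamma g)
    rw [← Category.assoc, IsIso.eq_comp_inv, F.gamma_naturality]
  whiskerRight_comp {_ _ _ _ f f'} η g h := by
    change _ = F.assoc f g h ≫ _ ≫ inv (F.assoc f' g h)
    rw [← Category.assoc, IsIso.eq_comp_inv, ← F.assoc_naturality, F.hcomp_id]
  whisker_assoc f g g' η h := by
    change _ = inv (F.assoc f g h) ≫ _ ≫ F.assoc f g' h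
    rw [IsIso.eq_inv_comp, F.assoc_naturality]
  whisker_exchange η θ := by simp only [← F.hcomp_comp, Category.comp_id, Category.id_comp]
  pentagon f g h i := by
    change F.hcomp (inv (F.assoc f g h)) (𝟙 i) ≫ inv (F.assoc f (F.comp g h) i) ≫
      F.hcomp (𝟙 f) (inv (F.assoc g h i)) = inv (F.assoc (F.comp f g) h i) ≫ inv (F.assoc f g _)
    refine Eq.trans ?_ ((IsIso.inv_eq_inv.2 (F.pentagon f g h i)).trans IsIso.inv_comp)
    simp only [IsIso.inv_comp, F.inv_hcomp, IsIso.inv_id]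
  triangle f g := by
    change inv (F.assoc f (F.id _) g) ≫ _ = F.hcomp (F.gamma f) (𝟙 g)
    rw [IsIso.inv_comp_eq, F.triangle]
    rfl

/-- The data and properties of `KurStructure` hold by construction. -/
def kurStructure : @KurStructure C F.bicategory sp _ nb S (@F.base) (@F.one) (fun η ↦ Hom₂.mor η) :=
  let _ := F.bicategory
  { base_id := F.base_id, base_comp := F.base_comp, idData := F.idData, compData := F.compData
    two_id := fun f ↦ ⟨_, isIdRep_idRep (F.one f), rfl⟩
    two_vert := fun {A _ _ _ _} η θ x y hx hy ↦ ⟨exists_vert x y, fun z H ↦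
      (congrArg₂ TwoMor.comp hx hy).trans (TwoMor.comp_eq (F.isOpen A) H)⟩
    two_horiz := fun {A _ _ f f' g _} η θ x y hx hy ↦
      ⟨exists_horiz _ _ x y (F.mapsTo f), fun z H ↦ by
        have := TwoMor.hcomp_eq (F.isOpen A) (F.mapsTo f) H
        rw [← hx, ← hy] at this
        refine Eq.trans (congrArg Hom₂.mor (a₂ := F.hcomp η θ) ?_) this
        exact (F.hcomp_comp η (𝟙 f') (𝟙 g) θ).symm.trans
          (by rw [Category.comp_id, Category.id_comp])⟩
    two_assoc := fun f g k ↦ ⟨_, F.isAssocRep f g k, rfl⟩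
    two_beta := fun f ↦ ⟨_, (exists_isBetaRep _ _).choose_spec, rfl⟩
    two_gamma := fun f ↦ ⟨_, (exists_isGammaRep _ _).choose_spec, rfl⟩ }

lemma essentiallySmall (A B : C) : EssentiallySmall.{u} (F.Hom A B) :=
  essentiallySmall_of_code (fun f ↦ (F.base f, (F.one f).code)) fun f g h ↦ by
    obtain ⟨h1, h2⟩ := Prod.ext_iff.1 h
    obtain ⟨η⟩ := OneMor.nonempty_twoMor_of_code_eq h2
    let η' : f ⟶ g := ⟨h1, η⟩
    exact ⟨asIso η'⟩

end KurFrame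

/-- The 1-morphisms of `Kur_S(X)`. -/
def KurObj.frame {X : Type u} [TopologicalSpace X] (S : Opens X) :
    KurFrame (fun _ : KurObj S ↦ X) (fun A ↦ A.nb) fun _ ↦ (S : Set X) where
  isOpen _ := S.2
  Hom A B := OneMor A.nb B.nb (ContinuousMap.id X) S
  base _ := ContinuousMap.id X
  one f := f
  mapsTo _ := Set.mapsTo_id _
  id A := (OneMor.exists_id A.nb S _ rfl).choose
  comp f g := (OneMor.exists_comp f g (Set.mapsTo_id _) rfl).choose
  base_id _ := rfl
  base_comp _ _ := rfl
  idData A := (OneMor.exists_id A.nb S _ rfl).choose_spec.some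
  compData f g := (OneMor.exists_comp f g (Set.mapsTo_id _) rfl).choose_spec.some

/-- The 1-morphisms of `GKur`. -/
def GKurObj.frame : KurFrame (fun A : GKurObj.{u} ↦ A.space) (fun A ↦ A.nb) fun _ ↦ Set.univ where
  isOpen _ := isOpen_univ
  Hom := GKurHom
  base f := f.map
  one f := f.mor
  mapsTo _ := Set.mapsTo_univ _ _
  id A := ⟨_, (OneMor.exists_id A.nb Set.univ _ rfl).choose⟩
  comp f g := ⟨_, (OneMor.exists_comp f.mor g.mor (Set.mapsTo_univ _ _) rfl).choose⟩
  base_id _ := rfl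
  base_comp _ _ := rfl
  idData A := (OneMor.exists_id A.nb Set.univ _ rfl).choose_spec.some
  compData f g := (OneMor.exists_comp f.mor g.mor (Set.mapsTo_univ _ _) rfl).choose_spec.some

end Bicategories

/-- The construction makes `Kur_S(X)` and `GKur` into weak 2-categories in which all 2-morphisms are
invertible: there are bicategories with these objects, with 1-morphisms and 2-morphisms (via `e`
and `e₂`) those of Kuranishi neighbourhoods, and with the constructed identities, compositions and
coherence 2-isomorphisms. The categories of 1-morphisms between two objects are essentially
small. -/
theorem theorem3p1 :
    (∀ (X : Type u) [TopologicalSpace X] (S : Opens X),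
      ∃ (_ : Bicategory.{u, u + 1} (KurObj S))
        (e : ∀ {A B : KurObj S}, (A ⟶ B) ≃ OneMor A.nb B.nb (ContinuousMap.id X) S)
        (e₂ : ∀ {A B : KurObj S} {f g : A ⟶ B}, (f ⟶ g) ≃ TwoMor (e f) (e g)),
        Nonempty (KurStructure (fun _ : KurObj S ↦ X) (fun A ↦ A.nb) (fun _ ↦ (S : Set X))
          (fun _ ↦ ContinuousMap.id X) (fun f ↦ e f) (fun η ↦ e₂ η)) ∧
        (∀ (A B : KurObj S) (f g : A ⟶ B) (η : f ⟶ g), IsIso η) ∧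
        (∀ A B : KurObj S, EssentiallySmall.{u} (A ⟶ B))) ∧
    (∃ (_ : Bicategory.{u, u + 1} GKurObj.{u})
        (e : ∀ {A B : GKurObj.{u}}, (A ⟶ B) ≃ GKurHom A B)
        (e₂ : ∀ {A B : GKurObj.{u}} {f g : A ⟶ B}, (f ⟶ g) ≃ GKurHom₂ (e f) (e g)),
        Nonempty (KurStructure (fun A : GKurObj.{u} ↦ A.space) (fun A ↦ A.nb)
          (fun _ ↦ Set.univ) (fun f ↦ (e f).map) (fun f ↦ (e f).mor) (fun η ↦ (e₂ η).mor)) ∧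
        (∀ (A B : GKurObj.{u}) (f g : A ⟶ B) (η : f ⟶ g), IsIso η) ∧
        (∀ A B : GKurObj.{u}, EssentiallySmall.{u} (A ⟶ B))) := by
  refine ⟨fun X _ S ↦ ⟨(KurObj.frame S).bicategory, Equiv.refl _,
    ⟨fun η ↦ η.mor, fun η ↦ ⟨rfl, η⟩, fun _ ↦ rfl, fun _ ↦ rfl⟩, ⟨(KurObj.frame S).kurStructure⟩,
    fun _ _ _ _ η ↦ (KurObj.frame S).isIso η, (KurObj.frame S).essentiallySmall⟩,
    GKurObj.frame.bicategory, Equiv.refl _, ⟨fun η ↦ ⟨η.base_eq, η.mor⟩, fun η ↦ ⟨η.map_eq, η.mor⟩,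
    fun _ ↦ rfl, fun _ ↦ rfl⟩, ⟨GKurObj.frame.kurStructure⟩,
    fun _ _ _ _ η ↦ GKurObj.frame.isIso η, GKurObj.frame.essentiallySmall⟩
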